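/- **Conventions.** All vector spaces are finite-dimensional over $\mathbb C$ unless they are algebras. A super-vector space $V=V_0\oplus V_1$ has parity involution $\omega_V(v)=(-1)^{|v|}v$; $\mathbf{SVect}$ is the category of super-vector spaces and even linear maps, and $\tau_{V,W}(v\otimes w)=(-1)^{|v||w|}\,w\otimes v$. Associators go $X(YZ)\to(XY)Z$. Unit isomorphisms are the canonical ones of vector spaces. Fix $\beta\in\mathbb C$ with $\beta^4=-1$. **The category $\mathrm{Rep}(Q,\Phi,R)$.** $Q$ is the $\mathbb C$-algebra with generators $E,F,K^{\pm1}$ and relations $KEK^{-1}=i^2E$, $KFK^{-1}=i^{-2}F$, $[E,F]=\frac{K-K^{-1}}{i-i^{-1}}$, $E^2=F^2=0$, $K^4=1$ (the restricted quantum group of $sl(2)$ at $q=i$), with coproduct $\Delta(E)=1\otimes E+E\otimes K$, $\Delta(F)=K^{-1}\otimes F+F\otimes 1$, $\Delta(K)=K\otimes K$ and counit $\varepsilon(E)=\varepsilon(F)=0$, $\varepsilon(K)=1$. Let $e_0=\frac12(1+K^2)$, $e_1=\frac12(1-K^2)$. Define $\Phi\in Q^{\otimes3}$ and $R\in Q^{\otimes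 2}$ by $$\Phi=e_0\otimes e_0\otimes e_0+e_1\otimes e_0\otimes e_0+\Phi^{010}\,e_0\otimes e_1\otimes e_0+e_0\otimes e_0\otimes e_1+e_1\otimes e_1\otimes e_0+\Phi^{101}\,e_1\otimes e_0\otimes e_1+e_0\otimes e_1\otimes e_1+\Phi^{111}\,e_1\otimes e_1\otimes e_1,$$ $$\Phi^{010}=1\otimes1\otimes1-(1+i)E\otimes K\otimes F+(1-i)FK\otimes K\otimes EK+2EFK\otimes1\otimes EFK,$$ $$\Phi^{101}=(i-1)1\otimes F\otimes EK+1\otimes K\otimes1+2\cdot1\otimes EF\otimes EFK-(1+i)1\otimes EK\otimes F-(1+i)E\otimes FK\otimes1+2i\,E\otimes EFK\otimes F+(1-i)FK\otimes E\otimes1-2i\,FK\otimes EFK\otimes EK-2EFK\otimes EF\otimes1,$$ $$\Phi^{111}=i\beta^2\{(1+i)1\otimes F\otimes EK-1\otimes K\otimes1-2\cdot1\otimes EF\otimes1-2i\,1\otimes EF\otimes EFK+(1+i)1\otimes EK\otimes F-(1+i)E\otimes1\otimes F+(1+i)E\otimes FK\otimes1+2i\,E\otimes FK\otimes EFK+2E\otimes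 EFK\otimes F-(1+i)FK\otimes1\otimes EK+(1+i)FK\otimes E\otimes1+2i\,FK\otimes E\otimes EFK+2FK\otimes EFK\otimes EK+2i\,EFK\otimes F\otimes EK+2i\,EFK\otimes K\otimes EFK-2i\,EFK\otimes EF\otimes1+2i\,EFK\otimes EK\otimes F+4EFK\otimes EF\otimes EFK\},$$ $$R=R^{00}e_0\otimes e_0+R^{01}e_0\otimes e_1+R^{10}e_1\otimes e_0+R^{11}e_1\otimes e_1,$$ $$R^{00}=\tfrac12(1\otimes1+1\otimes K+K\otimes1-K\otimes K)\{1\otimes1+2i\,E\otimes F\},$$ $$R^{01}=\tfrac12(1\otimes1-i\,1\otimes K+K\otimes1+i\,K\otimes K)\{1\otimes1+(1-i)FK\otimes EK-(1-i)E\otimes F+(1+i)EFK\otimes1+2i\,EFK\otimes EFK\},$$ $$R^{10}=\tfrac12(1\otimes1+1\otimes K-i\,K\otimes1+i\,K\otimes K)\{1\otimes K+(1-i)FK\otimes E+(1-i)E\otimes FK-(1-i)1\otimes EF-2i\,EFK\otimes EF\},$$ $$R^{11}=\tfrac\beta2(1\otimes1-i\,1\otimes K-i\,K\otimes1+K\otimes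 K)\{-i\,K\otimes1+2i\,EK\otimes F+(1-i)K\otimes EFK-(1+i)EF\otimes1-2i\,EF\otimes EFK\}.$$ $\mathrm{Rep}(Q,\Phi,R)$ is the category of finite-dimensional $Q$-modules, with tensor product $\otimes_{\mathbb C}$ and $Q$ acting through $\Delta$, unit $\mathbb C$ with $Q$ acting through $\varepsilon$, associator the action of $\Phi$, and braiding the action of $R$ followed by the flip $x\otimes y\mapsto y\otimes x$. **The category $\mathcal{SF}$.** Let $\mathsf G$ be the Grassmann algebra with odd generators $a_1,a_2$, a Hopf algebra in $\mathbf{SVect}$ with $\Delta(a_j)=a_j\otimes1+1\otimes a_j$ and antipode $S(a_j)=-a_j$. $\mathcal{SF}=\mathcal{SF}_0\oplus\mathcal{SF}_1$, where $\mathcal{SF}_0=\mathrm{Rep}_{sv}(\mathsf G)$ is the category of finite-dimensional representations of $\mathsf G$ in super-vector spaces (with even $\mathsf{G}$-linear maps) and $\mathcal{SF}_1=\mathbf{SVect}$; objects and morphism spaces are direct sums. The tensor product $*$ is bilinear (distributes over $\oplus$) with $X*Y=X\otimes Y$ (diagonal $\mathsf G$-action via the coproduct, with signs) in $\mathcal{SF}_0$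 for $X,Y\in\mathcal{SF}_0$; $X*Y=X\otimes Y\in\mathcal{SF}_1$ if exactly one of $X,Y$ is in $\mathcal{SF}_1$; $X*Y=\mathsf G\otimes X\otimes Y\in\mathcal{SF}_0$ (left multiplication on $\mathsf G$) if both are in $\mathcal{SF}_1$; on morphisms $f*g=f\otimes g$, respectively $\mathrm{id}_{\mathsf G}\otimes f\otimes g$. The unit is $\mathbb C^{1|0}\in\mathcal{SF}_0$ with trivial action. Put $C=a_2\otimes a_1-a_1\otimes a_2$, $\hat C=-2a_1a_2$, and let $C^{(13)}$ be the action of $C$ on the first and third tensor factor, $C^{(13)}(x\otimes y\otimes z)=(-1)^{|x|+|y|}(a_2x\otimes y\otimes a_1z-a_1x\otimes y\otimes a_2z)$. Let $\phi:\mathsf G\to\mathsf G$, $\phi(1)=\beta^2a_1a_2$, $\phi(a_j)=\beta^2a_j$, $\phi(a_1a_2)=-\beta^2$. With $\rho$ denoting actions, the associator $X*(Y*Z)\to(X*Y)*Z$ for $X,Y,Z$ in the indicated sectors is: - 000, 001, 100: the identity; 010: $\exp(C^{(13)})$; - 011: $X\otimes\mathsf G\otimes Y\otimes Z\to\mathsf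 G\otimes X\otimes Y\otimes Z$, $\big[\{\mathrm{id}_{\mathsf G}\otimes(\rho^X\circ(S\otimes\mathrm{id}_X))\}\circ\{\Delta\otimes\mathrm{id}_X\}\circ\tau_{X,\mathsf G}\big]\otimes\mathrm{id}_{Y\otimes Z}$; - 101: $\exp(C^{(13)})$ on $\mathsf G\otimes X\otimes Y\otimes Z$, where $C$ acts on the first factor $\mathsf G$ (by left multiplication) and on the third factor $Y$; - 110: $\{\mathrm{id}\otimes\rho^Z\}\circ\{\mathrm{id}_{\mathsf G}\otimes\tau_{\mathsf G,X\otimes Y}\otimes\mathrm{id}_Z\}\circ\{\Delta\otimes\mathrm{id}_{X\otimes Y\otimes Z}\}$ on $\mathsf G\otimes X\otimes Y\otimes Z$; - 111: $\{\phi\otimes\mathrm{id}\}\circ\{\tau_{X,\mathsf G}\otimes\mathrm{id}_{Y\otimes Z}\}:X\otimes\mathsf G\otimes Y\otimes Z\to\mathsf G\otimes X\otimes Y\otimes Z$. The braiding $X*Y\to Y*X$ is, in the sectors 00, 01, 10, 11, $$\tau_{X,Y}\circ\exp(-C),\quad \tau_{X,Y}\circ\{\exp(\tfrac12\hat C)\otimes\mathrm{id}_Y\},\quad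 \tau_{X,Y}\circ\{\mathrm{id}_X\otimes\exp(\tfrac12\hat C)\}\circ\{\mathrm{id}_X\otimes\omega_Y\},\quad \beta\,(\mathrm{id}_{\mathsf G}\otimes\tau_{X,Y})\circ\{\exp(-\tfrac12\hat C)\otimes\mathrm{id}_X\otimes\omega_Y\}.$$ **The functors.** Let $\mathsf S$ be the algebra with odd generators $x^\pm$, an even generator $L$ and relations $x^\pm L=Lx^\pm$, $x^+x^-+x^-x^+=\frac12(1-L)$, $(x^\pm)^2=0$, $L^2=1$; put $e_0=\frac12(1+L)$, $e_1=\frac12(1-L)$, and let $\Delta^{\mathsf S}:\mathsf S\to\mathsf S\otimes\mathsf S$ be the homomorphism of superalgebras with $\Delta^{\mathsf S}(x^\pm)=x^\pm\otimes1+(e_0-ie_1)\otimes x^\pm\pm i\,e_1\otimes e_1(x^+-x^-)$, $\Delta^{\mathsf S}(L)=L\otimes L$. Let $b=x^-x^+e_1$, $B=\mathsf Sb$, $\xi=x^++x^-$, $\delta_1=1+x^+x^-$, and let $R_a$ be right multiplication by $a$, with $R_b:\mathsf S\to B$. $\mathrm{Rep}\,\mathsf S$ is the category of finite-dimensional representations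 of $\mathsf S$ in super-vector spaces. - $D:\mathcal{SF}\to\mathrm{Rep}\,\mathsf S$ sends $U\in\mathcal{SF}_0$ to $U$ with $x^+,x^-,L$ acting by $a_1,a_2,1$, sends $U\in\mathcal{SF}_1$ to $B\otimes U$ with $\mathsf{S}$ acting on the left module $B$, and sends $f$ to $f$, respectively $\mathrm{id}_B\otimes f$. - $G:\mathrm{Rep}\,\mathsf S\to\mathrm{Rep}\,Q$ keeps the space and the maps; $K$ acts by $(e_0+ie_1)\,\omega$, and $-iF$ and $EK^{-1}$ act by $x^+$ and $x^-$. - For $U,V\in\mathcal{SF}$ the map $\Delta_{U,V}:D(U*V)\to D(U)\otimes D(V)$ is, in the sectors: 00: $u\otimes v\mapsto u\otimes v+(-1)^{|u|}x^-u\otimes x^+v$; 01: $(\rho^U\otimes R_b\otimes\mathrm{id}_V)\circ(R_{\delta_1}\otimes\tau_{\mathsf S,U}\otimes\mathrm{id}_V)\circ(\Delta^{\mathsf S}\otimes\mathrm{id})$ on $B\otimes U\otimes V$; 10: $(R_b\otimes\mathrm{id}_U\otimes\rho^V)\circ(\mathrm{id}_{\mathsf S}\otimes\tau_{\mathsf S,U}\otimes\mathrm{id}_V)\circ(\Delta^{\mathsf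 S}\otimes\mathrm{id})$ on $B\otimes U\otimes V$; 11: $(\mathrm{id}_B\otimes\tau_{B,U}\otimes\mathrm{id}_V)\circ\big([(R_b\otimes R_b)\circ\Delta^{\mathsf S}]\otimes\mathrm{id}\big)$ on $\mathsf G\otimes U\otimes V$, with $\mathsf G$ identified with $\mathsf Se_0$ via $a_1\mapsto x^+e_0$, $a_2\mapsto x^-e_0$. - For $M,N\in\mathrm{Rep}\,\mathsf S$ put $\Gamma_{M,N}(u\otimes v)=u\otimes v+e_1u\otimes(\xi-1)e_1v$. Let $P=G\circ D$ and $\Pi_{U,V}=\Gamma_{D(U),D(V)}\circ\Delta_{U,V}:P(U*V)\to P(U)\otimes P(V)$. **Theorem.** For each $\beta\in\mathbb C$ with $\beta^4=-1$, the data above make $\mathcal{SF}$ and $\mathrm{Rep}(Q,\Phi,R)$ into braided monoidal categories, and these are equivalent as $\mathbb C$-linear braided monoidal categories. More precisely, the functor $P=G\circ D:\mathcal{SF}\to\mathrm{Rep}(Q,\Phi,R)$ is $\mathbb C$-linear and an equivalence of categories, and the maps $\Pi_{U,V}$, together with the projection $P(\mathbf 1)=\mathbb C\oplus (B\otimes 0)\to\mathbb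 C$, make it a braided (strong) monoidal functor. -/

import Mathlib

open CategoryTheory

noncomputable section

namespace SympFerm

/-! ## The axioms of a braided monoidal category for given structure maps -/

section Laws

open scoped MonoidalCategory

/-- The axioms of a braided monoidal category (the ones of Mathlib's `MonoidalCategory` and
`BraidedCategory`), for given tensor product, unit, associativity and unit isomorphisms (the
`MonoidalCategoryStruct`) and given braiding isomorphisms `c`. -/
structure BraidedMonoidalLaws (C : Type*) [Category C] [MonoidalCategoryStruct C]
    (c : ∀ X Y : C, X ⊗ Y ≅ Y ⊗ X) : Prop where
  tensorHom_def : ∀ {X₁ Y₁ X₂ Y₂ : C} (f : X₁ ⟶ Y₁) (g : X₂ ⟶ Y₂),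
    f ⊗ₘ g = (f ▷ X₂) ≫ (Y₁ ◁ g)
  id_tensorHom_id : ∀ X₁ X₂ : C, 𝟙 X₁ ⊗ₘ 𝟙 X₂ = 𝟙 (X₁ ⊗ X₂)
  tensorHom_comp_tensorHom : ∀ {X₁ Y₁ Z₁ X₂ Y₂ Z₂ : C} (f₁ : X₁ ⟶ Y₁) (f₂ : X₂ ⟶ Y₂)
    (g₁ : Y₁ ⟶ Z₁) (g₂ : Y₂ ⟶ Z₂), (f₁ ⊗ₘ f₂) ≫ (g₁ ⊗ₘ g₂) = (f₁ ≫ g₁) ⊗ₘ (f₂ ≫ g₂)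
  whiskerLeft_id : ∀ X Y : C, X ◁ 𝟙 Y = 𝟙 (X ⊗ Y)
  id_whiskerRight : ∀ X Y : C, 𝟙 X ▷ Y = 𝟙 (X ⊗ Y)
  associator_naturality : ∀ {X₁ X₂ X₃ Y₁ Y₂ Y₃ : C} (f₁ : X₁ ⟶ Y₁) (f₂ : X₂ ⟶ Y₂)
    (f₃ : X₃ ⟶ Y₃),
    ((f₁ ⊗ₘ f₂) ⊗ₘ f₃) ≫ (α_ Y₁ Y₂ Y₃).hom = (α_ X₁ X₂ X₃).hom ≫ (f₁ ⊗ₘ (f₂ ⊗ₘ f₃))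
  leftUnitor_naturality : ∀ {X Y : C} (f : X ⟶ Y),
    𝟙_ C ◁ f ≫ (λ_ Y).hom = (λ_ X).hom ≫ f
  rightUnitor_naturality : ∀ {X Y : C} (f : X ⟶ Y),
    f ▷ 𝟙_ C ≫ (ρ_ Y).hom = (ρ_ X).hom ≫ f
  pentagon : ∀ W X Y Z : C,
    (α_ W X Y).hom ▷ Z ≫ (α_ W (X ⊗ Y) Z).hom ≫ W ◁ (α_ X Y Z).hom =
      (α_ (W ⊗ X) Y Z).hom ≫ (α_ W X (Y ⊗ Z)).hom
  triangle : ∀ X Y : C, (α_ X (𝟙_ C) Y).hom ≫ X ◁ (λ_ Y).hom = (ρ_ X).hom ▷ Y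
  braiding_naturality_right : ∀ (X : C) {Y Z : C} (f : Y ⟶ Z),
    X ◁ f ≫ (c X Z).hom = (c X Y).hom ≫ f ▷ X
  braiding_naturality_left : ∀ {X Y : C} (f : X ⟶ Y) (Z : C),
    f ▷ Z ≫ (c Y Z).hom = (c X Z).hom ≫ Z ◁ f
  hexagon_forward : ∀ X Y Z : C,
    (α_ X Y Z).hom ≫ (c X (Y ⊗ Z)).hom ≫ (α_ Y Z X).hom =
      ((c X Y).hom ▷ Z) ≫ (α_ Y X Z).hom ≫ (Y ◁ (c X Z).hom)
  hexagon_reverse : ∀ X Y Z : C,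
    (α_ X Y Z).inv ≫ (c (X ⊗ Y) Z).hom ≫ (α_ Z X Y).inv =
      (X ◁ (c Y Z).hom) ≫ (α_ X Z Y).inv ≫ ((c X Z).hom ▷ Y)

/-- Mathlib's monoidal category with the given structure maps. -/
@[reducible] def BraidedMonoidalLaws.monoidal {C : Type*} [Category C]
    [S : MonoidalCategoryStruct C] {c : ∀ X Y : C, X ⊗ Y ≅ Y ⊗ X}
    (h : BraidedMonoidalLaws C c) : MonoidalCategory C :=
  { S with
    tensorHom_def := h.tensorHom_def
    id_tensorHom_id := h.id_tensorHom_id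
    tensorHom_comp_tensorHom := h.tensorHom_comp_tensorHom
    whiskerLeft_id := h.whiskerLeft_id
    id_whiskerRight := h.id_whiskerRight
    associator_naturality := h.associator_naturality
    leftUnitor_naturality := h.leftUnitor_naturality
    rightUnitor_naturality := h.rightUnitor_naturality
    pentagon := h.pentagon
    triangle := h.triangle }

/-- Mathlib's braided category with the given structure maps. -/
@[reducible] def BraidedMonoidalLaws.braided {C : Type*} [Category C]
    [S : MonoidalCategoryStruct C] {c : ∀ X Y : C, X ⊗ Y ≅ Y ⊗ X}
    (h : BraidedMonoidalLaws C c) : @BraidedCategory C _ h.monoidal :=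
  letI := h.monoidal
  { braiding := c
    braiding_naturality_right := h.braiding_naturality_right
    braiding_naturality_left := h.braiding_naturality_left
    hexagon_forward := h.hexagon_forward
    hexagon_reverse := h.hexagon_reverse }

end Laws

open scoped TensorProduct
open TensorProduct (map comm assoc lid rid)

/-! ## The Grassmann algebra `G` and the algebra `S` -/

/-- The four-dimensional algebra `ℂ⟨x, y⟩ / (x² = y² = 0, xy + yx = c)`, in coordinates with
respect to its basis `1, x, y, xy`. See `Cl.lift` for the universal property. -/
def Cl (_c : ℂ) : Type := Fin 4 → ℂ

namespace Cl

variable {c : ℂ}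

instance : AddCommGroup (Cl c) := inferInstanceAs (AddCommGroup (Fin 4 → ℂ))
instance : Module ℂ (Cl c) := inferInstanceAs (Module ℂ (Fin 4 → ℂ))
instance : FiniteDimensional ℂ (Cl c) := inferInstanceAs (FiniteDimensional ℂ (Fin 4 → ℂ))

/-- The element `p + q x + r y + s xy`. -/
def mk (p q r s : ℂ) : Cl c := ![p, q, r, s]

/-- The `i`-th coordinate with respect to the basis `1, x, y, xy`. -/
def coord (a : Cl c) (i : Fin 4) : ℂ := (show Fin 4 → ℂ from a) i

theorem ext {a b : Cl c} (h0 : a.coord 0 = b.coord 0) (h1 : a.coord 1 = b.coord 1)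
    (h2 : a.coord 2 = b.coord 2) (h3 : a.coord 3 = b.coord 3) : a = b := by
  funext i
  fin_cases i
  · exact h0
  · exact h1
  · exact h2
  · exact h3

@[simp] theorem mk_coord0 (p q r s : ℂ) : (mk p q r s : Cl c).coord 0 = p := rfl
@[simp] theorem mk_coord1 (p q r s : ℂ) : (mk p q r s : Cl c).coord 1 = q := rfl
@[simp] theorem mk_coord2 (p q r s : ℂ) : (mk p q r s : Cl c).coord 2 = r := rfl
@[simp] theorem mk_coord3 (p q r s : ℂ) : (mk p q r s : Cl c).coord 3 = s := rfl
@[simp] theorem add_coord (a b : Cl c) (i : Fin 4) : (a + b).coord i = a.coord i + b.coord i := rfl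
@[simp] theorem smul_coord (z : ℂ) (a : Cl c) (i : Fin 4) : (z • a).coord i = z * a.coord i := rfl
@[simp] theorem neg_coord (a : Cl c) (i : Fin 4) : (-a).coord i = -a.coord i := rfl
@[simp] theorem zero_coord (i : Fin 4) : (0 : Cl c).coord i = 0 := rfl

instance : One (Cl c) := ⟨mk 1 0 0 0⟩

instance : Mul (Cl c) := ⟨fun a b => mk
  (a.coord 0 * b.coord 0 + c * (a.coord 2 * b.coord 1))
  (a.coord 0 * b.coord 1 + a.coord 1 * b.coord 0 + c * (a.coord 3 * b.coord 1))
  (a.coord 0 * b.coord 2 + a.coord 2 * b.coord 0 + c * (a.coord 2 * b.coord 3))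
  (a.coord 0 * b.coord 3 + a.coord 3 * b.coord 0 + a.coord 1 * b.coord 2 - a.coord 2 * b.coord 1
    + c * (a.coord 3 * b.coord 3))⟩

theorem one_def : (1 : Cl c) = mk 1 0 0 0 := rfl

theorem mul_def (a b : Cl c) : a * b = mk
  (a.coord 0 * b.coord 0 + c * (a.coord 2 * b.coord 1))
  (a.coord 0 * b.coord 1 + a.coord 1 * b.coord 0 + c * (a.coord 3 * b.coord 1))
  (a.coord 0 * b.coord 2 + a.coord 2 * b.coord 0 + c * (a.coord 2 * b.coord 3))
  (a.coord 0 * b.coord 3 + a.coord 3 * b.coord 0 + a.coord 1 * b.coord 2 - a.coord 2 * b.coord 1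
    + c * (a.coord 3 * b.coord 3)) := rfl

instance : Ring (Cl c) :=
  { (inferInstance : AddCommGroup (Cl c)), (inferInstance : One (Cl c)),
    (inferInstance : Mul (Cl c)) with
    left_distrib := fun a b d => by apply ext <;> simp [mul_def] <;> ring
    right_distrib := fun a b d => by apply ext <;> simp [mul_def] <;> ring
    zero_mul := fun a => by apply ext <;> simp [mul_def]
    mul_zero := fun a => by apply ext <;> simp [mul_def]
    mul_assoc := fun a b d => by apply ext <;> simp [mul_def] <;> ring
    one_mul := fun a => by apply ext <;> simp [mul_def, one_def]
    mul_one := fun a => by apply ext <;> simp [mul_def, one_def] }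

instance : Algebra ℂ (Cl c) :=
  Algebra.ofModule
    (fun z a b => by apply ext <;> simp [mul_def] <;> ring)
    (fun z a b => by apply ext <;> simp [mul_def] <;> ring)

/-- The generator `x`. -/
def x : Cl c := mk 0 1 0 0

/-- The generator `y`. -/
def y : Cl c := mk 0 0 1 0

theorem x_mul_x : (x : Cl c) * x = 0 := by apply ext <;> simp [mul_def, x]
theorem y_mul_y : (y : Cl c) * y = 0 := by apply ext <;> simp [mul_def, y]
theorem x_mul_y : (x : Cl c) * y = mk 0 0 0 1 := by apply ext <;> simp [mul_def, x, y]
theorem x_mul_y_add : (x : Cl c) * y + y * x = algebraMap ℂ (Cl c) c := by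
  rw [Algebra.algebraMap_eq_smul_one]
  apply ext <;> simp [mul_def, x, y, one_def]

/-- The linear map with the values `v₀, v₁, v₂, v₃` on the basis `1, x, y, xy`. -/
def lin {M : Type*} [AddCommGroup M] [Module ℂ M] (v₀ v₁ v₂ v₃ : M) : Cl c →ₗ[ℂ] M where
  toFun a := a.coord 0 • v₀ + a.coord 1 • v₁ + a.coord 2 • v₂ + a.coord 3 • v₃
  map_add' a b := by simp only [add_coord, add_smul]; abel
  map_smul' z a := by simp only [smul_coord, mul_smul, smul_add, RingHom.id_apply]

theorem lin_apply {M : Type*} [AddCommGroup M] [Module ℂ M] (v₀ v₁ v₂ v₃ : M) (a : Cl c) :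
    lin v₀ v₁ v₂ v₃ a
      = a.coord 0 • v₀ + a.coord 1 • v₁ + a.coord 2 • v₂ + a.coord 3 • v₃ := rfl

/-- Universal property: elements `p, m` of an algebra with `p² = m² = 0` and `pm + mp = c`
determine an algebra homomorphism `x ↦ p`, `y ↦ m`. -/
def lift {A : Type*} [Ring A] [Algebra ℂ A] (p m : A) (hp : p * p = 0) (hm : m * m = 0)
    (hpm : p * m + m * p = algebraMap ℂ A c) : Cl c →ₐ[ℂ] A :=
  AlgHom.ofLinearMap (lin 1 p m (p * m))
    (by simp [lin_apply, one_def])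
    (by
      have h : m * p = algebraMap ℂ A c - p * m := by rw [← hpm]; abel
      rw [Algebra.algebraMap_eq_smul_one] at h
      have h1 : p * (p * m) = 0 := by rw [← mul_assoc, hp, zero_mul]
      have h2 : p * m * m = 0 := by rw [mul_assoc, hm, mul_zero]
      have h3 : m * (p * m) = c • m := by
        rw [← mul_assoc, h, sub_mul, h2, sub_zero, smul_mul_assoc, one_mul]
      have h4 : p * m * p = c • p := by
        rw [mul_assoc, h, mul_sub, h1, sub_zero, mul_smul_comm, mul_one]
      have h5 : p * m * (p * m) = c • (p * m) := by rw [mul_assoc, h3, mul_smul_comm]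
      intro a b
      simp only [lin_apply, mul_def, mk_coord0, mk_coord1, mk_coord2, mk_coord3, add_mul, mul_add,
        smul_mul_smul_comm, one_mul, mul_one, hp, hm, h, h1, h2, h3, h4, h5, smul_zero, smul_sub,
        smul_smul]
      module)

@[simp] theorem lift_x {A : Type*} [Ring A] [Algebra ℂ A] (p m : A) (hp : p * p = 0)
    (hm : m * m = 0) (hpm : p * m + m * p = algebraMap ℂ A c) : lift p m hp hm hpm x = p := by
  simp [lift, lin_apply, x]

@[simp] theorem lift_y {A : Type*} [Ring A] [Algebra ℂ A] (p m : A) (hp : p * p = 0)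
    (hm : m * m = 0) (hpm : p * m + m * p = algebraMap ℂ A c) : lift p m hp hm hpm y = m := by
  simp [lift, lin_apply, y]

/-- The generators generate: homomorphisms that agree on `x` and `y` are equal. -/
theorem algHom_ext {A : Type*} [Ring A] [Algebra ℂ A] {f g : Cl c →ₐ[ℂ] A} (hx : f x = g x)
    (hy : f y = g y) : f = g := by
  have key : ∀ a : Cl c, a = a.coord 0 • (1 : Cl c) + a.coord 1 • x + a.coord 2 • y
      + a.coord 3 • (x * y) := fun a => by
    rw [x_mul_y]; apply ext <;> simp [x, y, one_def]
  ext a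
  rw [key a]
  simp only [map_add, map_smul, map_mul, map_one, hx, hy]

end Cl

/-- An associative algebra over `ℂ` with a `ℤ/2`-grading by an algebra automorphism `parity`,
which is `(-1)^s` on the part of degree `s`. -/
class SuperAlgebra (A : Type) [Ring A] [Algebra ℂ A] where
  parity : A →ₐ[ℂ] A
  parity_parity : ∀ a, parity (parity a) = a

/-- The even subspace, for a parity involution `ω`. -/
def evenPart {V : Type} [AddCommGroup V] [Module ℂ V] (ω : V →ₗ[ℂ] V) : Submodule ℂ V :=
  LinearMap.ker (ω - LinearMap.id)

/-- The odd subspace, for a parity involution `ω`. -/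
def oddPart {V : Type} [AddCommGroup V] [Module ℂ V] (ω : V →ₗ[ℂ] V) : Submodule ℂ V :=
  LinearMap.ker (ω + LinearMap.id)

theorem mem_evenPart {V : Type} [AddCommGroup V] [Module ℂ V] {ω : V →ₗ[ℂ] V} {v : V} :
    v ∈ evenPart ω ↔ ω v = v := by
  simp [evenPart, sub_eq_zero]

theorem mem_oddPart {V : Type} [AddCommGroup V] [Module ℂ V] {ω : V →ₗ[ℂ] V} {v : V} :
    v ∈ oddPart ω ↔ ω v = -v := by
  simp [oddPart, add_eq_zero_iff_eq_neg]

/-- An involution `ω` is the same as a `ℤ/2`-grading: the space is the direct sum of the even and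
the odd subspace. -/
theorem isCompl_evenPart_oddPart {V : Type} [AddCommGroup V] [Module ℂ V] (ω : V →ₗ[ℂ] V)
    (h : ∀ v, ω (ω v) = v) : IsCompl (evenPart ω) (oddPart ω) := by
  constructor
  · rw [Submodule.disjoint_def]
    intro v h0 h1
    rw [mem_evenPart] at h0
    rw [mem_oddPart, h0] at h1
    have h2 : (2 : ℂ) • v = 0 := by rw [two_smul]; nth_rewrite 1 [h1]; simp
    simpa using h2
  · rw [codisjoint_iff, eq_top_iff]
    intro v _
    have hv : v = (1 / 2 : ℂ) • (v + ω v) + (1 / 2 : ℂ) • (v - ω v) := by module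
    rw [hv]
    refine Submodule.add_mem_sup ?_ ?_
    · rw [mem_evenPart]; simp [h, add_comm]
    · rw [mem_oddPart]; simp only [map_smul, map_sub, h]; module

/-- The symmetric braiding `v ⊗ w ↦ (-1)^{|v||w|} w ⊗ v` of super-vector spaces, in terms of the
parity involutions; `(-1)^{|v||w|} = (1 + (-1)^{|v|} + (-1)^{|w|} - (-1)^{|v|} (-1)^{|w|}) / 2`. -/
def superFlip {V W : Type} [AddCommGroup V] [Module ℂ V] [AddCommGroup W] [Module ℂ W]
    (ωV : V →ₗ[ℂ] V) (ωW : W →ₗ[ℂ] W) : V ⊗[ℂ] W →ₗ[ℂ] W ⊗[ℂ] V :=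
  (comm ℂ V W).toLinearMap ∘ₗ ((1 / 2 : ℂ) •
    (LinearMap.id + map ωV LinearMap.id + map LinearMap.id ωW - map ωV ωW))

theorem superFlip_of_even_left {V W : Type} [AddCommGroup V] [Module ℂ V] [AddCommGroup W]
    [Module ℂ W] (ωV : V →ₗ[ℂ] V) (ωW : W →ₗ[ℂ] W) {v : V} (w : W) (hv : v ∈ evenPart ωV) :
    superFlip ωV ωW (v ⊗ₜ w) = w ⊗ₜ v := by
  rw [mem_evenPart] at hv
  have h : (v ⊗ₜ[ℂ] w + v ⊗ₜ[ℂ] w + v ⊗ₜ[ℂ] ωW w - v ⊗ₜ[ℂ] ωW w) = (2 : ℂ) • (v ⊗ₜ[ℂ] w) := by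
    module
  simp [superFlip, hv, h, smul_smul]

theorem superFlip_of_even_right {V W : Type} [AddCommGroup V] [Module ℂ V] [AddCommGroup W]
    [Module ℂ W] (ωV : V →ₗ[ℂ] V) (ωW : W →ₗ[ℂ] W) (v : V) {w : W} (hw : w ∈ evenPart ωW) :
    superFlip ωV ωW (v ⊗ₜ w) = w ⊗ₜ v := by
  rw [mem_evenPart] at hw
  have h : (v ⊗ₜ[ℂ] w + ωV v ⊗ₜ[ℂ] w + v ⊗ₜ[ℂ] w - ωV v ⊗ₜ[ℂ] w) = (2 : ℂ) • (v ⊗ₜ[ℂ] w) := by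
    module
  simp [superFlip, hw, h, smul_smul]

theorem superFlip_of_odd {V W : Type} [AddCommGroup V] [Module ℂ V] [AddCommGroup W]
    [Module ℂ W] (ωV : V →ₗ[ℂ] V) (ωW : W →ₗ[ℂ] W) {v : V} {w : W} (hv : v ∈ oddPart ωV)
    (hw : w ∈ oddPart ωW) : superFlip ωV ωW (v ⊗ₜ w) = -(w ⊗ₜ v) := by
  rw [mem_oddPart] at hv hw
  have h : (v ⊗ₜ[ℂ] w - v ⊗ₜ[ℂ] w - v ⊗ₜ[ℂ] w - v ⊗ₜ[ℂ] w) = (2 : ℂ) • (-(v ⊗ₜ[ℂ] w)) := by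
    module
  simp only [superFlip, LinearMap.comp_apply, LinearMap.smul_apply, LinearMap.sub_apply,
    LinearMap.add_apply, LinearMap.id_apply, TensorProduct.map_tmul, hv, hw,
    TensorProduct.neg_tmul, TensorProduct.tmul_neg, neg_neg, ← sub_eq_add_neg, h]
  simp [smul_smul]

namespace Cl

variable {c : ℂ}

theorem eq_sum (a : Cl c) : a = a.coord 0 • (1 : Cl c) + a.coord 1 • x + a.coord 2 • y
    + a.coord 3 • (x * y) := by
  rw [x_mul_y]; apply ext <;> simp [x, y, one_def]

/-- `x` and `y` are odd. -/
instance : SuperAlgebra (Cl c) where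
  parity := lift (-x) (-y) (by simp [x_mul_x]) (by simp [y_mul_y]) (by simp [x_mul_y_add])
  parity_parity a := by
    have h : ((lift (-x) (-y) (by simp [x_mul_x]) (by simp [y_mul_y])
        (by simp [x_mul_y_add]) : Cl c →ₐ[ℂ] Cl c).comp
        (lift (-x) (-y) (by simp [x_mul_x]) (by simp [y_mul_y])
        (by simp [x_mul_y_add]))) = AlgHom.id ℂ (Cl c) := by
      apply algHom_ext <;> simp
    exact congrArg (fun f => f a) h

open SuperAlgebra (parity)

@[simp] theorem parity_x : parity (x : Cl c) = -x := lift_x _ _ _ _ _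
@[simp] theorem parity_y : parity (y : Cl c) = -y := lift_y _ _ _ _ _

theorem parity_compat {V : Type} [AddCommGroup V] [Module ℂ V] (ω : V →ₗ[ℂ] V)
    (ρ : Cl c →ₐ[ℂ] Module.End ℂ V) (hx : ∀ v, ω (ρ x v) = -ρ x (ω v))
    (hy : ∀ v, ω (ρ y v) = -ρ y (ω v)) (a : Cl c) (v : V) :
    ω (ρ a v) = ρ (parity a) (ω v) := by
  conv_lhs => rw [eq_sum a]
  conv_rhs => rw [eq_sum a]
  simp [hx, hy]

theorem intertwiner {V W : Type} [AddCommGroup V] [Module ℂ V] [AddCommGroup W] [Module ℂ W]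
    (ρ : Cl c →ₐ[ℂ] Module.End ℂ V) (ρ' : Cl c →ₐ[ℂ] Module.End ℂ W) (f : V →ₗ[ℂ] W)
    (hx : ∀ v, f (ρ x v) = ρ' x (f v)) (hy : ∀ v, f (ρ y v) = ρ' y (f v)) (a : Cl c) (v : V) :
    f (ρ a v) = ρ' a (f v) := by
  rw [eq_sum a]
  simp [hx, hy]

end Cl

open SuperAlgebra (parity)

/-- The parity of a superalgebra as a linear map. -/
abbrev parityLin (A : Type) [Ring A] [Algebra ℂ A] [SuperAlgebra A] : A →ₗ[ℂ] A :=
  (parity (A := A)).toLinearMap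

/-- The map `p ⊗ q ⊗ u ⊗ v ↦ (-1)^{|q||u|} p ⊗ u ⊗ q ⊗ v`, the symmetric braiding of super-vector
spaces in the two middle factors. -/
def superSwap {P Q U V : Type} [AddCommGroup P] [Module ℂ P] [AddCommGroup Q] [Module ℂ Q]
    [AddCommGroup U] [Module ℂ U] [AddCommGroup V] [Module ℂ V]
    (ωQ : Q →ₗ[ℂ] Q) (ωU : U →ₗ[ℂ] U) :
    (P ⊗[ℂ] Q) ⊗[ℂ] (U ⊗[ℂ] V) →ₗ[ℂ] (P ⊗[ℂ] U) ⊗[ℂ] (Q ⊗[ℂ] V) :=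
  (assoc ℂ P U (Q ⊗[ℂ] V)).symm.toLinearMap ∘ₗ
    map LinearMap.id ((assoc ℂ U Q V).toLinearMap ∘ₗ map (superFlip ωQ ωU) LinearMap.id ∘ₗ
      (assoc ℂ Q U V).symm.toLinearMap) ∘ₗ
    (assoc ℂ P Q (U ⊗[ℂ] V)).toLinearMap

/-- The multiplication `(a ⊗ b)(a' ⊗ b') = (-1)^{|b||a'|} aa' ⊗ bb'` of the tensor product
of a superalgebra with itself, in super-vector spaces. -/
def superMul {A : Type} [Ring A] [Algebra ℂ A] [SuperAlgebra A] (s t : A ⊗[ℂ] A) : A ⊗[ℂ] A :=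
  map (LinearMap.mul' ℂ A) (LinearMap.mul' ℂ A)
    (superSwap (parityLin A) (parityLin A) (s ⊗ₜ[ℂ] t))

/-- The Grassmann algebra with the odd generators `a₁`, `a₂`. -/
abbrev G : Type := Cl 0

/-- The generator `a₁` of `G`. -/
abbrev a₁ : G := Cl.x

/-- The generator `a₂` of `G`. -/
abbrev a₂ : G := Cl.y

/-- The coproduct of `G`: the homomorphism of superalgebras with
`a_j ↦ a_j ⊗ 1 + 1 ⊗ a_j`, given by its values on the basis `1, a₁, a₂, a₁a₂`. -/
def coG : G →ₗ[ℂ] G ⊗[ℂ] G :=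
  Cl.lin (1 ⊗ₜ 1) (a₁ ⊗ₜ 1 + 1 ⊗ₜ a₁) (a₂ ⊗ₜ 1 + 1 ⊗ₜ a₂)
    (superMul (a₁ ⊗ₜ 1 + 1 ⊗ₜ a₁) (a₂ ⊗ₜ 1 + 1 ⊗ₜ a₂))

/-- The antipode of `G`: `a_j ↦ -a_j`, hence `a₁a₂ ↦ (-1)^{|a₁||a₂|} S(a₂) S(a₁) = a₁a₂`. -/
def antipodeG : G →ₗ[ℂ] G := Cl.lin 1 (-a₁) (-a₂) (-(a₂ * a₁))

/-- The map `φ` in the associator of three twisted objects. -/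
def phiG (β : ℂ) : G →ₗ[ℂ] G :=
  Cl.lin (β ^ 2 • (a₁ * a₂)) (β ^ 2 • a₁) (β ^ 2 • a₂) (-(β ^ 2 • 1))

/-- The algebra `S`, the direct sum of a Grassmann and a Clifford algebra. It is the algebra
generated by `x⁺, x⁻, L` with the relations in `S.relations`. -/
abbrev S : Type := Cl 0 × Cl 1

namespace S

/-- The odd generator `x⁺`. -/
def xp : S := (Cl.x, Cl.x)

/-- The odd generator `x⁻`. -/
def xm : S := (Cl.y, Cl.y)

/-- The even generator `L`. -/
def L : S := (1, -1)

/-- The idempotent `e₀`. -/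
def e₀ : S := (1 / 2 : ℂ) • (1 + L)

/-- The idempotent `e₁`. -/
def e₁ : S := (1 / 2 : ℂ) • (1 - L)

theorem e₀_eq : e₀ = (1, 0) := by
  refine Prod.ext ?_ ?_
  · change (1 / 2 : ℂ) • ((1 : Cl 0) + 1) = 1
    module
  · change (1 / 2 : ℂ) • ((1 : Cl 1) + -1) = 0
    module

theorem e₁_eq : e₁ = (0, 1) := by
  refine Prod.ext ?_ ?_
  · change (1 / 2 : ℂ) • ((1 : Cl 0) - 1) = 0
    module
  · change (1 / 2 : ℂ) • ((1 : Cl 1) - -1) = 1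
    module

theorem relations : xp * L = L * xp ∧ xm * L = L * xm ∧ xp * xm + xm * xp = (1 / 2 : ℂ) • (1 - L) ∧
    xp * xp = 0 ∧ xm * xm = 0 ∧ L * L = 1 := by
  refine ⟨?_, ?_, ?_, ?_, ?_, ?_⟩
  · simp [xp, L]
  · simp [xm, L]
  · change _ = e₁
    rw [e₁_eq]
    simp [xp, xm, Cl.x_mul_y_add]
  · simp [xp, Cl.x_mul_x]
  · simp [xm, Cl.y_mul_y]
  · simp [L]

instance : SuperAlgebra S where
  parity := AlgHom.prod ((parity (A := Cl 0)).comp (AlgHom.fst ℂ _ _))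
    ((parity (A := Cl 1)).comp (AlgHom.snd ℂ _ _))
  parity_parity a := by
    simp [SuperAlgebra.parity_parity]

/-- The value of the coproduct of `S` on `x⁺`. -/
def coXp : S ⊗[ℂ] S :=
  xp ⊗ₜ 1 + (e₀ - Complex.I • e₁) ⊗ₜ xp + Complex.I • (e₁ ⊗ₜ (e₁ * (xp - xm)))

/-- The value of the coproduct of `S` on `x⁻`. -/
def coXm : S ⊗[ℂ] S :=
  xm ⊗ₜ 1 + (e₀ - Complex.I • e₁) ⊗ₜ xm - Complex.I • (e₁ ⊗ₜ (e₁ * (xp - xm)))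

/-- The value of the coproduct of `S` on `L`. -/
def coL : S ⊗[ℂ] S := L ⊗ₜ L

/-- The value of the coproduct of `S` on `e₀ = (1 + L) / 2`. -/
def coE₀ : S ⊗[ℂ] S := (1 / 2 : ℂ) • (1 ⊗ₜ 1 + coL)

/-- The value of the coproduct of `S` on `e₁ = (1 - L) / 2`. -/
def coE₁ : S ⊗[ℂ] S := (1 / 2 : ℂ) • (1 ⊗ₜ 1 - coL)

/-- The coproduct of `S`: the homomorphism of superalgebras `S → S ⊗ S` with the above values on
the generators, given by its values on the basis `e₀, x⁺e₀, x⁻e₀, x⁺x⁻e₀, e₁, x⁺e₁, x⁻e₁, x⁺x⁻e₁`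
of `S`. -/
def co : S →ₗ[ℂ] S ⊗[ℂ] S :=
  (Cl.lin coE₀ (superMul coXp coE₀) (superMul coXm coE₀) (superMul (superMul coXp coXm) coE₀)) ∘ₗ
      LinearMap.fst ℂ (Cl 0) (Cl 1) +
    (Cl.lin coE₁ (superMul coXp coE₁) (superMul coXm coE₁) (superMul (superMul coXp coXm) coE₁)) ∘ₗ
      LinearMap.snd ℂ (Cl 0) (Cl 1)

/-- The even element `b = x⁻x⁺e₁`. -/
def b : S := xm * xp * e₁

/-- The element `δ₁ = 1 + x⁺x⁻`. -/
def δ₁ : S := 1 + xp * xm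

/-- The element `ξ = x⁺ + x⁻`. -/
def ξ : S := xp + xm

/-- The left ideal `B = S b`. -/
def B : Submodule ℂ S := LinearMap.range (LinearMap.mulRight ℂ b)

/-- The projection `S → B`, right multiplication with `b`. -/
def Rb : S →ₗ[ℂ] B := (LinearMap.mulRight ℂ b).rangeRestrict

theorem parity_b : parity b = b := by
  have h1 : parity xp = -xp := Prod.ext Cl.parity_x Cl.parity_x
  have h2 : parity xm = -xm := Prod.ext Cl.parity_y Cl.parity_y
  have h3 : parity e₁ = e₁ := by
    rw [e₁_eq]; exact Prod.ext (map_zero (parity (A := Cl 0))) (map_one (parity (A := Cl 1)))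
  simp [b, h1, h2, h3]

theorem mul_mem_B (s : S) {t : S} (ht : t ∈ B) : s * t ∈ B := by
  obtain ⟨u, rfl⟩ := ht
  exact ⟨s * u, by simp [mul_assoc]⟩

theorem parity_mem_B {t : S} (ht : t ∈ B) : parity t ∈ B := by
  obtain ⟨u, rfl⟩ := ht
  exact ⟨parity u, by simp [parity_b]⟩

end S

/-! ## Super-vector spaces and super-representations -/

/-- A finite-dimensional complex super-vector space: the grading is given by the parity involution
`ω`, which is `(-1)^s` on the subspace of degree `s`. -/
structure SVect where
  V : Type
  [addCommGroup : AddCommGroup V]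
  [module : Module ℂ V]
  [finiteDimensional : FiniteDimensional ℂ V]
  ω : V →ₗ[ℂ] V
  ω_ω : ∀ v, ω (ω v) = v

attribute [instance] SVect.addCommGroup SVect.module SVect.finiteDimensional
attribute [simp] SVect.ω_ω

/-- The tensor product of super-vector spaces. -/
abbrev SVect.tensor (X Y : SVect) : SVect where
  V := X.V ⊗[ℂ] Y.V
  ω := map X.ω Y.ω
  ω_ω v := by
    have h : (map X.ω Y.ω) ∘ₗ (map X.ω Y.ω) = LinearMap.id :=
      TensorProduct.ext' fun x y => by simp
    exact LinearMap.congr_fun h v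

/-- The direct sum of super-vector spaces. -/
abbrev SVect.sum (X Y : SVect) : SVect where
  V := X.V × Y.V
  ω := LinearMap.prodMap X.ω Y.ω
  ω_ω v := by simp

/-- The symmetric braiding of super-vector spaces. -/
abbrev SVect.flip (X Y : SVect) : X.V ⊗[ℂ] Y.V →ₗ[ℂ] Y.V ⊗[ℂ] X.V := superFlip X.ω Y.ω

/-- The space `ℂ^{1|0}`. -/
abbrev SVect.one : SVect where
  V := ℂ
  ω := LinearMap.id
  ω_ω _ := rfl

/-- The zero space. -/
abbrev SVect.zero : SVect where
  V := PUnit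
  ω := LinearMap.id
  ω_ω _ := rfl

/-- The super-vector space underlying `G`. -/
abbrev svG : SVect where
  V := G
  ω := parityLin G
  ω_ω := SuperAlgebra.parity_parity

/-- A finite-dimensional representation of a superalgebra `A` in super-vector spaces: the action
map `A ⊗ V → V` is even. -/
structure SRep (A : Type) [Ring A] [Algebra ℂ A] [SuperAlgebra A] extends SVect where
  ρ : A →ₐ[ℂ] Module.End ℂ V
  ω_ρ : ∀ a v, ω (ρ a v) = ρ (parity a) (ω v)

namespace SRep

section Category

variable {A : Type} [Ring A] [Algebra ℂ A] [SuperAlgebra A]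

/-- The even `A`-linear maps. -/
def homs (X Y : SRep A) : Submodule ℂ (X.V →ₗ[ℂ] Y.V) where
  carrier := {f | (∀ v, f (X.ω v) = Y.ω (f v)) ∧ ∀ a v, f (X.ρ a v) = Y.ρ a (f v)}
  add_mem' hf hg := ⟨fun v => by simp [hf.1, hg.1], fun a v => by simp [hf.2, hg.2]⟩
  zero_mem' := ⟨fun v => by simp, fun a v => by simp⟩
  smul_mem' z f hf := ⟨fun v => by simp [hf.1], fun a v => by simp [hf.2]⟩

instance : Category (SRep A) where
  Hom X Y := homs X Y
  id X := ⟨LinearMap.id, fun _ => rfl, fun _ _ => rfl⟩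
  comp f g := ⟨g.1 ∘ₗ f.1, fun v => by simp [f.2.1, g.2.1], fun a v => by simp [f.2.2, g.2.2]⟩

instance : Preadditive (SRep A) where
  homGroup X Y := inferInstanceAs (AddCommGroup (homs X Y))
  add_comp _ _ _ f f' g := Subtype.ext (LinearMap.comp_add f.1 f'.1 g.1)
  comp_add _ _ _ f g g' := Subtype.ext (LinearMap.add_comp f.1 g'.1 g.1)

instance : Linear ℂ (SRep A) where
  homModule X Y := inferInstanceAs (Module ℂ (homs X Y))
  smul_comp _ _ _ r f g := Subtype.ext (LinearMap.comp_smul g.1 r f.1)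
  comp_smul _ _ _ f r g := Subtype.ext (LinearMap.smul_comp r g.1 f.1)

/-- The direct sum of representations. -/
abbrev sum (X Y : SRep A) : SRep A where
  toSVect := X.toSVect.sum Y.toSVect
  ρ := AlgHom.ofLinearMap
    { toFun := fun a => LinearMap.prodMap (X.ρ a) (Y.ρ a)
      map_add' := fun a a' => by ext <;> simp
      map_smul' := fun z a => by ext <;> simp }
    (by ext <;> simp) (fun a a' => by ext <;> simp)
  ω_ρ a v := Prod.ext (X.ω_ρ a v.1) (Y.ω_ρ a v.2)

end Category

section Grassmann

variable (X Y : SRep G)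

theorem ω_a₁ (v : X.V) : X.ω (X.ρ a₁ v) = -X.ρ a₁ (X.ω v) := by
  rw [X.ω_ρ, Cl.parity_x, map_neg, LinearMap.neg_apply]

theorem ω_a₂ (v : X.V) : X.ω (X.ρ a₂ v) = -X.ρ a₂ (X.ω v) := by
  rw [X.ω_ρ, Cl.parity_y, map_neg, LinearMap.neg_apply]

theorem a₁_a₁ (v : X.V) : X.ρ a₁ (X.ρ a₁ v) = 0 := by
  rw [← Module.End.mul_apply, ← map_mul, Cl.x_mul_x, map_zero, LinearMap.zero_apply]

theorem a₂_a₂ (v : X.V) : X.ρ a₂ (X.ρ a₂ v) = 0 := by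
  rw [← Module.End.mul_apply, ← map_mul, Cl.y_mul_y, map_zero, LinearMap.zero_apply]

theorem a₁_a₂ (v : X.V) : X.ρ a₁ (X.ρ a₂ v) = -X.ρ a₂ (X.ρ a₁ v) := by
  rw [eq_neg_iff_add_eq_zero, ← Module.End.mul_apply, ← Module.End.mul_apply, ← map_mul, ← map_mul,
    ← LinearMap.add_apply, ← map_add, Cl.x_mul_y_add, map_zero, map_zero, LinearMap.zero_apply]

/-- The tensor product of two representations of `G` in super-vector spaces: `g` acts by
`x ⊗ y ↦ ∑ (-1)^{|g''||x|} g'.x ⊗ g''.y`, so `a_j` acts by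
`x ⊗ y ↦ a_j.x ⊗ y + (-1)^{|x|} x ⊗ a_j.y`. -/
abbrev tensor : SRep G where
  toSVect := X.toSVect.tensor Y.toSVect
  ρ := Cl.lift (map (X.ρ a₁) LinearMap.id + map X.ω (Y.ρ a₁))
    (map (X.ρ a₂) LinearMap.id + map X.ω (Y.ρ a₂))
    (TensorProduct.ext' fun x y => by simp [ω_a₁, a₁_a₁, TensorProduct.neg_tmul])
    (TensorProduct.ext' fun x y => by simp [ω_a₂, a₂_a₂, TensorProduct.neg_tmul])
    (TensorProduct.ext' fun x y => by
      simp [ω_a₁, ω_a₂, a₁_a₂, TensorProduct.neg_tmul, TensorProduct.tmul_neg]; abel)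
  ω_ρ := Cl.parity_compat _ _
    (fun v => by
      rw [Cl.lift_x]
      refine LinearMap.congr_fun (f := map X.ω Y.ω ∘ₗ (map (X.ρ a₁) LinearMap.id + map X.ω (Y.ρ a₁)))
        (g := -((map (X.ρ a₁) LinearMap.id + map X.ω (Y.ρ a₁)) ∘ₗ map X.ω Y.ω))
        (TensorProduct.ext' fun x y => ?_) v
      simp [ω_a₁, TensorProduct.neg_tmul, TensorProduct.tmul_neg, add_comm])
    (fun v => by
      rw [Cl.lift_y]
      refine LinearMap.congr_fun (f := map X.ω Y.ω ∘ₗ (map (X.ρ a₂) LinearMap.id + map X.ω (Y.ρ a₂)))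
        (g := -((map (X.ρ a₂) LinearMap.id + map X.ω (Y.ρ a₂)) ∘ₗ map X.ω Y.ω))
        (TensorProduct.ext' fun x y => ?_) v
      simp [ω_a₂, TensorProduct.neg_tmul, TensorProduct.tmul_neg, add_comm])

/-- The trivial representation `ℂ^{1|0}` of `G`: `a₁` and `a₂` act by `0`. -/
abbrev one : SRep G where
  toSVect := SVect.one
  ρ := Cl.lift 0 0 (by simp) (by simp) (by simp)
  ω_ρ := Cl.parity_compat _ _ (fun v => by simp) (fun v => by simp)

/-- The action of `G` on `G ⊗ W` by left multiplication on the first factor. -/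
abbrev free (W : SVect) : SRep G where
  toSVect := svG.tensor W
  ρ := (Module.End.rTensorAlgHom ℂ G W.V).comp (Algebra.lmul ℂ G)
  ω_ρ g v := by
    refine LinearMap.congr_fun (f := map (parityLin G) W.ω ∘ₗ LinearMap.rTensor W.V (LinearMap.mulLeft ℂ g))
      (g := LinearMap.rTensor W.V (LinearMap.mulLeft ℂ (parity g)) ∘ₗ map (parityLin G) W.ω)
      (TensorProduct.ext' fun x y => ?_) v
    simp

end Grassmann

end SRep

/-! ## The category `SF` -/

/-- The category `SF = Rep_sv(G) ⊕ SVect`: an object is a pair of a representation of `G` in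
super-vector spaces and a super-vector space. -/
structure SF where
  /-- the untwisted component, in `Rep_sv(G)` -/
  c₀ : SRep G
  /-- the twisted component, in `SVect` -/
  c₁ : SVect

namespace SF

/-- The morphism space of `SF`: pairs of an even `G`-linear map and an even linear map. -/
def homs (X Y : SF) : Submodule ℂ ((X.c₀.V →ₗ[ℂ] Y.c₀.V) × (X.c₁.V →ₗ[ℂ] Y.c₁.V)) where
  carrier := {f | ((∀ v, f.1 (X.c₀.ω v) = Y.c₀.ω (f.1 v)) ∧
    ∀ a v, f.1 (X.c₀.ρ a v) = Y.c₀.ρ a (f.1 v)) ∧ ∀ v, f.2 (X.c₁.ω v) = Y.c₁.ω (f.2 v)}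
  add_mem' hf hg := ⟨⟨fun v => by simp [hf.1.1, hg.1.1], fun a v => by simp [hf.1.2, hg.1.2]⟩,
    fun v => by simp [hf.2, hg.2]⟩
  zero_mem' := ⟨⟨fun v => by simp, fun a v => by simp⟩, fun v => by simp⟩
  smul_mem' z f hf := ⟨⟨fun v => by simp [hf.1.1], fun a v => by simp [hf.1.2]⟩,
    fun v => by simp [hf.2]⟩

instance : Category SF where
  Hom X Y := homs X Y
  id X := ⟨(LinearMap.id, LinearMap.id), ⟨fun _ => rfl, fun _ _ => rfl⟩, fun _ => rfl⟩
  comp f g := ⟨(g.1.1 ∘ₗ f.1.1, g.1.2 ∘ₗ f.1.2),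
    ⟨fun v => by simp [f.2.1.1, g.2.1.1], fun a v => by simp [f.2.1.2, g.2.1.2]⟩,
    fun v => by simp [f.2.2, g.2.2]⟩

instance : Preadditive SF where
  homGroup X Y := inferInstanceAs (AddCommGroup (homs X Y))
  add_comp _ _ _ f f' g := Subtype.ext
    (Prod.ext (LinearMap.comp_add f.1.1 f'.1.1 g.1.1) (LinearMap.comp_add f.1.2 f'.1.2 g.1.2))
  comp_add _ _ _ f g g' := Subtype.ext
    (Prod.ext (LinearMap.add_comp f.1.1 g'.1.1 g.1.1) (LinearMap.add_comp f.1.2 g'.1.2 g.1.2))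

instance : Linear ℂ SF where
  homModule X Y := inferInstanceAs (Module ℂ (homs X Y))
  smul_comp _ _ _ r f g := Subtype.ext
    (Prod.ext (LinearMap.comp_smul g.1.1 r f.1.1) (LinearMap.comp_smul g.1.2 r f.1.2))
  comp_smul _ _ _ f r g := Subtype.ext
    (Prod.ext (LinearMap.smul_comp r g.1.1 f.1.1) (LinearMap.smul_comp r g.1.2 f.1.2))

/-- The map of untwisted components of a morphism. -/
def map₀ {X Y : SF} (f : X ⟶ Y) : X.c₀.V →ₗ[ℂ] Y.c₀.V := f.1.1

/-- The map of twisted components of a morphism. -/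
def map₁ {X Y : SF} (f : X ⟶ Y) : X.c₁.V →ₗ[ℂ] Y.c₁.V := f.1.2

/-- The tensor product `X * Y`: it is `X ⊗ Y` with the diagonal action of `G` for untwisted `X, Y`,
the super-vector space `X ⊗ Y` if exactly one of `X, Y` is twisted, `G ⊗ X ⊗ Y` if both are
twisted, and it distributes over direct sums. -/
abbrev tensorObj (X Y : SF) : SF where
  c₀ := (X.c₀.tensor Y.c₀).sum (SRep.free (X.c₁.tensor Y.c₁))
  c₁ := (X.c₀.toSVect.tensor Y.c₁).sum (X.c₁.tensor Y.c₀.toSVect)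

theorem map₀_ω {X Y : SF} (f : X ⟶ Y) (v : X.c₀.V) : map₀ f (X.c₀.ω v) = Y.c₀.ω (map₀ f v) :=
  f.2.1.1 v

theorem map₀_ρ {X Y : SF} (f : X ⟶ Y) (a : G) (v : X.c₀.V) :
    map₀ f (X.c₀.ρ a v) = Y.c₀.ρ a (map₀ f v) :=
  f.2.1.2 a v

theorem map₁_ω {X Y : SF} (f : X ⟶ Y) (v : X.c₁.V) : map₁ f (X.c₁.ω v) = Y.c₁.ω (map₁ f v) :=
  f.2.2 v

/-- The tensor product `f * g` of morphisms: `f ⊗ g` in the first three cases, `id_G ⊗ f ⊗ g` if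
both are twisted. -/
def tensorHom {X X' Y Y' : SF} (f : X ⟶ X') (g : Y ⟶ Y') : tensorObj X Y ⟶ tensorObj X' Y' :=
  ⟨(LinearMap.prodMap (map (map₀ f) (map₀ g)) (map LinearMap.id (map (map₁ f) (map₁ g))),
    LinearMap.prodMap (map (map₀ f) (map₁ g)) (map (map₁ f) (map₀ g))), by
    refine ⟨⟨fun v => Prod.ext ?_ ?_, fun a v => Prod.ext ?_ ?_⟩, fun v => Prod.ext ?_ ?_⟩
    · refine LinearMap.congr_fun (f := map (map₀ f) (map₀ g) ∘ₗ map X.c₀.ω Y.c₀.ω)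
        (g := map X'.c₀.ω Y'.c₀.ω ∘ₗ map (map₀ f) (map₀ g)) (TensorProduct.ext' fun x y => ?_) v.1
      simp [map₀_ω]
    · refine LinearMap.congr_fun
        (f := map LinearMap.id (map (map₁ f) (map₁ g)) ∘ₗ map (parityLin G) (map X.c₁.ω Y.c₁.ω))
        (g := map (parityLin G) (map X'.c₁.ω Y'.c₁.ω) ∘ₗ map LinearMap.id (map (map₁ f) (map₁ g)))
        (TensorProduct.ext_threefold' fun h x y => ?_) v.2
      simp [map₁_ω]
    · refine Cl.intertwiner (X.c₀.tensor Y.c₀).ρ (X'.c₀.tensor Y'.c₀).ρ (map (map₀ f) (map₀ g))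
        (fun v => ?_) (fun v => ?_) a v.1
      · rw [Cl.lift_x, Cl.lift_x]
        refine LinearMap.congr_fun
          (f := map (map₀ f) (map₀ g) ∘ₗ
            (map (X.c₀.ρ a₁) LinearMap.id + map X.c₀.ω (Y.c₀.ρ a₁)))
          (g := (map (X'.c₀.ρ a₁) LinearMap.id + map X'.c₀.ω (Y'.c₀.ρ a₁)) ∘ₗ
            map (map₀ f) (map₀ g)) (TensorProduct.ext' fun x y => ?_) v
        simp [map₀_ω, map₀_ρ]
      · rw [Cl.lift_y, Cl.lift_y]
        refine LinearMap.congr_fun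
          (f := map (map₀ f) (map₀ g) ∘ₗ
            (map (X.c₀.ρ a₂) LinearMap.id + map X.c₀.ω (Y.c₀.ρ a₂)))
          (g := (map (X'.c₀.ρ a₂) LinearMap.id + map X'.c₀.ω (Y'.c₀.ρ a₂)) ∘ₗ
            map (map₀ f) (map₀ g)) (TensorProduct.ext' fun x y => ?_) v
        simp [map₀_ω, map₀_ρ]
    · refine LinearMap.congr_fun
        (f := map LinearMap.id (map (map₁ f) (map₁ g)) ∘ₗ
          LinearMap.rTensor _ (LinearMap.mulLeft ℂ a))
        (g := LinearMap.rTensor _ (LinearMap.mulLeft ℂ a) ∘ₗ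
          map LinearMap.id (map (map₁ f) (map₁ g))) (TensorProduct.ext' fun h x => ?_) v.2
      simp
    · refine LinearMap.congr_fun (f := map (map₀ f) (map₁ g) ∘ₗ map X.c₀.ω Y.c₁.ω)
        (g := map X'.c₀.ω Y'.c₁.ω ∘ₗ map (map₀ f) (map₁ g)) (TensorProduct.ext' fun x y => ?_) v.1
      simp [map₀_ω, map₁_ω]
    · refine LinearMap.congr_fun (f := map (map₁ f) (map₀ g) ∘ₗ map X.c₁.ω Y.c₀.ω)
        (g := map X'.c₁.ω Y'.c₀.ω ∘ₗ map (map₁ f) (map₀ g)) (TensorProduct.ext' fun x y => ?_) v.2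
      simp [map₀_ω, map₁_ω]⟩

/-- The tensor unit: `ℂ^{1|0}` with the trivial action of `G`, untwisted. -/
abbrev tensorUnit : SF where
  c₀ := SRep.one
  c₁ := SVect.zero

/-! ### The associator of `SF`, sector by sector

The indices say which of `X, Y, Z` are untwisted (`0`) and twisted (`1`). -/

/-- `1 + C + C²/2`, the exponential of an endomorphism `C` with `C³ = 0`. -/
def expC {V : Type} [AddCommGroup V] [Module ℂ V] (C : V →ₗ[ℂ] V) : V →ₗ[ℂ] V :=
  LinearMap.id + C + (1 / 2 : ℂ) • (C ∘ₗ C)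

/-- The action of the copairing `C = a₂ ⊗ a₁ - a₁ ⊗ a₂` on the first and third factor:
`x ⊗ y ⊗ z ↦ (-1)^{|x|+|y|} (a₂.x ⊗ y ⊗ a₁.z - a₁.x ⊗ y ⊗ a₂.z)`. -/
def C13 (X : SRep G) (Y : SVect) (Z : SRep G) :
    X.V ⊗[ℂ] (Y.V ⊗[ℂ] Z.V) →ₗ[ℂ] X.V ⊗[ℂ] (Y.V ⊗[ℂ] Z.V) :=
  map (X.ρ a₂ ∘ₗ X.ω) (map Y.ω (Z.ρ a₁)) - map (X.ρ a₁ ∘ₗ X.ω) (map Y.ω (Z.ρ a₂))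

/-- The action of `C = a₂ ⊗ a₁ - a₁ ⊗ a₂`:
`x ⊗ y ↦ (-1)^{|x|} (a₂.x ⊗ a₁.y - a₁.x ⊗ a₂.y)`. -/
def C12 (X Y : SRep G) : X.V ⊗[ℂ] Y.V →ₗ[ℂ] X.V ⊗[ℂ] Y.V :=
  map (X.ρ a₂ ∘ₗ X.ω) (Y.ρ a₁) - map (X.ρ a₁ ∘ₗ X.ω) (Y.ρ a₂)

/-- The trivial rebracketing, used in the sectors 000, 001, 100. -/
def assocTriv (X Y Z : SVect) : X.V ⊗[ℂ] (Y.V ⊗[ℂ] Z.V) →ₗ[ℂ] (X.V ⊗[ℂ] Y.V) ⊗[ℂ] Z.V :=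
  (assoc ℂ X.V Y.V Z.V).symm.toLinearMap

/-- Sector 010: `exp(C^{(13)})`. -/
def assoc010 (X : SRep G) (Y : SVect) (Z : SRep G) :
    X.V ⊗[ℂ] (Y.V ⊗[ℂ] Z.V) →ₗ[ℂ] (X.V ⊗[ℂ] Y.V) ⊗[ℂ] Z.V :=
  assocTriv X.toSVect Y Z.toSVect ∘ₗ expC (C13 X Y Z)

/-- The action map `G ⊗ X → X`. -/
def act (X : SRep G) : G ⊗[ℂ] X.V →ₗ[ℂ] X.V := TensorProduct.lift X.ρ.toLinearMap

/-- The map `[{id_G ⊗ (ρ^X ∘ (S ⊗ id_X))} ∘ {Δ ⊗ id_X} ∘ τ_{X,G}] : X ⊗ G → G ⊗ X`,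
with `τ` the symmetric braiding of super-vector spaces. -/
def past (X : SRep G) : X.V ⊗[ℂ] G →ₗ[ℂ] G ⊗[ℂ] X.V :=
  map LinearMap.id (act X ∘ₗ map antipodeG LinearMap.id) ∘ₗ
    (assoc ℂ G G X.V).toLinearMap ∘ₗ map coG LinearMap.id ∘ₗ SVect.flip X.toSVect svG

/-- Sector 011. -/
def assoc011 (X : SRep G) (Y Z : SVect) :
    X.V ⊗[ℂ] (G ⊗[ℂ] (Y.V ⊗[ℂ] Z.V)) →ₗ[ℂ] G ⊗[ℂ] ((X.V ⊗[ℂ] Y.V) ⊗[ℂ] Z.V) :=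
  map LinearMap.id (assoc ℂ X.V Y.V Z.V).symm.toLinearMap ∘ₗ
    (assoc ℂ G X.V (Y.V ⊗[ℂ] Z.V)).toLinearMap ∘ₗ
      map (past X) LinearMap.id ∘ₗ (assoc ℂ X.V G (Y.V ⊗[ℂ] Z.V)).symm.toLinearMap

/-- Sector 101: `exp(C^{(13)})`, acting on `G` (by left multiplication) and on the second object
`Y`, the first and third factor of `G ⊗ X ⊗ Y ⊗ Z`. -/
def assoc101 (X : SVect) (Y : SRep G) (Z : SVect) :
    G ⊗[ℂ] (X.V ⊗[ℂ] (Y.V ⊗[ℂ] Z.V)) →ₗ[ℂ] G ⊗[ℂ] ((X.V ⊗[ℂ] Y.V) ⊗[ℂ] Z.V) :=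
  expC
      (map (LinearMap.mulLeft ℂ a₂ ∘ₗ parityLin G) (map (map X.ω (Y.ρ a₁)) LinearMap.id) -
        map (LinearMap.mulLeft ℂ a₁ ∘ₗ parityLin G) (map (map X.ω (Y.ρ a₂)) LinearMap.id)) ∘ₗ
    map LinearMap.id (assoc ℂ X.V Y.V Z.V).symm.toLinearMap

/-- Sector 110: `{id ⊗ ρ^Z} ∘ {id_G ⊗ τ_{G, X ⊗ Y} ⊗ id_Z} ∘ {Δ ⊗ id}`. -/
def assoc110 (X Y : SVect) (Z : SRep G) :
    G ⊗[ℂ] (X.V ⊗[ℂ] (Y.V ⊗[ℂ] Z.V)) →ₗ[ℂ] (G ⊗[ℂ] (X.V ⊗[ℂ] Y.V)) ⊗[ℂ] Z.V :=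
  (assoc ℂ G (X.V ⊗[ℂ] Y.V) Z.V).symm.toLinearMap ∘ₗ
    map LinearMap.id
      (map LinearMap.id (act Z) ∘ₗ (assoc ℂ (X.V ⊗[ℂ] Y.V) G Z.V).toLinearMap ∘ₗ
        map (SVect.flip svG (X.tensor Y)) LinearMap.id ∘ₗ
          (assoc ℂ G (X.V ⊗[ℂ] Y.V) Z.V).symm.toLinearMap) ∘ₗ
      (assoc ℂ G G ((X.V ⊗[ℂ] Y.V) ⊗[ℂ] Z.V)).toLinearMap ∘ₗ
        map coG (assoc ℂ X.V Y.V Z.V).symm.toLinearMap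

/-- Sector 111: `{φ ⊗ id} ∘ {τ_{X,G} ⊗ id}`. -/
def assoc111 (β : ℂ) (X Y Z : SVect) :
    X.V ⊗[ℂ] (G ⊗[ℂ] (Y.V ⊗[ℂ] Z.V)) →ₗ[ℂ] (G ⊗[ℂ] (X.V ⊗[ℂ] Y.V)) ⊗[ℂ] Z.V :=
  (assoc ℂ G (X.V ⊗[ℂ] Y.V) Z.V).symm.toLinearMap ∘ₗ
    map (phiG β) (assoc ℂ X.V Y.V Z.V).symm.toLinearMap ∘ₗ
      (assoc ℂ G X.V (Y.V ⊗[ℂ] Z.V)).toLinearMap ∘ₗ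
        map (SVect.flip X svG) LinearMap.id ∘ₗ (assoc ℂ X.V G (Y.V ⊗[ℂ] Z.V)).symm.toLinearMap

section Components

variable {M N P N' P' : Type} [AddCommGroup M] [Module ℂ M] [AddCommGroup N] [Module ℂ N]
  [AddCommGroup P] [Module ℂ P] [AddCommGroup N'] [Module ℂ N'] [AddCommGroup P'] [Module ℂ P']

/-- The first projection of a direct sum. -/
abbrev p₁ : N × P →ₗ[ℂ] N := LinearMap.fst ℂ N P
/-- The second projection of a direct sum. -/
abbrev p₂ : N × P →ₗ[ℂ] P := LinearMap.snd ℂ N P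
/-- The first inclusion of a direct sum. -/
abbrev i₁ : N →ₗ[ℂ] N × P := LinearMap.inl ℂ N P
/-- The second inclusion of a direct sum. -/
abbrev i₂ : P →ₗ[ℂ] N × P := LinearMap.inr ℂ N P

end Components

/-- The untwisted component of the associator `X * (Y * Z) → (X * Y) * Z`: the sum of the maps of
the sectors 000, 011, 101, 110. -/
def assocEven (X Y Z : SF) : (tensorObj X (tensorObj Y Z)).c₀.V →ₗ[ℂ]
    (tensorObj (tensorObj X Y) Z).c₀.V :=
  i₁ ∘ₗ map i₁ LinearMap.id ∘ₗ assocTriv X.c₀.toSVect Y.c₀.toSVect Z.c₀.toSVect ∘ₗ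
      map LinearMap.id p₁ ∘ₗ p₁ +
    i₂ ∘ₗ map LinearMap.id (map i₁ LinearMap.id) ∘ₗ assoc011 X.c₀ Y.c₁ Z.c₁ ∘ₗ
      map LinearMap.id p₂ ∘ₗ p₁ +
    i₂ ∘ₗ map LinearMap.id (map i₂ LinearMap.id) ∘ₗ assoc101 X.c₁ Y.c₀ Z.c₁ ∘ₗ
      map LinearMap.id (map LinearMap.id p₁) ∘ₗ p₂ +
    i₁ ∘ₗ map i₂ LinearMap.id ∘ₗ assoc110 X.c₁ Y.c₁ Z.c₀ ∘ₗ
      map LinearMap.id (map LinearMap.id p₂) ∘ₗ p₂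

/-- The twisted component of the associator `X * (Y * Z) → (X * Y) * Z`: the sum of the maps of
the sectors 001, 010, 100, 111. -/
def assocOdd (β : ℂ) (X Y Z : SF) : (tensorObj X (tensorObj Y Z)).c₁.V →ₗ[ℂ]
    (tensorObj (tensorObj X Y) Z).c₁.V :=
  i₁ ∘ₗ map i₁ LinearMap.id ∘ₗ assocTriv X.c₀.toSVect Y.c₀.toSVect Z.c₁ ∘ₗ
      map LinearMap.id p₁ ∘ₗ p₁ +
    i₂ ∘ₗ map i₁ LinearMap.id ∘ₗ assoc010 X.c₀ Y.c₁ Z.c₀ ∘ₗ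
      map LinearMap.id p₂ ∘ₗ p₁ +
    i₂ ∘ₗ map i₂ LinearMap.id ∘ₗ assocTriv X.c₁ Y.c₀.toSVect Z.c₀.toSVect ∘ₗ
      map LinearMap.id p₁ ∘ₗ p₂ +
    i₁ ∘ₗ map i₂ LinearMap.id ∘ₗ assoc111 β X.c₁ Y.c₁ Z.c₁ ∘ₗ
      map LinearMap.id p₂ ∘ₗ p₂

/-! ### The braiding of `SF`, sector by sector -/

/-- `exp(t Ĉ / 2) = 1 - t a₁a₂ ∈ G`, where `Ĉ = -2 a₁a₂` and `(a₁a₂)² = 0`. -/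
def expHalf (t : ℂ) : G := 1 - t • (a₁ * a₂)

/-- Sector 00: `τ_{X,Y} ∘ exp(-C)`. -/
def braid00 (X Y : SRep G) : X.V ⊗[ℂ] Y.V →ₗ[ℂ] Y.V ⊗[ℂ] X.V :=
  SVect.flip X.toSVect Y.toSVect ∘ₗ expC (-C12 X Y)

/-- Sector 01: `τ_{X,Y} ∘ {exp(Ĉ/2) ⊗ id}`. -/
def braid01 (X : SRep G) (Y : SVect) : X.V ⊗[ℂ] Y.V →ₗ[ℂ] Y.V ⊗[ℂ] X.V :=
  SVect.flip X.toSVect Y ∘ₗ map (X.ρ (expHalf 1)) LinearMap.id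

/-- Sector 10: `τ_{X,Y} ∘ {id ⊗ exp(Ĉ/2)} ∘ {id ⊗ ω_Y}`. -/
def braid10 (X : SVect) (Y : SRep G) : X.V ⊗[ℂ] Y.V →ₗ[ℂ] Y.V ⊗[ℂ] X.V :=
  SVect.flip X Y.toSVect ∘ₗ map LinearMap.id (Y.ρ (expHalf 1)) ∘ₗ map LinearMap.id Y.ω

/-- Sector 11: `β (id_G ⊗ τ_{X,Y}) ∘ {exp(-Ĉ/2) ⊗ id_X ⊗ ω_Y}`. -/
def braid11 (β : ℂ) (X Y : SVect) : G ⊗[ℂ] (X.V ⊗[ℂ] Y.V) →ₗ[ℂ] G ⊗[ℂ] (Y.V ⊗[ℂ] X.V) :=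
  β • (map LinearMap.id (SVect.flip X Y) ∘ₗ
    map (LinearMap.mulLeft ℂ (expHalf (-1))) (map LinearMap.id Y.ω))

/-- The untwisted component of the braiding `X * Y → Y * X`. -/
def braidEven (β : ℂ) (X Y : SF) : (tensorObj X Y).c₀.V →ₗ[ℂ] (tensorObj Y X).c₀.V :=
  LinearMap.prodMap (braid00 X.c₀ Y.c₀) (braid11 β X.c₁ Y.c₁)

/-- The twisted component of the braiding `X * Y → Y * X`. -/
def braidOdd (X Y : SF) : (tensorObj X Y).c₁.V →ₗ[ℂ] (tensorObj Y X).c₁.V :=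
  i₂ ∘ₗ braid01 X.c₀ Y.c₁ ∘ₗ p₁ + i₁ ∘ₗ braid10 X.c₁ Y.c₀ ∘ₗ p₂

/-- The tensor product and the tensor unit, with given associativity and unit isomorphisms. Mathlib's
convention for the associator is inverse to the one here. -/
abbrev monoidalStruct
    (assoc : ∀ X Y Z : SF, tensorObj X (tensorObj Y Z) ≅ tensorObj (tensorObj X Y) Z)
    (leftUnitor : ∀ X : SF, tensorObj tensorUnit X ≅ X)
    (rightUnitor : ∀ X : SF, tensorObj X tensorUnit ≅ X) : MonoidalCategoryStruct SF where
  tensorObj := tensorObj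
  whiskerLeft := fun X _ _ f => tensorHom (𝟙 X) f
  whiskerRight := fun f Y => tensorHom f (𝟙 Y)
  tensorHom := tensorHom
  tensorUnit := tensorUnit
  associator := fun X Y Z => (assoc X Y Z).symm
  leftUnitor := leftUnitor
  rightUnitor := rightUnitor

/-- The braided monoidal structure of `SF` for the parameter `β`: the tensor product, the unit
and all the structure maps are prescribed (so there is at most one such structure), and they are
isomorphisms in `SF` which satisfy the axioms of a braided monoidal category. -/
structure BraidedStructure (β : ℂ) where
  /-- the associator `X * (Y * Z) ≅ (X * Y) * Z` -/
  assoc : ∀ X Y Z : SF, tensorObj X (tensorObj Y Z) ≅ tensorObj (tensorObj X Y) Z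
  /-- the unit isomorphism `1 * X ≅ X` -/
  leftUnitor : ∀ X : SF, tensorObj tensorUnit X ≅ X
  /-- the unit isomorphism `X * 1 ≅ X` -/
  rightUnitor : ∀ X : SF, tensorObj X tensorUnit ≅ X
  /-- the braiding `X * Y ≅ Y * X` -/
  braiding : ∀ X Y : SF, tensorObj X Y ≅ tensorObj Y X
  map₀_assoc : ∀ X Y Z, map₀ (assoc X Y Z).hom = assocEven X Y Z
  map₁_assoc : ∀ X Y Z, map₁ (assoc X Y Z).hom = assocOdd β X Y Z
  map₀_leftUnitor : ∀ X, map₀ (leftUnitor X).hom = (lid ℂ X.c₀.V).toLinearMap ∘ₗ p₁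
  map₁_leftUnitor : ∀ X, map₁ (leftUnitor X).hom = (lid ℂ X.c₁.V).toLinearMap ∘ₗ p₁
  map₀_rightUnitor : ∀ X, map₀ (rightUnitor X).hom = (rid ℂ X.c₀.V).toLinearMap ∘ₗ p₁
  map₁_rightUnitor : ∀ X, map₁ (rightUnitor X).hom = (rid ℂ X.c₁.V).toLinearMap ∘ₗ p₂
  map₀_braiding : ∀ X Y, map₀ (braiding X Y).hom = braidEven β X Y
  map₁_braiding : ∀ X Y, map₁ (braiding X Y).hom = braidOdd X Y
  laws : @BraidedMonoidalLaws SF _ (monoidalStruct assoc leftUnitor rightUnitor) braiding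

/-- `SF` as a braided monoidal category: the monoidal structure. -/
@[reducible] def BraidedStructure.monoidal {β : ℂ} (s : BraidedStructure β) :
    MonoidalCategory SF :=
  @BraidedMonoidalLaws.monoidal SF _
    (monoidalStruct s.assoc s.leftUnitor s.rightUnitor) s.braiding s.laws

/-- `SF` as a braided monoidal category: the braiding. -/
@[reducible] def BraidedStructure.braided {β : ℂ} (s : BraidedStructure β) :
    @BraidedCategory SF _ s.monoidal :=
  @BraidedMonoidalLaws.braided SF _
    (monoidalStruct s.assoc s.leftUnitor s.rightUnitor) s.braiding s.laws

end SF

/-! ## The functor from `SF` to the category of `S`-modules in super-vector spaces -/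

/-- The category `Rep S` of finite-dimensional representations of `S` in super-vector spaces. -/
abbrev RepS : Type 1 := SRep S

/-- The super-vector space underlying `S`. -/
abbrev svS : SVect where
  V := S
  ω := parityLin S
  ω_ω := SuperAlgebra.parity_parity

/-- The left `S`-module `B = S b`. -/
abbrev modB : RepS where
  V := S.B
  ω := (parityLin S).restrict fun _ => S.parity_mem_B
  ω_ω v := Subtype.ext (SuperAlgebra.parity_parity v.1)
  ρ := AlgHom.ofLinearMap
    { toFun := fun s => (LinearMap.mulLeft ℂ s).restrict fun _ => S.mul_mem_B s
      map_add' := fun s t => LinearMap.ext fun v => Subtype.ext (add_mul s t v.1)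
      map_smul' := fun z s => LinearMap.ext fun v => Subtype.ext (smul_mul_assoc z s v.1) }
    (LinearMap.ext fun v => Subtype.ext (one_mul v.1))
    (fun s t => LinearMap.ext fun v => Subtype.ext (mul_assoc s t v.1))
  ω_ρ s v := Subtype.ext (map_mul (parity (A := S)) s v.1)

namespace SF

/-- On untwisted objects: the same space, `x⁺` acts by `a₁`, `x⁻` by `a₂` and `L` by `1`. -/
abbrev D₀ (X : SRep G) : RepS where
  toSVect := X.toSVect
  ρ := X.ρ.comp (AlgHom.fst ℂ (Cl 0) (Cl 1))
  ω_ρ s v := X.ω_ρ s.1 v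

/-- On twisted objects: `B ⊗ X`, with `S` acting on the left factor. -/
abbrev D₁ (X : SVect) : RepS where
  toSVect := modB.toSVect.tensor X
  ρ := (Module.End.rTensorAlgHom ℂ S.B X.V).comp modB.ρ
  ω_ρ s v := by
    refine LinearMap.congr_fun (f := map modB.ω X.ω ∘ₗ LinearMap.rTensor X.V (modB.ρ s))
      (g := LinearMap.rTensor X.V (modB.ρ (parity s)) ∘ₗ map modB.ω X.ω)
      (TensorProduct.ext' fun x y => ?_) v
    rw [LinearMap.comp_apply, LinearMap.comp_apply, LinearMap.rTensor_tmul, TensorProduct.map_tmul,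
      TensorProduct.map_tmul, LinearMap.rTensor_tmul, modB.ω_ρ]

/-- The functor `D : SF ⥤ Rep S`. -/
def D : SF ⥤ RepS where
  obj X := (D₀ X.c₀).sum (D₁ X.c₁)
  map {X Y} f := ⟨LinearMap.prodMap (map₀ f) (map LinearMap.id (map₁ f)),
    fun v => by
      refine Prod.ext (map₀_ω f v.1) (LinearMap.congr_fun
        (f := map LinearMap.id (map₁ f) ∘ₗ map modB.ω X.c₁.ω)
        (g := map modB.ω Y.c₁.ω ∘ₗ map LinearMap.id (map₁ f))
        (TensorProduct.ext' fun x y => ?_) v.2)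
      rw [LinearMap.comp_apply, LinearMap.comp_apply, TensorProduct.map_tmul,
        TensorProduct.map_tmul, TensorProduct.map_tmul, TensorProduct.map_tmul, map₁_ω]
      rfl,
    fun s v => by
      refine Prod.ext (map₀_ρ f s.1 v.1) (LinearMap.congr_fun
        (f := map LinearMap.id (map₁ f) ∘ₗ LinearMap.rTensor X.c₁.V (modB.ρ s))
        (g := LinearMap.rTensor Y.c₁.V (modB.ρ s) ∘ₗ map LinearMap.id (map₁ f))
        (TensorProduct.ext' fun x y => ?_) v.2)
      rw [LinearMap.comp_apply, LinearMap.comp_apply, LinearMap.rTensor_tmul,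
        TensorProduct.map_tmul, TensorProduct.map_tmul, LinearMap.rTensor_tmul]
      rfl⟩
  map_id X := Subtype.ext (by
    change LinearMap.prodMap LinearMap.id (map LinearMap.id LinearMap.id) = LinearMap.id
    rw [TensorProduct.map_id, LinearMap.prodMap_id])
  map_comp f g := Subtype.ext (by
    change LinearMap.prodMap (map₀ g ∘ₗ map₀ f) (map LinearMap.id (map₁ g ∘ₗ map₁ f)) =
      LinearMap.prodMap (map₀ g) (map LinearMap.id (map₁ g)) ∘ₗ
        LinearMap.prodMap (map₀ f) (map LinearMap.id (map₁ f))
    rw [LinearMap.prodMap_comp, ← TensorProduct.map_comp, LinearMap.id_comp])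

end SF

/-! ## The restricted quantum group `Q` at `q = i` -/

/-- The generators of `Q`. -/
inductive QGen : Type
  | E | F | K | Kinv

/-- Elements of an algebra which satisfy the defining relations of the restricted quantum group
of `sl(2)` at `q = i`. -/
structure QRelations {A : Type} [Ring A] [Algebra ℂ A] (E F K Kinv : A) : Prop where
  K_Kinv : K * Kinv = 1
  Kinv_K : Kinv * K = 1
  K_E : K * E * Kinv = Complex.I ^ 2 • E
  K_F : K * F * Kinv = (Complex.I ^ 2)⁻¹ • F
  E_F : E * F - F * E = (Complex.I - Complex.I⁻¹)⁻¹ • (K - Kinv)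
  E_sq : E ^ 2 = 0
  F_sq : F ^ 2 = 0
  K_pow : K ^ 4 = 1

/-- The defining relations of `Q`, in the free algebra. -/
inductive QRel : FreeAlgebra ℂ QGen → FreeAlgebra ℂ QGen → Prop
  | K_Kinv : QRel (FreeAlgebra.ι ℂ QGen.K * FreeAlgebra.ι ℂ QGen.Kinv) 1
  | Kinv_K : QRel (FreeAlgebra.ι ℂ QGen.Kinv * FreeAlgebra.ι ℂ QGen.K) 1
  | K_E : QRel (FreeAlgebra.ι ℂ QGen.K * FreeAlgebra.ι ℂ QGen.E * FreeAlgebra.ι ℂ QGen.Kinv)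
      (Complex.I ^ 2 • FreeAlgebra.ι ℂ QGen.E)
  | K_F : QRel (FreeAlgebra.ι ℂ QGen.K * FreeAlgebra.ι ℂ QGen.F * FreeAlgebra.ι ℂ QGen.Kinv)
      ((Complex.I ^ 2)⁻¹ • FreeAlgebra.ι ℂ QGen.F)
  | E_F : QRel (FreeAlgebra.ι ℂ QGen.E * FreeAlgebra.ι ℂ QGen.F -
        FreeAlgebra.ι ℂ QGen.F * FreeAlgebra.ι ℂ QGen.E)
      ((Complex.I - Complex.I⁻¹)⁻¹ • (FreeAlgebra.ι ℂ QGen.K - FreeAlgebra.ι ℂ QGen.Kinv))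
  | E_sq : QRel (FreeAlgebra.ι ℂ QGen.E ^ 2) 0
  | F_sq : QRel (FreeAlgebra.ι ℂ QGen.F ^ 2) 0
  | K_pow : QRel (FreeAlgebra.ι ℂ QGen.K ^ 4) 1

/-- The restricted quantum group of `sl(2)` at `q = i`, as an algebra. -/
def Q : Type := RingQuot QRel

instance : Ring Q := inferInstanceAs (Ring (RingQuot QRel))
instance : Algebra ℂ Q := inferInstanceAs (Algebra ℂ (RingQuot QRel))

namespace Q

/-- The quotient map from the free algebra. -/
def mk : FreeAlgebra ℂ QGen →ₐ[ℂ] Q := RingQuot.mkAlgHom ℂ QRel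

theorem mk_rel {u v : FreeAlgebra ℂ QGen} (h : QRel u v) : mk u = mk v :=
  RingQuot.mkAlgHom_rel ℂ h

/-- The image of a generator in `Q`. -/
def gen (g : QGen) : Q := mk (FreeAlgebra.ι ℂ g)

/-- The generator `E`. -/
abbrev E : Q := gen QGen.E
/-- The generator `F`. -/
abbrev F : Q := gen QGen.F
/-- The generator `K`. -/
abbrev K : Q := gen QGen.K
/-- The generator `K⁻¹`. -/
abbrev Kinv : Q := gen QGen.Kinv

theorem relations : QRelations E F K Kinv where
  K_Kinv := by
    have h := mk_rel QRel.K_Kinv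
    simp only [map_mul, map_one] at h
    exact h
  Kinv_K := by
    have h := mk_rel QRel.Kinv_K
    simp only [map_mul, map_one] at h
    exact h
  K_E := by
    have h := mk_rel QRel.K_E
    simp only [map_mul, map_smul] at h
    exact h
  K_F := by
    have h := mk_rel QRel.K_F
    simp only [map_mul, map_smul] at h
    exact h
  E_F := by
    have h := mk_rel QRel.E_F
    simp only [map_mul, map_smul, map_sub] at h
    exact h
  E_sq := by
    have h := mk_rel QRel.E_sq
    simp only [map_pow, map_zero] at h
    exact h
  F_sq := by
    have h := mk_rel QRel.F_sq
    simp only [map_pow, map_zero] at h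
    exact h
  K_pow := by
    have h := mk_rel QRel.K_pow
    simp only [map_pow, map_one] at h
    exact h

section Lift

variable {A : Type} [Ring A] [Algebra ℂ A]

/-- The values of a homomorphism on the generators. -/
def genValues (e f k k' : A) : QGen → A
  | QGen.E => e
  | QGen.F => f
  | QGen.K => k
  | QGen.Kinv => k'

/-- Elements with the defining relations determine an algebra homomorphism on `Q`. -/
def lift {e f k k' : A} (h : QRelations e f k k') : Q →ₐ[ℂ] A :=
  RingQuot.liftAlgHom ℂ ⟨FreeAlgebra.lift ℂ (genValues e f k k'), by
    intro u v huv
    cases huv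
    · simpa [genValues] using h.K_Kinv
    · simpa [genValues] using h.Kinv_K
    · simpa only [map_mul, map_smul, FreeAlgebra.lift_ι_apply, genValues] using h.K_E
    · simpa only [map_mul, map_smul, FreeAlgebra.lift_ι_apply, genValues] using h.K_F
    · simpa only [map_mul, map_smul, map_sub, FreeAlgebra.lift_ι_apply, genValues] using h.E_F
    · simpa only [map_pow, map_zero, FreeAlgebra.lift_ι_apply, genValues] using h.E_sq
    · simpa only [map_pow, map_zero, FreeAlgebra.lift_ι_apply, genValues] using h.F_sq
    · simpa only [map_pow, map_one, FreeAlgebra.lift_ι_apply, genValues] using h.K_pow⟩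

theorem lift_gen {e f k k' : A} (h : QRelations e f k k') (g : QGen) :
    lift h (gen g) = genValues e f k k' g :=
  (RingQuot.liftAlgHom_mkAlgHom_apply ℂ _ _ _).trans (FreeAlgebra.lift_ι_apply _ _)

/-- Homomorphisms on `Q` are determined by their values on the generators. -/
theorem algHom_ext {f g : Q →ₐ[ℂ] A} (h : ∀ u, f (gen u) = g (gen u)) : f = g :=
  RingQuot.ringQuot_ext' ℂ f g (FreeAlgebra.hom_ext (funext h))

theorem induction {p : Q → Prop} (hs : ∀ z : ℂ, p (algebraMap ℂ Q z)) (hg : ∀ u, p (gen u))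
    (ha : ∀ a b, p a → p b → p (a + b)) (hm : ∀ a b, p a → p b → p (a * b)) (a : Q) : p a := by
  obtain ⟨b, rfl⟩ := RingQuot.mkAlgHom_surjective ℂ QRel a
  change p (mk b)
  induction b using FreeAlgebra.induction with
  | grade0 z => rw [AlgHom.commutes]; exact hs z
  | grade1 u => exact hg u
  | mul a b ha hb => rw [map_mul]; exact hm _ _ ha hb
  | add a b h h' => rw [map_add]; exact ha _ _ h h'

/-- A linear map that commutes with the generators is an intertwiner. -/
theorem intertwiner {V W : Type} [AddCommGroup V] [Module ℂ V] [AddCommGroup W] [Module ℂ W]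
    (ρ : Q →ₐ[ℂ] Module.End ℂ V) (ρ' : Q →ₐ[ℂ] Module.End ℂ W) (f : V →ₗ[ℂ] W)
    (h : ∀ u v, f (ρ (gen u) v) = ρ' (gen u) (f v)) (a : Q) : ∀ v, f (ρ a v) = ρ' a (f v) := by
  induction a using induction with
  | hs z => intro v; simp [Module.algebraMap_end_apply]
  | hg u => exact h u
  | ha a b ha hb => intro v; simp [ha v, hb v]
  | hm a b ha hb => intro v; rw [map_mul, map_mul, Module.End.mul_apply, Module.End.mul_apply, ha, hb]

end Lift

/-- The coproduct of `Q`: `E ↦ 1 ⊗ E + E ⊗ K`, `F ↦ K⁻¹ ⊗ F + F ⊗ 1`, `K ↦ K ⊗ K`. -/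
def Δ : Q →ₐ[ℂ] Q ⊗[ℂ] Q :=
  lift (e := 1 ⊗ₜ[ℂ] E + E ⊗ₜ[ℂ] K) (f := Kinv ⊗ₜ[ℂ] F + F ⊗ₜ[ℂ] 1) (k := K ⊗ₜ[ℂ] K)
      (k' := Kinv ⊗ₜ[ℂ] Kinv) <| by
    have hq : (Complex.I ^ 2 : ℂ) = -1 := Complex.I_sq
    have hKK := relations.K_Kinv
    have hKK' := relations.Kinv_K
    have hE := relations.K_E
    have hF := relations.K_F
    have hEF := relations.E_F
    have hE2 := relations.E_sq
    have hF2 := relations.F_sq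
    have hK4 := relations.K_pow
    have hi : ((-1 : ℂ))⁻¹ = -1 := by norm_num
    rw [hq] at hE hF
    rw [hi] at hF
    rw [neg_smul, one_smul] at hE hF
    have hKE : K * E = -(E * K) := by
      have h := congrArg (fun u => u * K) hE
      simpa only [mul_assoc, hKK', mul_one, neg_mul] using h
    have hKF : K * F = -(F * K) := by
      have h := congrArg (fun u => u * K) hF
      simpa only [mul_assoc, hKK', mul_one, neg_mul] using h
    have hEK' : Kinv * E = -(E * Kinv) := by
      calc Kinv * E = Kinv * (E * K) * Kinv := by rw [mul_assoc, mul_assoc, hKK, mul_one]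
        _ = -(Kinv * (K * E) * Kinv) := by rw [hKE, mul_neg, neg_mul, neg_neg]
        _ = -(E * Kinv) := by rw [← mul_assoc, hKK', one_mul]
    constructor
    · simp [hKK]
      rfl
    · simp [hKK']
      rfl
    · rw [hq]
      have hKKK : K * K * Kinv = K := by rw [mul_assoc, hKK, mul_one]
      simp [mul_add, add_mul, hKK, hKKK, hE, TensorProduct.neg_tmul, TensorProduct.tmul_neg]
    · rw [hq, hi]
      simp [mul_add, add_mul, hKK, hF, TensorProduct.neg_tmul, TensorProduct.tmul_neg, add_comm]
    · have h1 : (1 ⊗ₜ[ℂ] E + E ⊗ₜ[ℂ] K) * (Kinv ⊗ₜ[ℂ] F + F ⊗ₜ[ℂ] 1) -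
          (Kinv ⊗ₜ[ℂ] F + F ⊗ₜ[ℂ] 1) * (1 ⊗ₜ[ℂ] E + E ⊗ₜ[ℂ] K) =
          Kinv ⊗ₜ[ℂ] (E * F - F * E) + (E * F - F * E) ⊗ₜ[ℂ] K := by
        simp only [mul_add, add_mul, Algebra.TensorProduct.tmul_mul_tmul, one_mul, mul_one, hKF,
          hEK', TensorProduct.neg_tmul, TensorProduct.tmul_neg, TensorProduct.sub_tmul,
          TensorProduct.tmul_sub]
        abel
      rw [h1, hEF]
      simp only [TensorProduct.tmul_smul, TensorProduct.smul_tmul', TensorProduct.tmul_sub,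
        TensorProduct.sub_tmul, smul_sub]
      abel
    · rw [pow_two] at hE2 ⊢
      simp [mul_add, add_mul, hE2, hKE, TensorProduct.tmul_neg]
    · rw [pow_two] at hF2 ⊢
      have hFK' : Kinv * F = -(F * Kinv) := by
        calc Kinv * F = Kinv * (F * K) * Kinv := by rw [mul_assoc, mul_assoc, hKK, mul_one]
          _ = -(Kinv * (K * F) * Kinv) := by rw [hKF, mul_neg, neg_mul, neg_neg]
          _ = -(F * Kinv) := by rw [← mul_assoc, hKK', one_mul]
      simp [mul_add, add_mul, hF2, hFK', TensorProduct.neg_tmul]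
    · simp [hK4]
      rfl

/-- The counit of `Q`: `E, F ↦ 0` and `K ↦ 1`. -/
def ε : Q →ₐ[ℂ] ℂ :=
  lift (e := 0) (f := 0) (k := 1) (k' := 1) (by constructor <;> simp)

/-- The central idempotent `e₀ = (1 + K²) / 2`. -/
def e₀ : Q := (1 / 2 : ℂ) • (1 + K ^ 2)

/-- The central idempotent `e₁ = (1 - K²) / 2`. -/
def e₁ : Q := (1 / 2 : ℂ) • (1 - K ^ 2)

/-- The element `f⁺ = -i F`. -/
def fp : Q := -Complex.I • F

/-- The element `f⁻ = E K⁻¹`. -/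
def fm : Q := E * Kinv

/-- The element `a ⊗ b ⊗ c`. -/
abbrev t (a b c : Q) : Q ⊗[ℂ] (Q ⊗[ℂ] Q) := a ⊗ₜ (b ⊗ₜ c)

/-- The component 010 of the coassociator. -/
def Φ010 : Q ⊗[ℂ] (Q ⊗[ℂ] Q) :=
  t 1 1 1 - (1 + Complex.I) • t E K F + (1 - Complex.I) • t (F * K) K (E * K)
    + (2 : ℂ) • t (E * F * K) 1 (E * F * K)

/-- The component 101 of the coassociator. -/
def Φ101 : Q ⊗[ℂ] (Q ⊗[ℂ] Q) :=
  (Complex.I - 1) • t 1 F (E * K) + t 1 K 1 + (2 : ℂ) • t 1 (E * F) (E * F * K)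
    - (1 + Complex.I) • t 1 (E * K) F
    - (1 + Complex.I) • t E (F * K) 1 + (2 * Complex.I) • t E (E * F * K) F
    + (1 - Complex.I) • t (F * K) E 1
    - (2 * Complex.I) • t (F * K) (E * F * K) (E * K) - (2 : ℂ) • t (E * F * K) (E * F) 1

/-- The component 111 of the coassociator. -/
def Φ111 (β : ℂ) : Q ⊗[ℂ] (Q ⊗[ℂ] Q) :=
  (Complex.I * β ^ 2) •
    ((1 + Complex.I) • t 1 F (E * K) - t 1 K 1 - (2 : ℂ) • t 1 (E * F) 1
      - (2 * Complex.I) • t 1 (E * F) (E * F * K)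
      + (1 + Complex.I) • t 1 (E * K) F - (1 + Complex.I) • t E 1 F
      + (1 + Complex.I) • t E (F * K) 1 + (2 * Complex.I) • t E (F * K) (E * F * K)
      + (2 : ℂ) • t E (E * F * K) F - (1 + Complex.I) • t (F * K) 1 (E * K)
      + (1 + Complex.I) • t (F * K) E 1 + (2 * Complex.I) • t (F * K) E (E * F * K)
      + (2 : ℂ) • t (F * K) (E * F * K) (E * K) + (2 * Complex.I) • t (E * F * K) F (E * K)
      + (2 * Complex.I) • t (E * F * K) K (E * F * K) - (2 * Complex.I) • t (E * F * K) (E * F) 1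
      + (2 * Complex.I) • t (E * F * K) (E * K) F
      + (4 : ℂ) • t (E * F * K) (E * F) (E * F * K))

/-- The coassociator `Φ ∈ Q ⊗ Q ⊗ Q`. -/
def Φ (β : ℂ) : Q ⊗[ℂ] (Q ⊗[ℂ] Q) :=
  t e₀ e₀ e₀
    + t e₁ e₀ e₀ + Φ010 * t e₀ e₁ e₀ + t e₀ e₀ e₁
    + t e₁ e₁ e₀ + Φ101 * t e₁ e₀ e₁ + t e₀ e₁ e₁
    + Φ111 β * t e₁ e₁ e₁

/-- The component 00 of the R-matrix. -/
def R00 : Q ⊗[ℂ] Q :=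
  ((1 / 2 : ℂ) • (1 ⊗ₜ 1 + 1 ⊗ₜ K + K ⊗ₜ 1 - K ⊗ₜ K)) *
    (1 ⊗ₜ 1 + (2 * Complex.I) • (E ⊗ₜ F))

/-- The component 01 of the R-matrix. -/
def R01 : Q ⊗[ℂ] Q :=
  ((1 / 2 : ℂ) • (1 ⊗ₜ 1 - Complex.I • (1 ⊗ₜ K) + K ⊗ₜ 1 + Complex.I • (K ⊗ₜ K))) *
    (1 ⊗ₜ 1 + (1 - Complex.I) • ((F * K) ⊗ₜ (E * K)) - (1 - Complex.I) • (E ⊗ₜ F)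
      + (1 + Complex.I) • ((E * F * K) ⊗ₜ 1) + (2 * Complex.I) • ((E * F * K) ⊗ₜ (E * F * K)))

/-- The component 10 of the R-matrix. -/
def R10 : Q ⊗[ℂ] Q :=
  ((1 / 2 : ℂ) • (1 ⊗ₜ 1 + 1 ⊗ₜ K - Complex.I • (K ⊗ₜ 1) + Complex.I • (K ⊗ₜ K))) *
    (1 ⊗ₜ K + (1 - Complex.I) • ((F * K) ⊗ₜ E) + (1 - Complex.I) • (E ⊗ₜ (F * K))
      - (1 - Complex.I) • (1 ⊗ₜ (E * F)) - (2 * Complex.I) • ((E * F * K) ⊗ₜ (E * F)))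

/-- The component 11 of the R-matrix. -/
def R11 (β : ℂ) : Q ⊗[ℂ] Q :=
  ((β / 2) • (1 ⊗ₜ 1 - Complex.I • (1 ⊗ₜ K) - Complex.I • (K ⊗ₜ 1) + K ⊗ₜ K)) *
    (-Complex.I • (K ⊗ₜ 1) + (2 * Complex.I) • ((E * K) ⊗ₜ F)
      + (1 - Complex.I) • (K ⊗ₜ (E * F * K)) - (1 + Complex.I) • ((E * F) ⊗ₜ 1)
      - (2 * Complex.I) • ((E * F) ⊗ₜ (E * F * K)))

/-- The R-matrix `R ∈ Q ⊗ Q`. -/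
def R (β : ℂ) : Q ⊗[ℂ] Q :=
  R00 * (e₀ ⊗ₜ e₀) + R01 * (e₀ ⊗ₜ e₁) + R10 * (e₁ ⊗ₜ e₀) + R11 β * (e₁ ⊗ₜ e₁)

end Q


/-! ## The category of representations of `Q` -/

/-- A finite-dimensional representation of `Q`. -/
structure RepQ where
  V : Type
  [addCommGroup : AddCommGroup V]
  [module : Module ℂ V]
  [finiteDimensional : FiniteDimensional ℂ V]
  ρ : Q →ₐ[ℂ] Module.End ℂ V

attribute [instance] RepQ.addCommGroup RepQ.module RepQ.finiteDimensional

namespace RepQ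

/-- The `Q`-linear maps. -/
def homs (X Y : RepQ) : Submodule ℂ (X.V →ₗ[ℂ] Y.V) where
  carrier := {f | ∀ a v, f (X.ρ a v) = Y.ρ a (f v)}
  add_mem' hf hg := fun a v => by simp [hf a v, hg a v]
  zero_mem' := fun a v => by simp
  smul_mem' z f hf := fun a v => by simp [hf a v]

instance : Category RepQ where
  Hom X Y := homs X Y
  id X := ⟨LinearMap.id, fun _ _ => rfl⟩
  comp f g := ⟨g.1 ∘ₗ f.1, fun a v => by
    rw [LinearMap.comp_apply, LinearMap.comp_apply, f.2 a v, g.2 a]⟩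

instance : Preadditive RepQ where
  homGroup X Y := inferInstanceAs (AddCommGroup (homs X Y))
  add_comp _ _ _ f f' g := Subtype.ext (LinearMap.comp_add f.1 f'.1 g.1)
  comp_add _ _ _ f g g' := Subtype.ext (LinearMap.add_comp f.1 g'.1 g.1)

instance : Linear ℂ RepQ where
  homModule X Y := inferInstanceAs (Module ℂ (homs X Y))
  smul_comp _ _ _ r f g := Subtype.ext (LinearMap.comp_smul g.1 r f.1)
  comp_smul _ _ _ f r g := Subtype.ext (LinearMap.smul_comp r g.1 f.1)

/-- The linear map underlying a morphism. -/
def lin {X Y : RepQ} (f : X ⟶ Y) : X.V →ₗ[ℂ] Y.V := f.1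

theorem lin_ρ {X Y : RepQ} (f : X ⟶ Y) (a : Q) (v : X.V) : lin f (X.ρ a v) = Y.ρ a (lin f v) :=
  f.2 a v

/-- The action of `Q ⊗ Q` on `X ⊗ Y`. -/
def act2 (X Y : RepQ) : Q ⊗[ℂ] Q →ₐ[ℂ] Module.End ℂ (X.V ⊗[ℂ] Y.V) :=
  Module.endTensorEndAlgHom.comp (Algebra.TensorProduct.map X.ρ Y.ρ)

theorem act2_tmul (X Y : RepQ) (a b : Q) : act2 X Y (a ⊗ₜ b) = map (X.ρ a) (Y.ρ b) := rfl

/-- The action of `Q ⊗ Q ⊗ Q` on `X ⊗ (Y ⊗ Z)`. -/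
def act3 (X Y Z : RepQ) : Q ⊗[ℂ] (Q ⊗[ℂ] Q) →ₐ[ℂ] Module.End ℂ (X.V ⊗[ℂ] (Y.V ⊗[ℂ] Z.V)) :=
  Module.endTensorEndAlgHom.comp (Algebra.TensorProduct.map X.ρ (act2 Y Z))

theorem act3_tmul (X Y Z : RepQ) (a b c : Q) :
    act3 X Y Z (Q.t a b c) = map (X.ρ a) (map (Y.ρ b) (Z.ρ c)) := rfl

/-- The tensor product of representations, with `Q` acting through the coproduct. -/
abbrev tensorObj (X Y : RepQ) : RepQ where
  V := X.V ⊗[ℂ] Y.V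
  ρ := (act2 X Y).comp Q.Δ

/-- The tensor product of morphisms. -/
def tensorHom {X X' Y Y' : RepQ} (f : X ⟶ X') (g : Y ⟶ Y') : tensorObj X Y ⟶ tensorObj X' Y' :=
  ⟨map (lin f) (lin g), fun a v => by
    have key : ∀ (s : Q ⊗[ℂ] Q) (v : X.V ⊗[ℂ] Y.V),
        map (lin f) (lin g) (act2 X Y s v) = act2 X' Y' s (map (lin f) (lin g) v) := by
      intro s v
      induction s with
      | zero => simp
      | add s t hs ht => simp only [map_add, LinearMap.add_apply, hs, ht]
      | tmul a b =>
        refine LinearMap.congr_fun (f := map (lin f) (lin g) ∘ₗ map (X.ρ a) (Y.ρ b))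
          (g := map (X'.ρ a) (Y'.ρ b) ∘ₗ map (lin f) (lin g)) (TensorProduct.ext' fun x y => ?_) v
        simp only [LinearMap.comp_apply, TensorProduct.map_tmul, lin_ρ]
    exact key (Q.Δ a) v⟩

/-- The tensor unit: `ℂ`, with `Q` acting through the counit. -/
abbrev tensorUnit : RepQ where
  V := ℂ
  ρ := (Algebra.lmul ℂ ℂ).comp Q.ε

/-- The associator `X ⊗ (Y ⊗ Z) → (X ⊗ Y) ⊗ Z`: the action of the coassociator `Φ`. -/
def assocMap (β : ℂ) (X Y Z : RepQ) : X.V ⊗[ℂ] (Y.V ⊗[ℂ] Z.V) →ₗ[ℂ] (X.V ⊗[ℂ] Y.V) ⊗[ℂ] Z.V :=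
  (assoc ℂ X.V Y.V Z.V).symm.toLinearMap ∘ₗ act3 X Y Z (Q.Φ β)

/-- The braiding `X ⊗ Y → Y ⊗ X`: the action of the R-matrix, followed by the flip. -/
def braidMap (β : ℂ) (X Y : RepQ) : X.V ⊗[ℂ] Y.V →ₗ[ℂ] Y.V ⊗[ℂ] X.V :=
  (comm ℂ X.V Y.V).toLinearMap ∘ₗ act2 X Y (Q.R β)

/-- The tensor product and the tensor unit, with given associativity and unit isomorphisms. Mathlib's
convention for the associator is inverse to the one here. -/
abbrev monoidalStruct
    (assoc : ∀ X Y Z : RepQ, tensorObj X (tensorObj Y Z) ≅ tensorObj (tensorObj X Y) Z)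
    (leftUnitor : ∀ X : RepQ, tensorObj tensorUnit X ≅ X)
    (rightUnitor : ∀ X : RepQ, tensorObj X tensorUnit ≅ X) : MonoidalCategoryStruct RepQ where
  tensorObj := tensorObj
  whiskerLeft := fun X _ _ f => tensorHom (𝟙 X) f
  whiskerRight := fun f Y => tensorHom f (𝟙 Y)
  tensorHom := tensorHom
  tensorUnit := tensorUnit
  associator := fun X Y Z => (assoc X Y Z).symm
  leftUnitor := leftUnitor
  rightUnitor := rightUnitor

/-- The braided monoidal category `Rep (Q, Φ, R)`: the tensor product, the unit and all the
structure maps are prescribed (so there is at most one such structure), and they are isomorphisms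
of representations which satisfy the axioms of a braided monoidal category. -/
structure BraidedStructure (β : ℂ) where
  /-- the associator `X ⊗ (Y ⊗ Z) ≅ (X ⊗ Y) ⊗ Z` -/
  assoc : ∀ X Y Z : RepQ, tensorObj X (tensorObj Y Z) ≅ tensorObj (tensorObj X Y) Z
  /-- the unit isomorphism `1 ⊗ X ≅ X` -/
  leftUnitor : ∀ X : RepQ, tensorObj tensorUnit X ≅ X
  /-- the unit isomorphism `X ⊗ 1 ≅ X` -/
  rightUnitor : ∀ X : RepQ, tensorObj X tensorUnit ≅ X
  /-- the braiding `X ⊗ Y ≅ Y ⊗ X` -/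
  braiding : ∀ X Y : RepQ, tensorObj X Y ≅ tensorObj Y X
  lin_assoc : ∀ X Y Z, lin (assoc X Y Z).hom = assocMap β X Y Z
  lin_leftUnitor : ∀ X, lin (leftUnitor X).hom = (lid ℂ X.V).toLinearMap
  lin_rightUnitor : ∀ X, lin (rightUnitor X).hom = (rid ℂ X.V).toLinearMap
  lin_braiding : ∀ X Y, lin (braiding X Y).hom = braidMap β X Y
  laws : @BraidedMonoidalLaws RepQ _ (monoidalStruct assoc leftUnitor rightUnitor) braiding

/-- `Rep Q` as a braided monoidal category: the monoidal structure. -/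
@[reducible] def BraidedStructure.monoidal {β : ℂ} (s : BraidedStructure β) :
    MonoidalCategory RepQ :=
  @BraidedMonoidalLaws.monoidal RepQ _
    (monoidalStruct s.assoc s.leftUnitor s.rightUnitor) s.braiding s.laws

/-- `Rep Q` as a braided monoidal category: the braiding. -/
@[reducible] def BraidedStructure.braided {β : ℂ} (s : BraidedStructure β) :
    @BraidedCategory RepQ _ s.monoidal :=
  @BraidedMonoidalLaws.braided RepQ _
    (monoidalStruct s.assoc s.leftUnitor s.rightUnitor) s.braiding s.laws

end RepQ

/-! ## The functor from `S`-modules in super-vector spaces to `Q`-modules -/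

namespace RepS

/-- The element `z = e₀ + i e₁` of `S`. -/
def z : S := S.e₀ + Complex.I • S.e₁

/-- The inverse `e₀ - i e₁` of `z`. -/
def zinv : S := S.e₀ - Complex.I • S.e₁

variable (U : RepS)

/-- `K` acts by `z ω`. -/
def actK : Module.End ℂ U.V := U.ρ z * U.ω

/-- `K⁻¹` acts by `z⁻¹ ω`. -/
def actKinv : Module.End ℂ U.V := U.ρ zinv * U.ω

/-- `E = f⁻ K` acts by `x⁻ K`. -/
def actE : Module.End ℂ U.V := U.ρ S.xm * actK U

/-- `F = i f⁺` acts by `i x⁺`. -/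
def actF : Module.End ℂ U.V := Complex.I • U.ρ S.xp

theorem z_eq : z = (1, Complex.I • (1 : Cl 1)) := by
  rw [z, S.e₀_eq, S.e₁_eq]; simp

theorem zinv_eq : zinv = (1, -(Complex.I • (1 : Cl 1))) := by
  rw [zinv, S.e₀_eq, S.e₁_eq]; simp

theorem parity_xp : parity S.xp = -S.xp := Prod.ext Cl.parity_x Cl.parity_x

theorem parity_xm : parity S.xm = -S.xm := Prod.ext Cl.parity_y Cl.parity_y

theorem parity_prod (a : Cl 0) (b : Cl 1) : parity ((a, b) : S) = (parity a, parity b) := rfl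

theorem parity_z : parity z = z := by
  rw [z_eq, parity_prod]; simp

theorem parity_zinv : parity zinv = zinv := by
  rw [zinv_eq, parity_prod]; simp

theorem z_mul_zinv : z * zinv = 1 := by
  rw [z_eq, zinv_eq]; simp [smul_smul]

theorem z_pow : z * (z * (z * z)) = 1 := by
  rw [z_eq]; simp [smul_smul]

theorem z_comm (a : S) : z * a = a * z := by
  rw [z_eq]; exact Prod.ext (by simp) (by simp)

theorem zinv_comm (a : S) : zinv * a = a * zinv := by
  rw [zinv_eq]; exact Prod.ext (by simp) (by simp)

theorem z_sub_zinv : (Complex.I - Complex.I⁻¹)⁻¹ • (z - zinv) = S.e₁ := by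
  have h : (Complex.I - Complex.I⁻¹)⁻¹ * (2 * Complex.I) = 1 := by
    rw [Complex.inv_I, sub_neg_eq_add, ← two_mul, inv_mul_cancel₀]
    simp
  have h' : z - zinv = (2 * Complex.I) • S.e₁ := by rw [z, zinv]; module
  rw [h', smul_smul, h, one_smul]

theorem e₁_mul_z : S.e₁ * z = Complex.I • S.e₁ := by
  rw [z_eq, S.e₁_eq]; simp

theorem xm_xp_anti : S.xm * S.xp + S.xp * S.xm = S.e₁ := by
  rw [add_comm]; exact S.relations.2.2.1

theorem ρω_mul_ρω (a b : S) :
    (U.ρ a * U.ω) * (U.ρ b * U.ω) = U.ρ (a * parity b) := by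
  refine LinearMap.ext fun v => ?_
  rw [map_mul]
  simp only [Module.End.mul_apply, U.ω_ρ, U.ω_ω]

theorem ρω_mul_ρ (a b : S) :
    (U.ρ a * U.ω) * U.ρ b = U.ρ (a * parity b) * U.ω := by
  refine LinearMap.ext fun v => ?_
  rw [map_mul]
  simp only [Module.End.mul_apply, U.ω_ρ]

theorem ρ_mul_ρω (a b : S) : U.ρ a * (U.ρ b * U.ω) = U.ρ (a * b) * U.ω := by
  rw [map_mul, mul_assoc]

theorem actE_eq : actE U = U.ρ (S.xm * z) * U.ω := ρ_mul_ρω U _ _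

theorem actF_eq : actF U = U.ρ (Complex.I • S.xp) := (map_smul U.ρ _ _).symm

theorem actRelations : QRelations (actE U) (actF U) (actK U) (actKinv U) where
  K_Kinv := by rw [actK, actKinv, ρω_mul_ρω, parity_zinv, z_mul_zinv, map_one]
  Kinv_K := by rw [actK, actKinv, ρω_mul_ρω, parity_z, ← z_comm, z_mul_zinv, map_one]
  K_E := by
    rw [actE_eq, actK, actKinv, ρω_mul_ρω, ρ_mul_ρω, map_mul parity, parity_z, parity_xm, Complex.I_sq,
      ← smul_mul_assoc, ← map_smul]
    congr 2
    rw [neg_mul, mul_neg, neg_mul, neg_smul, one_smul, z_comm, mul_assoc, z_mul_zinv, mul_one]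
  K_F := by
    rw [actF_eq, actK, actKinv, ρω_mul_ρ, ρω_mul_ρω, parity_zinv, Complex.I_sq, ← map_smul,
      map_smul parity, parity_xp]
    congr 1
    rw [z_comm, mul_assoc, z_mul_zinv, mul_one, inv_neg, inv_one, neg_smul, one_smul, smul_neg]
  E_F := by
    rw [actE_eq, actF_eq, actK, actKinv, ρω_mul_ρ, ρ_mul_ρω, ← sub_mul, ← sub_mul, ← map_sub,
      ← map_sub, ← smul_mul_assoc, ← map_smul, z_sub_zinv, map_smul, parity_xp]
    congr 2
    have h : S.xm * z * Complex.I • -S.xp - Complex.I • S.xp * (S.xm * z)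
        = -(Complex.I • ((S.xm * S.xp + S.xp * S.xm) * z)) := by
      rw [mul_assoc, z_comm, add_mul]
      simp only [smul_mul_assoc, mul_smul_comm, mul_neg, neg_mul, mul_assoc]
      module
    rw [h, xm_xp_anti, e₁_mul_z, smul_smul, Complex.I_mul_I, neg_smul, one_smul, neg_neg]
  E_sq := by
    rw [pow_two, actE_eq, ρω_mul_ρω, map_mul parity, parity_z, parity_xm]
    have h : S.xm * z * (-S.xm * z) = -(S.xm * S.xm * (z * z)) := by
      rw [mul_assoc, ← mul_assoc z, z_comm]
      simp only [mul_neg, neg_mul, mul_assoc]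
    rw [h, S.relations.2.2.2.2.1, zero_mul, neg_zero, map_zero]
  F_sq := by
    rw [pow_two, actF_eq, ← map_mul, smul_mul_smul_comm, S.relations.2.2.2.1, smul_zero, map_zero]
  K_pow := by
    rw [show (4 : ℕ) = 2 + 2 from rfl, pow_add, pow_two, actK, ρω_mul_ρω, parity_z, ← map_mul,
      mul_assoc, z_pow, map_one]

theorem lift_K : Q.lift (actRelations U) Q.K = actK U := Q.lift_gen _ _
theorem lift_Kinv : Q.lift (actRelations U) Q.Kinv = actKinv U := Q.lift_gen _ _
theorem lift_E : Q.lift (actRelations U) Q.E = actE U := Q.lift_gen _ _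
theorem lift_F : Q.lift (actRelations U) Q.F = actF U := Q.lift_gen _ _

theorem map_ρω {U U' : RepS} (f : U ⟶ U') (a : S) (v : U.V) :
    f.1 ((U.ρ a * U.ω) v) = (U'.ρ a * U'.ω) (f.1 v) := by
  rw [Module.End.mul_apply, f.2.2, f.2.1, Module.End.mul_apply]

/-- The functor `Rep S ⥤ Rep Q`: the same space, with `K` acting by `z ω`, and the elements
`f⁺ = -i F` and `f⁻ = E K⁻¹` of `Q` acting by `x⁺` and `x⁻`. -/
def toRepQ : RepS ⥤ RepQ where
  obj U := { V := U.V, ρ := Q.lift (actRelations U) }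
  map {U U'} f := ⟨f.1, by
    refine Q.intertwiner _ _ f.1 fun g v => ?_
    rw [Q.lift_gen, Q.lift_gen]
    cases g
    · change f.1 (actE U v) = actE U' (f.1 v)
      rw [actE_eq, actE_eq, map_ρω]
    · change f.1 (actF U v) = actF U' (f.1 v)
      rw [actF_eq, actF_eq, f.2.2]
    · exact map_ρω f _ v
    · exact map_ρω f _ v⟩
  map_id _ := rfl
  map_comp _ _ := rfl

theorem toRepQ_K (v : U.V) : (toRepQ.obj U).ρ Q.K v = U.ρ z (U.ω v) := by
  change Q.lift (actRelations U) Q.K v = _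
  rw [lift_K]; rfl

theorem toRepQ_fp (v : U.V) : (toRepQ.obj U).ρ Q.fp v = U.ρ S.xp v := by
  change Q.lift (actRelations U) Q.fp v = _
  rw [Q.fp, map_smul, lift_F, actF, smul_smul, neg_mul, Complex.I_mul_I, neg_neg, one_smul]

theorem toRepQ_fm (v : U.V) : (toRepQ.obj U).ρ Q.fm v = U.ρ S.xm v := by
  change Q.lift (actRelations U) Q.fm v = _
  rw [Q.fm, map_mul, lift_E, lift_Kinv, actE, mul_assoc, (actRelations U).K_Kinv, mul_one]

/-- The map `Γ` on the underlying vector spaces,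
`u ⊗ v ↦ u ⊗ v + e₁.u ⊗ (ξ - 1)e₁.v`. -/
def Γ (U V : RepS) : U.V ⊗[ℂ] V.V →ₗ[ℂ] U.V ⊗[ℂ] V.V :=
  LinearMap.id + map (U.ρ S.e₁) (V.ρ ((S.ξ - 1) * S.e₁))

end RepS

/-! ## The equivalence and its monoidal structure -/

namespace SF

/-- The equivalence `P`, the composite of the functors `SF ⥤ Rep S` and `Rep S ⥤ Rep Q`. -/
def P : SF ⥤ RepQ := D ⋙ RepS.toRepQ

/-- The action map `S ⊗ U → U` of an untwisted object `U`. -/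
def actS (U : SRep G) : S ⊗[ℂ] U.V →ₗ[ℂ] U.V := TensorProduct.lift (D₀ U).ρ.toLinearMap

/-- Sector 00: the action of `δ₀ = 1 ⊗ 1 + x⁻ ⊗ x⁺`,
`u ⊗ v ↦ u ⊗ v + (-1)^{|u|} x⁻.u ⊗ x⁺.v`. -/
def Δ00 (U V : SRep G) : U.V ⊗[ℂ] V.V →ₗ[ℂ] U.V ⊗[ℂ] V.V :=
  LinearMap.id + map ((D₀ U).ρ S.xm ∘ₗ U.ω) ((D₀ V).ρ S.xp)

/-- Sector 01: `(ρ^U ⊗ R_b ⊗ id) ∘ (R_{δ₁} ⊗ τ_{S,U} ⊗ id) ∘ (Δ^S ⊗ id ⊗ id)`. -/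
def Δ01 (U : SRep G) (V : SVect) : S.B ⊗[ℂ] (U.V ⊗[ℂ] V.V) →ₗ[ℂ] U.V ⊗[ℂ] (S.B ⊗[ℂ] V.V) :=
  map (actS U ∘ₗ map (LinearMap.mulRight ℂ S.δ₁) LinearMap.id) (map S.Rb LinearMap.id) ∘ₗ
    superSwap (parityLin S) U.ω ∘ₗ map (S.co ∘ₗ S.B.subtype) LinearMap.id

/-- Sector 10: `(R_b ⊗ id ⊗ ρ^V) ∘ (id ⊗ τ_{S,U} ⊗ id) ∘ (Δ^S ⊗ id ⊗ id)`. -/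
def Δ10 (U : SVect) (V : SRep G) : S.B ⊗[ℂ] (U.V ⊗[ℂ] V.V) →ₗ[ℂ] (S.B ⊗[ℂ] U.V) ⊗[ℂ] V.V :=
  map (map S.Rb LinearMap.id) (actS V) ∘ₗ
    superSwap (parityLin S) U.ω ∘ₗ map (S.co ∘ₗ S.B.subtype) LinearMap.id

/-- Sector 11: `(id ⊗ τ_{B,U} ⊗ id) ∘ ([(R_b ⊗ R_b) ∘ Δ^S] ⊗ id ⊗ id)`, where `G` is identified
with the direct summand `S e₀` of `S`. -/
def Δ11 (U V : SVect) :
    G ⊗[ℂ] (U.V ⊗[ℂ] V.V) →ₗ[ℂ] (S.B ⊗[ℂ] U.V) ⊗[ℂ] (S.B ⊗[ℂ] V.V) :=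
  superSwap modB.ω U.ω ∘ₗ
    map (map S.Rb S.Rb ∘ₗ S.co ∘ₗ LinearMap.inl ℂ (Cl 0) (Cl 1)) LinearMap.id

/-- The map `Δ_{U,V} : D(U * V) → D(U) ⊗ D(V)`: the sum of the maps of the four sectors. -/
def ΔD (U V : SF) : (D.obj (tensorObj U V)).V →ₗ[ℂ] (D.obj U).V ⊗[ℂ] (D.obj V).V :=
  map i₁ i₁ ∘ₗ Δ00 U.c₀ V.c₀ ∘ₗ p₁ ∘ₗ p₁ +
    map i₂ i₂ ∘ₗ Δ11 U.c₁ V.c₁ ∘ₗ p₂ ∘ₗ p₁ +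
    map i₁ i₂ ∘ₗ Δ01 U.c₀ V.c₁ ∘ₗ map LinearMap.id p₁ ∘ₗ p₂ +
    map i₂ i₁ ∘ₗ Δ10 U.c₁ V.c₀ ∘ₗ map LinearMap.id p₂ ∘ₗ p₂

/-- The map `Π_{U,V} : P(U * V) → P(U) ⊗ P(V)`. -/
def mapP (U V : SF) : (P.obj (tensorObj U V)).V →ₗ[ℂ] (P.obj U).V ⊗[ℂ] (P.obj V).V :=
  RepS.Γ (D.obj U) (D.obj V) ∘ₗ ΔD U V

/-- The map `P(1) → 1` of the tensor units; `P(1) = ℂ ⊕ B ⊗ 0`. -/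
def ηP : (P.obj tensorUnit).V →ₗ[ℂ] RepQ.tensorUnit.V := p₁

end SF

end SympFerm

end

noncomputable section

namespace SympFerm

open scoped TensorProduct
open TensorProduct (map comm assoc lid rid)
open SuperAlgebra (parity)

/-! ## Coproducts and parities in coordinates -/

section Swap

variable {V W P Q U : Type} [AddCommGroup V] [Module ℂ V] [AddCommGroup W] [Module ℂ W]
  [AddCommGroup P] [Module ℂ P] [AddCommGroup Q] [Module ℂ Q] [AddCommGroup U] [Module ℂ U]

/-! The axioms are verified by computation only in `SF`, and are then carried over to `Rep Q` along
`P`; no identity in a tensor power of `Q` is checked for `Φ` or `R`.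

In `SF` the components of `X * Y` are spanned by the vectors `x ⊗ y` and `g ⊗ x ⊗ y`, with `g` one
of `1, a₁, a₂, a₁a₂`. On these vectors the associator and the braiding have closed formulas in the
parities and the actions of `a₁`, `a₂` (`assoc_rules`, `braid_rules`), so that every axiom becomes,
sector by sector, an equality of finite sums in normal form. In the braiding the left vector is
taken homogeneous: the sign `(-1)^{|x||y|}` is then either absent or the parity involution of the
other factor. Bijectivity follows from explicit preimages of the spanning vectors and a dimension
count, and the same preimages tabulate the inverse associator. The hypothesis `β⁴ = -1` serves to
invert the associator of three and the braiding of two twisted objects. In the coherence laws it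
matters only when all objects are twisted: in the pentagon, where one side carries `β⁴`, and in one
hexagon, where one side carries `β⁸`.

On the other side, `e₀` and `e₁` are central orthogonal idempotents of `Q` with sum `1`. On `e₀M`
the operators `f⁺ = -iF` and `f⁻ = EK⁻¹` satisfy the Grassmann relations, and `K` is a parity
involution. On `e₁M` they satisfy `f⁺f⁻ + f⁻f⁺ = 1`, so `e₁M` is the direct sum of `ker f⁻` and its
image under `f⁺`, that is, `B` tensored with a multiplicity space on which `-iK` is the parity. This
recovers an object of `SF` from `M` (`bijective_counitMap`). The projections onto the pieces are
actions of elements of `Q` (`P_proj`), hence are respected by all `Q`-linear maps, and `P` is full.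

Each `P X` is spanned by untwisted vectors and the vectors `b ⊗ x`, `x⁺b ⊗ x`. In these terms `Π` is
a table of nine formulas (`mapT_rules`). From the table, `Π` is `Q`-linear (`mapT_gen`), bijective
(`bijective_mapT`), and compatible with the associators (`mapT_assoc`) and the braidings
(`mapT_braid`).

These squares are used twice. First, they present the actions of `Φ` and `R` on modules `P X` as
composites of `Q`-linear isomorphisms; since elements of `Q ⊗ Q` and `Q ⊗ Q ⊗ Q` act naturally and
every module is isomorphic to some `P X`, the same follows for all modules (`RepQ.descend`). Second,
they show that the quasi-inverse of `P` takes the structure maps of `Rep Q` to those of `SF`. It is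
faithful, so the laws of `SF` imply those of `Rep Q` (`BraidedComparison.laws`), and `P` with the
inverse of `Π` is braided monoidal. -/

theorem superFlip_even_left {ωV : V →ₗ[ℂ] V} (ωW : W →ₗ[ℂ] W) {v : V} (w : W) (hv : ωV v = v) :
    superFlip ωV ωW (v ⊗ₜ w) = w ⊗ₜ v :=
  superFlip_of_even_left _ _ _ (mem_evenPart.2 hv)

theorem superFlip_even_right (ωV : V →ₗ[ℂ] V) {ωW : W →ₗ[ℂ] W} (v : V) {w : W} (hw : ωW w = w) :
    superFlip ωV ωW (v ⊗ₜ w) = w ⊗ₜ v :=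
  superFlip_of_even_right _ _ _ (mem_evenPart.2 hw)

/-- For odd `v` the sign is `(-1)^{|w|}`, which is the parity involution applied to `w`; hence `w`
need not be homogeneous. This is how Koszul signs turn into occurrences of the parity. -/
theorem superFlip_odd_left {ωV : V →ₗ[ℂ] V} (ωW : W →ₗ[ℂ] W) {v : V} (w : W) (hv : ωV v = -v) :
    superFlip ωV ωW (v ⊗ₜ w) = ωW w ⊗ₜ v := by
  simp only [superFlip, LinearMap.comp_apply, LinearMap.smul_apply, LinearMap.sub_apply,
    LinearMap.add_apply, LinearMap.id_apply, TensorProduct.map_tmul, hv, map_smul, map_add, map_sub,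
    LinearEquiv.coe_coe, TensorProduct.comm_tmul, TensorProduct.tmul_neg]
  module

theorem superFlip_odd_right (ωV : V →ₗ[ℂ] V) {ωW : W →ₗ[ℂ] W} (v : V) {w : W} (hw : ωW w = -w) :
    superFlip ωV ωW (v ⊗ₜ w) = w ⊗ₜ ωV v := by
  simp only [superFlip, LinearMap.comp_apply, LinearMap.smul_apply, LinearMap.sub_apply,
    LinearMap.add_apply, LinearMap.id_apply, TensorProduct.map_tmul, hw, map_smul, map_add, map_sub,
    LinearEquiv.coe_coe, TensorProduct.comm_tmul, TensorProduct.neg_tmul]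
  module

/-- Any evaluation of the flip on the two middle vectors evaluates the swap; the rules for even and
odd `q` are instances. -/
theorem superSwap_tmul (ωQ : Q →ₗ[ℂ] Q) (ωU : U →ₗ[ℂ] U) (p : P) {q : Q} {u : U} (v : V)
    {q' : Q} {u' : U} (h : superFlip ωQ ωU (q ⊗ₜ u) = u' ⊗ₜ q') :
    superSwap ωQ ωU ((p ⊗ₜ q) ⊗ₜ (u ⊗ₜ v)) = (p ⊗ₜ[ℂ] u') ⊗ₜ[ℂ] (q' ⊗ₜ[ℂ] v) := by
  simp [superSwap, h]

theorem superSwap_even_left {ωQ : Q →ₗ[ℂ] Q} (ωU : U →ₗ[ℂ] U) (p : P) {q : Q} (u : U) (v : V)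
    (h : ωQ q = q) :
    superSwap ωQ ωU ((p ⊗ₜ q) ⊗ₜ (u ⊗ₜ v)) = (p ⊗ₜ[ℂ] u) ⊗ₜ[ℂ] (q ⊗ₜ[ℂ] v) :=
  superSwap_tmul _ _ _ _ (superFlip_even_left _ _ h)

theorem superSwap_odd_left {ωQ : Q →ₗ[ℂ] Q} (ωU : U →ₗ[ℂ] U) (p : P) {q : Q} (u : U) (v : V)
    (h : ωQ q = -q) :
    superSwap ωQ ωU ((p ⊗ₜ q) ⊗ₜ (u ⊗ₜ v)) = (p ⊗ₜ[ℂ] ωU u) ⊗ₜ[ℂ] (q ⊗ₜ[ℂ] v) :=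
  superSwap_tmul _ _ _ _ (superFlip_odd_left _ _ h)

variable {A : Type} [Ring A] [Algebra ℂ A] [SuperAlgebra A]

theorem superMul_even_left (p : A) {q : A} (u v : A) (h : parity q = q) :
    superMul (p ⊗ₜ q) (u ⊗ₜ v) = (p * u) ⊗ₜ[ℂ] (q * v) := by
  simp [superMul, superSwap_even_left (ωQ := parityLin A) (parityLin A) p u v h]

theorem superMul_odd_left (p : A) {q : A} (u v : A) (h : parity q = -q) :
    superMul (p ⊗ₜ q) (u ⊗ₜ v) = (p * parity u) ⊗ₜ[ℂ] (q * v) := by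
  simp [superMul, superSwap_odd_left (ωQ := parityLin A) (parityLin A) p u v h]

theorem superMul_add_left (s s' t : A ⊗[ℂ] A) :
    superMul (s + s') t = superMul s t + superMul s' t := by
  simp [superMul, TensorProduct.add_tmul]

theorem superMul_add_right (s t t' : A ⊗[ℂ] A) :
    superMul s (t + t') = superMul s t + superMul s t' := by
  simp [superMul, TensorProduct.tmul_add]

theorem superMul_smul_left (z : ℂ) (s t : A ⊗[ℂ] A) : superMul (z • s) t = z • superMul s t := by
  rw [superMul, superMul, ← TensorProduct.smul_tmul', map_smul, map_smul]

theorem superMul_smul_right (z : ℂ) (s t : A ⊗[ℂ] A) : superMul s (z • t) = z • superMul s t := by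
  simp only [superMul, TensorProduct.tmul_smul, map_smul]

end Swap

/-! ### The Hopf algebra `G` in its basis -/

/-- The basis `1, a₁, a₂, a₁a₂` of `G`. -/
def basisG : Fin 4 → G := ![1, a₁, a₂, a₁ * a₂]

theorem basisG_zero : basisG 0 = 1 := rfl
theorem basisG_one : basisG 1 = a₁ := rfl
theorem basisG_two : basisG 2 = a₂ := rfl
theorem basisG_three : basisG 3 = a₁ * a₂ := rfl

theorem parity_basisG : parity (basisG 0) = basisG 0 ∧ parity (basisG 1) = -basisG 1 ∧
    parity (basisG 2) = -basisG 2 ∧ parity (basisG 3) = basisG 3 := by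
  simp [basisG_zero, basisG_one, basisG_two, basisG_three]

theorem a₂_mul_a₁ : a₂ * a₁ = -(a₁ * a₂) := by
  rw [eq_neg_iff_add_eq_zero, add_comm]
  exact Cl.x_mul_y_add.trans (map_zero _)

theorem a₁_mul_basisG : a₁ * basisG 0 = basisG 1 ∧ a₁ * basisG 1 = 0 ∧ a₁ * basisG 2 = basisG 3 ∧
    a₁ * basisG 3 = 0 := by
  refine ⟨mul_one _, Cl.x_mul_x, rfl, ?_⟩
  rw [basisG_three, ← mul_assoc, Cl.x_mul_x, zero_mul]

theorem a₂_mul_basisG : a₂ * basisG 0 = basisG 2 ∧ a₂ * basisG 1 = -basisG 3 ∧ a₂ * basisG 2 = 0 ∧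
    a₂ * basisG 3 = 0 := by
  refine ⟨mul_one _, a₂_mul_a₁, Cl.y_mul_y, ?_⟩
  rw [basisG_three, ← mul_assoc, a₂_mul_a₁, neg_mul, mul_assoc, Cl.y_mul_y, mul_zero, neg_zero]

theorem lin_basisG {M : Type*} [AddCommGroup M] [Module ℂ M] (v₀ v₁ v₂ v₃ : M) :
    (Cl.lin v₀ v₁ v₂ v₃ : G →ₗ[ℂ] M) (basisG 0) = v₀ ∧
      (Cl.lin v₀ v₁ v₂ v₃ : G →ₗ[ℂ] M) (basisG 1) = v₁ ∧
      (Cl.lin v₀ v₁ v₂ v₃ : G →ₗ[ℂ] M) (basisG 2) = v₂ ∧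
      (Cl.lin v₀ v₁ v₂ v₃ : G →ₗ[ℂ] M) (basisG 3) = v₃ := by
  refine ⟨?_, ?_, ?_, ?_⟩ <;>
    simp [basisG_zero, basisG_one, basisG_two, basisG_three, Cl.lin_apply, Cl.mul_def, Cl.one_def,
      Cl.x, Cl.y]

theorem eq_sum_basisG (g : G) : g = ∑ k, g.coord k • basisG k := by
  rw [Fin.sum_univ_four]
  exact Cl.eq_sum g

/-- The value on `a₁a₂` is the product of the values on `a₁` and `a₂`; its one sign comes from `(1 ⊗
a₁)(a₂ ⊗ 1) = -a₂ ⊗ a₁`. -/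
theorem coG_basisG :
    coG (basisG 0) = basisG 0 ⊗ₜ basisG 0 ∧
    coG (basisG 1) = basisG 1 ⊗ₜ basisG 0 + basisG 0 ⊗ₜ basisG 1 ∧
    coG (basisG 2) = basisG 2 ⊗ₜ basisG 0 + basisG 0 ⊗ₜ basisG 2 ∧
    coG (basisG 3) = basisG 3 ⊗ₜ basisG 0 + basisG 1 ⊗ₜ basisG 2 - basisG 2 ⊗ₜ basisG 1 +
      basisG 0 ⊗ₜ basisG 3 := by
  refine ⟨(lin_basisG _ _ _ _).1, (lin_basisG _ _ _ _).2.1, (lin_basisG _ _ _ _).2.2.1,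
    (lin_basisG _ _ _ _).2.2.2.trans ?_⟩
  rw [superMul_add_left, superMul_add_right, superMul_add_right,
    superMul_even_left _ _ _ (map_one _), superMul_even_left _ _ _ (map_one _),
    superMul_odd_left _ _ _ Cl.parity_x, superMul_odd_left _ _ _ Cl.parity_x]
  simp only [Cl.parity_y, one_mul, mul_one, map_one, TensorProduct.neg_tmul, basisG_zero, basisG_one,
    basisG_two, basisG_three]
  abel

theorem antipodeG_basisG : antipodeG (basisG 0) = basisG 0 ∧ antipodeG (basisG 1) = -basisG 1 ∧
    antipodeG (basisG 2) = -basisG 2 ∧ antipodeG (basisG 3) = basisG 3 := by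
  refine ⟨(lin_basisG _ _ _ _).1, (lin_basisG _ _ _ _).2.1, (lin_basisG _ _ _ _).2.2.1,
    (lin_basisG _ _ _ _).2.2.2.trans ?_⟩
  rw [a₂_mul_a₁, neg_neg]; rfl

theorem phiG_basisG (β : ℂ) : phiG β (basisG 0) = β ^ 2 • basisG 3 ∧
    phiG β (basisG 1) = β ^ 2 • basisG 1 ∧ phiG β (basisG 2) = β ^ 2 • basisG 2 ∧
    phiG β (basisG 3) = -(β ^ 2 • basisG 0) :=
  lin_basisG _ _ _ _


namespace SF

/-! ## Tensor products in `SF` in terms of generators -/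

/-- The tensor product of `SF`, as an opaque object. -/
def tens (X Y : SF) : SF := tensorObj X Y

/-- The parity of the untwisted component. -/
def par₀ (X : SF) : X.c₀.V →ₗ[ℂ] X.c₀.V := X.c₀.ω

/-- The parity of the twisted component. -/
def par₁ (X : SF) : X.c₁.V →ₗ[ℂ] X.c₁.V := X.c₁.ω

/-- The action of `a₁`. -/
def A₁ (X : SF) : X.c₀.V →ₗ[ℂ] X.c₀.V := X.c₀.ρ a₁

/-- The action of `a₂`. -/
def A₂ (X : SF) : X.c₀.V →ₗ[ℂ] X.c₀.V := X.c₀.ρ a₂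

section Generators

variable {X Y : SF}

/-- The element `x ⊗ y` for untwisted `x`, `y`. -/
def ten₀₀ (x : X.c₀.V) (y : Y.c₀.V) : (tens X Y).c₀.V :=
  (i₁ (x ⊗ₜ y) : (tensorObj X Y).c₀.V)

/-- The element `g ⊗ x ⊗ y` for twisted `x`, `y` and an element `g` of the basis `1, a₁, a₂, a₁a₂`
of `G`. -/
def ten₁₁ (k : Fin 4) (x : X.c₁.V) (y : Y.c₁.V) : (tens X Y).c₀.V :=
  (i₂ (basisG k ⊗ₜ (x ⊗ₜ y)) : (tensorObj X Y).c₀.V)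

/-- The element `x ⊗ y` for untwisted `x` and twisted `y`. -/
def ten₀₁ (x : X.c₀.V) (y : Y.c₁.V) : (tens X Y).c₁.V :=
  (i₁ (x ⊗ₜ y) : (tensorObj X Y).c₁.V)

/-- The element `x ⊗ y` for twisted `x` and untwisted `y`. -/
def ten₁₀ (x : X.c₁.V) (y : Y.c₀.V) : (tens X Y).c₁.V :=
  (i₂ (x ⊗ₜ y) : (tensorObj X Y).c₁.V)

theorem par₀_par₀ (x : X.c₀.V) : par₀ X (par₀ X x) = x := X.c₀.ω_ω x
theorem par₁_par₁ (x : X.c₁.V) : par₁ X (par₁ X x) = x := X.c₁.ω_ω x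
theorem par₀_A₁ (x : X.c₀.V) : par₀ X (A₁ X x) = -A₁ X (par₀ X x) := X.c₀.ω_a₁ x
theorem par₀_A₂ (x : X.c₀.V) : par₀ X (A₂ X x) = -A₂ X (par₀ X x) := X.c₀.ω_a₂ x
theorem A₁_A₁ (x : X.c₀.V) : A₁ X (A₁ X x) = 0 := X.c₀.a₁_a₁ x
theorem A₂_A₂ (x : X.c₀.V) : A₂ X (A₂ X x) = 0 := X.c₀.a₂_a₂ x
theorem A₂_A₁ (x : X.c₀.V) : A₂ X (A₁ X x) = -A₁ X (A₂ X x) := by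
  rw [A₁, A₂, X.c₀.a₁_a₂, neg_neg]

theorem ten₀₀_add_left (x x' : X.c₀.V) (y : Y.c₀.V) :
    ten₀₀ (x + x') y = ten₀₀ x y + ten₀₀ x' y :=
  congrArg i₁ (TensorProduct.add_tmul x x' y) |>.trans (map_add i₁ _ _)
theorem ten₀₀_add_right (x : X.c₀.V) (y y' : Y.c₀.V) :
    ten₀₀ x (y + y') = ten₀₀ x y + ten₀₀ x y' :=
  congrArg i₁ (TensorProduct.tmul_add x y y') |>.trans (map_add i₁ _ _)
theorem ten₀₀_smul_left (z : ℂ) (x : X.c₀.V) (y : Y.c₀.V) :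
    ten₀₀ (z • x) y = z • ten₀₀ x y :=
  congrArg i₁ (TensorProduct.smul_tmul' z x y).symm |>.trans (map_smul i₁ _ _)
theorem ten₀₀_smul_right (z : ℂ) (x : X.c₀.V) (y : Y.c₀.V) :
    ten₀₀ x (z • y) = z • ten₀₀ x y :=
  congrArg i₁ (TensorProduct.tmul_smul z x y) |>.trans (map_smul i₁ _ _)

theorem ten₁₁_add_left (k : Fin 4) (x x' : X.c₁.V) (y : Y.c₁.V) :
    ten₁₁ k (x + x') y = ten₁₁ k x y + ten₁₁ k x' y :=
  congrArg (fun v => i₂ (basisG k ⊗ₜ v)) (TensorProduct.add_tmul x x' y) |>.trans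
    ((congrArg i₂ (TensorProduct.tmul_add _ _ _)).trans (map_add i₂ _ _))
theorem ten₁₁_add_right (k : Fin 4) (x : X.c₁.V) (y y' : Y.c₁.V) :
    ten₁₁ k x (y + y') = ten₁₁ k x y + ten₁₁ k x y' :=
  congrArg (fun v => i₂ (basisG k ⊗ₜ v)) (TensorProduct.tmul_add x y y') |>.trans
    ((congrArg i₂ (TensorProduct.tmul_add _ _ _)).trans (map_add i₂ _ _))
theorem ten₁₁_smul_left (k : Fin 4) (z : ℂ) (x : X.c₁.V) (y : Y.c₁.V) :
    ten₁₁ k (z • x) y = z • ten₁₁ k x y :=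
  congrArg (fun v => i₂ (basisG k ⊗ₜ v)) (TensorProduct.smul_tmul' z x y).symm |>.trans
    ((congrArg i₂ (TensorProduct.tmul_smul _ _ _)).trans (map_smul i₂ _ _))
theorem ten₁₁_smul_right (k : Fin 4) (z : ℂ) (x : X.c₁.V) (y : Y.c₁.V) :
    ten₁₁ k x (z • y) = z • ten₁₁ k x y :=
  congrArg (fun v => i₂ (basisG k ⊗ₜ v)) (TensorProduct.tmul_smul z x y) |>.trans
    ((congrArg i₂ (TensorProduct.tmul_smul _ _ _)).trans (map_smul i₂ _ _))

theorem ten₀₁_add_left (x x' : X.c₀.V) (y : Y.c₁.V) :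
    ten₀₁ (x + x') y = ten₀₁ x y + ten₀₁ x' y :=
  congrArg i₁ (TensorProduct.add_tmul x x' y) |>.trans (map_add i₁ _ _)
theorem ten₀₁_add_right (x : X.c₀.V) (y y' : Y.c₁.V) :
    ten₀₁ x (y + y') = ten₀₁ x y + ten₀₁ x y' :=
  congrArg i₁ (TensorProduct.tmul_add x y y') |>.trans (map_add i₁ _ _)
theorem ten₀₁_smul_left (z : ℂ) (x : X.c₀.V) (y : Y.c₁.V) :
    ten₀₁ (z • x) y = z • ten₀₁ x y :=
  congrArg i₁ (TensorProduct.smul_tmul' z x y).symm |>.trans (map_smul i₁ _ _)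
theorem ten₀₁_smul_right (z : ℂ) (x : X.c₀.V) (y : Y.c₁.V) :
    ten₀₁ x (z • y) = z • ten₀₁ x y :=
  congrArg i₁ (TensorProduct.tmul_smul z x y) |>.trans (map_smul i₁ _ _)

theorem ten₁₀_add_left (x x' : X.c₁.V) (y : Y.c₀.V) :
    ten₁₀ (x + x') y = ten₁₀ x y + ten₁₀ x' y :=
  congrArg i₂ (TensorProduct.add_tmul x x' y) |>.trans (map_add i₂ _ _)
theorem ten₁₀_add_right (x : X.c₁.V) (y y' : Y.c₀.V) :
    ten₁₀ x (y + y') = ten₁₀ x y + ten₁₀ x y' :=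
  congrArg i₂ (TensorProduct.tmul_add x y y') |>.trans (map_add i₂ _ _)
theorem ten₁₀_smul_left (z : ℂ) (x : X.c₁.V) (y : Y.c₀.V) :
    ten₁₀ (z • x) y = z • ten₁₀ x y :=
  congrArg i₂ (TensorProduct.smul_tmul' z x y).symm |>.trans (map_smul i₂ _ _)
theorem ten₁₀_smul_right (z : ℂ) (x : X.c₁.V) (y : Y.c₀.V) :
    ten₁₀ x (z • y) = z • ten₁₀ x y :=
  congrArg i₂ (TensorProduct.tmul_smul z x y) |>.trans (map_smul i₂ _ _)

theorem ten₀₀_neg_left (x : X.c₀.V) (y : Y.c₀.V) : ten₀₀ (-x) y = -ten₀₀ x y := by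
  rw [← neg_one_smul ℂ x, ten₀₀_smul_left, neg_one_smul]
theorem ten₀₀_neg_right (x : X.c₀.V) (y : Y.c₀.V) : ten₀₀ x (-y) = -ten₀₀ x y := by
  rw [← neg_one_smul ℂ y, ten₀₀_smul_right, neg_one_smul]
theorem ten₁₁_neg_left (k : Fin 4) (x : X.c₁.V) (y : Y.c₁.V) : ten₁₁ k (-x) y = -ten₁₁ k x y := by
  rw [← neg_one_smul ℂ x, ten₁₁_smul_left, neg_one_smul]
theorem ten₁₁_neg_right (k : Fin 4) (x : X.c₁.V) (y : Y.c₁.V) : ten₁₁ k x (-y) = -ten₁₁ k x y := by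
  rw [← neg_one_smul ℂ y, ten₁₁_smul_right, neg_one_smul]
theorem ten₀₁_neg_left (x : X.c₀.V) (y : Y.c₁.V) : ten₀₁ (-x) y = -ten₀₁ x y := by
  rw [← neg_one_smul ℂ x, ten₀₁_smul_left, neg_one_smul]
theorem ten₀₁_neg_right (x : X.c₀.V) (y : Y.c₁.V) : ten₀₁ x (-y) = -ten₀₁ x y := by
  rw [← neg_one_smul ℂ y, ten₀₁_smul_right, neg_one_smul]
theorem ten₁₀_neg_left (x : X.c₁.V) (y : Y.c₀.V) : ten₁₀ (-x) y = -ten₁₀ x y := by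
  rw [← neg_one_smul ℂ x, ten₁₀_smul_left, neg_one_smul]
theorem ten₁₀_neg_right (x : X.c₁.V) (y : Y.c₀.V) : ten₁₀ x (-y) = -ten₁₀ x y := by
  rw [← neg_one_smul ℂ y, ten₁₀_smul_right, neg_one_smul]

theorem ten₀₀_zero_left (y : Y.c₀.V) : ten₀₀ (0 : X.c₀.V) y = 0 := by
  rw [← zero_smul ℂ (0 : X.c₀.V), ten₀₀_smul_left, zero_smul]
theorem ten₀₀_zero_right (x : X.c₀.V) : ten₀₀ x (0 : Y.c₀.V) = 0 := by
  rw [← zero_smul ℂ (0 : Y.c₀.V), ten₀₀_smul_right, zero_smul]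
theorem ten₁₁_zero_left (k : Fin 4) (y : Y.c₁.V) : ten₁₁ k (0 : X.c₁.V) y = 0 := by
  rw [← zero_smul ℂ (0 : X.c₁.V), ten₁₁_smul_left, zero_smul]
theorem ten₁₁_zero_right (k : Fin 4) (x : X.c₁.V) : ten₁₁ k x (0 : Y.c₁.V) = 0 := by
  rw [← zero_smul ℂ (0 : Y.c₁.V), ten₁₁_smul_right, zero_smul]
theorem ten₀₁_zero_left (y : Y.c₁.V) : ten₀₁ (0 : X.c₀.V) y = 0 := by
  rw [← zero_smul ℂ (0 : X.c₀.V), ten₀₁_smul_left, zero_smul]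
theorem ten₀₁_zero_right (x : X.c₀.V) : ten₀₁ x (0 : Y.c₁.V) = 0 := by
  rw [← zero_smul ℂ (0 : Y.c₁.V), ten₀₁_smul_right, zero_smul]
theorem ten₁₀_zero_left (y : Y.c₀.V) : ten₁₀ (0 : X.c₁.V) y = 0 := by
  rw [← zero_smul ℂ (0 : X.c₁.V), ten₁₀_smul_left, zero_smul]
theorem ten₁₀_zero_right (x : X.c₁.V) : ten₁₀ x (0 : Y.c₀.V) = 0 := by
  rw [← zero_smul ℂ (0 : Y.c₀.V), ten₁₀_smul_right, zero_smul]

theorem ten₀₀_sub_left (x x' : X.c₀.V) (y : Y.c₀.V) :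
    ten₀₀ (x - x') y = ten₀₀ x y - ten₀₀ x' y := by
  rw [sub_eq_add_neg, ten₀₀_add_left, ten₀₀_neg_left, sub_eq_add_neg]
theorem ten₀₀_sub_right (x : X.c₀.V) (y y' : Y.c₀.V) :
    ten₀₀ x (y - y') = ten₀₀ x y - ten₀₀ x y' := by
  rw [sub_eq_add_neg, ten₀₀_add_right, ten₀₀_neg_right, sub_eq_add_neg]
theorem ten₁₁_sub_left (k : Fin 4) (x x' : X.c₁.V) (y : Y.c₁.V) :
    ten₁₁ k (x - x') y = ten₁₁ k x y - ten₁₁ k x' y := by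
  rw [sub_eq_add_neg, ten₁₁_add_left, ten₁₁_neg_left, sub_eq_add_neg]
theorem ten₁₁_sub_right (k : Fin 4) (x : X.c₁.V) (y y' : Y.c₁.V) :
    ten₁₁ k x (y - y') = ten₁₁ k x y - ten₁₁ k x y' := by
  rw [sub_eq_add_neg, ten₁₁_add_right, ten₁₁_neg_right, sub_eq_add_neg]
theorem ten₀₁_sub_left (x x' : X.c₀.V) (y : Y.c₁.V) :
    ten₀₁ (x - x') y = ten₀₁ x y - ten₀₁ x' y := by
  rw [sub_eq_add_neg, ten₀₁_add_left, ten₀₁_neg_left, sub_eq_add_neg]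
theorem ten₀₁_sub_right (x : X.c₀.V) (y y' : Y.c₁.V) :
    ten₀₁ x (y - y') = ten₀₁ x y - ten₀₁ x y' := by
  rw [sub_eq_add_neg, ten₀₁_add_right, ten₀₁_neg_right, sub_eq_add_neg]
theorem ten₁₀_sub_left (x x' : X.c₁.V) (y : Y.c₀.V) :
    ten₁₀ (x - x') y = ten₁₀ x y - ten₁₀ x' y := by
  rw [sub_eq_add_neg, ten₁₀_add_left, ten₁₀_neg_left, sub_eq_add_neg]
theorem ten₁₀_sub_right (x : X.c₁.V) (y y' : Y.c₀.V) :
    ten₁₀ x (y - y') = ten₁₀ x y - ten₁₀ x y' := by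
  rw [sub_eq_add_neg, ten₁₀_add_right, ten₁₀_neg_right, sub_eq_add_neg]

theorem par₀_ten₀₀ (x : X.c₀.V) (y : Y.c₀.V) :
    par₀ (tens X Y) (ten₀₀ x y) = ten₀₀ (par₀ X x) (par₀ Y y) := by
  refine Prod.ext rfl ?_
  exact map_zero (map (parityLin G) (map X.c₁.ω Y.c₁.ω))

/-- The scalar `σ` is the degree sign of the basis vector of `G`, so that the four basis vectors
share one argument. -/
theorem par₀_ten₁₁ (k : Fin 4) {σ : ℂ} (h : parity (basisG k) = σ • basisG k) (x : X.c₁.V)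
    (y : Y.c₁.V) : par₀ (tens X Y) (ten₁₁ k x y) = σ • ten₁₁ k (par₁ X x) (par₁ Y y) := by
  refine Prod.ext ((map_zero (map X.c₀.ω Y.c₀.ω)).trans (smul_zero σ).symm) ?_
  change parity (basisG k) ⊗ₜ (X.c₁.ω x ⊗ₜ Y.c₁.ω y) = σ • (basisG k ⊗ₜ (X.c₁.ω x ⊗ₜ Y.c₁.ω y))
  rw [h, TensorProduct.smul_tmul']

theorem par₀_ten₁₁_zero (x : X.c₁.V) (y : Y.c₁.V) :
    par₀ (tens X Y) (ten₁₁ 0 x y) = ten₁₁ 0 (par₁ X x) (par₁ Y y) := by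
  rw [par₀_ten₁₁ 0 (σ := 1) (by rw [one_smul]; exact parity_basisG.1), one_smul]
theorem par₀_ten₁₁_one (x : X.c₁.V) (y : Y.c₁.V) :
    par₀ (tens X Y) (ten₁₁ 1 x y) = -ten₁₁ 1 (par₁ X x) (par₁ Y y) := by
  rw [par₀_ten₁₁ 1 (σ := -1) (by rw [neg_one_smul]; exact parity_basisG.2.1), neg_one_smul]
theorem par₀_ten₁₁_two (x : X.c₁.V) (y : Y.c₁.V) :
    par₀ (tens X Y) (ten₁₁ 2 x y) = -ten₁₁ 2 (par₁ X x) (par₁ Y y) := by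
  rw [par₀_ten₁₁ 2 (σ := -1) (by rw [neg_one_smul]; exact parity_basisG.2.2.1), neg_one_smul]
theorem par₀_ten₁₁_three (x : X.c₁.V) (y : Y.c₁.V) :
    par₀ (tens X Y) (ten₁₁ 3 x y) = ten₁₁ 3 (par₁ X x) (par₁ Y y) := by
  rw [par₀_ten₁₁ 3 (σ := 1) (by rw [one_smul]; exact parity_basisG.2.2.2), one_smul]

theorem par₁_ten₀₁ (x : X.c₀.V) (y : Y.c₁.V) :
    par₁ (tens X Y) (ten₀₁ x y) = ten₀₁ (par₀ X x) (par₁ Y y) := by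
  refine Prod.ext rfl ?_
  exact map_zero (map X.c₁.ω Y.c₀.ω)

theorem par₁_ten₁₀ (x : X.c₁.V) (y : Y.c₀.V) :
    par₁ (tens X Y) (ten₁₀ x y) = ten₁₀ (par₁ X x) (par₀ Y y) := by
  refine Prod.ext ?_ rfl
  exact map_zero (map X.c₀.ω Y.c₁.ω)

theorem tens_ρ (g : G) (v : (tensorObj X Y).c₀.V) :
    (tens X Y).c₀.ρ g v =
      (((X.c₀.tensor Y.c₀).ρ g v.1, (SRep.free (X.c₁.tensor Y.c₁)).ρ g v.2) :
        (tensorObj X Y).c₀.V) := rfl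

theorem A₁_ten₀₀ (x : X.c₀.V) (y : Y.c₀.V) :
    A₁ (tens X Y) (ten₀₀ x y) = ten₀₀ (A₁ X x) y + ten₀₀ (par₀ X x) (A₁ Y y) := by
  refine (tens_ρ _ _).trans (Prod.ext ?_ ?_)
  · change (X.c₀.tensor Y.c₀).ρ a₁ (x ⊗ₜ y) = _
    rw [Cl.lift_x]; rfl
  · exact (map_zero ((SRep.free (X.c₁.tensor Y.c₁)).ρ a₁)).trans (add_zero _).symm

theorem A₂_ten₀₀ (x : X.c₀.V) (y : Y.c₀.V) :
    A₂ (tens X Y) (ten₀₀ x y) = ten₀₀ (A₂ X x) y + ten₀₀ (par₀ X x) (A₂ Y y) := by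
  refine (tens_ρ _ _).trans (Prod.ext ?_ ?_)
  · change (X.c₀.tensor Y.c₀).ρ a₂ (x ⊗ₜ y) = _
    rw [Cl.lift_y]; rfl
  · exact (map_zero ((SRep.free (X.c₁.tensor Y.c₁)).ρ a₂)).trans (add_zero _).symm

/-- A generator of `G` sends each basis vector to a multiple of a basis vector, so a target `l` and
a scalar `σ` suffice; where the product vanishes, `σ = 0` and the target is arbitrary. -/
theorem ρ_ten₁₁ (g : G) {k l : Fin 4} {σ : ℂ} (h : g * basisG k = σ • basisG l) (x : X.c₁.V)
    (y : Y.c₁.V) : (tens X Y).c₀.ρ g (ten₁₁ k x y) = σ • ten₁₁ l x y := by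
  refine (tens_ρ _ _).trans (Prod.ext ?_ ?_)
  · exact (map_zero ((X.c₀.tensor Y.c₀).ρ g)).trans (smul_zero σ).symm
  · change (g * basisG k) ⊗ₜ (x ⊗ₜ y) = σ • (basisG l ⊗ₜ (x ⊗ₜ y))
    rw [h, TensorProduct.smul_tmul']

theorem A₁_ten₁₁_zero (x : X.c₁.V) (y : Y.c₁.V) :
    A₁ (tens X Y) (ten₁₁ 0 x y) = ten₁₁ 1 x y := by
  rw [A₁, ρ_ten₁₁ a₁ (l := 1) (σ := 1) (by rw [one_smul]; exact a₁_mul_basisG.1), one_smul]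
theorem A₁_ten₁₁_one (x : X.c₁.V) (y : Y.c₁.V) : A₁ (tens X Y) (ten₁₁ 1 x y) = 0 := by
  rw [A₁, ρ_ten₁₁ a₁ (l := 1) (σ := 0) (by rw [zero_smul]; exact a₁_mul_basisG.2.1), zero_smul]
theorem A₁_ten₁₁_two (x : X.c₁.V) (y : Y.c₁.V) :
    A₁ (tens X Y) (ten₁₁ 2 x y) = ten₁₁ 3 x y := by
  rw [A₁, ρ_ten₁₁ a₁ (l := 3) (σ := 1) (by rw [one_smul]; exact a₁_mul_basisG.2.2.1), one_smul]
theorem A₁_ten₁₁_three (x : X.c₁.V) (y : Y.c₁.V) : A₁ (tens X Y) (ten₁₁ 3 x y) = 0 := by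
  rw [A₁, ρ_ten₁₁ a₁ (l := 3) (σ := 0) (by rw [zero_smul]; exact a₁_mul_basisG.2.2.2), zero_smul]
theorem A₂_ten₁₁_zero (x : X.c₁.V) (y : Y.c₁.V) :
    A₂ (tens X Y) (ten₁₁ 0 x y) = ten₁₁ 2 x y := by
  rw [A₂, ρ_ten₁₁ a₂ (l := 2) (σ := 1) (by rw [one_smul]; exact a₂_mul_basisG.1), one_smul]
theorem A₂_ten₁₁_one (x : X.c₁.V) (y : Y.c₁.V) :
    A₂ (tens X Y) (ten₁₁ 1 x y) = -ten₁₁ 3 x y := by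
  rw [A₂, ρ_ten₁₁ a₂ (l := 3) (σ := -1) (by rw [neg_one_smul]; exact a₂_mul_basisG.2.1),
    neg_one_smul]
theorem A₂_ten₁₁_two (x : X.c₁.V) (y : Y.c₁.V) : A₂ (tens X Y) (ten₁₁ 2 x y) = 0 := by
  rw [A₂, ρ_ten₁₁ a₂ (l := 2) (σ := 0) (by rw [zero_smul]; exact a₂_mul_basisG.2.2.1), zero_smul]
theorem A₂_ten₁₁_three (x : X.c₁.V) (y : Y.c₁.V) : A₂ (tens X Y) (ten₁₁ 3 x y) = 0 := by
  rw [A₂, ρ_ten₁₁ a₂ (l := 3) (σ := 0) (by rw [zero_smul]; exact a₂_mul_basisG.2.2.2), zero_smul]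

/-- The untwisted component of `X * Y` is spanned by the elements `x ⊗ y` and `g ⊗ x ⊗ y`. -/
theorem tens_c₀_eq_top {p : Submodule ℂ (tens X Y).c₀.V}
    (h₀ : ∀ (x : X.c₀.V) (y : Y.c₀.V), ten₀₀ x y ∈ p)
    (h₁ : ∀ (k : Fin 4) (x : X.c₁.V) (y : Y.c₁.V), ten₁₁ k x y ∈ p) : p = ⊤ := by
  rw [eq_top_iff]
  rintro v -
  have h₀' : ∀ w : X.c₀.V ⊗[ℂ] Y.c₀.V, (i₁ w : (tensorObj X Y).c₀.V) ∈ p := by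
    intro w
    induction w with
    | zero => rw [map_zero]; exact p.zero_mem
    | add a b ha hb => rw [map_add]; exact p.add_mem ha hb
    | tmul x y => exact h₀ x y
  have h₁' : ∀ w : G ⊗[ℂ] (X.c₁.V ⊗[ℂ] Y.c₁.V), (i₂ w : (tensorObj X Y).c₀.V) ∈ p := by
    intro w
    induction w with
    | zero => rw [map_zero]; exact p.zero_mem
    | add a b ha hb => rw [map_add]; exact p.add_mem ha hb
    | tmul g w =>
      induction w with
      | zero => rw [TensorProduct.tmul_zero, map_zero]; exact p.zero_mem
      | add a b ha hb => rw [TensorProduct.tmul_add, map_add]; exact p.add_mem ha hb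
      | tmul x y =>
        rw [eq_sum_basisG g, TensorProduct.sum_tmul, map_sum]
        refine p.sum_mem fun k _ => ?_
        rw [← TensorProduct.smul_tmul', map_smul]
        exact p.smul_mem _ (h₁ k x y)
  have hv : v = (i₁ (show (tensorObj X Y).c₀.V from v).1 : (tensorObj X Y).c₀.V) +
      (i₂ (show (tensorObj X Y).c₀.V from v).2 : (tensorObj X Y).c₀.V) :=
    Prod.ext (add_zero _).symm (zero_add _).symm
  rw [hv]
  exact p.add_mem (h₀' _) (h₁' _)

/-- The twisted component of `X * Y` is spanned by the elements `x ⊗ y`. -/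
theorem tens_c₁_eq_top {p : Submodule ℂ (tens X Y).c₁.V}
    (h₀ : ∀ (x : X.c₀.V) (y : Y.c₁.V), ten₀₁ x y ∈ p)
    (h₁ : ∀ (x : X.c₁.V) (y : Y.c₀.V), ten₁₀ x y ∈ p) : p = ⊤ := by
  rw [eq_top_iff]
  rintro v -
  have h₀' : ∀ w : X.c₀.V ⊗[ℂ] Y.c₁.V, (i₁ w : (tensorObj X Y).c₁.V) ∈ p := by
    intro w
    induction w with
    | zero => rw [map_zero]; exact p.zero_mem
    | add a b ha hb => rw [map_add]; exact p.add_mem ha hb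
    | tmul x y => exact h₀ x y
  have h₁' : ∀ w : X.c₁.V ⊗[ℂ] Y.c₀.V, (i₂ w : (tensorObj X Y).c₁.V) ∈ p := by
    intro w
    induction w with
    | zero => rw [map_zero]; exact p.zero_mem
    | add a b ha hb => rw [map_add]; exact p.add_mem ha hb
    | tmul x y => exact h₁ x y
  have hv : v = (i₁ (show (tensorObj X Y).c₁.V from v).1 : (tensorObj X Y).c₁.V) +
      (i₂ (show (tensorObj X Y).c₁.V from v).2 : (tensorObj X Y).c₁.V) :=
    Prod.ext (add_zero _).symm (zero_add _).symm
  rw [hv]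
  exact p.add_mem (h₀' _) (h₁' _)

end Generators

/-- The generators of a tensor product are bilinear. -/
theorem ten_linear :
    (∀ {X Y : SF} (x x' : X.c₀.V) (y : Y.c₀.V), ten₀₀ (x + x') y = ten₀₀ x y + ten₀₀ x' y) ∧
    (∀ {X Y : SF} (x : X.c₀.V) (y y' : Y.c₀.V), ten₀₀ x (y + y') = ten₀₀ x y + ten₀₀ x y') ∧
    (∀ {X Y : SF} (k : Fin 4) (x x' : X.c₁.V) (y : Y.c₁.V), ten₁₁ k (x + x') y = ten₁₁ k x y +
      ten₁₁ k x' y) ∧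
    (∀ {X Y : SF} (k : Fin 4) (x : X.c₁.V) (y y' : Y.c₁.V), ten₁₁ k x (y + y') = ten₁₁ k x y +
      ten₁₁ k x y') ∧
    (∀ {X Y : SF} (x x' : X.c₀.V) (y : Y.c₁.V), ten₀₁ (x + x') y = ten₀₁ x y + ten₀₁ x' y) ∧
    (∀ {X Y : SF} (x : X.c₀.V) (y y' : Y.c₁.V), ten₀₁ x (y + y') = ten₀₁ x y + ten₀₁ x y') ∧
    (∀ {X Y : SF} (x x' : X.c₁.V) (y : Y.c₀.V), ten₁₀ (x + x') y = ten₁₀ x y + ten₁₀ x' y) ∧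
    (∀ {X Y : SF} (x : X.c₁.V) (y y' : Y.c₀.V), ten₁₀ x (y + y') = ten₁₀ x y + ten₁₀ x y') ∧
    (∀ {X Y : SF} (x x' : X.c₀.V) (y : Y.c₀.V), ten₀₀ (x - x') y = ten₀₀ x y - ten₀₀ x' y) ∧
    (∀ {X Y : SF} (x : X.c₀.V) (y y' : Y.c₀.V), ten₀₀ x (y - y') = ten₀₀ x y - ten₀₀ x y') ∧
    (∀ {X Y : SF} (k : Fin 4) (x x' : X.c₁.V) (y : Y.c₁.V), ten₁₁ k (x - x') y = ten₁₁ k x y -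
      ten₁₁ k x' y) ∧
    (∀ {X Y : SF} (k : Fin 4) (x : X.c₁.V) (y y' : Y.c₁.V), ten₁₁ k x (y - y') = ten₁₁ k x y -
      ten₁₁ k x y') ∧
    (∀ {X Y : SF} (x x' : X.c₀.V) (y : Y.c₁.V), ten₀₁ (x - x') y = ten₀₁ x y - ten₀₁ x' y) ∧
    (∀ {X Y : SF} (x : X.c₀.V) (y y' : Y.c₁.V), ten₀₁ x (y - y') = ten₀₁ x y - ten₀₁ x y') ∧
    (∀ {X Y : SF} (x x' : X.c₁.V) (y : Y.c₀.V), ten₁₀ (x - x') y = ten₁₀ x y - ten₁₀ x' y) ∧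
    (∀ {X Y : SF} (x : X.c₁.V) (y y' : Y.c₀.V), ten₁₀ x (y - y') = ten₁₀ x y - ten₁₀ x y') ∧
    (∀ {X Y : SF} (x : X.c₀.V) (y : Y.c₀.V), ten₀₀ (-x) y = -ten₀₀ x y) ∧
    (∀ {X Y : SF} (x : X.c₀.V) (y : Y.c₀.V), ten₀₀ x (-y) = -ten₀₀ x y) ∧
    (∀ {X Y : SF} (k : Fin 4) (x : X.c₁.V) (y : Y.c₁.V), ten₁₁ k (-x) y = -ten₁₁ k x y) ∧
    (∀ {X Y : SF} (k : Fin 4) (x : X.c₁.V) (y : Y.c₁.V), ten₁₁ k x (-y) = -ten₁₁ k x y) ∧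
    (∀ {X Y : SF} (x : X.c₀.V) (y : Y.c₁.V), ten₀₁ (-x) y = -ten₀₁ x y) ∧
    (∀ {X Y : SF} (x : X.c₀.V) (y : Y.c₁.V), ten₀₁ x (-y) = -ten₀₁ x y) ∧
    (∀ {X Y : SF} (x : X.c₁.V) (y : Y.c₀.V), ten₁₀ (-x) y = -ten₁₀ x y) ∧
    (∀ {X Y : SF} (x : X.c₁.V) (y : Y.c₀.V), ten₁₀ x (-y) = -ten₁₀ x y) ∧
    (∀ {X Y : SF} (z : ℂ) (x : X.c₀.V) (y : Y.c₀.V), ten₀₀ (z • x) y = z • ten₀₀ x y) ∧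
    (∀ {X Y : SF} (z : ℂ) (x : X.c₀.V) (y : Y.c₀.V), ten₀₀ x (z • y) = z • ten₀₀ x y) ∧
    (∀ {X Y : SF} (k : Fin 4) (z : ℂ) (x : X.c₁.V) (y : Y.c₁.V), ten₁₁ k (z • x) y = z • ten₁₁ k
      x y) ∧
    (∀ {X Y : SF} (k : Fin 4) (z : ℂ) (x : X.c₁.V) (y : Y.c₁.V), ten₁₁ k x (z • y) = z • ten₁₁ k
      x y) ∧
    (∀ {X Y : SF} (z : ℂ) (x : X.c₀.V) (y : Y.c₁.V), ten₀₁ (z • x) y = z • ten₀₁ x y) ∧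
    (∀ {X Y : SF} (z : ℂ) (x : X.c₀.V) (y : Y.c₁.V), ten₀₁ x (z • y) = z • ten₀₁ x y) ∧
    (∀ {X Y : SF} (z : ℂ) (x : X.c₁.V) (y : Y.c₀.V), ten₁₀ (z • x) y = z • ten₁₀ x y) ∧
    (∀ {X Y : SF} (z : ℂ) (x : X.c₁.V) (y : Y.c₀.V), ten₁₀ x (z • y) = z • ten₁₀ x y) ∧
    (∀ {X Y : SF} (y : Y.c₀.V), ten₀₀ (0 : X.c₀.V) y = 0) ∧
    (∀ {X Y : SF} (x : X.c₀.V), ten₀₀ x (0 : Y.c₀.V) = 0) ∧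
    (∀ {X Y : SF} (k : Fin 4) (y : Y.c₁.V), ten₁₁ k (0 : X.c₁.V) y = 0) ∧
    (∀ {X Y : SF} (k : Fin 4) (x : X.c₁.V), ten₁₁ k x (0 : Y.c₁.V) = 0) ∧
    (∀ {X Y : SF} (y : Y.c₁.V), ten₀₁ (0 : X.c₀.V) y = 0) ∧
    (∀ {X Y : SF} (x : X.c₀.V), ten₀₁ x (0 : Y.c₁.V) = 0) ∧
    (∀ {X Y : SF} (y : Y.c₀.V), ten₁₀ (0 : X.c₁.V) y = 0) ∧
    (∀ {X Y : SF} (x : X.c₁.V), ten₁₀ x (0 : Y.c₀.V) = 0) :=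
  ⟨ten₀₀_add_left, ten₀₀_add_right, ten₁₁_add_left, ten₁₁_add_right, ten₀₁_add_left,
    ten₀₁_add_right, ten₁₀_add_left, ten₁₀_add_right, ten₀₀_sub_left, ten₀₀_sub_right,
    ten₁₁_sub_left, ten₁₁_sub_right, ten₀₁_sub_left, ten₀₁_sub_right, ten₁₀_sub_left,
    ten₁₀_sub_right, ten₀₀_neg_left, ten₀₀_neg_right, ten₁₁_neg_left, ten₁₁_neg_right,
    ten₀₁_neg_left, ten₀₁_neg_right, ten₁₀_neg_left, ten₁₀_neg_right, ten₀₀_smul_left,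
    ten₀₀_smul_right, ten₁₁_smul_left, ten₁₁_smul_right, ten₀₁_smul_left,
    ten₀₁_smul_right, ten₁₀_smul_left, ten₁₀_smul_right, ten₀₀_zero_left,
    ten₀₀_zero_right, ten₁₁_zero_left, ten₁₁_zero_right, ten₀₁_zero_left,
    ten₀₁_zero_right, ten₁₀_zero_left, ten₁₀_zero_right⟩

/-- The parities on generators. -/
theorem par_rules :
    (∀ {X Y : SF} (x : X.c₀.V) (y : Y.c₀.V), par₀ (tens X Y) (ten₀₀ x y) = ten₀₀ (par₀ X x)
      (par₀ Y y)) ∧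
    (∀ {X Y : SF} (x : X.c₁.V) (y : Y.c₁.V), par₀ (tens X Y) (ten₁₁ 0 x y) = ten₁₁ 0 (par₁ X x)
      (par₁ Y y)) ∧
    (∀ {X Y : SF} (x : X.c₁.V) (y : Y.c₁.V), par₀ (tens X Y) (ten₁₁ 1 x y) = -ten₁₁ 1 (par₁ X x)
      (par₁ Y y)) ∧
    (∀ {X Y : SF} (x : X.c₁.V) (y : Y.c₁.V), par₀ (tens X Y) (ten₁₁ 2 x y) = -ten₁₁ 2 (par₁ X x)
      (par₁ Y y)) ∧
    (∀ {X Y : SF} (x : X.c₁.V) (y : Y.c₁.V), par₀ (tens X Y) (ten₁₁ 3 x y) = ten₁₁ 3 (par₁ X x)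
      (par₁ Y y)) ∧
    (∀ {X Y : SF} (x : X.c₀.V) (y : Y.c₁.V), par₁ (tens X Y) (ten₀₁ x y) = ten₀₁ (par₀ X x)
      (par₁ Y y)) ∧
    (∀ {X Y : SF} (x : X.c₁.V) (y : Y.c₀.V), par₁ (tens X Y) (ten₁₀ x y) = ten₁₀ (par₁ X x)
      (par₀ Y y)) ∧
    (∀ {X : SF} (x : X.c₀.V), par₀ X (par₀ X x) = x) ∧
    (∀ {X : SF} (x : X.c₁.V), par₁ X (par₁ X x) = x) ∧
    (∀ {X : SF} (x : X.c₀.V), par₀ X (A₁ X x) = -A₁ X (par₀ X x)) ∧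
    (∀ {X : SF} (x : X.c₀.V), par₀ X (A₂ X x) = -A₂ X (par₀ X x)) :=
  ⟨par₀_ten₀₀, par₀_ten₁₁_zero, par₀_ten₁₁_one, par₀_ten₁₁_two, par₀_ten₁₁_three, par₁_ten₀₁,
    par₁_ten₁₀, par₀_par₀, par₁_par₁, par₀_A₁, par₀_A₂⟩

/-- The actions of `a₁` and `a₂` on generators. -/
theorem grassmann_rules :
    (∀ {X Y : SF} (x : X.c₀.V) (y : Y.c₀.V), A₁ (tens X Y) (ten₀₀ x y) = ten₀₀ (A₁ X x) y +
      ten₀₀ (par₀ X x) (A₁ Y y)) ∧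
    (∀ {X Y : SF} (x : X.c₁.V) (y : Y.c₁.V), A₁ (tens X Y) (ten₁₁ 0 x y) = ten₁₁ 1 x y) ∧
    (∀ {X Y : SF} (x : X.c₁.V) (y : Y.c₁.V), A₁ (tens X Y) (ten₁₁ 1 x y) = 0) ∧
    (∀ {X Y : SF} (x : X.c₁.V) (y : Y.c₁.V), A₁ (tens X Y) (ten₁₁ 2 x y) = ten₁₁ 3 x y) ∧
    (∀ {X Y : SF} (x : X.c₁.V) (y : Y.c₁.V), A₁ (tens X Y) (ten₁₁ 3 x y) = 0) ∧
    (∀ {X Y : SF} (x : X.c₀.V) (y : Y.c₀.V), A₂ (tens X Y) (ten₀₀ x y) = ten₀₀ (A₂ X x) y +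
      ten₀₀ (par₀ X x) (A₂ Y y)) ∧
    (∀ {X Y : SF} (x : X.c₁.V) (y : Y.c₁.V), A₂ (tens X Y) (ten₁₁ 0 x y) = ten₁₁ 2 x y) ∧
    (∀ {X Y : SF} (x : X.c₁.V) (y : Y.c₁.V), A₂ (tens X Y) (ten₁₁ 1 x y) = -ten₁₁ 3 x y) ∧
    (∀ {X Y : SF} (x : X.c₁.V) (y : Y.c₁.V), A₂ (tens X Y) (ten₁₁ 2 x y) = 0) ∧
    (∀ {X Y : SF} (x : X.c₁.V) (y : Y.c₁.V), A₂ (tens X Y) (ten₁₁ 3 x y) = 0) ∧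
    (∀ {X : SF} (x : X.c₀.V), A₁ X (A₁ X x) = 0) ∧
    (∀ {X : SF} (x : X.c₀.V), A₂ X (A₂ X x) = 0) ∧
    (∀ {X : SF} (x : X.c₀.V), A₂ X (A₁ X x) = -A₁ X (A₂ X x)) :=
  ⟨A₁_ten₀₀, A₁_ten₁₁_zero, A₁_ten₁₁_one, A₁_ten₁₁_two, A₁_ten₁₁_three, A₂_ten₀₀,
    A₂_ten₁₁_zero, A₂_ten₁₁_one, A₂_ten₁₁_two, A₂_ten₁₁_three, A₁_A₁, A₂_A₂, A₂_A₁⟩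

end SF

namespace SF

/-! ## The associator of `SF` on generators -/

section Sectors

open TensorProduct (map_tmul assoc_tmul assoc_symm_tmul)

theorem act_tmul (X : SRep G) (g : G) (x : X.V) : act X (g ⊗ₜ x) = X.ρ g x := rfl

theorem ρ_basisG (X : SRep G) (x : X.V) : X.ρ (basisG 0) x = x ∧ X.ρ (basisG 1) x = X.ρ a₁ x ∧
    X.ρ (basisG 2) x = X.ρ a₂ x ∧ X.ρ (basisG 3) x = X.ρ a₁ (X.ρ a₂ x) := by
  simp [basisG_zero, basisG_one, basisG_two, basisG_three]

/-- The map is `x ⊗ g ↦ ∑ ± g' ⊗ S(g'')x`. For odd `g` the flip leaves `ω x`, and the antipode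
reverses the sign of each term in which a single `a_j` reaches `x`. -/
theorem past_apply (X : SRep G) (x : X.V) :
    past X (x ⊗ₜ basisG 0) = basisG 0 ⊗ₜ x ∧
    past X (x ⊗ₜ basisG 1) = basisG 1 ⊗ₜ X.ω x - basisG 0 ⊗ₜ X.ρ a₁ (X.ω x) ∧
    past X (x ⊗ₜ basisG 2) = basisG 2 ⊗ₜ X.ω x - basisG 0 ⊗ₜ X.ρ a₂ (X.ω x) ∧
    past X (x ⊗ₜ basisG 3) = basisG 3 ⊗ₜ x - basisG 1 ⊗ₜ X.ρ a₂ x + basisG 2 ⊗ₜ X.ρ a₁ x +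
      basisG 0 ⊗ₜ X.ρ a₁ (X.ρ a₂ x) := by
  obtain ⟨p0, p1, p2, p3⟩ := parity_basisG
  obtain ⟨c0, c1, c2, c3⟩ := coG_basisG
  obtain ⟨s0, s1, s2, s3⟩ := antipodeG_basisG
  have f0 : SVect.flip X.toSVect svG (x ⊗ₜ basisG 0) = basisG 0 ⊗ₜ x :=
    superFlip_even_right _ _ p0
  have f1 : SVect.flip X.toSVect svG (x ⊗ₜ basisG 1) = basisG 1 ⊗ₜ X.ω x :=
    superFlip_odd_right _ _ p1
  have f2 : SVect.flip X.toSVect svG (x ⊗ₜ basisG 2) = basisG 2 ⊗ₜ X.ω x :=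
    superFlip_odd_right _ _ p2
  have f3 : SVect.flip X.toSVect svG (x ⊗ₜ basisG 3) = basisG 3 ⊗ₜ x :=
    superFlip_even_right _ _ p3
  have r0 := fun x => (ρ_basisG X x).1
  have r1 := fun x => (ρ_basisG X x).2.1
  have r2 := fun x => (ρ_basisG X x).2.2.1
  have r3 := fun x => (ρ_basisG X x).2.2.2
  refine ⟨?_, ?_, ?_, ?_⟩ <;>
    simp only [past, LinearMap.comp_apply, f0, f1, f2, f3, map_tmul, LinearMap.id_apply, c0, c1, c2, c3, map_add, map_sub,
      TensorProduct.add_tmul, TensorProduct.sub_tmul, LinearEquiv.coe_coe, assoc_tmul, s0, s1, s2, s3,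
      act_tmul, r0, r1, r2, r3, map_neg, LinearMap.neg_apply, TensorProduct.tmul_neg]
  all_goals abel

variable {X Y Z : SF}

/-- On a vector of a single sector the projections `p₁`, `p₂` annihilate three of the four summands.
The same reason gives the other seven sectors. -/
theorem assocEven_i₁_i₁ (x : X.c₀.V) (w : Y.c₀.V ⊗[ℂ] Z.c₀.V) :
    assocEven X Y Z (i₁ (x ⊗ₜ i₁ w)) =
      (i₁ (map i₁ LinearMap.id (assocTriv X.c₀.toSVect Y.c₀.toSVect Z.c₀.toSVect (x ⊗ₜ w))) :
        (tensorObj (tensorObj X Y) Z).c₀.V) := by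
  simp [assocEven]

theorem assocEven_i₁_i₂ (x : X.c₀.V) (w : G ⊗[ℂ] (Y.c₁.V ⊗[ℂ] Z.c₁.V)) :
    assocEven X Y Z (i₁ (x ⊗ₜ i₂ w)) =
      (i₂ (map LinearMap.id (map i₁ LinearMap.id) (assoc011 X.c₀ Y.c₁ Z.c₁ (x ⊗ₜ w))) :
        (tensorObj (tensorObj X Y) Z).c₀.V) := by
  simp [assocEven]

theorem assocEven_i₂_i₁ (g : G) (x : X.c₁.V) (w : Y.c₀.V ⊗[ℂ] Z.c₁.V) :
    assocEven X Y Z (i₂ (g ⊗ₜ (x ⊗ₜ i₁ w))) =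
      (i₂ (map LinearMap.id (map i₂ LinearMap.id) (assoc101 X.c₁ Y.c₀ Z.c₁ (g ⊗ₜ (x ⊗ₜ w)))) :
        (tensorObj (tensorObj X Y) Z).c₀.V) := by
  simp [assocEven]

theorem assocEven_i₂_i₂ (g : G) (x : X.c₁.V) (w : Y.c₁.V ⊗[ℂ] Z.c₀.V) :
    assocEven X Y Z (i₂ (g ⊗ₜ (x ⊗ₜ i₂ w))) =
      (i₁ (map i₂ LinearMap.id (assoc110 X.c₁ Y.c₁ Z.c₀ (g ⊗ₜ (x ⊗ₜ w)))) :
        (tensorObj (tensorObj X Y) Z).c₀.V) := by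
  simp [assocEven]

theorem assocOdd_i₁_i₁ (β : ℂ) (x : X.c₀.V) (w : Y.c₀.V ⊗[ℂ] Z.c₁.V) :
    assocOdd β X Y Z (i₁ (x ⊗ₜ i₁ w)) =
      (i₁ (map i₁ LinearMap.id (assocTriv X.c₀.toSVect Y.c₀.toSVect Z.c₁ (x ⊗ₜ w))) :
        (tensorObj (tensorObj X Y) Z).c₁.V) := by
  simp [assocOdd]

theorem assocOdd_i₁_i₂ (β : ℂ) (x : X.c₀.V) (w : Y.c₁.V ⊗[ℂ] Z.c₀.V) :
    assocOdd β X Y Z (i₁ (x ⊗ₜ i₂ w)) =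
      (i₂ (map i₁ LinearMap.id (assoc010 X.c₀ Y.c₁ Z.c₀ (x ⊗ₜ w))) :
        (tensorObj (tensorObj X Y) Z).c₁.V) := by
  simp [assocOdd]

theorem assocOdd_i₂_i₁ (β : ℂ) (x : X.c₁.V) (w : Y.c₀.V ⊗[ℂ] Z.c₀.V) :
    assocOdd β X Y Z (i₂ (x ⊗ₜ i₁ w)) =
      (i₂ (map i₂ LinearMap.id (assocTriv X.c₁ Y.c₀.toSVect Z.c₀.toSVect (x ⊗ₜ w))) :
        (tensorObj (tensorObj X Y) Z).c₁.V) := by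
  simp [assocOdd]

theorem assocOdd_i₂_i₂ (β : ℂ) (x : X.c₁.V) (w : G ⊗[ℂ] (Y.c₁.V ⊗[ℂ] Z.c₁.V)) :
    assocOdd β X Y Z (i₂ (x ⊗ₜ i₂ w)) =
      (i₁ (map i₂ LinearMap.id (assoc111 β X.c₁ Y.c₁ Z.c₁ (x ⊗ₜ w))) :
        (tensorObj (tensorObj X Y) Z).c₁.V) := by
  simp [assocOdd]

/-- The two twisted vectors are only carried along; the content of the sector is in `past`. -/
theorem assoc011_apply (x : X.c₀.V) (k : Fin 4) (y : Y.c₁.V) (z : Z.c₁.V) :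
    assoc011 X.c₀ Y.c₁ Z.c₁ (x ⊗ₜ (basisG k ⊗ₜ (y ⊗ₜ z))) =
      map LinearMap.id (assoc ℂ X.c₀.V Y.c₁.V Z.c₁.V).symm.toLinearMap
        (assoc ℂ G X.c₀.V (Y.c₁.V ⊗[ℂ] Z.c₁.V) (past X.c₀ (x ⊗ₜ basisG k) ⊗ₜ (y ⊗ₜ z))) := by
  simp [assoc011]

/-- The untwisted component of the associator. -/
def assoc₀ (X Y Z : SF) : (tens X (tens Y Z)).c₀.V →ₗ[ℂ] (tens (tens X Y) Z).c₀.V :=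
  assocEven X Y Z

/-- The twisted component of the associator. -/
def assoc₁ (β : ℂ) (X Y Z : SF) : (tens X (tens Y Z)).c₁.V →ₗ[ℂ] (tens (tens X Y) Z).c₁.V :=
  assocOdd β X Y Z

theorem assoc₀_000 (x : X.c₀.V) (y : Y.c₀.V) (z : Z.c₀.V) :
    assoc₀ X Y Z (ten₀₀ x (ten₀₀ y z)) = ten₀₀ (ten₀₀ x y) z :=
  assocEven_i₁_i₁ x (y ⊗ₜ z)

theorem assoc₀_011_zero (x : X.c₀.V) (y : Y.c₁.V) (z : Z.c₁.V) :
    assoc₀ X Y Z (ten₀₀ x (ten₁₁ 0 y z)) = ten₁₁ 0 (ten₀₁ x y) z := by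
  refine (assocEven_i₁_i₂ x (basisG 0 ⊗ₜ (y ⊗ₜ z))).trans ?_
  rw [assoc011_apply, (past_apply X.c₀ x).1]
  rfl

theorem assoc₀_011_one (x : X.c₀.V) (y : Y.c₁.V) (z : Z.c₁.V) :
    assoc₀ X Y Z (ten₀₀ x (ten₁₁ 1 y z)) =
      ten₁₁ 1 (ten₀₁ (par₀ X x) y) z - ten₁₁ 0 (ten₀₁ (A₁ X (par₀ X x)) y) z := by
  refine (assocEven_i₁_i₂ x (basisG 1 ⊗ₜ (y ⊗ₜ z))).trans ?_
  rw [assoc011_apply, (past_apply X.c₀ x).2.1]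
  simp only [TensorProduct.sub_tmul, map_sub]
  rfl

theorem assoc₀_011_two (x : X.c₀.V) (y : Y.c₁.V) (z : Z.c₁.V) :
    assoc₀ X Y Z (ten₀₀ x (ten₁₁ 2 y z)) =
      ten₁₁ 2 (ten₀₁ (par₀ X x) y) z - ten₁₁ 0 (ten₀₁ (A₂ X (par₀ X x)) y) z := by
  refine (assocEven_i₁_i₂ x (basisG 2 ⊗ₜ (y ⊗ₜ z))).trans ?_
  rw [assoc011_apply, (past_apply X.c₀ x).2.2.1]
  simp only [TensorProduct.sub_tmul, map_sub]
  rfl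

theorem assoc₀_011_three (x : X.c₀.V) (y : Y.c₁.V) (z : Z.c₁.V) :
    assoc₀ X Y Z (ten₀₀ x (ten₁₁ 3 y z)) =
      ten₁₁ 3 (ten₀₁ x y) z - ten₁₁ 1 (ten₀₁ (A₂ X x) y) z + ten₁₁ 2 (ten₀₁ (A₁ X x) y) z +
        ten₁₁ 0 (ten₀₁ (A₁ X (A₂ X x)) y) z := by
  refine (assocEven_i₁_i₂ x (basisG 3 ⊗ₜ (y ⊗ₜ z))).trans ?_
  rw [assoc011_apply, (past_apply X.c₀ x).2.2.2]
  simp only [TensorProduct.sub_tmul, map_sub, TensorProduct.add_tmul, map_add]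
  rfl

/-- The square of `a₂ ⊗ a₁ - a₁ ⊗ a₂` is a multiple of `a₁a₂ ⊗ a₁a₂`, and with the factor `1/2` of
the exponential its coefficient is `-1`. On `a₁` and `a₂` only one linear term survives, on `a₁a₂`
none. -/
theorem assoc101_apply (x : X.c₁.V) (y : Y.c₀.V) (z : Z.c₁.V) :
    assoc101 X.c₁ Y.c₀ Z.c₁ (basisG 0 ⊗ₜ (x ⊗ₜ (y ⊗ₜ z))) =
      basisG 0 ⊗ₜ ((x ⊗ₜ y) ⊗ₜ z) + basisG 2 ⊗ₜ ((X.c₁.ω x ⊗ₜ Y.c₀.ρ a₁ y) ⊗ₜ z) -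
        basisG 1 ⊗ₜ ((X.c₁.ω x ⊗ₜ Y.c₀.ρ a₂ y) ⊗ₜ z) -
        basisG 3 ⊗ₜ ((x ⊗ₜ Y.c₀.ρ a₁ (Y.c₀.ρ a₂ y)) ⊗ₜ z) ∧
    assoc101 X.c₁ Y.c₀ Z.c₁ (basisG 1 ⊗ₜ (x ⊗ₜ (y ⊗ₜ z))) =
      basisG 1 ⊗ₜ ((x ⊗ₜ y) ⊗ₜ z) + basisG 3 ⊗ₜ ((X.c₁.ω x ⊗ₜ Y.c₀.ρ a₁ y) ⊗ₜ z) ∧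
    assoc101 X.c₁ Y.c₀ Z.c₁ (basisG 2 ⊗ₜ (x ⊗ₜ (y ⊗ₜ z))) =
      basisG 2 ⊗ₜ ((x ⊗ₜ y) ⊗ₜ z) + basisG 3 ⊗ₜ ((X.c₁.ω x ⊗ₜ Y.c₀.ρ a₂ y) ⊗ₜ z) ∧
    assoc101 X.c₁ Y.c₀ Z.c₁ (basisG 3 ⊗ₜ (x ⊗ₜ (y ⊗ₜ z))) = basisG 3 ⊗ₜ ((x ⊗ₜ y) ⊗ₜ z) := by
  obtain ⟨p0, p1, p2, p3⟩ := parity_basisG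
  obtain ⟨b0, b1, b2, b3⟩ := a₁_mul_basisG
  obtain ⟨d0, d1, d2, d3⟩ := a₂_mul_basisG
  have h : ∀ y, Y.c₀.ρ a₂ (Y.c₀.ρ a₁ y) = -Y.c₀.ρ a₁ (Y.c₀.ρ a₂ y) := fun y => by
    rw [SRep.a₁_a₂, neg_neg]
  refine ⟨?_, ?_, ?_, ?_⟩ <;>
    simp only [assoc101, expC, LinearMap.comp_apply, LinearMap.add_apply, LinearMap.sub_apply, LinearMap.smul_apply, LinearMap.id_apply, map_tmul,
      LinearEquiv.coe_coe, assoc_symm_tmul, LinearMap.mulLeft_apply, AlgHom.toLinearMap_apply,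
      p0, p1, p2, p3, b0, b1, b2, b3, d0, d1, d2, d3, map_sub, map_neg, mul_neg, neg_neg, SVect.ω_ω,
      SRep.a₁_a₁, SRep.a₂_a₂, h, TensorProduct.neg_tmul, TensorProduct.tmul_neg,
      TensorProduct.zero_tmul, TensorProduct.tmul_zero, map_zero, neg_zero] <;>
    module

theorem assoc₀_101_zero (x : X.c₁.V) (y : Y.c₀.V) (z : Z.c₁.V) :
    assoc₀ X Y Z (ten₁₁ 0 x (ten₀₁ y z)) =
      ten₁₁ 0 (ten₁₀ x y) z + ten₁₁ 2 (ten₁₀ (par₁ X x) (A₁ Y y)) z -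
        ten₁₁ 1 (ten₁₀ (par₁ X x) (A₂ Y y)) z - ten₁₁ 3 (ten₁₀ x (A₁ Y (A₂ Y y))) z := by
  refine (assocEven_i₂_i₁ (basisG 0) x (y ⊗ₜ z)).trans ?_
  rw [(assoc101_apply x y z).1]
  simp only [map_sub, map_add]
  rfl

theorem assoc₀_101_one (x : X.c₁.V) (y : Y.c₀.V) (z : Z.c₁.V) :
    assoc₀ X Y Z (ten₁₁ 1 x (ten₀₁ y z)) =
      ten₁₁ 1 (ten₁₀ x y) z + ten₁₁ 3 (ten₁₀ (par₁ X x) (A₁ Y y)) z := by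
  refine (assocEven_i₂_i₁ (basisG 1) x (y ⊗ₜ z)).trans ?_
  rw [(assoc101_apply x y z).2.1]
  simp only [map_add]
  rfl

theorem assoc₀_101_two (x : X.c₁.V) (y : Y.c₀.V) (z : Z.c₁.V) :
    assoc₀ X Y Z (ten₁₁ 2 x (ten₀₁ y z)) =
      ten₁₁ 2 (ten₁₀ x y) z + ten₁₁ 3 (ten₁₀ (par₁ X x) (A₂ Y y)) z := by
  refine (assocEven_i₂_i₁ (basisG 2) x (y ⊗ₜ z)).trans ?_
  rw [(assoc101_apply x y z).2.2.1]
  simp only [map_add]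
  rfl

theorem assoc₀_101_three (x : X.c₁.V) (y : Y.c₀.V) (z : Z.c₁.V) :
    assoc₀ X Y Z (ten₁₁ 3 x (ten₀₁ y z)) = ten₁₁ 3 (ten₁₀ x y) z := by
  refine (assocEven_i₂_i₁ (basisG 3) x (y ⊗ₜ z)).trans ?_
  rw [(assoc101_apply x y z).2.2.2]
  rfl

/-- The second leg of the coproduct travels past `x ⊗ y` to `z`; when it is odd it leaves the parity
on both `x` and `y`. -/
theorem assoc110_apply (x : X.c₁.V) (y : Y.c₁.V) (z : Z.c₀.V) :
    assoc110 X.c₁ Y.c₁ Z.c₀ (basisG 0 ⊗ₜ (x ⊗ₜ (y ⊗ₜ z))) = (basisG 0 ⊗ₜ (x ⊗ₜ y)) ⊗ₜ z ∧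
    assoc110 X.c₁ Y.c₁ Z.c₀ (basisG 1 ⊗ₜ (x ⊗ₜ (y ⊗ₜ z))) =
      (basisG 1 ⊗ₜ (x ⊗ₜ y)) ⊗ₜ z + (basisG 0 ⊗ₜ (X.c₁.ω x ⊗ₜ Y.c₁.ω y)) ⊗ₜ Z.c₀.ρ a₁ z ∧
    assoc110 X.c₁ Y.c₁ Z.c₀ (basisG 2 ⊗ₜ (x ⊗ₜ (y ⊗ₜ z))) =
      (basisG 2 ⊗ₜ (x ⊗ₜ y)) ⊗ₜ z + (basisG 0 ⊗ₜ (X.c₁.ω x ⊗ₜ Y.c₁.ω y)) ⊗ₜ Z.c₀.ρ a₂ z ∧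
    assoc110 X.c₁ Y.c₁ Z.c₀ (basisG 3 ⊗ₜ (x ⊗ₜ (y ⊗ₜ z))) =
      (basisG 3 ⊗ₜ (x ⊗ₜ y)) ⊗ₜ z + (basisG 1 ⊗ₜ (X.c₁.ω x ⊗ₜ Y.c₁.ω y)) ⊗ₜ Z.c₀.ρ a₂ z -
        (basisG 2 ⊗ₜ (X.c₁.ω x ⊗ₜ Y.c₁.ω y)) ⊗ₜ Z.c₀.ρ a₁ z +
        (basisG 0 ⊗ₜ (x ⊗ₜ y)) ⊗ₜ Z.c₀.ρ a₁ (Z.c₀.ρ a₂ z) := by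
  obtain ⟨p0, p1, p2, p3⟩ := parity_basisG
  obtain ⟨c0, c1, c2, c3⟩ := coG_basisG
  have f0 : ∀ w, SVect.flip svG (X.c₁.tensor Y.c₁) (basisG 0 ⊗ₜ w) = w ⊗ₜ basisG 0 :=
    fun w => superFlip_even_left _ _ p0
  have f1 : ∀ w, SVect.flip svG (X.c₁.tensor Y.c₁) (basisG 1 ⊗ₜ w) =
      (map X.c₁.ω Y.c₁.ω) w ⊗ₜ basisG 1 :=
    fun w => superFlip_odd_left _ _ p1
  have f2 : ∀ w, SVect.flip svG (X.c₁.tensor Y.c₁) (basisG 2 ⊗ₜ w) =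
      (map X.c₁.ω Y.c₁.ω) w ⊗ₜ basisG 2 :=
    fun w => superFlip_odd_left _ _ p2
  have f3 : ∀ w, SVect.flip svG (X.c₁.tensor Y.c₁) (basisG 3 ⊗ₜ w) = w ⊗ₜ basisG 3 :=
    fun w => superFlip_even_left _ _ p3
  have r0 := fun x => (ρ_basisG Z.c₀ x).1
  have r1 := fun x => (ρ_basisG Z.c₀ x).2.1
  have r2 := fun x => (ρ_basisG Z.c₀ x).2.2.1
  have r3 := fun x => (ρ_basisG Z.c₀ x).2.2.2
  refine ⟨?_, ?_, ?_, ?_⟩ <;>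
    simp only [assoc110, LinearMap.comp_apply, map_tmul, c0, c1, c2, c3, LinearEquiv.coe_coe, assoc_symm_tmul,
      TensorProduct.add_tmul, TensorProduct.sub_tmul, map_add, map_sub, assoc_tmul, LinearMap.id_apply, f0, f1,
      f2, f3, act_tmul, r0, r1, r2, r3]

theorem assoc₀_110_zero (x : X.c₁.V) (y : Y.c₁.V) (z : Z.c₀.V) :
    assoc₀ X Y Z (ten₁₁ 0 x (ten₁₀ y z)) = ten₀₀ (ten₁₁ 0 x y) z := by
  refine (assocEven_i₂_i₂ (basisG 0) x (y ⊗ₜ z)).trans ?_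
  rw [(assoc110_apply x y z).1]
  rfl

theorem assoc₀_110_one (x : X.c₁.V) (y : Y.c₁.V) (z : Z.c₀.V) :
    assoc₀ X Y Z (ten₁₁ 1 x (ten₁₀ y z)) =
      ten₀₀ (ten₁₁ 1 x y) z + ten₀₀ (ten₁₁ 0 (par₁ X x) (par₁ Y y)) (A₁ Z z) := by
  refine (assocEven_i₂_i₂ (basisG 1) x (y ⊗ₜ z)).trans ?_
  rw [(assoc110_apply x y z).2.1]
  simp only [map_add]
  rfl

theorem assoc₀_110_two (x : X.c₁.V) (y : Y.c₁.V) (z : Z.c₀.V) :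
    assoc₀ X Y Z (ten₁₁ 2 x (ten₁₀ y z)) =
      ten₀₀ (ten₁₁ 2 x y) z + ten₀₀ (ten₁₁ 0 (par₁ X x) (par₁ Y y)) (A₂ Z z) := by
  refine (assocEven_i₂_i₂ (basisG 2) x (y ⊗ₜ z)).trans ?_
  rw [(assoc110_apply x y z).2.2.1]
  simp only [map_add]
  rfl

theorem assoc₀_110_three (x : X.c₁.V) (y : Y.c₁.V) (z : Z.c₀.V) :
    assoc₀ X Y Z (ten₁₁ 3 x (ten₁₀ y z)) =
      ten₀₀ (ten₁₁ 3 x y) z + ten₀₀ (ten₁₁ 1 (par₁ X x) (par₁ Y y)) (A₂ Z z) -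
        ten₀₀ (ten₁₁ 2 (par₁ X x) (par₁ Y y)) (A₁ Z z) +
        ten₀₀ (ten₁₁ 0 x y) (A₁ Z (A₂ Z z)) := by
  refine (assocEven_i₂_i₂ (basisG 3) x (y ⊗ₜ z)).trans ?_
  rw [(assoc110_apply x y z).2.2.2]
  simp only [map_sub, map_add]
  rfl

variable (β : ℂ)

theorem assoc₁_001 (x : X.c₀.V) (y : Y.c₀.V) (z : Z.c₁.V) :
    assoc₁ β X Y Z (ten₀₁ x (ten₀₁ y z)) = ten₀₁ (ten₀₀ x y) z :=
  assocOdd_i₁_i₁ β x (y ⊗ₜ z)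

theorem assoc₁_100 (x : X.c₁.V) (y : Y.c₀.V) (z : Z.c₀.V) :
    assoc₁ β X Y Z (ten₁₀ x (ten₀₀ y z)) = ten₁₀ (ten₁₀ x y) z :=
  assocOdd_i₂_i₁ β x (y ⊗ₜ z)

/-- The exponential again stops at second order, with coefficient `-1`; there the parities picked up
by the middle vector cancel. -/
theorem assoc010_apply (x : X.c₀.V) (y : Y.c₁.V) (z : Z.c₀.V) :
    assoc010 X.c₀ Y.c₁ Z.c₀ (x ⊗ₜ (y ⊗ₜ z)) =
      (x ⊗ₜ y) ⊗ₜ z + (X.c₀.ρ a₂ (X.c₀.ω x) ⊗ₜ Y.c₁.ω y) ⊗ₜ Z.c₀.ρ a₁ z -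
        (X.c₀.ρ a₁ (X.c₀.ω x) ⊗ₜ Y.c₁.ω y) ⊗ₜ Z.c₀.ρ a₂ z -
        (X.c₀.ρ a₁ (X.c₀.ρ a₂ x) ⊗ₜ y) ⊗ₜ Z.c₀.ρ a₁ (Z.c₀.ρ a₂ z) := by
  have h : ∀ (X : SRep G) (y : X.V), X.ρ a₂ (X.ρ a₁ y) = -X.ρ a₁ (X.ρ a₂ y) := fun X y => by
    rw [SRep.a₁_a₂, neg_neg]
  simp only [assoc010, assocTriv, C13, expC, LinearMap.comp_apply, LinearMap.add_apply, LinearMap.sub_apply, LinearMap.smul_apply, LinearMap.id_apply,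
    map_tmul, LinearEquiv.coe_coe, assoc_symm_tmul, SRep.ω_a₁, SRep.ω_a₂, SVect.ω_ω, h, SRep.a₁_a₁,
    SRep.a₂_a₂, TensorProduct.neg_tmul, TensorProduct.tmul_neg, TensorProduct.zero_tmul,
    TensorProduct.tmul_zero, map_zero, neg_zero, map_add, map_sub, map_smul, map_neg]
  module

theorem assoc₁_010 (x : X.c₀.V) (y : Y.c₁.V) (z : Z.c₀.V) :
    assoc₁ β X Y Z (ten₀₁ x (ten₁₀ y z)) =
      ten₁₀ (ten₀₁ x y) z + ten₁₀ (ten₀₁ (A₂ X (par₀ X x)) (par₁ Y y)) (A₁ Z z) -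
        ten₁₀ (ten₀₁ (A₁ X (par₀ X x)) (par₁ Y y)) (A₂ Z z) -
        ten₁₀ (ten₀₁ (A₁ X (A₂ X x)) y) (A₁ Z (A₂ Z z)) := by
  refine (assocOdd_i₁_i₂ β x (y ⊗ₜ z)).trans ?_
  rw [assoc010_apply]
  simp only [map_sub, map_add]
  rfl

/-- Up to scalars `φ` exchanges `1` and `a₁a₂` and fixes `a₁`, `a₂`; the odd basis vectors pass `x`
at the cost of its parity. -/
theorem assoc111_apply (x : X.c₁.V) (y : Y.c₁.V) (z : Z.c₁.V) :
    assoc111 β X.c₁ Y.c₁ Z.c₁ (x ⊗ₜ (basisG 0 ⊗ₜ (y ⊗ₜ z))) =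
      β ^ 2 • ((basisG 3 ⊗ₜ (x ⊗ₜ y)) ⊗ₜ z) ∧
    assoc111 β X.c₁ Y.c₁ Z.c₁ (x ⊗ₜ (basisG 1 ⊗ₜ (y ⊗ₜ z))) =
      β ^ 2 • ((basisG 1 ⊗ₜ (X.c₁.ω x ⊗ₜ y)) ⊗ₜ z) ∧
    assoc111 β X.c₁ Y.c₁ Z.c₁ (x ⊗ₜ (basisG 2 ⊗ₜ (y ⊗ₜ z))) =
      β ^ 2 • ((basisG 2 ⊗ₜ (X.c₁.ω x ⊗ₜ y)) ⊗ₜ z) ∧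
    assoc111 β X.c₁ Y.c₁ Z.c₁ (x ⊗ₜ (basisG 3 ⊗ₜ (y ⊗ₜ z))) =
      -(β ^ 2 • ((basisG 0 ⊗ₜ (x ⊗ₜ y)) ⊗ₜ z)) := by
  obtain ⟨p0, p1, p2, p3⟩ := parity_basisG
  obtain ⟨c0, c1, c2, c3⟩ := phiG_basisG β
  have f0 : SVect.flip X.c₁ svG (x ⊗ₜ basisG 0) = basisG 0 ⊗ₜ x := superFlip_even_right _ _ p0
  have f1 : SVect.flip X.c₁ svG (x ⊗ₜ basisG 1) = basisG 1 ⊗ₜ X.c₁.ω x :=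
    superFlip_odd_right _ _ p1
  have f2 : SVect.flip X.c₁ svG (x ⊗ₜ basisG 2) = basisG 2 ⊗ₜ X.c₁.ω x :=
    superFlip_odd_right _ _ p2
  have f3 : SVect.flip X.c₁ svG (x ⊗ₜ basisG 3) = basisG 3 ⊗ₜ x := superFlip_even_right _ _ p3
  refine ⟨?_, ?_, ?_, ?_⟩ <;>
    simp only [assoc111, LinearMap.comp_apply, LinearEquiv.coe_coe, assoc_symm_tmul, map_tmul, f0, f1, f2, f3,
      LinearMap.id_apply, assoc_tmul, c0, c1, c2, c3, TensorProduct.neg_tmul, map_neg] <;>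
    simp only [← TensorProduct.smul_tmul', map_smul, assoc_symm_tmul]

theorem assoc₁_111_zero (x : X.c₁.V) (y : Y.c₁.V) (z : Z.c₁.V) :
    assoc₁ β X Y Z (ten₁₀ x (ten₁₁ 0 y z)) = β ^ 2 • ten₀₁ (ten₁₁ 3 x y) z := by
  refine (assocOdd_i₂_i₂ β x (basisG 0 ⊗ₜ (y ⊗ₜ z))).trans ?_
  rw [(assoc111_apply β x y z).1]
  simp only [map_smul]
  rfl

theorem assoc₁_111_one (x : X.c₁.V) (y : Y.c₁.V) (z : Z.c₁.V) :
    assoc₁ β X Y Z (ten₁₀ x (ten₁₁ 1 y z)) = β ^ 2 • ten₀₁ (ten₁₁ 1 (par₁ X x) y) z := by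
  refine (assocOdd_i₂_i₂ β x (basisG 1 ⊗ₜ (y ⊗ₜ z))).trans ?_
  rw [(assoc111_apply β x y z).2.1]
  simp only [map_smul]
  rfl

theorem assoc₁_111_two (x : X.c₁.V) (y : Y.c₁.V) (z : Z.c₁.V) :
    assoc₁ β X Y Z (ten₁₀ x (ten₁₁ 2 y z)) = β ^ 2 • ten₀₁ (ten₁₁ 2 (par₁ X x) y) z := by
  refine (assocOdd_i₂_i₂ β x (basisG 2 ⊗ₜ (y ⊗ₜ z))).trans ?_
  rw [(assoc111_apply β x y z).2.2.1]
  simp only [map_smul]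
  rfl

theorem assoc₁_111_three (x : X.c₁.V) (y : Y.c₁.V) (z : Z.c₁.V) :
    assoc₁ β X Y Z (ten₁₀ x (ten₁₁ 3 y z)) = -(β ^ 2 • ten₀₁ (ten₁₁ 0 x y) z) := by
  refine (assocOdd_i₂_i₂ β x (basisG 3 ⊗ₜ (y ⊗ₜ z))).trans ?_
  rw [(assoc111_apply β x y z).2.2.2]
  simp only [map_smul, map_neg]
  rfl

end Sectors

/-- The associator on generators. -/
theorem assoc_rules :
    (∀ {X Y Z : SF} (x : X.c₀.V) (y : Y.c₀.V) (z : Z.c₀.V), assoc₀ X Y Z (ten₀₀ x (ten₀₀ y z)) =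
      ten₀₀ (ten₀₀ x y) z) ∧
    (∀ {X Y Z : SF} (x : X.c₀.V) (y : Y.c₁.V) (z : Z.c₁.V), assoc₀ X Y Z (ten₀₀ x (ten₁₁ 0 y z))
      = ten₁₁ 0 (ten₀₁ x y) z) ∧
    (∀ {X Y Z : SF} (x : X.c₀.V) (y : Y.c₁.V) (z : Z.c₁.V), assoc₀ X Y Z (ten₀₀ x (ten₁₁ 1 y z))
      = ten₁₁ 1 (ten₀₁ (par₀ X x) y) z - ten₁₁ 0 (ten₀₁ (A₁ X (par₀ X x)) y) z) ∧
    (∀ {X Y Z : SF} (x : X.c₀.V) (y : Y.c₁.V) (z : Z.c₁.V), assoc₀ X Y Z (ten₀₀ x (ten₁₁ 2 y z))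
      = ten₁₁ 2 (ten₀₁ (par₀ X x) y) z - ten₁₁ 0 (ten₀₁ (A₂ X (par₀ X x)) y) z) ∧
    (∀ {X Y Z : SF} (x : X.c₀.V) (y : Y.c₁.V) (z : Z.c₁.V), assoc₀ X Y Z (ten₀₀ x (ten₁₁ 3 y z))
      = ten₁₁ 3 (ten₀₁ x y) z - ten₁₁ 1 (ten₀₁ (A₂ X x) y) z + ten₁₁ 2 (ten₀₁ (A₁ X x) y) z
      + ten₁₁ 0 (ten₀₁ (A₁ X (A₂ X x)) y) z) ∧
    (∀ {X Y Z : SF} (x : X.c₁.V) (y : Y.c₀.V) (z : Z.c₁.V), assoc₀ X Y Z (ten₁₁ 0 x (ten₀₁ y z))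
      = ten₁₁ 0 (ten₁₀ x y) z + ten₁₁ 2 (ten₁₀ (par₁ X x) (A₁ Y y)) z - ten₁₁ 1 (ten₁₀ (par₁
      X x) (A₂ Y y)) z - ten₁₁ 3 (ten₁₀ x (A₁ Y (A₂ Y y))) z) ∧
    (∀ {X Y Z : SF} (x : X.c₁.V) (y : Y.c₀.V) (z : Z.c₁.V), assoc₀ X Y Z (ten₁₁ 1 x (ten₀₁ y z))
      = ten₁₁ 1 (ten₁₀ x y) z + ten₁₁ 3 (ten₁₀ (par₁ X x) (A₁ Y y)) z) ∧
    (∀ {X Y Z : SF} (x : X.c₁.V) (y : Y.c₀.V) (z : Z.c₁.V), assoc₀ X Y Z (ten₁₁ 2 x (ten₀₁ y z))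
      = ten₁₁ 2 (ten₁₀ x y) z + ten₁₁ 3 (ten₁₀ (par₁ X x) (A₂ Y y)) z) ∧
    (∀ {X Y Z : SF} (x : X.c₁.V) (y : Y.c₀.V) (z : Z.c₁.V), assoc₀ X Y Z (ten₁₁ 3 x (ten₀₁ y z))
      = ten₁₁ 3 (ten₁₀ x y) z) ∧
    (∀ {X Y Z : SF} (x : X.c₁.V) (y : Y.c₁.V) (z : Z.c₀.V), assoc₀ X Y Z (ten₁₁ 0 x (ten₁₀ y z))
      = ten₀₀ (ten₁₁ 0 x y) z) ∧
    (∀ {X Y Z : SF} (x : X.c₁.V) (y : Y.c₁.V) (z : Z.c₀.V), assoc₀ X Y Z (ten₁₁ 1 x (ten₁₀ y z))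
      = ten₀₀ (ten₁₁ 1 x y) z + ten₀₀ (ten₁₁ 0 (par₁ X x) (par₁ Y y)) (A₁ Z z)) ∧
    (∀ {X Y Z : SF} (x : X.c₁.V) (y : Y.c₁.V) (z : Z.c₀.V), assoc₀ X Y Z (ten₁₁ 2 x (ten₁₀ y z))
      = ten₀₀ (ten₁₁ 2 x y) z + ten₀₀ (ten₁₁ 0 (par₁ X x) (par₁ Y y)) (A₂ Z z)) ∧
    (∀ {X Y Z : SF} (x : X.c₁.V) (y : Y.c₁.V) (z : Z.c₀.V), assoc₀ X Y Z (ten₁₁ 3 x (ten₁₀ y z))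
      = ten₀₀ (ten₁₁ 3 x y) z + ten₀₀ (ten₁₁ 1 (par₁ X x) (par₁ Y y)) (A₂ Z z) - ten₀₀
      (ten₁₁ 2 (par₁ X x) (par₁ Y y)) (A₁ Z z) + ten₀₀ (ten₁₁ 0 x y) (A₁ Z (A₂ Z z))) ∧
    (∀ {β : ℂ} {X Y Z : SF} (x : X.c₀.V) (y : Y.c₀.V) (z : Z.c₁.V), assoc₁ β X Y Z (ten₀₁ x
      (ten₀₁ y z)) = ten₀₁ (ten₀₀ x y) z) ∧
    (∀ {β : ℂ} {X Y Z : SF} (x : X.c₀.V) (y : Y.c₁.V) (z : Z.c₀.V), assoc₁ β X Y Z (ten₀₁ x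
      (ten₁₀ y z)) = ten₁₀ (ten₀₁ x y) z + ten₁₀ (ten₀₁ (A₂ X (par₀ X x)) (par₁ Y y)) (A₁ Z
      z) - ten₁₀ (ten₀₁ (A₁ X (par₀ X x)) (par₁ Y y)) (A₂ Z z) - ten₁₀ (ten₀₁ (A₁ X (A₂ X
      x)) y) (A₁ Z (A₂ Z z))) ∧
    (∀ {β : ℂ} {X Y Z : SF} (x : X.c₁.V) (y : Y.c₀.V) (z : Z.c₀.V), assoc₁ β X Y Z (ten₁₀ x
      (ten₀₀ y z)) = ten₁₀ (ten₁₀ x y) z) ∧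
    (∀ {β : ℂ} {X Y Z : SF} (x : X.c₁.V) (y : Y.c₁.V) (z : Z.c₁.V), assoc₁ β X Y Z (ten₁₀ x
      (ten₁₁ 0 y z)) = β ^ 2 • ten₀₁ (ten₁₁ 3 x y) z) ∧
    (∀ {β : ℂ} {X Y Z : SF} (x : X.c₁.V) (y : Y.c₁.V) (z : Z.c₁.V), assoc₁ β X Y Z (ten₁₀ x
      (ten₁₁ 1 y z)) = β ^ 2 • ten₀₁ (ten₁₁ 1 (par₁ X x) y) z) ∧
    (∀ {β : ℂ} {X Y Z : SF} (x : X.c₁.V) (y : Y.c₁.V) (z : Z.c₁.V), assoc₁ β X Y Z (ten₁₀ x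
      (ten₁₁ 2 y z)) = β ^ 2 • ten₀₁ (ten₁₁ 2 (par₁ X x) y) z) ∧
    (∀ {β : ℂ} {X Y Z : SF} (x : X.c₁.V) (y : Y.c₁.V) (z : Z.c₁.V), assoc₁ β X Y Z (ten₁₀ x
      (ten₁₁ 3 y z)) = -(β ^ 2 • ten₀₁ (ten₁₁ 0 x y) z)) :=
  ⟨assoc₀_000, assoc₀_011_zero, assoc₀_011_one, assoc₀_011_two, assoc₀_011_three,
    assoc₀_101_zero, assoc₀_101_one, assoc₀_101_two, assoc₀_101_three, assoc₀_110_zero,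
    assoc₀_110_one, assoc₀_110_two, assoc₀_110_three, assoc₁_001 _, assoc₁_010 _,
    assoc₁_100 _, assoc₁_111_zero _, assoc₁_111_one _, assoc₁_111_two _, assoc₁_111_three _⟩

end SF

namespace SF

/-! ## Extensionality, and morphisms between tensor products -/

section Ext

variable {X Y : SF}

/-- `ten₀₀ x` as a linear map. -/
def tenL₀₀ (x : X.c₀.V) : Y.c₀.V →ₗ[ℂ] (tens X Y).c₀.V where
  toFun := ten₀₀ x
  map_add' := ten₀₀_add_right x
  map_smul' z := ten₀₀_smul_right z x

/-- `ten₁₁ k x` as a linear map. -/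
def tenL₁₁ (k : Fin 4) (x : X.c₁.V) : Y.c₁.V →ₗ[ℂ] (tens X Y).c₀.V where
  toFun := ten₁₁ k x
  map_add' := ten₁₁_add_right k x
  map_smul' z := ten₁₁_smul_right k z x

/-- `ten₀₁ x` as a linear map. -/
def tenL₀₁ (x : X.c₀.V) : Y.c₁.V →ₗ[ℂ] (tens X Y).c₁.V where
  toFun := ten₀₁ x
  map_add' := ten₀₁_add_right x
  map_smul' z := ten₀₁_smul_right z x

/-- `ten₁₀ x` as a linear map. -/
def tenL₁₀ (x : X.c₁.V) : Y.c₀.V →ₗ[ℂ] (tens X Y).c₁.V where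
  toFun := ten₁₀ x
  map_add' := ten₁₀_add_right x
  map_smul' z := ten₁₀_smul_right z x

/-- `ten₀₀ · y` as a linear map. -/
def tenR₀₀ (y : Y.c₀.V) : X.c₀.V →ₗ[ℂ] (tens X Y).c₀.V where
  toFun x := ten₀₀ x y
  map_add' x x' := ten₀₀_add_left x x' y
  map_smul' z x := ten₀₀_smul_left z x y

/-- `ten₁₁ k · y` as a linear map. -/
def tenR₁₁ (k : Fin 4) (y : Y.c₁.V) : X.c₁.V →ₗ[ℂ] (tens X Y).c₀.V where
  toFun x := ten₁₁ k x y
  map_add' x x' := ten₁₁_add_left k x x' y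
  map_smul' z x := ten₁₁_smul_left k z x y

/-- `ten₀₁ · y` as a linear map. -/
def tenR₀₁ (y : Y.c₁.V) : X.c₀.V →ₗ[ℂ] (tens X Y).c₁.V where
  toFun x := ten₀₁ x y
  map_add' x x' := ten₀₁_add_left x x' y
  map_smul' z x := ten₀₁_smul_left z x y

/-- `ten₁₀ · y` as a linear map. -/
def tenR₁₀ (y : Y.c₀.V) : X.c₁.V →ₗ[ℂ] (tens X Y).c₁.V where
  toFun x := ten₁₀ x y
  map_add' x x' := ten₁₀_add_left x x' y
  map_smul' z x := ten₁₀_smul_left z x y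

theorem tenL_rules {X Y : SF} : (∀ (x : X.c₀.V) (y : Y.c₀.V), tenL₀₀ x y = ten₀₀ x y) ∧
    (∀ (k : Fin 4) (x : X.c₁.V) (y : Y.c₁.V), tenL₁₁ k x y = ten₁₁ k x y) ∧
    (∀ (x : X.c₀.V) (y : Y.c₁.V), tenL₀₁ x y = ten₀₁ x y) ∧
    (∀ (x : X.c₁.V) (y : Y.c₀.V), tenL₁₀ x y = ten₁₀ x y) :=
  ⟨fun _ _ => rfl, fun _ _ _ => rfl, fun _ _ => rfl, fun _ _ => rfl⟩

variable {M : Type} [AddCommGroup M] [Module ℂ M]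

/-- The hypotheses are equations of linear maps in the right variable, so that the lemma applies
again when the right factor is itself a tensor product. -/
theorem tens_c₀_ext {f g : (tens X Y).c₀.V →ₗ[ℂ] M}
    (h : ∀ x : X.c₀.V, f ∘ₗ tenL₀₀ x = g ∘ₗ tenL₀₀ x)
    (h0 : ∀ x : X.c₁.V, f ∘ₗ tenL₁₁ 0 x = g ∘ₗ tenL₁₁ 0 x)
    (h1 : ∀ x : X.c₁.V, f ∘ₗ tenL₁₁ 1 x = g ∘ₗ tenL₁₁ 1 x)
    (h2 : ∀ x : X.c₁.V, f ∘ₗ tenL₁₁ 2 x = g ∘ₗ tenL₁₁ 2 x)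
    (h3 : ∀ x : X.c₁.V, f ∘ₗ tenL₁₁ 3 x = g ∘ₗ tenL₁₁ 3 x) : f = g := by
  refine LinearMap.eqLocus_eq_top.1 (tens_c₀_eq_top (fun x y => LinearMap.congr_fun (h x) y)
    fun k x y => ?_)
  fin_cases k
  · exact LinearMap.congr_fun (h0 x) y
  · exact LinearMap.congr_fun (h1 x) y
  · exact LinearMap.congr_fun (h2 x) y
  · exact LinearMap.congr_fun (h3 x) y

theorem tens_c₁_ext {f g : (tens X Y).c₁.V →ₗ[ℂ] M}
    (h : ∀ x : X.c₀.V, f ∘ₗ tenL₀₁ x = g ∘ₗ tenL₀₁ x)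
    (h' : ∀ x : X.c₁.V, f ∘ₗ tenL₁₀ x = g ∘ₗ tenL₁₀ x) : f = g :=
  LinearMap.eqLocus_eq_top.1 (tens_c₁_eq_top (fun x y => LinearMap.congr_fun (h x) y)
    fun x y => LinearMap.congr_fun (h' x) y)

/-- Morphisms of `SF` from linear maps that commute with the parities and with `a₁`, `a₂`. -/
def homMk {X Y : SF} (f : X.c₀.V →ₗ[ℂ] Y.c₀.V) (g : X.c₁.V →ₗ[ℂ] Y.c₁.V)
    (hp : f ∘ₗ par₀ X = par₀ Y ∘ₗ f) (h₁ : f ∘ₗ A₁ X = A₁ Y ∘ₗ f) (h₂ : f ∘ₗ A₂ X = A₂ Y ∘ₗ f)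
    (hg : g ∘ₗ par₁ X = par₁ Y ∘ₗ g) : X ⟶ Y :=
  ⟨(f, g), ⟨LinearMap.congr_fun hp, Cl.intertwiner X.c₀.ρ Y.c₀.ρ f (LinearMap.congr_fun h₁)
    (LinearMap.congr_fun h₂)⟩, LinearMap.congr_fun hg⟩

theorem hom_ext {X Y : SF} {f g : X ⟶ Y} (h₀ : map₀ f = map₀ g) (h₁ : map₁ f = map₁ g) : f = g :=
  Subtype.ext (Prod.ext h₀ h₁)

theorem map₀_comp {X Y Z : SF} (f : X ⟶ Y) (g : Y ⟶ Z) : map₀ (f ≫ g) = map₀ g ∘ₗ map₀ f := rfl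
theorem map₁_comp {X Y Z : SF} (f : X ⟶ Y) (g : Y ⟶ Z) : map₁ (f ≫ g) = map₁ g ∘ₗ map₁ f := rfl
theorem map₀_id (X : SF) : map₀ (𝟙 X) = LinearMap.id := rfl
theorem map₁_id (X : SF) : map₁ (𝟙 X) = LinearMap.id := rfl

theorem map₀_par₀ {X Y : SF} (f : X ⟶ Y) (x : X.c₀.V) : map₀ f (par₀ X x) = par₀ Y (map₀ f x) :=
  map₀_ω f x
theorem map₀_A₁ {X Y : SF} (f : X ⟶ Y) (x : X.c₀.V) : map₀ f (A₁ X x) = A₁ Y (map₀ f x) :=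
  map₀_ρ f a₁ x
theorem map₀_A₂ {X Y : SF} (f : X ⟶ Y) (x : X.c₀.V) : map₀ f (A₂ X x) = A₂ Y (map₀ f x) :=
  map₀_ρ f a₂ x
theorem map₁_par₁ {X Y : SF} (f : X ⟶ Y) (x : X.c₁.V) : map₁ f (par₁ X x) = par₁ Y (map₁ f x) :=
  map₁_ω f x

/-- The isomorphism with given underlying bijective linear maps. -/
def isoOfBijective {X Y : SF} (f : X ⟶ Y) (h₀ : Function.Bijective (map₀ f))
    (h₁ : Function.Bijective (map₁ f)) : X ≅ Y where
  hom := f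
  inv := ⟨((LinearEquiv.ofBijective (map₀ f) h₀).symm.toLinearMap,
      (LinearEquiv.ofBijective (map₁ f) h₁).symm.toLinearMap),
    ⟨fun v => (LinearEquiv.symm_apply_eq _).2 (by
        rw [LinearEquiv.ofBijective_apply, map₀_ω]
        exact congrArg _ ((LinearEquiv.ofBijective (map₀ f) h₀).apply_symm_apply v).symm),
      fun a v => (LinearEquiv.symm_apply_eq _).2 (by
        rw [LinearEquiv.ofBijective_apply, map₀_ρ]
        exact congrArg _ ((LinearEquiv.ofBijective (map₀ f) h₀).apply_symm_apply v).symm)⟩,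
    fun v => (LinearEquiv.symm_apply_eq _).2 (by
        rw [LinearEquiv.ofBijective_apply, map₁_ω]
        exact congrArg _ ((LinearEquiv.ofBijective (map₁ f) h₁).apply_symm_apply v).symm)⟩
  hom_inv_id := hom_ext
    (LinearMap.ext fun v => (LinearEquiv.ofBijective (map₀ f) h₀).symm_apply_apply v)
    (LinearMap.ext fun v => (LinearEquiv.ofBijective (map₁ f) h₁).symm_apply_apply v)
  inv_hom_id := hom_ext
    (LinearMap.ext fun v => (LinearEquiv.ofBijective (map₀ f) h₀).apply_symm_apply v)
    (LinearMap.ext fun v => (LinearEquiv.ofBijective (map₁ f) h₁).apply_symm_apply v)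

/-- A vector with known image gives a value of the inverse, so the preimages that prove surjectivity
also tabulate the inverse. -/
theorem map₀_inv_eq {X Y : SF} (e : X ≅ Y) {x : X.c₀.V} {y : Y.c₀.V} (h : map₀ e.hom x = y) :
    map₀ e.inv y = x := by
  rw [← h]
  exact LinearMap.congr_fun (congrArg map₀ e.hom_inv_id) x

theorem map₁_inv_eq {X Y : SF} (e : X ≅ Y) {x : X.c₁.V} {y : Y.c₁.V} (h : map₁ e.hom x = y) :
    map₁ e.inv y = x := by
  rw [← h]
  exact LinearMap.congr_fun (congrArg map₁ e.hom_inv_id) x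

/-- The tensor product of morphisms. -/
def tensHom {X X' Y Y' : SF} (f : X ⟶ X') (g : Y ⟶ Y') : tens X Y ⟶ tens X' Y' := tensorHom f g

variable {X' Y' : SF} (f : X ⟶ X') (g : Y ⟶ Y')

theorem map₀_tensHom_ten₀₀ (x : X.c₀.V) (y : Y.c₀.V) :
    map₀ (tensHom f g) (ten₀₀ x y) = ten₀₀ (map₀ f x) (map₀ g y) :=
  Prod.ext rfl (map_zero (map LinearMap.id (map (map₁ f) (map₁ g))))

theorem map₀_tensHom_ten₁₁ (k : Fin 4) (x : X.c₁.V) (y : Y.c₁.V) :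
    map₀ (tensHom f g) (ten₁₁ k x y) = ten₁₁ k (map₁ f x) (map₁ g y) :=
  Prod.ext (map_zero (map (map₀ f) (map₀ g))) rfl

theorem map₁_tensHom_ten₀₁ (x : X.c₀.V) (y : Y.c₁.V) :
    map₁ (tensHom f g) (ten₀₁ x y) = ten₀₁ (map₀ f x) (map₁ g y) :=
  Prod.ext rfl (map_zero (map (map₁ f) (map₀ g)))

theorem map₁_tensHom_ten₁₀ (x : X.c₁.V) (y : Y.c₀.V) :
    map₁ (tensHom f g) (ten₁₀ x y) = ten₁₀ (map₁ f x) (map₀ g y) :=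
  Prod.ext (map_zero (map (map₀ f) (map₁ g))) rfl

/-- Tensor products of morphisms on generators. -/
theorem tensHom_rules : (∀ {X Y X' Y' : SF} (f : X ⟶ X') (g : Y ⟶ Y') (x : X.c₀.V) (y : Y.c₀.V),
      map₀ (tensHom f g) (ten₀₀ x y) = ten₀₀ (map₀ f x) (map₀ g y)) ∧
    (∀ {X Y X' Y' : SF} (f : X ⟶ X') (g : Y ⟶ Y') (k : Fin 4) (x : X.c₁.V) (y : Y.c₁.V),
      map₀ (tensHom f g) (ten₁₁ k x y) = ten₁₁ k (map₁ f x) (map₁ g y)) ∧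
    (∀ {X Y X' Y' : SF} (f : X ⟶ X') (g : Y ⟶ Y') (x : X.c₀.V) (y : Y.c₁.V),
      map₁ (tensHom f g) (ten₀₁ x y) = ten₀₁ (map₀ f x) (map₁ g y)) ∧
    (∀ {X Y X' Y' : SF} (f : X ⟶ X') (g : Y ⟶ Y') (x : X.c₁.V) (y : Y.c₀.V),
      map₁ (tensHom f g) (ten₁₀ x y) = ten₁₀ (map₁ f x) (map₀ g y)) ∧
    (∀ X : SF, map₀ (𝟙 X) = LinearMap.id) ∧ (∀ X : SF, map₁ (𝟙 X) = LinearMap.id) :=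
  ⟨map₀_tensHom_ten₀₀, map₀_tensHom_ten₁₁, map₁_tensHom_ten₀₁, map₁_tensHom_ten₁₀, map₀_id, map₁_id⟩

theorem tensHom_id (X Y : SF) : tensHom (𝟙 X) (𝟙 Y) = 𝟙 (tens X Y) := by
  refine hom_ext (tens_c₀_ext ?_ ?_ ?_ ?_ ?_) (tens_c₁_ext ?_ ?_) <;> intro x <;> ext y <;>
    simp only [LinearMap.comp_apply, tenL_rules, tensHom_rules, LinearMap.id_apply]

theorem tensHom_comp {X Y Z X' Y' Z' : SF} (f : X ⟶ Y) (g : Y ⟶ Z) (f' : X' ⟶ Y') (g' : Y' ⟶ Z') :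
    tensHom f f' ≫ tensHom g g' = tensHom (f ≫ g) (f' ≫ g') := by
  refine hom_ext (tens_c₀_ext ?_ ?_ ?_ ?_ ?_) (tens_c₁_ext ?_ ?_) <;> intro x <;> ext y <;>
    simp only [LinearMap.comp_apply, tenL_rules, tensHom_rules, LinearMap.id_apply, map₀_comp, map₁_comp]

end Ext

/-! ### Dimensions of tensor products -/

section Finrank

variable (X Y : SF)

theorem finrank_G : Module.finrank ℂ G = 4 := by
  change Module.finrank ℂ (Fin 4 → ℂ) = 4
  simp

/-- The factor `4` is the dimension of `G` in the twisted-twisted sector. -/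
theorem finrank_tens_c₀ : Module.finrank ℂ (tens X Y).c₀.V =
    Module.finrank ℂ X.c₀.V * Module.finrank ℂ Y.c₀.V +
      4 * (Module.finrank ℂ X.c₁.V * Module.finrank ℂ Y.c₁.V) := by
  change Module.finrank ℂ ((X.c₀.V ⊗[ℂ] Y.c₀.V) × (G ⊗[ℂ] (X.c₁.V ⊗[ℂ] Y.c₁.V))) = _
  rw [Module.finrank_prod, Module.finrank_tensorProduct, Module.finrank_tensorProduct,
    Module.finrank_tensorProduct, finrank_G]

theorem finrank_tens_c₁ : Module.finrank ℂ (tens X Y).c₁.V =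
    Module.finrank ℂ X.c₀.V * Module.finrank ℂ Y.c₁.V +
      Module.finrank ℂ X.c₁.V * Module.finrank ℂ Y.c₀.V := by
  change Module.finrank ℂ ((X.c₀.V ⊗[ℂ] Y.c₁.V) × (X.c₁.V ⊗[ℂ] Y.c₀.V)) = _
  rw [Module.finrank_prod, Module.finrank_tensorProduct, Module.finrank_tensorProduct]

theorem bijective_of_range_eq_top {V W : Type} [AddCommGroup V] [Module ℂ V] [FiniteDimensional ℂ V]
    [AddCommGroup W] [Module ℂ W] [FiniteDimensional ℂ W] (f : V →ₗ[ℂ] W)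
    (h : Module.finrank ℂ V = Module.finrank ℂ W) (hf : LinearMap.range f = ⊤) :
    Function.Bijective f := by
  have hs := LinearMap.range_eq_top.1 hf
  exact ⟨(LinearMap.injective_iff_surjective_of_finrank_eq_finrank h).2 hs, hs⟩

end Finrank

/-! ## The associator as an isomorphism -/

section Associator

variable (β : ℂ) (X Y Z : SF)

theorem assoc₀_par₀ : assoc₀ X Y Z ∘ₗ par₀ (tens X (tens Y Z)) =
    par₀ (tens (tens X Y) Z) ∘ₗ assoc₀ X Y Z := by
  -- Extensionality is applied first to the outer and then to the inner tensor product, which leaves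
  -- one goal for each kind of generator of `X * (Y * Z)`.
  repeat' (first | apply tens_c₀_ext | apply tens_c₁_ext | apply LinearMap.ext | intro _)
  all_goals
    simp only [LinearMap.comp_apply, tenL_rules, assoc_rules, par_rules, map_add, map_sub, map_neg, map_smul,
      ten_linear, neg_neg, grassmann_rules]
  all_goals abel

theorem assoc₁_par₁ : assoc₁ β X Y Z ∘ₗ par₁ (tens X (tens Y Z)) =
    par₁ (tens (tens X Y) Z) ∘ₗ assoc₁ β X Y Z := by
  repeat' (first | apply tens_c₀_ext | apply tens_c₁_ext | apply LinearMap.ext | intro _)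
  all_goals
    simp only [LinearMap.comp_apply, tenL_rules, assoc_rules, par_rules, map_add, map_sub, map_neg, map_smul,
      ten_linear, neg_neg, grassmann_rules, smul_neg]

theorem assoc₀_A₁ : assoc₀ X Y Z ∘ₗ A₁ (tens X (tens Y Z)) =
    A₁ (tens (tens X Y) Z) ∘ₗ assoc₀ X Y Z := by
  repeat' (first | apply tens_c₀_ext | apply tens_c₁_ext | apply LinearMap.ext | intro _)
  all_goals
    simp only [LinearMap.comp_apply, tenL_rules, assoc_rules, par_rules, map_add, map_sub, map_neg, map_smul,
      ten_linear, neg_neg, grassmann_rules, map_zero, neg_zero]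
  all_goals abel

theorem assoc₀_A₂ : assoc₀ X Y Z ∘ₗ A₂ (tens X (tens Y Z)) =
    A₂ (tens (tens X Y) Z) ∘ₗ assoc₀ X Y Z := by
  repeat' (first | apply tens_c₀_ext | apply tens_c₁_ext | apply LinearMap.ext | intro _)
  all_goals
    simp only [LinearMap.comp_apply, tenL_rules, assoc_rules, par_rules, map_add, map_sub, map_neg, map_smul,
      ten_linear, neg_neg, grassmann_rules, map_zero, neg_zero]
  all_goals abel

/-- The associator as a morphism. -/
def assocHom : tens X (tens Y Z) ⟶ tens (tens X Y) Z :=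
  homMk (assoc₀ X Y Z) (assoc₁ β X Y Z) (assoc₀_par₀ X Y Z) (assoc₀_A₁ X Y Z) (assoc₀_A₂ X Y Z)
    (assoc₁_par₁ β X Y Z)

theorem map₀_assocHom : map₀ (assocHom β X Y Z) = assoc₀ X Y Z := rfl
theorem map₁_assocHom : map₁ (assocHom β X Y Z) = assoc₁ β X Y Z := rfl

end Associator

end SF

namespace SF

/-! ## Inverse and pentagon of the associator -/

section Pentagon

variable {β : ℂ} {X Y Z : SF}

/-- Through this rule the condition on `β` enters the preimages in sector 111 and the pentagon. -/
theorem sq_smul_sq_smul (hβ : β ^ 4 = -1) {V : Type} [AddCommGroup V] [Module ℂ V] (v : V) :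
    β ^ 2 • β ^ 2 • v = -v := by
  rw [smul_smul, ← pow_add, hβ, neg_one_smul]

/-- In sector 011 the associator acts on `x` by `S(g'')`; the inverse acts by `g''` itself, since
the two contributions cancel by the antipode identity. This gives the preimages below. -/
theorem assoc₀_pre_011_zero (x : X.c₀.V) (y : Y.c₁.V) (z : Z.c₁.V) :
    assoc₀ X Y Z (ten₀₀ x (ten₁₁ 0 y z)) = ten₁₁ 0 (ten₀₁ x y) z := by
  simp only [assoc_rules, par_rules, map_add, map_sub, map_neg, map_smul, map_zero,
      ten_linear, grassmann_rules, neg_neg, smul_neg, neg_zero]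

theorem assoc₀_pre_011_one (x : X.c₀.V) (y : Y.c₁.V) (z : Z.c₁.V) :
    assoc₀ X Y Z (ten₀₀ (par₀ X x) (ten₁₁ 1 y z) + ten₀₀ (A₁ X x) (ten₁₁ 0 y z)) = ten₁₁ 1
    (ten₀₁ x y) z := by
  simp only [assoc_rules, par_rules, map_add, map_sub, map_neg, map_smul, map_zero,
      ten_linear, grassmann_rules, neg_neg, smul_neg, neg_zero]
  abel

theorem assoc₀_pre_011_two (x : X.c₀.V) (y : Y.c₁.V) (z : Z.c₁.V) :
    assoc₀ X Y Z (ten₀₀ (par₀ X x) (ten₁₁ 2 y z) + ten₀₀ (A₂ X x) (ten₁₁ 0 y z)) = ten₁₁ 2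
    (ten₀₁ x y) z := by
  simp only [assoc_rules, par_rules, map_add, map_sub, map_neg, map_smul, map_zero,
      ten_linear, grassmann_rules, neg_neg, smul_neg, neg_zero]
  abel

theorem assoc₀_pre_011_three (x : X.c₀.V) (y : Y.c₁.V) (z : Z.c₁.V) :
    assoc₀ X Y Z (ten₀₀ x (ten₁₁ 3 y z) - ten₀₀ (A₂ X (par₀ X x)) (ten₁₁ 1 y z) + ten₀₀ (A₁ X
    (par₀ X x)) (ten₁₁ 2 y z) + ten₀₀ (A₁ X (A₂ X x)) (ten₁₁ 0 y z)) = ten₁₁ 3 (ten₀₁ x y) z :=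
    by
  simp only [assoc_rules, par_rules, map_add, map_sub, map_neg, map_smul, map_zero,
      ten_linear, grassmann_rules, neg_neg, smul_neg, neg_zero]
  abel

/-- The preimage is the value of `exp(-C)`: the linear terms change sign, the quadratic one does
not. The same applies to sector 010. -/
theorem assoc₀_pre_101_zero (x : X.c₁.V) (y : Y.c₀.V) (z : Z.c₁.V) :
    assoc₀ X Y Z (ten₁₁ 0 x (ten₀₁ y z) - ten₁₁ 2 (par₁ X x) (ten₀₁ (A₁ Y y) z) + ten₁₁ 1 (par₁
    X x) (ten₀₁ (A₂ Y y) z) - ten₁₁ 3 x (ten₀₁ (A₁ Y (A₂ Y y)) z)) = ten₁₁ 0 (ten₁₀ x y) z := by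
  simp only [assoc_rules, par_rules, map_add, map_sub, map_neg, map_smul, map_zero,
      ten_linear, grassmann_rules, neg_neg, smul_neg, neg_zero]
  abel

theorem assoc₀_pre_101_one (x : X.c₁.V) (y : Y.c₀.V) (z : Z.c₁.V) :
    assoc₀ X Y Z (ten₁₁ 1 x (ten₀₁ y z) - ten₁₁ 3 (par₁ X x) (ten₀₁ (A₁ Y y) z)) = ten₁₁ 1
    (ten₁₀ x y) z := by
  simp only [assoc_rules, par_rules, map_add, map_sub, map_neg, map_smul, map_zero,
      ten_linear, grassmann_rules, neg_neg, smul_neg, neg_zero]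
  abel

theorem assoc₀_pre_101_two (x : X.c₁.V) (y : Y.c₀.V) (z : Z.c₁.V) :
    assoc₀ X Y Z (ten₁₁ 2 x (ten₀₁ y z) - ten₁₁ 3 (par₁ X x) (ten₀₁ (A₂ Y y) z)) = ten₁₁ 2
    (ten₁₀ x y) z := by
  simp only [assoc_rules, par_rules, map_add, map_sub, map_neg, map_smul, map_zero,
      ten_linear, grassmann_rules, neg_neg, smul_neg, neg_zero]
  abel

theorem assoc₀_pre_101_three (x : X.c₁.V) (y : Y.c₀.V) (z : Z.c₁.V) :
    assoc₀ X Y Z (ten₁₁ 3 x (ten₀₁ y z)) = ten₁₁ 3 (ten₁₀ x y) z := by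
  simp only [assoc_rules, par_rules, map_add, map_sub, map_neg, map_smul, map_zero,
      ten_linear, grassmann_rules, neg_neg, smul_neg, neg_zero]

/-- In sector 110 the associator acts on `z` by `g''`, so the inverse inserts the antipode, which is
visible in the signs of the terms with a single `a_j`. -/
theorem assoc₀_pre_110_zero (x : X.c₁.V) (y : Y.c₁.V) (z : Z.c₀.V) :
    assoc₀ X Y Z (ten₁₁ 0 x (ten₁₀ y z)) = ten₀₀ (ten₁₁ 0 x y) z := by
  simp only [assoc_rules, par_rules, map_add, map_sub, map_neg, map_smul, map_zero,
      ten_linear, grassmann_rules, neg_neg, smul_neg, neg_zero]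

theorem assoc₀_pre_110_one (x : X.c₁.V) (y : Y.c₁.V) (z : Z.c₀.V) :
    assoc₀ X Y Z (ten₁₁ 1 x (ten₁₀ y z) - ten₁₁ 0 (par₁ X x) (ten₁₀ (par₁ Y y) (A₁ Z z))) =
    ten₀₀ (ten₁₁ 1 x y) z := by
  simp only [assoc_rules, par_rules, map_add, map_sub, map_neg, map_smul, map_zero,
      ten_linear, grassmann_rules, neg_neg, smul_neg, neg_zero]
  abel

theorem assoc₀_pre_110_two (x : X.c₁.V) (y : Y.c₁.V) (z : Z.c₀.V) :
    assoc₀ X Y Z (ten₁₁ 2 x (ten₁₀ y z) - ten₁₁ 0 (par₁ X x) (ten₁₀ (par₁ Y y) (A₂ Z z))) =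
    ten₀₀ (ten₁₁ 2 x y) z := by
  simp only [assoc_rules, par_rules, map_add, map_sub, map_neg, map_smul, map_zero,
      ten_linear, grassmann_rules, neg_neg, smul_neg, neg_zero]
  abel

theorem assoc₀_pre_110_three (x : X.c₁.V) (y : Y.c₁.V) (z : Z.c₀.V) :
    assoc₀ X Y Z (ten₁₁ 3 x (ten₁₀ y z) - ten₁₁ 1 (par₁ X x) (ten₁₀ (par₁ Y y) (A₂ Z z)) + ten₁₁
    2 (par₁ X x) (ten₁₀ (par₁ Y y) (A₁ Z z)) + ten₁₁ 0 x (ten₁₀ y (A₁ Z (A₂ Z z)))) = ten₀₀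
    (ten₁₁ 3 x y) z := by
  simp only [assoc_rules, par_rules, map_add, map_sub, map_neg, map_smul, map_zero,
      ten_linear, grassmann_rules, neg_neg, smul_neg, neg_zero]
  abel

theorem assoc₀_pre_000 (x : X.c₀.V) (y : Y.c₀.V) (z : Z.c₀.V) :
    assoc₀ X Y Z (ten₀₀ x (ten₀₀ y z)) = ten₀₀ (ten₀₀ x y) z := by
  simp only [assoc_rules, par_rules, map_add, map_sub, map_neg, map_smul, map_zero,
      ten_linear, grassmann_rules, neg_neg, smul_neg, neg_zero]

theorem assoc₁_pre_001 (β : ℂ) (x : X.c₀.V) (y : Y.c₀.V) (z : Z.c₁.V) :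
    assoc₁ β X Y Z (ten₀₁ x (ten₀₁ y z)) = ten₀₁ (ten₀₀ x y) z := by
  simp only [assoc_rules, par_rules, map_add, map_sub, map_neg, map_smul, map_zero,
      ten_linear, grassmann_rules, neg_neg, smul_neg, neg_zero]

theorem assoc₁_pre_100 (β : ℂ) (x : X.c₁.V) (y : Y.c₀.V) (z : Z.c₀.V) :
    assoc₁ β X Y Z (ten₁₀ x (ten₀₀ y z)) = ten₁₀ (ten₁₀ x y) z := by
  simp only [assoc_rules, par_rules, map_add, map_sub, map_neg, map_smul, map_zero,
      ten_linear, grassmann_rules, neg_neg, smul_neg, neg_zero]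

theorem assoc₁_pre_010 (β : ℂ) (x : X.c₀.V) (y : Y.c₁.V) (z : Z.c₀.V) :
    assoc₁ β X Y Z (ten₀₁ x (ten₁₀ y z) - ten₀₁ (A₂ X (par₀ X x)) (ten₁₀ (par₁ Y y) (A₁ Z z)) +
    ten₀₁ (A₁ X (par₀ X x)) (ten₁₀ (par₁ Y y) (A₂ Z z)) - ten₀₁ (A₁ X (A₂ X x)) (ten₁₀ y (A₁ Z
    (A₂ Z z)))) = ten₁₀ (ten₀₁ x y) z := by
  simp only [assoc_rules, par_rules, map_add, map_sub, map_neg, map_smul, map_zero,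
      ten_linear, grassmann_rules, neg_neg, smul_neg, neg_zero]
  abel

/-- Since `β⁴ = -1`, the square of `φ` is `1` on `1`, `a₁a₂` and `-1` on `a₁`, `a₂`. So the inverse
of `φ` is `φ` on the even and `-φ` on the odd basis vectors. -/
theorem assoc₁_pre_111_zero (hβ : β ^ 4 = -1) (x : X.c₁.V) (y : Y.c₁.V) (z : Z.c₁.V) :
    assoc₁ β X Y Z (β ^ 2 • ten₁₀ x (ten₁₁ 3 y z)) = ten₀₁ (ten₁₁ 0 x y) z := by
  simp only [assoc_rules, par_rules, map_add, map_sub, map_neg, map_smul, map_zero,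
      ten_linear, grassmann_rules, neg_neg, smul_neg, neg_zero, sq_smul_sq_smul hβ]

theorem assoc₁_pre_111_one (hβ : β ^ 4 = -1) (x : X.c₁.V) (y : Y.c₁.V) (z : Z.c₁.V) :
    assoc₁ β X Y Z (-(β ^ 2 • ten₁₀ (par₁ X x) (ten₁₁ 1 y z))) = ten₀₁ (ten₁₁ 1 x y) z := by
  simp only [assoc_rules, par_rules, map_add, map_sub, map_neg, map_smul, map_zero,
      ten_linear, grassmann_rules, neg_neg, smul_neg, neg_zero, sq_smul_sq_smul hβ]

theorem assoc₁_pre_111_two (hβ : β ^ 4 = -1) (x : X.c₁.V) (y : Y.c₁.V) (z : Z.c₁.V) :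
    assoc₁ β X Y Z (-(β ^ 2 • ten₁₀ (par₁ X x) (ten₁₁ 2 y z))) = ten₀₁ (ten₁₁ 2 x y) z := by
  simp only [assoc_rules, par_rules, map_add, map_sub, map_neg, map_smul, map_zero,
      ten_linear, grassmann_rules, neg_neg, smul_neg, neg_zero, sq_smul_sq_smul hβ]

theorem assoc₁_pre_111_three (hβ : β ^ 4 = -1) (x : X.c₁.V) (y : Y.c₁.V) (z : Z.c₁.V) :
    assoc₁ β X Y Z (-(β ^ 2 • ten₁₀ x (ten₁₁ 0 y z))) = ten₀₁ (ten₁₁ 3 x y) z := by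
  simp only [assoc_rules, par_rules, map_add, map_sub, map_neg, map_smul, map_zero,
      ten_linear, grassmann_rules, neg_neg, smul_neg, neg_zero, sq_smul_sq_smul hβ]

theorem range_assoc₀ : LinearMap.range (assoc₀ X Y Z) = ⊤ := by
  refine tens_c₀_eq_top (fun w z => ?_) (fun k w z => ?_)
  -- The left factor `w` lies itself in a tensor product; pulling the range back along `w ↦ w ⊗ z`
  -- allows it to be tested on the spanning vectors of `X * Y`.
  · have h : (LinearMap.range (assoc₀ X Y Z)).comap (tenR₀₀ z) = ⊤ :=
      tens_c₀_eq_top (fun x y => ⟨_, assoc₀_pre_000 x y z⟩) (fun k x y => by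
        fin_cases k
        · exact ⟨_, assoc₀_pre_110_zero x y z⟩
        · exact ⟨_, assoc₀_pre_110_one x y z⟩
        · exact ⟨_, assoc₀_pre_110_two x y z⟩
        · exact ⟨_, assoc₀_pre_110_three x y z⟩)
    exact (eq_top_iff.1 h) (Submodule.mem_top (x := w))
  · have h : (LinearMap.range (assoc₀ X Y Z)).comap (tenR₁₁ k z) = ⊤ :=
      tens_c₁_eq_top (fun x y => by
        fin_cases k
        · exact ⟨_, assoc₀_pre_011_zero x y z⟩
        · exact ⟨_, assoc₀_pre_011_one x y z⟩
        · exact ⟨_, assoc₀_pre_011_two x y z⟩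
        · exact ⟨_, assoc₀_pre_011_three x y z⟩) (fun x y => by
        fin_cases k
        · exact ⟨_, assoc₀_pre_101_zero x y z⟩
        · exact ⟨_, assoc₀_pre_101_one x y z⟩
        · exact ⟨_, assoc₀_pre_101_two x y z⟩
        · exact ⟨_, assoc₀_pre_101_three x y z⟩)
    exact (eq_top_iff.1 h) (Submodule.mem_top (x := w))

theorem range_assoc₁ (hβ : β ^ 4 = -1) : LinearMap.range (assoc₁ β X Y Z) = ⊤ := by
  refine tens_c₁_eq_top (fun w z => ?_) (fun w z => ?_)
  · have h : (LinearMap.range (assoc₁ β X Y Z)).comap (tenR₀₁ z) = ⊤ :=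
      tens_c₀_eq_top (fun x y => ⟨_, assoc₁_pre_001 β x y z⟩) (fun k x y => by
        fin_cases k
        · exact ⟨_, assoc₁_pre_111_zero hβ x y z⟩
        · exact ⟨_, assoc₁_pre_111_one hβ x y z⟩
        · exact ⟨_, assoc₁_pre_111_two hβ x y z⟩
        · exact ⟨_, assoc₁_pre_111_three hβ x y z⟩)
    exact (eq_top_iff.1 h) (Submodule.mem_top (x := w))
  · have h : (LinearMap.range (assoc₁ β X Y Z)).comap (tenR₁₀ z) = ⊤ :=
      tens_c₁_eq_top (fun x y => ⟨_, assoc₁_pre_010 β x y z⟩)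
        (fun x y => ⟨_, assoc₁_pre_100 β x y z⟩)
    exact (eq_top_iff.1 h) (Submodule.mem_top (x := w))

/-- The associator as an isomorphism. -/
def assocIso (hβ : β ^ 4 = -1) (X Y Z : SF) : tens X (tens Y Z) ≅ tens (tens X Y) Z :=
  isoOfBijective (assocHom β X Y Z)
    (bijective_of_range_eq_top _ (by simp only [finrank_tens_c₀, finrank_tens_c₁]; ring)
      range_assoc₀)
    (bijective_of_range_eq_top _ (by simp only [finrank_tens_c₀, finrank_tens_c₁]; ring)
      (range_assoc₁ hβ))

theorem assocIso_inv_011_zero (hβ : β ^ 4 = -1) (x : X.c₀.V) (y : Y.c₁.V) (z : Z.c₁.V) :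
    map₀ (assocIso hβ X Y Z).inv (ten₁₁ 0 (ten₀₁ x y) z) =
      ten₀₀ x (ten₁₁ 0 y z) :=
  map₀_inv_eq _ (assoc₀_pre_011_zero x y z)

theorem assocIso_inv_011_one (hβ : β ^ 4 = -1) (x : X.c₀.V) (y : Y.c₁.V) (z : Z.c₁.V) :
    map₀ (assocIso hβ X Y Z).inv (ten₁₁ 1 (ten₀₁ x y) z) =
      ten₀₀ (par₀ X x) (ten₁₁ 1 y z) + ten₀₀ (A₁ X x) (ten₁₁ 0 y z) :=
  map₀_inv_eq _ (assoc₀_pre_011_one x y z)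

theorem assocIso_inv_011_two (hβ : β ^ 4 = -1) (x : X.c₀.V) (y : Y.c₁.V) (z : Z.c₁.V) :
    map₀ (assocIso hβ X Y Z).inv (ten₁₁ 2 (ten₀₁ x y) z) =
      ten₀₀ (par₀ X x) (ten₁₁ 2 y z) + ten₀₀ (A₂ X x) (ten₁₁ 0 y z) :=
  map₀_inv_eq _ (assoc₀_pre_011_two x y z)

theorem assocIso_inv_011_three (hβ : β ^ 4 = -1) (x : X.c₀.V) (y : Y.c₁.V) (z : Z.c₁.V) :
    map₀ (assocIso hβ X Y Z).inv (ten₁₁ 3 (ten₀₁ x y) z) =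
      ten₀₀ x (ten₁₁ 3 y z) - ten₀₀ (A₂ X (par₀ X x)) (ten₁₁ 1 y z) + ten₀₀ (A₁ X (par₀ X x))
      (ten₁₁ 2 y z) + ten₀₀ (A₁ X (A₂ X x)) (ten₁₁ 0 y z) :=
  map₀_inv_eq _ (assoc₀_pre_011_three x y z)

theorem assocIso_inv_101_zero (hβ : β ^ 4 = -1) (x : X.c₁.V) (y : Y.c₀.V) (z : Z.c₁.V) :
    map₀ (assocIso hβ X Y Z).inv (ten₁₁ 0 (ten₁₀ x y) z) =
      ten₁₁ 0 x (ten₀₁ y z) - ten₁₁ 2 (par₁ X x) (ten₀₁ (A₁ Y y) z) + ten₁₁ 1 (par₁ X x)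
      (ten₀₁ (A₂ Y y) z) - ten₁₁ 3 x (ten₀₁ (A₁ Y (A₂ Y y)) z) :=
  map₀_inv_eq _ (assoc₀_pre_101_zero x y z)

theorem assocIso_inv_101_one (hβ : β ^ 4 = -1) (x : X.c₁.V) (y : Y.c₀.V) (z : Z.c₁.V) :
    map₀ (assocIso hβ X Y Z).inv (ten₁₁ 1 (ten₁₀ x y) z) =
      ten₁₁ 1 x (ten₀₁ y z) - ten₁₁ 3 (par₁ X x) (ten₀₁ (A₁ Y y) z) :=
  map₀_inv_eq _ (assoc₀_pre_101_one x y z)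

theorem assocIso_inv_101_two (hβ : β ^ 4 = -1) (x : X.c₁.V) (y : Y.c₀.V) (z : Z.c₁.V) :
    map₀ (assocIso hβ X Y Z).inv (ten₁₁ 2 (ten₁₀ x y) z) =
      ten₁₁ 2 x (ten₀₁ y z) - ten₁₁ 3 (par₁ X x) (ten₀₁ (A₂ Y y) z) :=
  map₀_inv_eq _ (assoc₀_pre_101_two x y z)

theorem assocIso_inv_101_three (hβ : β ^ 4 = -1) (x : X.c₁.V) (y : Y.c₀.V) (z : Z.c₁.V) :
    map₀ (assocIso hβ X Y Z).inv (ten₁₁ 3 (ten₁₀ x y) z) =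
      ten₁₁ 3 x (ten₀₁ y z) :=
  map₀_inv_eq _ (assoc₀_pre_101_three x y z)

theorem assocIso_inv_110_zero (hβ : β ^ 4 = -1) (x : X.c₁.V) (y : Y.c₁.V) (z : Z.c₀.V) :
    map₀ (assocIso hβ X Y Z).inv (ten₀₀ (ten₁₁ 0 x y) z) =
      ten₁₁ 0 x (ten₁₀ y z) :=
  map₀_inv_eq _ (assoc₀_pre_110_zero x y z)

theorem assocIso_inv_110_one (hβ : β ^ 4 = -1) (x : X.c₁.V) (y : Y.c₁.V) (z : Z.c₀.V) :
    map₀ (assocIso hβ X Y Z).inv (ten₀₀ (ten₁₁ 1 x y) z) =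
      ten₁₁ 1 x (ten₁₀ y z) - ten₁₁ 0 (par₁ X x) (ten₁₀ (par₁ Y y) (A₁ Z z)) :=
  map₀_inv_eq _ (assoc₀_pre_110_one x y z)

theorem assocIso_inv_110_two (hβ : β ^ 4 = -1) (x : X.c₁.V) (y : Y.c₁.V) (z : Z.c₀.V) :
    map₀ (assocIso hβ X Y Z).inv (ten₀₀ (ten₁₁ 2 x y) z) =
      ten₁₁ 2 x (ten₁₀ y z) - ten₁₁ 0 (par₁ X x) (ten₁₀ (par₁ Y y) (A₂ Z z)) :=
  map₀_inv_eq _ (assoc₀_pre_110_two x y z)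

theorem assocIso_inv_110_three (hβ : β ^ 4 = -1) (x : X.c₁.V) (y : Y.c₁.V) (z : Z.c₀.V) :
    map₀ (assocIso hβ X Y Z).inv (ten₀₀ (ten₁₁ 3 x y) z) =
      ten₁₁ 3 x (ten₁₀ y z) - ten₁₁ 1 (par₁ X x) (ten₁₀ (par₁ Y y) (A₂ Z z)) + ten₁₁ 2 (par₁ X
      x) (ten₁₀ (par₁ Y y) (A₁ Z z)) + ten₁₁ 0 x (ten₁₀ y (A₁ Z (A₂ Z z))) :=
  map₀_inv_eq _ (assoc₀_pre_110_three x y z)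

theorem assocIso_inv_000 (hβ : β ^ 4 = -1) (x : X.c₀.V) (y : Y.c₀.V) (z : Z.c₀.V) :
    map₀ (assocIso hβ X Y Z).inv (ten₀₀ (ten₀₀ x y) z) =
      ten₀₀ x (ten₀₀ y z) :=
  map₀_inv_eq _ (assoc₀_pre_000 x y z)

theorem assocIso_inv_001 (hβ : β ^ 4 = -1) (x : X.c₀.V) (y : Y.c₀.V) (z : Z.c₁.V) :
    map₁ (assocIso hβ X Y Z).inv (ten₀₁ (ten₀₀ x y) z) =
      ten₀₁ x (ten₀₁ y z) :=
  map₁_inv_eq _ (assoc₁_pre_001 β x y z)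

theorem assocIso_inv_100 (hβ : β ^ 4 = -1) (x : X.c₁.V) (y : Y.c₀.V) (z : Z.c₀.V) :
    map₁ (assocIso hβ X Y Z).inv (ten₁₀ (ten₁₀ x y) z) =
      ten₁₀ x (ten₀₀ y z) :=
  map₁_inv_eq _ (assoc₁_pre_100 β x y z)

theorem assocIso_inv_010 (hβ : β ^ 4 = -1) (x : X.c₀.V) (y : Y.c₁.V) (z : Z.c₀.V) :
    map₁ (assocIso hβ X Y Z).inv (ten₁₀ (ten₀₁ x y) z) =
      ten₀₁ x (ten₁₀ y z) - ten₀₁ (A₂ X (par₀ X x)) (ten₁₀ (par₁ Y y) (A₁ Z z)) + ten₀₁ (A₁ X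
      (par₀ X x)) (ten₁₀ (par₁ Y y) (A₂ Z z)) - ten₀₁ (A₁ X (A₂ X x)) (ten₁₀ y (A₁ Z (A₂ Z
      z))) :=
  map₁_inv_eq _ (assoc₁_pre_010 β x y z)

theorem assocIso_inv_111_zero (hβ : β ^ 4 = -1) (x : X.c₁.V) (y : Y.c₁.V) (z : Z.c₁.V) :
    map₁ (assocIso hβ X Y Z).inv (ten₀₁ (ten₁₁ 0 x y) z) =
      β ^ 2 • ten₁₀ x (ten₁₁ 3 y z) :=
  map₁_inv_eq _ (assoc₁_pre_111_zero hβ x y z)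

theorem assocIso_inv_111_one (hβ : β ^ 4 = -1) (x : X.c₁.V) (y : Y.c₁.V) (z : Z.c₁.V) :
    map₁ (assocIso hβ X Y Z).inv (ten₀₁ (ten₁₁ 1 x y) z) =
      -(β ^ 2 • ten₁₀ (par₁ X x) (ten₁₁ 1 y z)) :=
  map₁_inv_eq _ (assoc₁_pre_111_one hβ x y z)

theorem assocIso_inv_111_two (hβ : β ^ 4 = -1) (x : X.c₁.V) (y : Y.c₁.V) (z : Z.c₁.V) :
    map₁ (assocIso hβ X Y Z).inv (ten₀₁ (ten₁₁ 2 x y) z) =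
      -(β ^ 2 • ten₁₀ (par₁ X x) (ten₁₁ 2 y z)) :=
  map₁_inv_eq _ (assoc₁_pre_111_two hβ x y z)

theorem assocIso_inv_111_three (hβ : β ^ 4 = -1) (x : X.c₁.V) (y : Y.c₁.V) (z : Z.c₁.V) :
    map₁ (assocIso hβ X Y Z).inv (ten₀₁ (ten₁₁ 3 x y) z) =
      -(β ^ 2 • ten₁₀ x (ten₁₁ 0 y z)) :=
  map₁_inv_eq _ (assoc₁_pre_111_three hβ x y z)

/-- For four twisted objects the path through `(W * X) * (Y * Z)` uses sectors 110 and 011 and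
contains no `β`, whereas the other path uses sector 111 twice; this is where `β⁴ = -1` is needed. -/
theorem pentagon₀ (hβ : β ^ 4 = -1) (W X Y Z : SF) :
    map₀ (assocHom β (tens W X) Y Z) ∘ₗ map₀ (assocHom β W X (tens Y Z)) =
      map₀ (tensHom (assocHom β W X Y) (𝟙 Z)) ∘ₗ map₀ (assocHom β W (tens X Y) Z) ∘ₗ
        map₀ (tensHom (𝟙 W) (assocHom β X Y Z)) := by
  repeat' (first | apply tens_c₀_ext | apply tens_c₁_ext | apply LinearMap.ext | intro _)
  all_goals
    simp only [LinearMap.comp_apply, tenL_rules, assoc_rules, par_rules, map_add, map_sub, map_neg, map_smul,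
      map_zero, ten_linear, grassmann_rules, tensHom_rules, LinearMap.id_apply, neg_neg, smul_neg, neg_zero,
      smul_zero, sub_zero, zero_sub, add_zero, zero_add, sub_neg_eq_add, map₀_assocHom,
      map₁_assocHom, smul_add, smul_sub, sq_smul_sq_smul hβ]
  all_goals module

/-- With an odd number of twisted objects both paths carry the same power of `β`, so `β` is
arbitrary. -/
theorem pentagon₁ (β : ℂ) (W X Y Z : SF) :
    map₁ (assocHom β (tens W X) Y Z) ∘ₗ map₁ (assocHom β W X (tens Y Z)) =
      map₁ (tensHom (assocHom β W X Y) (𝟙 Z)) ∘ₗ map₁ (assocHom β W (tens X Y) Z) ∘ₗ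
        map₁ (tensHom (𝟙 W) (assocHom β X Y Z)) := by
  repeat' (first | apply tens_c₀_ext | apply tens_c₁_ext | apply LinearMap.ext | intro _)
  all_goals
    simp only [LinearMap.comp_apply, tenL_rules, assoc_rules, par_rules, map_add, map_sub, map_neg, map_smul,
      map_zero, ten_linear, grassmann_rules, tensHom_rules, LinearMap.id_apply, neg_neg, smul_neg, neg_zero,
      smul_zero, sub_zero, zero_sub, add_zero, zero_add, sub_neg_eq_add, map₀_assocHom,
      map₁_assocHom]
  all_goals module

theorem assocHom_pentagon (hβ : β ^ 4 = -1) (W X Y Z : SF) :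
    assocHom β W X (tens Y Z) ≫ assocHom β (tens W X) Y Z =
      tensHom (𝟙 W) (assocHom β X Y Z) ≫ assocHom β W (tens X Y) Z ≫
        tensHom (assocHom β W X Y) (𝟙 Z) :=
  hom_ext (pentagon₀ hβ W X Y Z) (pentagon₁ β W X Y Z)

end Pentagon

/-- The inverse of the associator on generators. -/
theorem assocIso_inv_rules :
    (∀ {β : ℂ} {X Y Z : SF} (hβ : β ^ 4 = -1) (x : X.c₀.V) (y : Y.c₁.V) (z : Z.c₁.V), map₀
      (assocIso hβ X Y Z).inv (ten₁₁ 0 (ten₀₁ x y) z) = ten₀₀ x (ten₁₁ 0 y z)) ∧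
    (∀ {β : ℂ} {X Y Z : SF} (hβ : β ^ 4 = -1) (x : X.c₀.V) (y : Y.c₁.V) (z : Z.c₁.V), map₀
      (assocIso hβ X Y Z).inv (ten₁₁ 1 (ten₀₁ x y) z) = ten₀₀ (par₀ X x) (ten₁₁ 1 y z) +
      ten₀₀ (A₁ X x) (ten₁₁ 0 y z)) ∧
    (∀ {β : ℂ} {X Y Z : SF} (hβ : β ^ 4 = -1) (x : X.c₀.V) (y : Y.c₁.V) (z : Z.c₁.V), map₀
      (assocIso hβ X Y Z).inv (ten₁₁ 2 (ten₀₁ x y) z) = ten₀₀ (par₀ X x) (ten₁₁ 2 y z) +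
      ten₀₀ (A₂ X x) (ten₁₁ 0 y z)) ∧
    (∀ {β : ℂ} {X Y Z : SF} (hβ : β ^ 4 = -1) (x : X.c₀.V) (y : Y.c₁.V) (z : Z.c₁.V), map₀
      (assocIso hβ X Y Z).inv (ten₁₁ 3 (ten₀₁ x y) z) = ten₀₀ x (ten₁₁ 3 y z) - ten₀₀ (A₂ X
      (par₀ X x)) (ten₁₁ 1 y z) + ten₀₀ (A₁ X (par₀ X x)) (ten₁₁ 2 y z) + ten₀₀ (A₁ X (A₂ X
      x)) (ten₁₁ 0 y z)) ∧
    (∀ {β : ℂ} {X Y Z : SF} (hβ : β ^ 4 = -1) (x : X.c₁.V) (y : Y.c₀.V) (z : Z.c₁.V), map₀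
      (assocIso hβ X Y Z).inv (ten₁₁ 0 (ten₁₀ x y) z) = ten₁₁ 0 x (ten₀₁ y z) - ten₁₁ 2
      (par₁ X x) (ten₀₁ (A₁ Y y) z) + ten₁₁ 1 (par₁ X x) (ten₀₁ (A₂ Y y) z) - ten₁₁ 3 x
      (ten₀₁ (A₁ Y (A₂ Y y)) z)) ∧
    (∀ {β : ℂ} {X Y Z : SF} (hβ : β ^ 4 = -1) (x : X.c₁.V) (y : Y.c₀.V) (z : Z.c₁.V), map₀
      (assocIso hβ X Y Z).inv (ten₁₁ 1 (ten₁₀ x y) z) = ten₁₁ 1 x (ten₀₁ y z) - ten₁₁ 3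
      (par₁ X x) (ten₀₁ (A₁ Y y) z)) ∧
    (∀ {β : ℂ} {X Y Z : SF} (hβ : β ^ 4 = -1) (x : X.c₁.V) (y : Y.c₀.V) (z : Z.c₁.V), map₀
      (assocIso hβ X Y Z).inv (ten₁₁ 2 (ten₁₀ x y) z) = ten₁₁ 2 x (ten₀₁ y z) - ten₁₁ 3
      (par₁ X x) (ten₀₁ (A₂ Y y) z)) ∧
    (∀ {β : ℂ} {X Y Z : SF} (hβ : β ^ 4 = -1) (x : X.c₁.V) (y : Y.c₀.V) (z : Z.c₁.V), map₀
      (assocIso hβ X Y Z).inv (ten₁₁ 3 (ten₁₀ x y) z) = ten₁₁ 3 x (ten₀₁ y z)) ∧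
    (∀ {β : ℂ} {X Y Z : SF} (hβ : β ^ 4 = -1) (x : X.c₁.V) (y : Y.c₁.V) (z : Z.c₀.V), map₀
      (assocIso hβ X Y Z).inv (ten₀₀ (ten₁₁ 0 x y) z) = ten₁₁ 0 x (ten₁₀ y z)) ∧
    (∀ {β : ℂ} {X Y Z : SF} (hβ : β ^ 4 = -1) (x : X.c₁.V) (y : Y.c₁.V) (z : Z.c₀.V), map₀
      (assocIso hβ X Y Z).inv (ten₀₀ (ten₁₁ 1 x y) z) = ten₁₁ 1 x (ten₁₀ y z) - ten₁₁ 0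
      (par₁ X x) (ten₁₀ (par₁ Y y) (A₁ Z z))) ∧
    (∀ {β : ℂ} {X Y Z : SF} (hβ : β ^ 4 = -1) (x : X.c₁.V) (y : Y.c₁.V) (z : Z.c₀.V), map₀
      (assocIso hβ X Y Z).inv (ten₀₀ (ten₁₁ 2 x y) z) = ten₁₁ 2 x (ten₁₀ y z) - ten₁₁ 0
      (par₁ X x) (ten₁₀ (par₁ Y y) (A₂ Z z))) ∧
    (∀ {β : ℂ} {X Y Z : SF} (hβ : β ^ 4 = -1) (x : X.c₁.V) (y : Y.c₁.V) (z : Z.c₀.V), map₀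
      (assocIso hβ X Y Z).inv (ten₀₀ (ten₁₁ 3 x y) z) = ten₁₁ 3 x (ten₁₀ y z) - ten₁₁ 1
      (par₁ X x) (ten₁₀ (par₁ Y y) (A₂ Z z)) + ten₁₁ 2 (par₁ X x) (ten₁₀ (par₁ Y y) (A₁ Z
      z)) + ten₁₁ 0 x (ten₁₀ y (A₁ Z (A₂ Z z)))) ∧
    (∀ {β : ℂ} {X Y Z : SF} (hβ : β ^ 4 = -1) (x : X.c₀.V) (y : Y.c₀.V) (z : Z.c₀.V), map₀
      (assocIso hβ X Y Z).inv (ten₀₀ (ten₀₀ x y) z) = ten₀₀ x (ten₀₀ y z)) ∧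
    (∀ {β : ℂ} {X Y Z : SF} (hβ : β ^ 4 = -1) (x : X.c₀.V) (y : Y.c₀.V) (z : Z.c₁.V), map₁
      (assocIso hβ X Y Z).inv (ten₀₁ (ten₀₀ x y) z) = ten₀₁ x (ten₀₁ y z)) ∧
    (∀ {β : ℂ} {X Y Z : SF} (hβ : β ^ 4 = -1) (x : X.c₁.V) (y : Y.c₀.V) (z : Z.c₀.V), map₁
      (assocIso hβ X Y Z).inv (ten₁₀ (ten₁₀ x y) z) = ten₁₀ x (ten₀₀ y z)) ∧
    (∀ {β : ℂ} {X Y Z : SF} (hβ : β ^ 4 = -1) (x : X.c₀.V) (y : Y.c₁.V) (z : Z.c₀.V), map₁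
      (assocIso hβ X Y Z).inv (ten₁₀ (ten₀₁ x y) z) = ten₀₁ x (ten₁₀ y z) - ten₀₁ (A₂ X
      (par₀ X x)) (ten₁₀ (par₁ Y y) (A₁ Z z)) + ten₀₁ (A₁ X (par₀ X x)) (ten₁₀ (par₁ Y y)
      (A₂ Z z)) - ten₀₁ (A₁ X (A₂ X x)) (ten₁₀ y (A₁ Z (A₂ Z z)))) ∧
    (∀ {β : ℂ} {X Y Z : SF} (hβ : β ^ 4 = -1) (x : X.c₁.V) (y : Y.c₁.V) (z : Z.c₁.V), map₁
      (assocIso hβ X Y Z).inv (ten₀₁ (ten₁₁ 0 x y) z) = β ^ 2 • ten₁₀ x (ten₁₁ 3 y z)) ∧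
    (∀ {β : ℂ} {X Y Z : SF} (hβ : β ^ 4 = -1) (x : X.c₁.V) (y : Y.c₁.V) (z : Z.c₁.V), map₁
      (assocIso hβ X Y Z).inv (ten₀₁ (ten₁₁ 1 x y) z) = -(β ^ 2 • ten₁₀ (par₁ X x) (ten₁₁ 1
      y z))) ∧
    (∀ {β : ℂ} {X Y Z : SF} (hβ : β ^ 4 = -1) (x : X.c₁.V) (y : Y.c₁.V) (z : Z.c₁.V), map₁
      (assocIso hβ X Y Z).inv (ten₀₁ (ten₁₁ 2 x y) z) = -(β ^ 2 • ten₁₀ (par₁ X x) (ten₁₁ 2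
      y z))) ∧
    (∀ {β : ℂ} {X Y Z : SF} (hβ : β ^ 4 = -1) (x : X.c₁.V) (y : Y.c₁.V) (z : Z.c₁.V), map₁
      (assocIso hβ X Y Z).inv (ten₀₁ (ten₁₁ 3 x y) z) = -(β ^ 2 • ten₁₀ x (ten₁₁ 0 y z))) :=
  ⟨assocIso_inv_011_zero, assocIso_inv_011_one, assocIso_inv_011_two, assocIso_inv_011_three,
    assocIso_inv_101_zero, assocIso_inv_101_one, assocIso_inv_101_two,
    assocIso_inv_101_three, assocIso_inv_110_zero, assocIso_inv_110_one,
    assocIso_inv_110_two, assocIso_inv_110_three, assocIso_inv_000, assocIso_inv_001,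
    assocIso_inv_100, assocIso_inv_010, assocIso_inv_111_zero, assocIso_inv_111_one,
    assocIso_inv_111_two, assocIso_inv_111_three⟩

end SF

namespace SF

/-! ## The braiding of `SF` on generators -/

section Braiding

variable {X Y Z : SF}

/-- Two linear maps that agree on homogeneous vectors agree. -/
theorem homogeneous_ext {V W : Type} [AddCommGroup V] [Module ℂ V] [AddCommGroup W] [Module ℂ W]
    {ω : V →ₗ[ℂ] V} (hω : ∀ v, ω (ω v) = v) {f g : V →ₗ[ℂ] W} (he : ∀ v, ω v = v → f v = g v)
    (ho : ∀ v, ω v = -v → f v = g v) : f = g := by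
  refine LinearMap.ext fun v => ?_
  have hv : v = (1 / 2 : ℂ) • (v + ω v) + (1 / 2 : ℂ) • (v - ω v) := by module
  rw [hv, map_add, map_add, map_smul, map_smul, map_smul, map_smul,
    he (v + ω v) (by rw [map_add, hω, add_comm]), ho (v - ω v) (by rw [map_sub, hω, neg_sub])]

variable {M : Type} [AddCommGroup M] [Module ℂ M]

/-- Only the left vector has to be homogeneous: its degree alone decides between the identity and
the parity involution on the right factor. -/
theorem tens_c₀_ext_homogeneous {f g : (tens X Y).c₀.V →ₗ[ℂ] M}
    (h : ∀ x : X.c₀.V, par₀ X x = x → f ∘ₗ tenL₀₀ x = g ∘ₗ tenL₀₀ x)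
    (h' : ∀ x : X.c₀.V, par₀ X x = -x → f ∘ₗ tenL₀₀ x = g ∘ₗ tenL₀₀ x)
    (he : ∀ k, ∀ x : X.c₁.V, par₁ X x = x → f ∘ₗ tenL₁₁ k x = g ∘ₗ tenL₁₁ k x)
    (ho : ∀ k, ∀ x : X.c₁.V, par₁ X x = -x → f ∘ₗ tenL₁₁ k x = g ∘ₗ tenL₁₁ k x) : f = g := by
  have key : ∀ k, ∀ x : X.c₁.V, f ∘ₗ tenL₁₁ k x = g ∘ₗ tenL₁₁ k x := fun k x =>
    LinearMap.ext fun y => LinearMap.congr_fun (homogeneous_ext (f := f ∘ₗ tenR₁₁ k y)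
      (g := g ∘ₗ tenR₁₁ k y) par₁_par₁ (fun v hv => LinearMap.congr_fun (he k v hv) y)
      (fun v hv => LinearMap.congr_fun (ho k v hv) y)) x
  refine tens_c₀_ext (fun x => LinearMap.ext fun y => ?_) (key 0) (key 1) (key 2) (key 3)
  exact LinearMap.congr_fun (homogeneous_ext (f := f ∘ₗ tenR₀₀ y) (g := g ∘ₗ tenR₀₀ y) par₀_par₀
    (fun v hv => LinearMap.congr_fun (h v hv) y) (fun v hv => LinearMap.congr_fun (h' v hv) y)) x

theorem tens_c₁_ext_homogeneous {f g : (tens X Y).c₁.V →ₗ[ℂ] M}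
    (h : ∀ x : X.c₀.V, par₀ X x = x → f ∘ₗ tenL₀₁ x = g ∘ₗ tenL₀₁ x)
    (h' : ∀ x : X.c₀.V, par₀ X x = -x → f ∘ₗ tenL₀₁ x = g ∘ₗ tenL₀₁ x)
    (he : ∀ x : X.c₁.V, par₁ X x = x → f ∘ₗ tenL₁₀ x = g ∘ₗ tenL₁₀ x)
    (ho : ∀ x : X.c₁.V, par₁ X x = -x → f ∘ₗ tenL₁₀ x = g ∘ₗ tenL₁₀ x) : f = g :=
  tens_c₁_ext (fun x => LinearMap.ext fun y => LinearMap.congr_fun (homogeneous_ext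
      (f := f ∘ₗ tenR₀₁ y) (g := g ∘ₗ tenR₀₁ y) par₀_par₀
      (fun v hv => LinearMap.congr_fun (h v hv) y)
      (fun v hv => LinearMap.congr_fun (h' v hv) y)) x)
    (fun x => LinearMap.ext fun y => LinearMap.congr_fun (homogeneous_ext
      (f := f ∘ₗ tenR₁₀ y) (g := g ∘ₗ tenR₁₀ y) par₁_par₁
      (fun v hv => LinearMap.congr_fun (he v hv) y)
      (fun v hv => LinearMap.congr_fun (ho v hv) y)) x)

/-- The untwisted component of the braiding. -/
def braid₀ (β : ℂ) (X Y : SF) : (tens X Y).c₀.V →ₗ[ℂ] (tens Y X).c₀.V := braidEven β X Y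

/-- The twisted component of the braiding. -/
def braid₁ (X Y : SF) : (tens X Y).c₁.V →ₗ[ℂ] (tens Y X).c₁.V := braidOdd X Y

theorem expHalf_act (U : SRep G) (u : U.V) :
    U.ρ (expHalf 1) u = u - U.ρ a₁ (U.ρ a₂ u) := by
  simp [expHalf]

theorem expC_C12_apply (x : X.c₀.V) (y : Y.c₀.V) :
    expC (-C12 X.c₀ Y.c₀) (x ⊗ₜ y) = x ⊗ₜ y - A₂ X (par₀ X x) ⊗ₜ A₁ Y y +
      A₁ X (par₀ X x) ⊗ₜ A₂ Y y - A₁ X (A₂ X x) ⊗ₜ A₁ Y (A₂ Y y) := by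
  change _ = x ⊗ₜ[ℂ] y - X.c₀.ρ a₂ (X.c₀.ω x) ⊗ₜ[ℂ] Y.c₀.ρ a₁ y +
    X.c₀.ρ a₁ (X.c₀.ω x) ⊗ₜ[ℂ] Y.c₀.ρ a₂ y - X.c₀.ρ a₁ (X.c₀.ρ a₂ x) ⊗ₜ[ℂ] Y.c₀.ρ a₁ (Y.c₀.ρ a₂ y)
  simp only [expC, C12, LinearMap.add_apply, LinearMap.id_apply, LinearMap.neg_apply,
    LinearMap.sub_apply, LinearMap.smul_apply, LinearMap.comp_apply, TensorProduct.map_tmul,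
    map_neg, map_sub, SRep.ω_a₁, SRep.ω_a₂, SVect.ω_ω, SRep.a₁_a₁, SRep.a₂_a₂, SRep.a₁_a₂,
    TensorProduct.neg_tmul, TensorProduct.tmul_neg, TensorProduct.zero_tmul,
    TensorProduct.tmul_zero]
  module

theorem braid₀_00_of_eq {x : X.c₀.V} {y : Y.c₀.V} {β : ℂ} {w : Y.c₀.V ⊗[ℂ] X.c₀.V}
    (h : braid00 X.c₀ Y.c₀ (x ⊗ₜ y) = w) :
    braid₀ β X Y (ten₀₀ x y) = (i₁ w : (tensorObj Y X).c₀.V) := by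
  change braidEven β X Y (i₁ (x ⊗ₜ y)) = _
  rw [braidEven, LinearMap.inl_apply, LinearMap.prodMap_apply, h, map_zero, LinearMap.inl_apply]

/-- With `x` even, `a₁a₂x` is even and `a₁x`, `a₂x` are odd, so the flip puts the parity on the
partners of the two linear terms only. Moving it past `a_j` reverses the signs of these terms. -/
theorem braid₀_00_even {x : X.c₀.V} (y : Y.c₀.V) (β : ℂ) (hx : par₀ X x = x) :
    braid₀ β X Y (ten₀₀ x y) = ten₀₀ y x + ten₀₀ (A₁ Y (par₀ Y y)) (A₂ X x) -
      ten₀₀ (A₂ Y (par₀ Y y)) (A₁ X x) - ten₀₀ (A₁ Y (A₂ Y y)) (A₁ X (A₂ X x)) := by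
  have h0 : X.c₀.ω x = x := hx
  have h1 : X.c₀.ω (A₁ X x) = -A₁ X x := (par₀_A₁ x).trans (by rw [hx])
  have h2 : X.c₀.ω (A₂ X x) = -A₂ X x := (par₀_A₂ x).trans (by rw [hx])
  have h3 : X.c₀.ω (A₁ X (A₂ X x)) = A₁ X (A₂ X x) :=
    (par₀_A₁ _).trans (by rw [par₀_A₂, hx, map_neg, neg_neg])
  have e : braid00 X.c₀ Y.c₀ (x ⊗ₜ y) = y ⊗ₜ[ℂ] x - par₀ Y (A₁ Y y) ⊗ₜ[ℂ] A₂ X x +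
      par₀ Y (A₂ Y y) ⊗ₜ[ℂ] A₁ X x - A₁ Y (A₂ Y y) ⊗ₜ[ℂ] A₁ X (A₂ X x) := by
    rw [braid00, LinearMap.comp_apply, expC_C12_apply, hx, map_sub, map_add, map_sub,
      superFlip_even_left _ _ h0, superFlip_odd_left _ _ h2, superFlip_odd_left _ _ h1,
      superFlip_even_left _ _ h3]
    rfl
  rw [par₀_A₁, par₀_A₂, TensorProduct.neg_tmul, TensorProduct.neg_tmul, sub_neg_eq_add,
    ← sub_eq_add_neg] at e
  rw [braid₀_00_of_eq e, map_sub, map_sub, map_add]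
  rfl

/-- With `x` odd the roles are exchanged: the constant and the quadratic term receive the parity,
while the linear terms get a sign from `ω x = -x` in the exponential. -/
theorem braid₀_00_odd {x : X.c₀.V} (y : Y.c₀.V) (β : ℂ) (hx : par₀ X x = -x) :
    braid₀ β X Y (ten₀₀ x y) = ten₀₀ (par₀ Y y) x + ten₀₀ (A₁ Y y) (A₂ X x) -
      ten₀₀ (A₂ Y y) (A₁ X x) - ten₀₀ (A₁ Y (A₂ Y (par₀ Y y))) (A₁ X (A₂ X x)) := by
  have h0 : X.c₀.ω x = -x := hx
  have h1 : X.c₀.ω (A₁ X x) = A₁ X x := (par₀_A₁ x).trans (by rw [hx, map_neg, neg_neg])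
  have h2 : X.c₀.ω (A₂ X x) = A₂ X x := (par₀_A₂ x).trans (by rw [hx, map_neg, neg_neg])
  have h3 : X.c₀.ω (A₁ X (A₂ X x)) = -A₁ X (A₂ X x) :=
    (par₀_A₁ _).trans (by rw [par₀_A₂, hx, map_neg, map_neg, map_neg, neg_neg])
  have e : braid00 X.c₀ Y.c₀ (x ⊗ₜ y) = par₀ Y y ⊗ₜ[ℂ] x - -A₁ Y y ⊗ₜ[ℂ] A₂ X x +
      -A₂ Y y ⊗ₜ[ℂ] A₁ X x - par₀ Y (A₁ Y (A₂ Y y)) ⊗ₜ[ℂ] A₁ X (A₂ X x) := by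
    rw [braid00, LinearMap.comp_apply, expC_C12_apply, hx, map_neg, map_neg,
      TensorProduct.neg_tmul, TensorProduct.neg_tmul, map_sub,
      map_add, map_sub, map_neg, map_neg, superFlip_odd_left _ _ h0,
      superFlip_even_left _ _ h2, superFlip_even_left _ _ h1, superFlip_odd_left _ _ h3]
    rfl
  rw [par₀_A₁, par₀_A₂, map_neg, neg_neg, sub_neg_eq_add, ← sub_eq_add_neg] at e
  rw [braid₀_00_of_eq e, map_sub, map_sub, map_add]
  rfl

/-- The vector `y'` absorbs both the flip and the parity in the definition of this sector. The
factor `exp(-Ĉ/2) = 1 + a₁a₂` changes only the basis vector `1`, as `a₁a₂` annihilates the others.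
-/
theorem braid₀_11 {x : X.c₁.V} {y y' : Y.c₁.V} (β : ℂ)
    (h : SVect.flip X.c₁ Y.c₁ (x ⊗ₜ Y.c₁.ω y) = y' ⊗ₜ x) :
    braid₀ β X Y (ten₁₁ 0 x y) = β • (ten₁₁ 0 y' x + ten₁₁ 3 y' x) ∧
    braid₀ β X Y (ten₁₁ 1 x y) = β • ten₁₁ 1 y' x ∧
    braid₀ β X Y (ten₁₁ 2 x y) = β • ten₁₁ 2 y' x ∧
    braid₀ β X Y (ten₁₁ 3 x y) = β • ten₁₁ 3 y' x := by
  have key : ∀ (k : Fin 4) (g : G), expHalf (-1) * basisG k = g →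
      braid₀ β X Y (ten₁₁ k x y) = (i₂ (β • (g ⊗ₜ (y' ⊗ₜ x))) : (tensorObj Y X).c₀.V) := by
    intro k g hg
    refine Prod.ext (map_zero (braid00 X.c₀ Y.c₀)) ?_
    change (β • (map LinearMap.id (SVect.flip X.c₁ Y.c₁) ∘ₗ
      map (LinearMap.mulLeft ℂ (expHalf (-1))) (map LinearMap.id Y.c₁.ω)))
        (basisG k ⊗ₜ (x ⊗ₜ y)) = _
    rw [LinearMap.smul_apply, LinearMap.comp_apply, TensorProduct.map_tmul, TensorProduct.map_tmul,
      TensorProduct.map_tmul, LinearMap.mulLeft_apply, hg]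
    simp only [LinearMap.id_apply]
    rw [h]
    rfl
  have hx : (a₁ * a₂) * a₁ = 0 := by
    rw [mul_assoc, a₂_mul_a₁, mul_neg, ← mul_assoc, Cl.x_mul_x, zero_mul, neg_zero]
  have hy : (a₁ * a₂) * a₂ = 0 := by rw [mul_assoc, Cl.y_mul_y, mul_zero]
  refine ⟨(key 0 (basisG 0 + basisG 3) ?_).trans ?_, (key 1 (basisG 1) ?_).trans ?_,
    (key 2 (basisG 2) ?_).trans ?_, (key 3 (basisG 3) ?_).trans ?_⟩
  · rw [basisG_zero, basisG_three, expHalf, mul_one, neg_one_smul, sub_neg_eq_add]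
  · rw [TensorProduct.add_tmul, map_smul, map_add]; rfl
  · rw [basisG_one, expHalf, neg_one_smul, sub_neg_eq_add, add_mul, one_mul, hx, add_zero]
  · rw [map_smul]; rfl
  · rw [basisG_two, expHalf, neg_one_smul, sub_neg_eq_add, add_mul, one_mul, hy, add_zero]
  · rw [map_smul]; rfl
  · rw [basisG_three, expHalf, neg_one_smul, sub_neg_eq_add, add_mul, one_mul, ← mul_assoc, hx,
      zero_mul, add_zero]
  · rw [map_smul]; rfl

theorem braid₁_01_even {x : X.c₀.V} (y : Y.c₁.V) (hx : par₀ X x = x) :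
    braid₁ X Y (ten₀₁ x y) = ten₁₀ y (x - A₁ X (A₂ X x)) := by
  have h : par₀ X (x - A₁ X (A₂ X x)) = x - A₁ X (A₂ X x) := by
    rw [map_sub, par₀_A₁, par₀_A₂, hx, map_neg, neg_neg]
  have e : braid01 X.c₀ Y.c₁ (x ⊗ₜ y) = y ⊗ₜ (x - A₁ X (A₂ X x)) := by
    rw [braid01, LinearMap.comp_apply, TensorProduct.map_tmul, expHalf_act]
    exact superFlip_even_left _ _ h
  change braidOdd X Y (i₁ (x ⊗ₜ y)) = _
  simp only [braidOdd, LinearMap.add_apply, LinearMap.comp_apply, LinearMap.fst_apply,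
    LinearMap.snd_apply, LinearMap.inl_apply, e, map_zero, add_zero]
  rfl

theorem braid₁_01_odd {x : X.c₀.V} (y : Y.c₁.V) (hx : par₀ X x = -x) :
    braid₁ X Y (ten₀₁ x y) = ten₁₀ (par₁ Y y) (x - A₁ X (A₂ X x)) := by
  have h : par₀ X (x - A₁ X (A₂ X x)) = -(x - A₁ X (A₂ X x)) := by
    rw [map_sub, par₀_A₁, par₀_A₂, hx, map_neg, map_neg, map_neg, neg_neg, neg_sub,
      sub_neg_eq_add, add_comm, sub_eq_add_neg]
  have e : braid01 X.c₀ Y.c₁ (x ⊗ₜ y) = par₁ Y y ⊗ₜ (x - A₁ X (A₂ X x)) := by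
    rw [braid01, LinearMap.comp_apply, TensorProduct.map_tmul, expHalf_act]
    exact superFlip_odd_left _ _ h
  change braidOdd X Y (i₁ (x ⊗ₜ y)) = _
  simp only [braidOdd, LinearMap.add_apply, LinearMap.comp_apply, LinearMap.fst_apply,
    LinearMap.snd_apply, LinearMap.inl_apply, e, map_zero, add_zero]
  rfl

theorem braid₁_10_even {x : X.c₁.V} (y : Y.c₀.V) (hx : par₁ X x = x) :
    braid₁ X Y (ten₁₀ x y) = ten₀₁ (par₀ Y y - A₁ Y (A₂ Y (par₀ Y y))) x := by
  have e : braid10 X.c₁ Y.c₀ (x ⊗ₜ y) = (par₀ Y y - A₁ Y (A₂ Y (par₀ Y y))) ⊗ₜ x := by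
    rw [braid10, LinearMap.comp_apply, LinearMap.comp_apply, TensorProduct.map_tmul,
      TensorProduct.map_tmul, expHalf_act]
    exact superFlip_even_left _ _ hx
  change braidOdd X Y (i₂ (x ⊗ₜ y)) = _
  simp only [braidOdd, LinearMap.add_apply, LinearMap.comp_apply, LinearMap.fst_apply,
    LinearMap.snd_apply, LinearMap.inr_apply, e, map_zero, zero_add]
  rfl

/-- The parity prescribed on `Y` and the one produced by the flip past an odd vector cancel. -/
theorem braid₁_10_odd {x : X.c₁.V} (y : Y.c₀.V) (hx : par₁ X x = -x) :
    braid₁ X Y (ten₁₀ x y) = ten₀₁ (y - A₁ Y (A₂ Y y)) x := by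
  have e : braid10 X.c₁ Y.c₀ (x ⊗ₜ y) = (y - A₁ Y (A₂ Y y)) ⊗ₜ x := by
    rw [braid10, LinearMap.comp_apply, LinearMap.comp_apply, TensorProduct.map_tmul,
      TensorProduct.map_tmul, expHalf_act]
    refine (superFlip_odd_left _ _ hx).trans (congrArg (· ⊗ₜ[ℂ] x) ?_)
    change par₀ Y (par₀ Y y - A₁ Y (A₂ Y (par₀ Y y))) = _
    rw [map_sub, par₀_A₁, par₀_A₂, par₀_par₀, map_neg, neg_neg]
  change braidOdd X Y (i₂ (x ⊗ₜ y)) = _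
  simp only [braidOdd, LinearMap.add_apply, LinearMap.comp_apply, LinearMap.fst_apply,
    LinearMap.snd_apply, LinearMap.inr_apply, e, map_zero, zero_add]
  rfl

/-- The braiding on generators. -/
theorem braid_rules :
    (∀ {X Y : SF} {x : X.c₀.V} (y : Y.c₀.V) (β : ℂ), par₀ X x = x → braid₀ β X Y (ten₀₀ x y) =
      ten₀₀ y x + ten₀₀ (A₁ Y (par₀ Y y)) (A₂ X x) -
      ten₀₀ (A₂ Y (par₀ Y y)) (A₁ X x) - ten₀₀ (A₁ Y (A₂ Y y)) (A₁ X (A₂ X x))) ∧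
    (∀ {X Y : SF} {x : X.c₀.V} (y : Y.c₀.V) (β : ℂ), par₀ X x = -x → braid₀ β X Y (ten₀₀ x y) =
      ten₀₀ (par₀ Y y) x + ten₀₀ (A₁ Y y) (A₂ X x) -
      ten₀₀ (A₂ Y y) (A₁ X x) - ten₀₀ (A₁ Y (A₂ Y (par₀ Y y))) (A₁ X (A₂ X x))) ∧
    (∀ {X Y : SF} {x : X.c₁.V} (y : Y.c₁.V) (β : ℂ), par₁ X x = x →
      braid₀ β X Y (ten₁₁ 0 x y) = β • (ten₁₁ 0 (par₁ Y y) x + ten₁₁ 3 (par₁ Y y) x) ∧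
      braid₀ β X Y (ten₁₁ 1 x y) = β • ten₁₁ 1 (par₁ Y y) x ∧
      braid₀ β X Y (ten₁₁ 2 x y) = β • ten₁₁ 2 (par₁ Y y) x ∧
      braid₀ β X Y (ten₁₁ 3 x y) = β • ten₁₁ 3 (par₁ Y y) x) ∧
    (∀ {X Y : SF} {x : X.c₁.V} (y : Y.c₁.V) (β : ℂ), par₁ X x = -x →
      braid₀ β X Y (ten₁₁ 0 x y) = β • (ten₁₁ 0 y x + ten₁₁ 3 y x) ∧
      braid₀ β X Y (ten₁₁ 1 x y) = β • ten₁₁ 1 y x ∧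
      braid₀ β X Y (ten₁₁ 2 x y) = β • ten₁₁ 2 y x ∧
      braid₀ β X Y (ten₁₁ 3 x y) = β • ten₁₁ 3 y x) ∧
    (∀ {X Y : SF} {x : X.c₀.V} (y : Y.c₁.V), par₀ X x = x →
      braid₁ X Y (ten₀₁ x y) = ten₁₀ y (x - A₁ X (A₂ X x))) ∧
    (∀ {X Y : SF} {x : X.c₀.V} (y : Y.c₁.V), par₀ X x = -x →
      braid₁ X Y (ten₀₁ x y) = ten₁₀ (par₁ Y y) (x - A₁ X (A₂ X x))) ∧
    (∀ {X Y : SF} {x : X.c₁.V} (y : Y.c₀.V), par₁ X x = x →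
      braid₁ X Y (ten₁₀ x y) = ten₀₁ (par₀ Y y - A₁ Y (A₂ Y (par₀ Y y))) x) ∧
    (∀ {X Y : SF} {x : X.c₁.V} (y : Y.c₀.V), par₁ X x = -x →
      braid₁ X Y (ten₁₀ x y) = ten₀₁ (y - A₁ Y (A₂ Y y)) x) :=
  ⟨braid₀_00_even, braid₀_00_odd, fun _ β hx => braid₀_11 β (superFlip_even_left _ _ hx),
    fun _ β hx => braid₀_11 β ((superFlip_odd_left _ _ hx).trans
      (congrArg (· ⊗ₜ[ℂ] _) (par₁_par₁ _))),
    braid₁_01_even, braid₁_01_odd, braid₁_10_even, braid₁_10_odd⟩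

theorem braid₀_par₀ (β : ℂ) (X Y : SF) :
    braid₀ β X Y ∘ₗ par₀ (tens X Y) = par₀ (tens Y X) ∘ₗ braid₀ β X Y := by
  apply tens_c₀_ext_homogeneous
  all_goals try (intro k; fin_cases k)
  all_goals intro x hx; refine LinearMap.ext fun y => ?_
  all_goals
    simp only [LinearMap.comp_apply, tenL_rules, par_rules, ten_linear, map_neg, map_add, map_sub,
      map_smul, braid_rules, hx, grassmann_rules, neg_neg, Fin.mk_zero, Fin.mk_one, Fin.reduceFinMk, smul_add, smul_neg]
  all_goals try module

end Braiding

end SF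

namespace SF

/-! ## The braiding as an isomorphism, and the hexagons -/

section Hexagon

variable {X Y Z : SF}

/-- A vector is the sum of its even and odd parts; this is the form needed for ranges, where the
preimage depends on the degree. -/
theorem homogeneous_mem {V : Type} [AddCommGroup V] [Module ℂ V] {ω : V →ₗ[ℂ] V}
    (hω : ∀ v, ω (ω v) = v) {p : Submodule ℂ V} (he : ∀ v, ω v = v → v ∈ p)
    (ho : ∀ v, ω v = -v → v ∈ p) (v : V) : v ∈ p := by
  have hv : v = (1 / 2 : ℂ) • (v + ω v) + (1 / 2 : ℂ) • (v - ω v) := by module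
  rw [hv]
  exact p.add_mem (p.smul_mem _ (he _ (by rw [map_add, hω, add_comm])))
    (p.smul_mem _ (ho _ (by rw [map_sub, hω, neg_sub])))

theorem braid₀_A₁ (β : ℂ) (X Y : SF) :
    braid₀ β X Y ∘ₗ A₁ (tens X Y) = A₁ (tens Y X) ∘ₗ braid₀ β X Y := by
  apply tens_c₀_ext_homogeneous
  all_goals try (intro k; fin_cases k)
  all_goals intro x hx; refine LinearMap.ext fun y => ?_
  all_goals
    simp only [LinearMap.comp_apply, tenL_rules, par_rules, ten_linear, map_neg, map_add, map_sub,
      map_smul, braid_rules, hx, grassmann_rules, neg_neg, Fin.mk_zero, Fin.mk_one,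
      Fin.reduceFinMk, smul_add, smul_neg, map_zero]
  all_goals try module

theorem braid₀_A₂ (β : ℂ) (X Y : SF) :
    braid₀ β X Y ∘ₗ A₂ (tens X Y) = A₂ (tens Y X) ∘ₗ braid₀ β X Y := by
  apply tens_c₀_ext_homogeneous
  all_goals try (intro k; fin_cases k)
  all_goals intro x hx; refine LinearMap.ext fun y => ?_
  all_goals
    simp only [LinearMap.comp_apply, tenL_rules, par_rules, ten_linear, map_neg, map_add, map_sub,
      map_smul, braid_rules, hx, grassmann_rules, neg_neg, Fin.mk_zero, Fin.mk_one,
      Fin.reduceFinMk, smul_add, smul_neg, map_zero]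
  all_goals try module

theorem braid₁_par₁ (X Y : SF) : braid₁ X Y ∘ₗ par₁ (tens X Y) = par₁ (tens Y X) ∘ₗ braid₁ X Y := by
  apply tens_c₁_ext_homogeneous
  all_goals intro x hx; refine LinearMap.ext fun y => ?_
  all_goals
    simp only [LinearMap.comp_apply, tenL_rules, par_rules, ten_linear, map_neg, map_add, map_sub,
      map_smul, braid_rules, hx, grassmann_rules, neg_neg]
  all_goals try module

/-- The braiding as a morphism. -/
def braidHom (β : ℂ) (X Y : SF) : tens X Y ⟶ tens Y X :=
  homMk (braid₀ β X Y) (braid₁ X Y) (braid₀_par₀ β X Y) (braid₀_A₁ β X Y) (braid₀_A₂ β X Y)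
    (braid₁_par₁ X Y)

theorem map₀_braidHom (β : ℂ) (X Y : SF) : map₀ (braidHom β X Y) = braid₀ β X Y := rfl
theorem map₁_braidHom (β : ℂ) (X Y : SF) : map₁ (braidHom β X Y) = braid₁ X Y := rfl

theorem range_braid₀ {β : ℂ} (hβ : β ^ 4 = -1) : LinearMap.range (braid₀ β X Y) = ⊤ := by
  -- The scalar `-β³` is the inverse of `β`, because `β⁴ = -1`.
  have hβ' : ∀ v : (tens Y X).c₀.V, (-β ^ 3) • β • v = v := fun v => by
    rw [smul_smul, neg_mul, ← pow_succ, hβ, neg_neg, one_smul]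
  refine tens_c₀_eq_top (fun y x => ?_) (fun k y x => ?_)
  · refine homogeneous_mem (p := (LinearMap.range (braid₀ β X Y)).comap (tenL₀₀ y)) par₀_par₀
      -- The witnesses are the values of `exp(C)` on the flip of `y ⊗ x`: on `x ⊗ y` for even `x`,
      -- and on `x ⊗ ω y` for odd `x`.
      (fun x hx => ⟨ten₀₀ x y + ten₀₀ (A₂ X x) (A₁ Y y) - ten₀₀ (A₁ X x) (A₂ Y y) -
        ten₀₀ (A₁ X (A₂ X x)) (A₁ Y (A₂ Y y)), ?_⟩)
      (fun x hx => ⟨ten₀₀ x (par₀ Y y) - ten₀₀ (A₂ X x) (A₁ Y (par₀ Y y)) +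
        ten₀₀ (A₁ X x) (A₂ Y (par₀ Y y)) - ten₀₀ (A₁ X (A₂ X x)) (A₁ Y (A₂ Y (par₀ Y y))), ?_⟩) x
    all_goals
      simp only [LinearMap.comp_apply, tenL_rules, par_rules, ten_linear, map_neg, map_add, map_sub,
        map_smul, braid_rules, hx, grassmann_rules, neg_neg, map_zero, neg_zero]
      module
  · refine homogeneous_mem (p := (LinearMap.range (braid₀ β X Y)).comap (tenL₁₁ k y)) par₁_par₁
      (fun x hx => ?_) (fun x hx => ?_) x
    · fin_cases k
      -- The inverse of `1 + a₁a₂` is `1 - a₁a₂`; the parity on `y` cancels the one that the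
      -- braiding applies when `x` is even.
      · refine ⟨(-β ^ 3) • (ten₁₁ 0 x (par₁ Y y) - ten₁₁ 3 x (par₁ Y y)), ?_⟩
        simp only [par_rules, map_sub, map_smul, braid_rules, hx, tenL_rules, Fin.mk_zero, hβ', smul_sub,
          smul_add, add_sub_cancel_right]
      · refine ⟨(-β ^ 3) • ten₁₁ 1 x (par₁ Y y), ?_⟩
        simp only [par_rules, map_sub, map_smul, braid_rules, hx, tenL_rules, Fin.mk_one, hβ', smul_sub,
          smul_add, add_sub_cancel_right]
      · refine ⟨(-β ^ 3) • ten₁₁ 2 x (par₁ Y y), ?_⟩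
        simp only [par_rules, map_sub, map_smul, braid_rules, hx, tenL_rules, Fin.reduceFinMk, hβ', smul_sub,
          smul_add, add_sub_cancel_right]
      · refine ⟨(-β ^ 3) • ten₁₁ 3 x (par₁ Y y), ?_⟩
        simp only [par_rules, map_sub, map_smul, braid_rules, hx, tenL_rules, Fin.reduceFinMk, hβ', smul_sub,
          smul_add, add_sub_cancel_right]
    · fin_cases k
      · refine ⟨(-β ^ 3) • (ten₁₁ 0 x y - ten₁₁ 3 x y), ?_⟩
        simp only [par_rules, map_sub, map_smul, braid_rules, hx, tenL_rules, Fin.mk_zero, hβ', smul_sub,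
          smul_add, add_sub_cancel_right]
      · refine ⟨(-β ^ 3) • ten₁₁ 1 x y, ?_⟩
        simp only [par_rules, map_sub, map_smul, braid_rules, hx, tenL_rules, Fin.mk_one, hβ', smul_sub,
          smul_add, add_sub_cancel_right]
      · refine ⟨(-β ^ 3) • ten₁₁ 2 x y, ?_⟩
        simp only [par_rules, map_sub, map_smul, braid_rules, hx, tenL_rules, Fin.reduceFinMk, hβ', smul_sub,
          smul_add, add_sub_cancel_right]
      · refine ⟨(-β ^ 3) • ten₁₁ 3 x y, ?_⟩
        simp only [par_rules, map_sub, map_smul, braid_rules, hx, tenL_rules, Fin.reduceFinMk, hβ', smul_sub,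
          smul_add, add_sub_cancel_right]

theorem range_braid₁ : LinearMap.range (braid₁ X Y) = ⊤ := by
  refine tens_c₁_eq_top (fun y x => ?_) (fun y x => ?_)
  · refine homogeneous_mem (p := (LinearMap.range (braid₁ X Y)).comap (tenL₀₁ y)) par₁_par₁
      -- Here and below `1 + a₁a₂` inverts the factor `exp(Ĉ/2) = 1 - a₁a₂`, and the parities undo
      -- those of the flip and of the definition.
      (fun x hx => ⟨ten₁₀ x (par₀ Y y + A₁ Y (A₂ Y (par₀ Y y))), ?_⟩)
      (fun x hx => ⟨ten₁₀ x (y + A₁ Y (A₂ Y y)), ?_⟩) x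
    all_goals
      simp only [tenL_rules, par_rules, ten_linear, map_neg, map_add, map_sub,
        braid_rules, hx, grassmann_rules, neg_neg, map_zero, neg_zero]
      module
  · refine homogeneous_mem (p := (LinearMap.range (braid₁ X Y)).comap (tenL₁₀ y)) par₀_par₀
      (fun x hx => ⟨ten₀₁ x y + ten₀₁ (A₁ X (A₂ X x)) y, ?_⟩)
      (fun x hx => ⟨ten₀₁ x (par₁ Y y) + ten₀₁ (A₁ X (A₂ X x)) (par₁ Y y), ?_⟩) x
    all_goals
      simp only [tenL_rules, par_rules, ten_linear, map_neg, map_add, map_sub,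
        braid_rules, hx, grassmann_rules, neg_neg, map_zero, neg_zero]
      module

/-- The braiding as an isomorphism. -/
def braidIso {β : ℂ} (hβ : β ^ 4 = -1) (X Y : SF) : tens X Y ≅ tens Y X :=
  isoOfBijective (braidHom β X Y)
    (bijective_of_range_eq_top _ (by simp only [finrank_tens_c₀]; ring) (range_braid₀ hβ))
    (bijective_of_range_eq_top _ (by simp only [finrank_tens_c₁]; ring) range_braid₁)

theorem braidHom_naturality (β : ℂ) {X X' Y Y' : SF} (f : X ⟶ X') (g : Y ⟶ Y') :
    tensHom f g ≫ braidHom β X' Y' = braidHom β X Y ≫ tensHom g f := by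
  -- Morphisms are even, so the image of a homogeneous vector has the same degree and the rules for
  -- the braiding apply in the target as well.
  have h₀ : ∀ x, par₀ X x = x → par₀ X' (map₀ f x) = map₀ f x := fun x hx => by
    rw [← map₀_par₀, hx]
  have h₀' : ∀ x, par₀ X x = -x → par₀ X' (map₀ f x) = -map₀ f x := fun x hx => by
    rw [← map₀_par₀, hx, map_neg]
  have h₁ : ∀ x, par₁ X x = x → par₁ X' (map₁ f x) = map₁ f x := fun x hx => by
    rw [← map₁_par₁, hx]
  have h₁' : ∀ x, par₁ X x = -x → par₁ X' (map₁ f x) = -map₁ f x := fun x hx => by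
    rw [← map₁_par₁, hx, map_neg]
  apply hom_ext
  · apply tens_c₀_ext_homogeneous
    all_goals try (intro k; fin_cases k)
    all_goals intro x hx; refine LinearMap.ext fun y => ?_
    all_goals
      simp only [LinearMap.comp_apply, tenL_rules, map₀_comp, tensHom_rules, map₀_braidHom, map_add,
        map_sub, map_smul, braid_rules, hx, h₀, h₀', h₁, h₁', map₀_par₀, map₀_A₁, map₀_A₂, map₁_par₁,
        Fin.mk_zero, Fin.mk_one, Fin.reduceFinMk]
  · apply tens_c₁_ext_homogeneous
    all_goals intro x hx; refine LinearMap.ext fun y => ?_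
    all_goals
      simp only [LinearMap.comp_apply, tenL_rules, map₁_comp, tensHom_rules, map₁_braidHom, map_add,
        map_sub, braid_rules, hx, h₀, h₀', h₁, h₁', map₀_par₀, map₀_A₁, map₀_A₂, map₁_par₁]

theorem assocHom_naturality (β : ℂ) {X X' Y Y' Z Z' : SF} (f : X ⟶ X') (g : Y ⟶ Y') (h : Z ⟶ Z') :
    tensHom f (tensHom g h) ≫ assocHom β X' Y' Z' =
      assocHom β X Y Z ≫ tensHom (tensHom f g) h := by
  apply hom_ext
  all_goals
    repeat' (first | apply tens_c₀_ext | apply tens_c₁_ext | apply LinearMap.ext | intro _)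
  all_goals
    simp only [LinearMap.comp_apply, tenL_rules, map₀_comp, map₁_comp, tensHom_rules,
      map₀_assocHom, map₁_assocHom, map_add, map_sub, map_neg, map_smul, assoc_rules, map₀_par₀, map₀_A₁,
      map₀_A₂, map₁_par₁]

/-- The braidings have `X * Y`, `X` and `Y` on the left, so both `x` and `y` are taken homogeneous;
their tensor product is then homogeneous too. -/
theorem hexagon_reverse₀ {β : ℂ} (X Y Z : SF) :
    map₀ (assocHom β Z X Y) ∘ₗ map₀ (braidHom β (tens X Y) Z) ∘ₗ map₀ (assocHom β X Y Z) =
      map₀ (tensHom (braidHom β X Z) (𝟙 Y)) ∘ₗ map₀ (assocHom β X Z Y) ∘ₗ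
        map₀ (tensHom (𝟙 X) (braidHom β Y Z)) := by
  apply tens_c₀_ext_homogeneous
  all_goals try (intro k; fin_cases k)
  all_goals intro x hx
  all_goals first | apply tens_c₀_ext_homogeneous | apply tens_c₁_ext_homogeneous
  all_goals try (intro k; fin_cases k)
  all_goals intro y hy; refine LinearMap.ext fun z => ?_
  all_goals
    simp only [LinearMap.comp_apply, tenL_rules, tensHom_rules, LinearMap.id_apply, map₀_assocHom,
      map₁_assocHom, map₀_braidHom, map₁_braidHom, assoc_rules, braid_rules, hx, hy, par_rules,
      ten_linear, grassmann_rules, map_add, map_sub, map_neg, map_smul, map_zero, Fin.mk_zero,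
      Fin.mk_one, Fin.reduceFinMk, neg_neg, neg_zero, add_zero, zero_add, sub_zero]
  all_goals module

/-- For three twisted objects one side contains two associators, the other two braidings and one
associator: both have the factor `β⁴`, and no condition on `β` is needed. -/
theorem hexagon_reverse₁ {β : ℂ} (X Y Z : SF) :
    map₁ (assocHom β Z X Y) ∘ₗ map₁ (braidHom β (tens X Y) Z) ∘ₗ map₁ (assocHom β X Y Z) =
      map₁ (tensHom (braidHom β X Z) (𝟙 Y)) ∘ₗ map₁ (assocHom β X Z Y) ∘ₗ
        map₁ (tensHom (𝟙 X) (braidHom β Y Z)) := by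
  apply tens_c₁_ext_homogeneous
  all_goals intro x hx
  all_goals first | apply tens_c₀_ext_homogeneous | apply tens_c₁_ext_homogeneous
  all_goals try (intro k; fin_cases k)
  all_goals intro y hy; refine LinearMap.ext fun z => ?_
  all_goals
    simp only [LinearMap.comp_apply, tenL_rules, tensHom_rules, LinearMap.id_apply, map₀_assocHom,
      map₁_assocHom, map₀_braidHom, map₁_braidHom, assoc_rules, braid_rules, hx, hy, par_rules,
      ten_linear, grassmann_rules, map_add, map_sub, map_neg, map_smul, map_zero, Fin.mk_zero,
      Fin.mk_one, Fin.reduceFinMk, neg_neg, neg_zero, add_zero, zero_add, sub_zero]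
  all_goals module

/-- The hexagon is solved for the braiding with `Y * Z`, which leaves a single inverse associator.
In all its braidings `X` stands on the left, so only `x` has to be homogeneous. -/
theorem hexagon_forward₀ {β : ℂ} (hβ : β ^ 4 = -1) (X Y Z : SF) :
    map₀ (braidHom β X (tens Y Z)) =
      map₀ (assocHom β Y Z X) ∘ₗ map₀ (tensHom (𝟙 Y) (braidHom β X Z)) ∘ₗ
        map₀ (assocIso hβ Y X Z).inv ∘ₗ map₀ (tensHom (braidHom β X Y) (𝟙 Z)) ∘ₗ
          map₀ (assocHom β X Y Z) := by
  apply tens_c₀_ext_homogeneous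
  all_goals try (intro k; fin_cases k)
  all_goals intro x hx
  all_goals first | apply tens_c₀_ext | apply tens_c₁_ext
  all_goals intro y; refine LinearMap.ext fun z => ?_
  all_goals
    simp only [LinearMap.comp_apply, tenL_rules, tensHom_rules, LinearMap.id_apply, map₀_assocHom,
      map₁_assocHom, map₀_braidHom, map₁_braidHom, assoc_rules, braid_rules, hx, par_rules,
      ten_linear, grassmann_rules, map_add, map_sub, map_neg, map_smul, map_zero, Fin.mk_zero,
      Fin.mk_one, Fin.reduceFinMk, neg_neg, neg_zero, add_zero, zero_add, sub_zero, assocIso_inv_rules]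
  all_goals module

theorem hexagon_forward₁ {β : ℂ} (hβ : β ^ 4 = -1) (X Y Z : SF) :
    map₁ (braidHom β X (tens Y Z)) =
      map₁ (assocHom β Y Z X) ∘ₗ map₁ (tensHom (𝟙 Y) (braidHom β X Z)) ∘ₗ
        map₁ (assocIso hβ Y X Z).inv ∘ₗ map₁ (tensHom (braidHom β X Y) (𝟙 Z)) ∘ₗ
          map₁ (assocHom β X Y Z) := by
  -- For three twisted objects the left side has no factor `β`; the right side has three associators
  -- and two braidings, which contribute `β² β β² β β² = β⁸`.
  have hβ' : β ^ 8 = 1 := by linear_combination (β ^ 4 - 1) * hβ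
  apply tens_c₁_ext_homogeneous
  all_goals intro x hx
  all_goals first | apply tens_c₀_ext | apply tens_c₁_ext
  all_goals intro y; refine LinearMap.ext fun z => ?_
  all_goals
    simp only [LinearMap.comp_apply, tenL_rules, tensHom_rules, LinearMap.id_apply, map₀_assocHom,
      map₁_assocHom, map₀_braidHom, map₁_braidHom, assoc_rules, braid_rules, hx, par_rules,
      ten_linear, grassmann_rules, map_add, map_sub, map_neg, map_smul, map_zero, Fin.mk_zero,
      Fin.mk_one, Fin.reduceFinMk, neg_neg, neg_zero, add_zero, zero_add, sub_zero, assocIso_inv_rules]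
  all_goals
    match_scalars
    all_goals first | ring1 | linear_combination hβ' | linear_combination -hβ'

end Hexagon

end SF

namespace SF

/-! ## `SF` as a braided monoidal category -/

section Structure

/-- The tensor unit, as an opaque object. -/
def unit : SF := tensorUnit

variable {X Y : SF}

/-- The element `z` of the tensor unit. -/
def unitElt (z : ℂ) : unit.c₀.V := z

theorem par₀_unit (z : unit.c₀.V) : par₀ unit z = z := rfl
theorem A₁_unit (z : unit.c₀.V) : A₁ unit z = 0 := by
  change (Cl.lift (c := 0) (A := Module.End ℂ ℂ) 0 0 (by simp) (by simp) (by simp)) Cl.x z = 0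
  rw [Cl.lift_x]
  rfl
theorem A₂_unit (z : unit.c₀.V) : A₂ unit z = 0 := by
  change (Cl.lift (c := 0) (A := Module.End ℂ ℂ) 0 0 (by simp) (by simp) (by simp)) Cl.y z = 0
  rw [Cl.lift_y]
  rfl

/-- The untwisted component of the left unit isomorphism. -/
def left₀ (X : SF) : (tens unit X).c₀.V →ₗ[ℂ] X.c₀.V := (lid ℂ X.c₀.V).toLinearMap ∘ₗ p₁
/-- The twisted component of the left unit isomorphism. -/
def left₁ (X : SF) : (tens unit X).c₁.V →ₗ[ℂ] X.c₁.V := (lid ℂ X.c₁.V).toLinearMap ∘ₗ p₁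
/-- The untwisted component of the right unit isomorphism. -/
def right₀ (X : SF) : (tens X unit).c₀.V →ₗ[ℂ] X.c₀.V := (rid ℂ X.c₀.V).toLinearMap ∘ₗ p₁
/-- The twisted component of the right unit isomorphism. -/
def right₁ (X : SF) : (tens X unit).c₁.V →ₗ[ℂ] X.c₁.V := (rid ℂ X.c₁.V).toLinearMap ∘ₗ p₂

/-- The scalar given by an element of the tensor unit. -/
def scalar (z : unit.c₀.V) : ℂ := z

/-- The unit is untwisted with trivial action, so each unit isomorphism is scalar multiplication on
one summand and projects away the summand in which the unit would be twisted. -/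
theorem unit_rules :
    (∀ {X : SF} (z : unit.c₀.V) (x : X.c₀.V), left₀ X (ten₀₀ z x) = scalar z • x) ∧
    (∀ {X : SF} (k : Fin 4) (z : unit.c₁.V) (x : X.c₁.V), left₀ X (ten₁₁ k z x) = 0) ∧
    (∀ {X : SF} (z : unit.c₀.V) (x : X.c₁.V), left₁ X (ten₀₁ z x) = scalar z • x) ∧
    (∀ {X : SF} (z : unit.c₁.V) (x : X.c₀.V), left₁ X (ten₁₀ z x) = 0) ∧
    (∀ {X : SF} (x : X.c₀.V) (z : unit.c₀.V), right₀ X (ten₀₀ x z) = scalar z • x) ∧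
    (∀ {X : SF} (k : Fin 4) (x : X.c₁.V) (z : unit.c₁.V), right₀ X (ten₁₁ k x z) = 0) ∧
    (∀ {X : SF} (x : X.c₀.V) (z : unit.c₁.V), right₁ X (ten₀₁ x z) = 0) ∧
    (∀ {X : SF} (x : X.c₁.V) (z : unit.c₀.V), right₁ X (ten₁₀ x z) = scalar z • x) ∧
    (∀ z : unit.c₀.V, par₀ unit z = z) ∧ (∀ z : unit.c₀.V, A₁ unit z = 0) ∧
    (∀ z : unit.c₀.V, A₂ unit z = 0) :=
  ⟨fun z x => TensorProduct.lid_tmul x (scalar z), fun _ _ _ => map_zero (lid ℂ _),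
    fun z x => TensorProduct.lid_tmul x (scalar z), fun _ _ => map_zero (lid ℂ _),
    fun x z => TensorProduct.rid_tmul x (scalar z), fun _ _ _ => map_zero (rid ℂ _),
    fun _ _ => map_zero (rid ℂ _), fun x z => TensorProduct.rid_tmul x (scalar z), par₀_unit,
    A₁_unit, A₂_unit⟩

theorem left₀_par₀ (X : SF) : left₀ X ∘ₗ par₀ (tens unit X) = par₀ X ∘ₗ left₀ X := by
  apply tens_c₀_ext <;> intro z <;> refine LinearMap.ext fun x => ?_ <;>
    simp only [LinearMap.comp_apply, tenL_rules, par_rules, unit_rules, map_smul, map_zero, map_neg,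
      neg_zero]

theorem left₀_A₁ (X : SF) : left₀ X ∘ₗ A₁ (tens unit X) = A₁ X ∘ₗ left₀ X := by
  apply tens_c₀_ext <;> intro z <;> refine LinearMap.ext fun x => ?_ <;>
    simp only [LinearMap.comp_apply, tenL_rules, grassmann_rules, unit_rules, map_smul, map_zero,
      map_neg, map_add, neg_zero, ten_linear, zero_add]

theorem left₀_A₂ (X : SF) : left₀ X ∘ₗ A₂ (tens unit X) = A₂ X ∘ₗ left₀ X := by
  apply tens_c₀_ext <;> intro z <;> refine LinearMap.ext fun x => ?_ <;>
    simp only [LinearMap.comp_apply, tenL_rules, grassmann_rules, unit_rules, map_smul, map_zero,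
      map_neg, map_add, neg_zero, ten_linear, zero_add]

theorem left₁_par₁ (X : SF) : left₁ X ∘ₗ par₁ (tens unit X) = par₁ X ∘ₗ left₁ X := by
  apply tens_c₁_ext <;> intro z <;> refine LinearMap.ext fun x => ?_ <;>
    simp only [LinearMap.comp_apply, tenL_rules, par_rules, unit_rules, map_smul, map_zero, map_neg,
      neg_zero]

theorem right₀_par₀ (X : SF) : right₀ X ∘ₗ par₀ (tens X unit) = par₀ X ∘ₗ right₀ X := by
  apply tens_c₀_ext <;> intro z <;> refine LinearMap.ext fun x => ?_ <;>
    simp only [LinearMap.comp_apply, tenL_rules, par_rules, unit_rules, map_smul, map_zero, map_neg,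
      neg_zero]

theorem right₀_A₁ (X : SF) : right₀ X ∘ₗ A₁ (tens X unit) = A₁ X ∘ₗ right₀ X := by
  apply tens_c₀_ext <;> intro z <;> refine LinearMap.ext fun x => ?_ <;>
    simp only [LinearMap.comp_apply, tenL_rules, grassmann_rules, unit_rules, map_smul, map_zero,
      map_neg, map_add, neg_zero, ten_linear, add_zero]

theorem right₀_A₂ (X : SF) : right₀ X ∘ₗ A₂ (tens X unit) = A₂ X ∘ₗ right₀ X := by
  apply tens_c₀_ext <;> intro z <;> refine LinearMap.ext fun x => ?_ <;>
    simp only [LinearMap.comp_apply, tenL_rules, grassmann_rules, unit_rules, map_smul, map_zero,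
      map_neg, map_add, neg_zero, ten_linear, add_zero]

theorem right₁_par₁ (X : SF) : right₁ X ∘ₗ par₁ (tens X unit) = par₁ X ∘ₗ right₁ X := by
  apply tens_c₁_ext <;> intro z <;> refine LinearMap.ext fun x => ?_ <;>
    simp only [LinearMap.comp_apply, tenL_rules, par_rules, unit_rules, map_smul, map_zero, map_neg,
      neg_zero]

theorem finrank_unit : Module.finrank ℂ unit.c₀.V = 1 ∧ Module.finrank ℂ unit.c₁.V = 0 :=
  ⟨Module.finrank_self ℂ, Module.finrank_zero_of_subsingleton (M := PUnit)⟩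

theorem scalar_one (V : Type) [AddCommGroup V] [Module ℂ V] (v : V) :
    scalar (unitElt 1) • v = v := one_smul ℂ v

/-- The left unit isomorphism. -/
def leftIso (X : SF) : tens unit X ≅ X :=
  isoOfBijective (homMk (left₀ X) (left₁ X) (left₀_par₀ X) (left₀_A₁ X) (left₀_A₂ X) (left₁_par₁ X))
    (bijective_of_range_eq_top _ (by rw [finrank_tens_c₀, finrank_unit.1, finrank_unit.2]; ring)
      (LinearMap.range_eq_top.2 fun x => ⟨ten₀₀ (unitElt 1) x, (unit_rules.1 _ x).trans
        (scalar_one _ x)⟩))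
    (bijective_of_range_eq_top _ (by rw [finrank_tens_c₁, finrank_unit.1, finrank_unit.2]; ring)
      (LinearMap.range_eq_top.2 fun x => ⟨ten₀₁ (unitElt 1) x, (unit_rules.2.2.1 _ x).trans
        (scalar_one _ x)⟩))

/-- The right unit isomorphism. -/
def rightIso (X : SF) : tens X unit ≅ X :=
  isoOfBijective (homMk (right₀ X) (right₁ X) (right₀_par₀ X) (right₀_A₁ X) (right₀_A₂ X)
      (right₁_par₁ X))
    (bijective_of_range_eq_top _ (by rw [finrank_tens_c₀, finrank_unit.1, finrank_unit.2]; ring)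
      (LinearMap.range_eq_top.2 fun x => ⟨ten₀₀ x (unitElt 1), (unit_rules.2.2.2.2.1 x _).trans
        (scalar_one _ x)⟩))
    (bijective_of_range_eq_top _ (by rw [finrank_tens_c₁, finrank_unit.1, finrank_unit.2]; ring)
      (LinearMap.range_eq_top.2 fun x => ⟨ten₁₀ x (unitElt 1),
        (unit_rules.2.2.2.2.2.2.2.1 x _).trans (scalar_one _ x)⟩))

theorem unitIso_rules : (∀ X : SF, map₀ (leftIso X).hom = left₀ X) ∧
    (∀ X : SF, map₁ (leftIso X).hom = left₁ X) ∧ (∀ X : SF, map₀ (rightIso X).hom = right₀ X) ∧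
    (∀ X : SF, map₁ (rightIso X).hom = right₁ X) :=
  ⟨fun _ => rfl, fun _ => rfl, fun _ => rfl, fun _ => rfl⟩

theorem leftIso_naturality (f : X ⟶ Y) :
    tensHom (𝟙 unit) f ≫ (leftIso Y).hom = (leftIso X).hom ≫ f := by
  apply hom_ext
  all_goals first | apply tens_c₀_ext | apply tens_c₁_ext
  all_goals
    intro z; refine LinearMap.ext fun x => ?_
    simp only [LinearMap.comp_apply, tenL_rules, map₀_comp, map₁_comp, unitIso_rules, unit_rules,
      tensHom_rules, LinearMap.id_apply, map_smul, map_zero]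

theorem rightIso_naturality (f : X ⟶ Y) :
    tensHom f (𝟙 unit) ≫ (rightIso Y).hom = (rightIso X).hom ≫ f := by
  apply hom_ext
  all_goals first | apply tens_c₀_ext | apply tens_c₁_ext
  all_goals
    intro z; refine LinearMap.ext fun x => ?_
    simp only [LinearMap.comp_apply, tenL_rules, map₀_comp, map₁_comp, unitIso_rules, unit_rules,
      tensHom_rules, LinearMap.id_apply, map_smul, map_zero]

/-- With the unit in the middle the only associator that could be nontrivial is sector 101, and
there `exp(C)` acts through `a₁`, `a₂` on the unit, where they vanish. -/
theorem assocHom_triangle (β : ℂ) (X Y : SF) :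
    tensHom (𝟙 X) (leftIso Y).hom =
      assocHom β X unit Y ≫ tensHom (rightIso X).hom (𝟙 Y) := by
  apply hom_ext
  all_goals
    repeat' (first | apply tens_c₀_ext | apply tens_c₁_ext | apply LinearMap.ext | intro _)
  all_goals
    simp only [LinearMap.comp_apply, tenL_rules, map₀_comp, map₁_comp, unitIso_rules, unit_rules,
      tensHom_rules, LinearMap.id_apply, map_smul, map_zero, assoc_rules, map₀_assocHom,
      map₁_assocHom, ten_linear, map_add, map_sub, map_neg, smul_zero, neg_zero, sub_zero, add_zero]

/-- The tensor product of isomorphisms. -/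
def tensIso {X X' Y Y' : SF} (e : X ≅ X') (e' : Y ≅ Y') : tens X Y ≅ tens X' Y' where
  hom := tensHom e.hom e'.hom
  inv := tensHom e.inv e'.inv
  hom_inv_id := by rw [tensHom_comp, e.hom_inv_id, e'.hom_inv_id, tensHom_id]
  inv_hom_id := by rw [tensHom_comp, e.inv_hom_id, e'.inv_hom_id, tensHom_id]

variable {β : ℂ} (hβ : β ^ 4 = -1)

theorem assocIso_inv_pentagon (W X Y Z : SF) :
    tensHom (assocIso hβ W X Y).inv (𝟙 Z) ≫ (assocIso hβ W (tens X Y) Z).inv ≫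
      tensHom (𝟙 W) (assocIso hβ X Y Z).inv =
      (assocIso hβ (tens W X) Y Z).inv ≫ (assocIso hβ W X (tens Y Z)).inv := by
  have h : assocIso hβ W X (tens Y Z) ≪≫ assocIso hβ (tens W X) Y Z =
      tensIso (Iso.refl W) (assocIso hβ X Y Z) ≪≫ assocIso hβ W (tens X Y) Z ≪≫
        tensIso (assocIso hβ W X Y) (Iso.refl Z) := Iso.ext (assocHom_pentagon hβ W X Y Z)
  -- The pentagon is proved for the direction `X(YZ) → (XY)Z`; inverting both sides gives the form
  -- for the opposite convention.
  have h' := congrArg Iso.inv h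
  rw [Iso.trans_inv, Iso.trans_inv, Iso.trans_inv, Category.assoc] at h'
  exact h'.symm

theorem assocIso_inv_naturality {X X' Y Y' Z Z' : SF} (f : X ⟶ X') (g : Y ⟶ Y') (h : Z ⟶ Z') :
    tensHom (tensHom f g) h ≫ (assocIso hβ X' Y' Z').inv =
      (assocIso hβ X Y Z).inv ≫ tensHom f (tensHom g h) := by
  rw [Iso.comp_inv_eq, Category.assoc, Iso.eq_inv_comp]
  exact (assocHom_naturality β f g h).symm

theorem assocIso_inv_triangle (X Y : SF) :
    (assocIso hβ X unit Y).inv ≫ tensHom (𝟙 X) (leftIso Y).hom = tensHom (rightIso X).hom (𝟙 Y) := by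
  rw [Iso.inv_comp_eq]
  exact assocHom_triangle β X Y

theorem hexagon_forward (X Y Z : SF) :
    (assocIso hβ X Y Z).inv ≫ (braidIso hβ X (tens Y Z)).hom ≫ (assocIso hβ Y Z X).inv =
      tensHom (braidIso hβ X Y).hom (𝟙 Z) ≫ (assocIso hβ Y X Z).inv ≫
        tensHom (𝟙 Y) (braidIso hβ X Z).hom := by
  -- The computed form of the hexagon has the outer associators on the other side; they cancel after
  -- substitution.
  have h : (braidIso hβ X (tens Y Z)).hom = (assocIso hβ X Y Z).hom ≫
      tensHom (braidIso hβ X Y).hom (𝟙 Z) ≫ (assocIso hβ Y X Z).inv ≫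
        tensHom (𝟙 Y) (braidIso hβ X Z).hom ≫ (assocIso hβ Y Z X).hom :=
    hom_ext (hexagon_forward₀ hβ X Y Z) (hexagon_forward₁ hβ X Y Z)
  rw [h]
  simp only [Category.assoc, Iso.inv_hom_id_assoc, Iso.hom_inv_id, Category.comp_id]

theorem hexagon_reverse (X Y Z : SF) :
    (assocIso hβ X Y Z).hom ≫ (braidIso hβ (tens X Y) Z).hom ≫ (assocIso hβ Z X Y).hom =
      tensHom (𝟙 X) (braidIso hβ Y Z).hom ≫ (assocIso hβ X Z Y).hom ≫
        tensHom (braidIso hβ X Z).hom (𝟙 Y) :=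
  hom_ext (hexagon_reverse₀ X Y Z) (hexagon_reverse₁ X Y Z)

theorem braidIso_naturality_right (X : SF) {Y Z : SF} (f : Y ⟶ Z) :
    tensHom (𝟙 X) f ≫ (braidIso hβ X Z).hom = (braidIso hβ X Y).hom ≫ tensHom f (𝟙 X) :=
  braidHom_naturality β (𝟙 X) f

theorem braidIso_naturality_left {X Y : SF} (f : X ⟶ Y) (Z : SF) :
    tensHom f (𝟙 Z) ≫ (braidIso hβ Y Z).hom = (braidIso hβ X Z).hom ≫ tensHom (𝟙 Z) f :=
  braidHom_naturality β f (𝟙 Z)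

theorem tensHom_def {X X' Y Y' : SF} (f : X ⟶ X') (g : Y ⟶ Y') :
    tensHom f g = tensHom f (𝟙 Y) ≫ tensHom (𝟙 X') g := by
  rw [tensHom_comp, Category.comp_id, Category.id_comp]

/-- The tensor product of `SF` with its structure isomorphisms. -/
@[reducible] def tensStruct : MonoidalCategoryStruct SF where
  tensorObj := tens
  whiskerLeft X _ _ f := tensHom (𝟙 X) f
  whiskerRight f Y := tensHom f (𝟙 Y)
  tensorHom := tensHom
  tensorUnit := unit
  associator X Y Z := (assocIso hβ X Y Z).symm
  leftUnitor := leftIso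
  rightUnitor := rightIso

theorem tensStruct_laws : @BraidedMonoidalLaws SF _ (tensStruct hβ) (braidIso hβ) :=
  @BraidedMonoidalLaws.mk SF _ (tensStruct hβ) (braidIso hβ)
    tensHom_def tensHom_id (fun f₁ f₂ g₁ g₂ => tensHom_comp f₁ g₁ f₂ g₂) tensHom_id tensHom_id
    (assocIso_inv_naturality hβ) leftIso_naturality rightIso_naturality (assocIso_inv_pentagon hβ)
    (assocIso_inv_triangle hβ) (braidIso_naturality_right hβ) (braidIso_naturality_left hβ)
    (hexagon_forward hβ) (hexagon_reverse hβ)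

/-- The braided monoidal structure of `SF`. -/
def braidedStructure : BraidedStructure β where
  assoc := assocIso hβ
  leftUnitor := leftIso
  rightUnitor := rightIso
  braiding := braidIso hβ
  -- The opaque names unfold to the prescribed maps, so all these identities are definitional.
  map₀_assoc _ _ _ := rfl
  map₁_assoc _ _ _ := rfl
  map₀_leftUnitor _ := rfl
  map₁_leftUnitor _ := rfl
  map₀_rightUnitor _ := rfl
  map₁_rightUnitor _ := rfl
  map₀_braiding _ _ := rfl
  map₁_braiding _ _ := rfl
  laws := tensStruct_laws hβ

end Structure

end SF

namespace S

/-! ## The coproduct of `S` on its basis -/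

/-- The inclusion of the untwisted part of `S`. -/
def inc₀ : Cl 0 →ₗ[ℂ] S := LinearMap.inl ℂ (Cl 0) (Cl 1)
/-- The inclusion of the twisted part of `S`. -/
def inc₁ : Cl 1 →ₗ[ℂ] S := LinearMap.inr ℂ (Cl 0) (Cl 1)

theorem inc_mul : (∀ a a' : Cl 0, inc₀ a * inc₀ a' = inc₀ (a * a')) ∧
    (∀ (a : Cl 0) (c : Cl 1), inc₀ a * inc₁ c = 0) ∧ (∀ (c : Cl 1) (a : Cl 0), inc₁ c * inc₀ a = 0) ∧
    (∀ c c' : Cl 1, inc₁ c * inc₁ c' = inc₁ (c * c')) := by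
  refine ⟨fun a a' => Prod.ext rfl ?_, fun a c => Prod.ext ?_ ?_, fun c a => Prod.ext ?_ ?_,
    fun c c' => Prod.ext ?_ rfl⟩ <;> simp [inc₀, inc₁]

theorem parity_inc : (∀ a : Cl 0, parity (inc₀ a) = inc₀ (parity a)) ∧
    (∀ c : Cl 1, parity (inc₁ c) = inc₁ (parity c)) :=
  ⟨fun _ => Prod.ext rfl (map_zero (parity (A := Cl 1))),
    fun _ => Prod.ext (map_zero (parity (A := Cl 0))) rfl⟩

theorem eq_inc : xp = inc₀ Cl.x + inc₁ Cl.x ∧ xm = inc₀ Cl.y + inc₁ Cl.y ∧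
    e₀ = inc₀ 1 ∧ e₁ = inc₁ 1 ∧ L = inc₀ 1 - inc₁ 1 ∧ (1 : S) = inc₀ 1 + inc₁ 1 := by
  refine ⟨?_, ?_, e₀_eq, e₁_eq, ?_, ?_⟩ <;> refine Prod.ext ?_ ?_ <;> simp [inc₀, inc₁, xp, xm, L]

theorem y_mul_x {c : ℂ} : (Cl.y : Cl c) * Cl.x = c • 1 - Cl.x * Cl.y := by
  rw [eq_sub_iff_add_eq', Cl.x_mul_y_add, Algebra.algebraMap_eq_smul_one]

/-- From `Δ(L) = L ⊗ L`: the sectors add modulo `2`. -/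
theorem co_E : coE₀ = inc₀ 1 ⊗ₜ[ℂ] inc₀ 1 + inc₁ 1 ⊗ₜ[ℂ] inc₁ 1 ∧
    coE₁ = inc₀ 1 ⊗ₜ[ℂ] inc₁ 1 + inc₁ 1 ⊗ₜ[ℂ] inc₀ 1 := by
  simp only [coE₀, coE₁, coL, eq_inc, TensorProduct.add_tmul, TensorProduct.tmul_add,
    TensorProduct.sub_tmul, TensorProduct.tmul_sub]
  constructor <;> module

/-- In the sector `e₁ ⊗ e₁` the correction term cancels the second-leg `x⁺` of `Δ(x⁺)` and puts `x⁻`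
in its place, and conversely for `Δ(x⁻)`. -/
theorem co_X : coXp = inc₀ Cl.x ⊗ₜ[ℂ] (inc₀ 1 + inc₁ 1) + inc₁ Cl.x ⊗ₜ[ℂ] (inc₀ 1 + inc₁ 1)
      + inc₀ 1 ⊗ₜ (inc₀ Cl.x + inc₁ Cl.x)
      - Complex.I • inc₁ 1 ⊗ₜ inc₀ Cl.x - Complex.I • inc₁ 1 ⊗ₜ inc₁ Cl.y ∧
    coXm = inc₀ Cl.y ⊗ₜ[ℂ] (inc₀ 1 + inc₁ 1) + inc₁ Cl.y ⊗ₜ[ℂ] (inc₀ 1 + inc₁ 1)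
      + inc₀ 1 ⊗ₜ (inc₀ Cl.y + inc₁ Cl.y)
      - Complex.I • inc₁ 1 ⊗ₜ inc₀ Cl.y - Complex.I • inc₁ 1 ⊗ₜ inc₁ Cl.x := by
  simp only [coXp, coXm, eq_inc, TensorProduct.add_tmul, TensorProduct.tmul_add, mul_add, mul_sub,
    inc_mul, zero_add, one_mul, add_zero, sub_zero, add_sub_add_comm, sub_self,
    TensorProduct.sub_tmul, TensorProduct.tmul_sub, ← TensorProduct.smul_tmul']
  constructor <;> module

theorem parity_basis : parity (inc₀ 1) = inc₀ 1 ∧ parity (inc₁ 1) = inc₁ 1 ∧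
    parity (inc₀ Cl.x) = -inc₀ Cl.x ∧ parity (inc₁ Cl.x) = -inc₁ Cl.x ∧
    parity (inc₀ Cl.y) = -inc₀ Cl.y ∧ parity (inc₁ Cl.y) = -inc₁ Cl.y ∧
    parity (inc₀ (Cl.x * Cl.y)) = inc₀ (Cl.x * Cl.y) ∧
    parity (inc₁ (Cl.x * Cl.y)) = inc₁ (Cl.x * Cl.y) := by
  simp only [parity_inc, map_mul, map_one, Cl.parity_x, Cl.parity_y, map_neg, neg_mul_neg, and_self]

theorem superMul_even {q : S} (h : parity q = q) (a u v : S) :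
    superMul (a ⊗ₜ q) (u ⊗ₜ v) = (a * u) ⊗ₜ[ℂ] (q * v) := superMul_even_left a u v h

theorem superMul_odd {q : S} (h : parity q = -q) (a u v : S) :
    superMul (a ⊗ₜ q) (u ⊗ₜ v) = (a * parity u) ⊗ₜ[ℂ] (q * v) := superMul_odd_left a u v h

/-- The sign in the product depends on the second leg of the left factor, which in all computations
is a basis vector of known degree. -/
theorem superMul_inc : (∀ a u v : S, superMul (a ⊗ₜ inc₀ 1) (u ⊗ₜ v) =
      (a * u) ⊗ₜ[ℂ] (inc₀ 1 * v)) ∧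
    (∀ a u v : S, superMul (a ⊗ₜ inc₁ 1) (u ⊗ₜ v) = (a * u) ⊗ₜ[ℂ] (inc₁ 1 * v)) ∧
    (∀ a u v : S, superMul (a ⊗ₜ inc₀ Cl.x) (u ⊗ₜ v) = (a * parity u) ⊗ₜ[ℂ] (inc₀ Cl.x * v)) ∧
    (∀ a u v : S, superMul (a ⊗ₜ inc₁ Cl.x) (u ⊗ₜ v) = (a * parity u) ⊗ₜ[ℂ] (inc₁ Cl.x * v)) ∧
    (∀ a u v : S, superMul (a ⊗ₜ inc₀ Cl.y) (u ⊗ₜ v) = (a * parity u) ⊗ₜ[ℂ] (inc₀ Cl.y * v)) ∧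
    (∀ a u v : S, superMul (a ⊗ₜ inc₁ Cl.y) (u ⊗ₜ v) = (a * parity u) ⊗ₜ[ℂ] (inc₁ Cl.y * v)) ∧
    (∀ a u v : S, superMul (a ⊗ₜ inc₀ (Cl.x * Cl.y)) (u ⊗ₜ v) =
      (a * u) ⊗ₜ[ℂ] (inc₀ (Cl.x * Cl.y) * v)) ∧
    (∀ a u v : S, superMul (a ⊗ₜ inc₁ (Cl.x * Cl.y)) (u ⊗ₜ v) =
      (a * u) ⊗ₜ[ℂ] (inc₁ (Cl.x * Cl.y) * v)) := by
  obtain ⟨h₁, h₂, h₃, h₄, h₅, h₆, h₇, h₈⟩ := parity_basis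
  exact ⟨superMul_even h₁, superMul_even h₂, superMul_odd h₃, superMul_odd h₄, superMul_odd h₅,
    superMul_odd h₆, superMul_even h₇, superMul_even h₈⟩

theorem superMul_linear {A : Type} [Ring A] [Algebra ℂ A] [SuperAlgebra A] :
    (∀ s s' t : A ⊗[ℂ] A, superMul (s - s') t = superMul s t - superMul s' t) ∧
    (∀ s t t' : A ⊗[ℂ] A, superMul s (t - t') = superMul s t - superMul s t') ∧
    (∀ s t : A ⊗[ℂ] A, superMul (-s) t = -superMul s t) ∧
    (∀ s t : A ⊗[ℂ] A, superMul s (-t) = -superMul s t) ∧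
    (∀ t : A ⊗[ℂ] A, superMul 0 t = 0) ∧ (∀ t : A ⊗[ℂ] A, superMul t 0 = 0) ∧
    (∀ s s' t : A ⊗[ℂ] A, superMul (s + s') t = superMul s t + superMul s' t) ∧
    (∀ s t t' : A ⊗[ℂ] A, superMul s (t + t') = superMul s t + superMul s t') ∧
    (∀ (z : ℂ) (s t : A ⊗[ℂ] A), superMul (z • s) t = z • superMul s t) ∧
    (∀ (z : ℂ) (s t : A ⊗[ℂ] A), superMul s (z • t) = z • superMul s t) := by
  refine ⟨?_, ?_, ?_, ?_, ?_, ?_, superMul_add_left, superMul_add_right, superMul_smul_left,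
    superMul_smul_right⟩ <;> intros <;>
    simp only [superMul, TensorProduct.sub_tmul, TensorProduct.tmul_sub, TensorProduct.neg_tmul,
      TensorProduct.tmul_neg, TensorProduct.zero_tmul, TensorProduct.tmul_zero, map_sub, map_neg,
      map_zero]

/-- Besides the untwisted basis only `x⁺e₁ = x⁺b` and `(1 - x⁺x⁻)e₁ = b` are evaluated, since these
two elements span `B`. -/
theorem co_inc : co (inc₀ 1) = coE₀ ∧ co (inc₀ Cl.x) = superMul coXp coE₀ ∧
    co (inc₀ Cl.y) = superMul coXm coE₀ ∧
    co (inc₀ (Cl.x * Cl.y)) = superMul (superMul coXp coXm) coE₀ ∧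
    co (inc₁ Cl.x) = superMul coXp coE₁ ∧
    co (inc₁ (1 - Cl.x * Cl.y)) = coE₁ - superMul (superMul coXp coXm) coE₁ := by
  refine ⟨?_, ?_, ?_, ?_, ?_, ?_⟩ <;>
    (try simp only [Cl.x_mul_y]) <;>
    simp [co, inc₀, inc₁, Cl.lin_apply, Cl.one_def, Cl.x, Cl.y, sub_eq_add_neg]

/-- The even generator `b` of `B`. -/
def b₀ : B := Rb (inc₁ 1)
/-- The odd element `x⁺b` of `B`. -/
def b₁ : B := Rb (inc₁ Cl.x)

theorem b_eq : b = inc₁ (1 - Cl.x * Cl.y) := by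
  simp only [b, eq_inc, mul_add, add_mul, inc_mul, y_mul_x, mul_one, zero_add, add_zero, one_smul,
    map_zero]

theorem Rb_apply (s : S) : (Rb s : S) = s * inc₁ (1 - Cl.x * Cl.y) := congrArg (s * ·) b_eq

theorem x_mul_x_mul (c : ℂ) (a : Cl c) : Cl.x * (Cl.x * a) = 0 := by
  rw [← mul_assoc, Cl.x_mul_x, zero_mul]
theorem y_mul_y_mul (c : ℂ) (a : Cl c) : Cl.y * (Cl.y * a) = 0 := by
  rw [← mul_assoc, Cl.y_mul_y, zero_mul]
theorem y_mul_x_mul (c : ℂ) (a : Cl c) : Cl.y * (Cl.x * a) = c • a - Cl.x * (Cl.y * a) := by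
  rw [← mul_assoc, y_mul_x, sub_mul, smul_mul_assoc, one_mul, mul_assoc]

/-- Normal forms in `Cl c`. -/
theorem Cl_rules {c : ℂ} : (Cl.x : Cl c) * Cl.x = 0 ∧ (Cl.y : Cl c) * Cl.y = 0 ∧
    (Cl.y : Cl c) * Cl.x = c • 1 - Cl.x * Cl.y ∧ (∀ a : Cl c, Cl.x * (Cl.x * a) = 0) ∧
    (∀ a : Cl c, Cl.y * (Cl.y * a) = 0) ∧
    (∀ a : Cl c, Cl.y * (Cl.x * a) = c • a - Cl.x * (Cl.y * a)) :=
  ⟨Cl.x_mul_x, Cl.y_mul_y, y_mul_x, x_mul_x_mul c, y_mul_y_mul c, y_mul_x_mul c⟩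

theorem b₀_val : (b₀ : S) = inc₁ (1 - Cl.x * Cl.y) := by
  rw [b₀, Rb_apply, inc_mul.2.2.2, one_mul]
theorem b₁_val : (b₁ : S) = inc₁ Cl.x := by
  rw [b₁, Rb_apply, inc_mul.2.2.2]
  simp only [mul_sub, Cl_rules, mul_one, sub_zero]

/-- As `b = x⁻x⁺e₁`, right multiplication by `b` annihilates `Se₀`, `x⁻e₁` and `x⁺x⁻e₁`. -/
theorem Rb_rules : (∀ a, Rb (inc₀ a) = 0) ∧ Rb (inc₁ 1) = b₀ ∧ Rb (inc₁ Cl.x) = b₁ ∧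
    Rb (inc₁ Cl.y) = 0 ∧ Rb (inc₁ (Cl.x * Cl.y)) = 0 := by
  refine ⟨fun a => Subtype.ext ?_, rfl, rfl, Subtype.ext ?_, Subtype.ext ?_⟩ <;>
    simp only [Rb_apply, inc_mul, mul_sub, sub_mul, mul_assoc, Cl_rules, mul_one, sub_zero, one_smul,
      sub_self, map_zero, mul_zero, zero_sub, neg_zero, ZeroMemClass.coe_zero, map_sub]

/-- The action of `S` on `B`. -/
def actB : S →ₗ[ℂ] B →ₗ[ℂ] B := modB.ρ.toLinearMap
/-- The parity of `B`. -/
def parB : B →ₗ[ℂ] B := modB.ω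

/-- The action of `x⁺`, `x⁻`, `e₀`, `e₁` and of the parity on `B`. -/
theorem B_rules : actB xp b₀ = b₁ ∧ actB xp b₁ = 0 ∧ actB xm b₀ = 0 ∧ actB xm b₁ = b₀ ∧
    actB e₀ b₀ = 0 ∧ actB e₀ b₁ = 0 ∧ actB e₁ b₀ = b₀ ∧ actB e₁ b₁ = b₁ ∧
    parB b₀ = b₀ ∧ parB b₁ = -b₁ := by
  have h (s : S) (v : B) : (actB s v : S) = s * v.1 := rfl
  have h' (v : B) : (parB v : S) = parity v.1 := rfl
  refine ⟨?_, ?_, ?_, ?_, ?_, ?_, ?_, ?_, ?_, ?_⟩ <;> refine Subtype.ext ?_ <;>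
    simp only [h, h', b₀_val, b₁_val, eq_inc, add_mul, inc_mul, mul_sub, mul_one, one_mul, Cl_rules,
      sub_zero, zero_add, add_zero, sub_self, map_zero, ZeroMemClass.coe_zero, one_smul, parity_inc,
      map_sub, map_mul, map_one, Cl.parity_x, Cl.parity_y, neg_mul_neg, NegMemClass.coe_neg, map_neg,
      mul_zero]

/-- Of the eight basis vectors of `S`, right multiplication by `b` leaves only the images of `e₁`
and `x⁺e₁`. -/
theorem B_span (v : B) : v ∈ Submodule.span ℂ {b₀, b₁} := by
  obtain ⟨_, s, rfl⟩ := v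
  change Rb s ∈ _
  have h : s = inc₀ s.1 + (s.2.coord 0 • inc₁ 1 + s.2.coord 1 • inc₁ Cl.x + s.2.coord 2 • inc₁ Cl.y
      + s.2.coord 3 • inc₁ (Cl.x * Cl.y)) := by
    rw [Cl.x_mul_y]
    refine Prod.ext ?_ ?_
    · simp [inc₀, inc₁]
    · simp only [inc₀, inc₁, Prod.snd_add, Prod.smul_snd, LinearMap.inl_apply, LinearMap.inr_apply]
      apply Cl.ext <;> simp [Cl.x, Cl.y, Cl.one_def]
  rw [h]
  simp only [map_add, map_smul, Rb_rules, smul_zero, add_zero, zero_add]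
  exact Submodule.add_mem _ (Submodule.smul_mem _ _ (Submodule.subset_span (by simp)))
    (Submodule.smul_mem _ _ (Submodule.subset_span (by simp)))

end S

namespace SF

/-! ## The images of objects under `P`, in terms of generators -/

section Generators

variable (X : SF)

/-- The inclusion of the untwisted component of `X` into `D X`. -/
def du : X.c₀.V →ₗ[ℂ] (D.obj X).V := LinearMap.inl ℂ X.c₀.V (S.B ⊗[ℂ] X.c₁.V)

/-- The map `t ⊗ x ↦ t ⊗ x` from `B` and the twisted component of `X` to `D X`. -/
def db : S.B →ₗ[ℂ] X.c₁.V →ₗ[ℂ] (D.obj X).V :=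
  (TensorProduct.mk ℂ S.B X.c₁.V).compr₂ (LinearMap.inr ℂ X.c₀.V (S.B ⊗[ℂ] X.c₁.V))

/-- The identity of the vector space underlying `D X` and `P X`. -/
def toP : (D.obj X).V →ₗ[ℂ] (P.obj X).V := LinearMap.id

/-- The inclusion of the untwisted component of `X` into `P X`. -/
def pu : X.c₀.V →ₗ[ℂ] (P.obj X).V := toP X ∘ₗ du X

/-- The map `x ↦ b ⊗ x` from the twisted component of `X` to `P X`. -/
def pb₀ : X.c₁.V →ₗ[ℂ] (P.obj X).V := toP X ∘ₗ db X S.b₀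

/-- The map `x ↦ x⁺b ⊗ x` from the twisted component of `X` to `P X`. -/
def pb₁ : X.c₁.V →ₗ[ℂ] (P.obj X).V := toP X ∘ₗ db X S.b₁

variable {X}

/-- The twisted part of `P X` is `B ⊗ X`, and `b`, `x⁺b` span `B`. -/
theorem P_eq_top {p : Submodule ℂ (P.obj X).V} (h : ∀ x, pu X x ∈ p) (h₀ : ∀ x, pb₀ X x ∈ p)
    (h₁ : ∀ x, pb₁ X x ∈ p) : p = ⊤ := by
  refine eq_top_iff.2 fun v _ => ?_
  change X.c₀.V × (S.B ⊗[ℂ] X.c₁.V) at v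
  have hv : v = LinearMap.inl ℂ _ _ v.1 + LinearMap.inr ℂ _ _ v.2 := by simp
  rw [hv]
  refine p.add_mem (h v.1) ?_
  generalize v.2 = w
  induction w with
  | zero => rw [map_zero]; exact p.zero_mem
  | add w w' hw hw' => rw [map_add]; exact p.add_mem hw hw'
  | tmul s x =>
    obtain ⟨a, c, hs⟩ := Submodule.mem_span_pair.1 (S.B_span s)
    rw [← hs, TensorProduct.add_tmul, map_add, ← TensorProduct.smul_tmul', ← TensorProduct.smul_tmul',
      map_smul, map_smul]
    exact p.add_mem (p.smul_mem a (h₀ x)) (p.smul_mem c (h₁ x))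

theorem P_ext {M : Type*} [AddCommGroup M] [Module ℂ M] {f g : (P.obj X).V →ₗ[ℂ] M}
    (h : f ∘ₗ pu X = g ∘ₗ pu X) (h₀ : f ∘ₗ pb₀ X = g ∘ₗ pb₀ X) (h₁ : f ∘ₗ pb₁ X = g ∘ₗ pb₁ X) :
    f = g :=
  LinearMap.eqLocus_eq_top.1 (P_eq_top (p := LinearMap.eqLocus f g) (LinearMap.congr_fun h)
    (LinearMap.congr_fun h₀) (LinearMap.congr_fun h₁))

/-- The actions of `S` and the parity of `D X`. -/
theorem D_rules : (∀ {X : SF} (s : S) (x : X.c₀.V), (D.obj X).ρ s (du X x) = du X (X.c₀.ρ s.1 x)) ∧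
    (∀ {X : SF} (s : S) (t : S.B) (x : X.c₁.V), (D.obj X).ρ s (db X t x) = db X (S.actB s t) x) ∧
    (∀ {X : SF} (x : X.c₀.V), (D.obj X).ω (du X x) = du X (par₀ X x)) ∧
    (∀ {X : SF} (t : S.B) (x : X.c₁.V), (D.obj X).ω (db X t x) = db X (S.parB t) (par₁ X x)) :=
  ⟨fun {X} s _ => Prod.ext rfl (map_zero ((D₁ X.c₁).ρ s)),
    fun {X} s _ _ => Prod.ext (map_zero (X.c₀.ρ s.1)) rfl,
    fun {X} _ => Prod.ext rfl (map_zero (D₁ X.c₁).ω),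
    fun {X} _ _ => Prod.ext (map_zero X.c₀.ω) rfl⟩

theorem S_fst : S.e₀.1 = 1 ∧ S.e₁.1 = 0 ∧ S.xp.1 = a₁ ∧ S.xm.1 = a₂ :=
  ⟨by rw [S.e₀_eq], by rw [S.e₁_eq], rfl, rfl⟩

/-- The action of the generators of `Q` on `P X`, in terms of `D X`. -/
theorem toP_rules :
    (∀ {X : SF} (v : (D.obj X).V), (P.obj X).ρ Q.K (toP X v) =
      toP X ((D.obj X).ρ (S.e₀ + Complex.I • S.e₁) ((D.obj X).ω v))) ∧
    (∀ {X : SF} (v : (D.obj X).V), (P.obj X).ρ Q.Kinv (toP X v) =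
      toP X ((D.obj X).ρ (S.e₀ - Complex.I • S.e₁) ((D.obj X).ω v))) ∧
    (∀ {X : SF} (v : (D.obj X).V), (P.obj X).ρ Q.E (toP X v) =
      toP X ((D.obj X).ρ S.xm ((D.obj X).ρ (S.e₀ + Complex.I • S.e₁) ((D.obj X).ω v)))) ∧
    (∀ {X : SF} (v : (D.obj X).V), (P.obj X).ρ Q.F (toP X v) =
      toP X (Complex.I • (D.obj X).ρ S.xp v)) :=
  ⟨fun {X} v => LinearMap.congr_fun (RepS.lift_K (D.obj X)) v,
    fun {X} v => LinearMap.congr_fun (RepS.lift_Kinv (D.obj X)) v,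
    fun {X} v => LinearMap.congr_fun (RepS.lift_E (D.obj X)) v,
    fun {X} v => LinearMap.congr_fun (RepS.lift_F (D.obj X)) v⟩

/-- The action of the generators of `Q` on the generators of `P X`. -/
theorem P_rules :
    (∀ {X : SF} (x : X.c₀.V), (P.obj X).ρ Q.K (pu X x) = pu X (par₀ X x)) ∧
    (∀ {X : SF} (x : X.c₁.V), (P.obj X).ρ Q.K (pb₀ X x) = Complex.I • pb₀ X (par₁ X x)) ∧
    (∀ {X : SF} (x : X.c₁.V), (P.obj X).ρ Q.K (pb₁ X x) = -(Complex.I • pb₁ X (par₁ X x))) ∧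
    (∀ {X : SF} (x : X.c₀.V), (P.obj X).ρ Q.Kinv (pu X x) = pu X (par₀ X x)) ∧
    (∀ {X : SF} (x : X.c₁.V), (P.obj X).ρ Q.Kinv (pb₀ X x) = -(Complex.I • pb₀ X (par₁ X x))) ∧
    (∀ {X : SF} (x : X.c₁.V), (P.obj X).ρ Q.Kinv (pb₁ X x) = Complex.I • pb₁ X (par₁ X x)) ∧
    (∀ {X : SF} (x : X.c₀.V), (P.obj X).ρ Q.E (pu X x) = pu X (A₂ X (par₀ X x))) ∧
    (∀ {X : SF} (x : X.c₁.V), (P.obj X).ρ Q.E (pb₀ X x) = 0) ∧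
    (∀ {X : SF} (x : X.c₁.V), (P.obj X).ρ Q.E (pb₁ X x) = -(Complex.I • pb₀ X (par₁ X x))) ∧
    (∀ {X : SF} (x : X.c₀.V), (P.obj X).ρ Q.F (pu X x) = Complex.I • pu X (A₁ X x)) ∧
    (∀ {X : SF} (x : X.c₁.V), (P.obj X).ρ Q.F (pb₀ X x) = Complex.I • pb₁ X x) ∧
    (∀ {X : SF} (x : X.c₁.V), (P.obj X).ρ Q.F (pb₁ X x) = 0) := by
  refine ⟨?_, ?_, ?_, ?_, ?_, ?_, ?_, ?_, ?_, ?_, ?_, ?_⟩ <;> intro X x <;>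
    simp only [pu, pb₀, pb₁, LinearMap.comp_apply, toP_rules, D_rules, S.B_rules, S_fst, map_add,
      map_sub, map_smul, LinearMap.add_apply, LinearMap.sub_apply, LinearMap.smul_apply, map_one,
      map_zero, Module.End.one_apply, LinearMap.zero_apply, LinearMap.neg_apply, Prod.fst_add,
      Prod.fst_sub, Prod.smul_fst, map_neg, smul_zero, add_zero, zero_add, sub_zero, zero_sub,
      smul_neg, neg_zero, neg_neg] <;>
    rfl

end Generators

end SF

namespace SF

/-! ## The monoidal structure of `P` on generators -/

section Coherence

variable {X Y : SF}

/-- The map `Δ`, with the opaque tensor product of `SF`. -/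
def ΔT (X Y : SF) : (D.obj (tens X Y)).V →ₗ[ℂ] (D.obj X).V ⊗[ℂ] (D.obj Y).V := ΔD X Y

/-- The map is a sum over sectors composed with projections; a vector of one sector meets a single
summand. -/
theorem ΔT_sectors :
    (∀ (x : X.c₀.V) (y : Y.c₀.V), ΔT X Y (du _ (ten₀₀ x y)) =
      map (du X) (du Y) (Δ00 X.c₀ Y.c₀ (x ⊗ₜ y))) ∧
    (∀ (k : Fin 4) (x : X.c₁.V) (y : Y.c₁.V), ΔT X Y (du _ (ten₁₁ k x y)) =
      map (TensorProduct.lift (db X)) (TensorProduct.lift (db Y))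
        (Δ11 X.c₁ Y.c₁ (basisG k ⊗ₜ (x ⊗ₜ y)))) ∧
    (∀ (t : S.B) (x : X.c₀.V) (y : Y.c₁.V), ΔT X Y (db _ t (ten₀₁ x y)) =
      map (du X) (TensorProduct.lift (db Y)) (Δ01 X.c₀ Y.c₁ (t ⊗ₜ (x ⊗ₜ y)))) ∧
    (∀ (t : S.B) (x : X.c₁.V) (y : Y.c₀.V), ΔT X Y (db _ t (ten₁₀ x y)) =
      map (TensorProduct.lift (db X)) (du Y) (Δ10 X.c₁ Y.c₀ (t ⊗ₜ (x ⊗ₜ y)))) := by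
  let r (Z : SF) : S.B ⊗[ℂ] Z.c₁.V →ₗ[ℂ] (D.obj Z).V := LinearMap.inr ℂ Z.c₀.V (S.B ⊗[ℂ] Z.c₁.V)
  have hr (Z : SF) : TensorProduct.lift (db Z) = r Z := TensorProduct.ext rfl
  have h (a : X.c₀.V ⊗[ℂ] Y.c₀.V) (c : G ⊗[ℂ] (X.c₁.V ⊗[ℂ] Y.c₁.V))
      (d : S.B ⊗[ℂ] ((X.c₀.V ⊗[ℂ] Y.c₁.V) × (X.c₁.V ⊗[ℂ] Y.c₀.V))) :
      ΔT X Y (((a, c), d) : (D.obj (tensorObj X Y)).V) = map (du X) (du Y) (Δ00 X.c₀ Y.c₀ a) +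
        map (r X) (r Y) (Δ11 X.c₁ Y.c₁ c) +
        map (du X) (r Y) (Δ01 X.c₀ Y.c₁ (map LinearMap.id p₁ d)) +
        map (r X) (du Y) (Δ10 X.c₁ Y.c₀ (map LinearMap.id p₂ d)) := rfl
  rw [hr, hr]
  refine ⟨fun x y => ?_, fun k x y => ?_, fun t x y => ?_, fun t x y => ?_⟩
  · refine (h (x ⊗ₜ y) 0 0).trans ?_
    simp only [map_zero, add_zero]
  · refine (h 0 (basisG k ⊗ₜ (x ⊗ₜ y)) 0).trans ?_
    simp only [map_zero, add_zero, zero_add]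
  · refine (h 0 0 (t ⊗ₜ (x ⊗ₜ y, 0))).trans ?_
    simp only [map_zero, add_zero, zero_add, TensorProduct.map_tmul, LinearMap.fst_apply,
      LinearMap.snd_apply, TensorProduct.tmul_zero, LinearMap.id_apply]
  · refine (h 0 0 (t ⊗ₜ (0, x ⊗ₜ y))).trans ?_
    simp only [map_zero, add_zero, zero_add, TensorProduct.map_tmul, LinearMap.fst_apply,
      LinearMap.snd_apply, TensorProduct.tmul_zero, LinearMap.id_apply]

theorem Δ00_apply (x : X.c₀.V) (y : Y.c₀.V) :
    Δ00 X.c₀ Y.c₀ (x ⊗ₜ y) = x ⊗ₜ y + A₂ X (par₀ X x) ⊗ₜ A₁ Y y := rfl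

/-- The components of the coproduct of `S` in `B ⊗ B`. -/
theorem co_11 : ∀ k : Fin 4, map S.Rb S.Rb (S.co (LinearMap.inl ℂ (Cl 0) (Cl 1) (basisG k))) =
    (![S.b₀ ⊗ₜ[ℂ] S.b₀, S.b₁ ⊗ₜ[ℂ] S.b₀, (-Complex.I) • (S.b₀ ⊗ₜ[ℂ] S.b₁),
      (-1 : ℂ) • (S.b₀ ⊗ₜ[ℂ] S.b₀) + (-Complex.I) • (S.b₁ ⊗ₜ[ℂ] S.b₁)] : Fin 4 → S.B ⊗[ℂ] S.B) k := by
  intro k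
  change map S.Rb S.Rb (S.co (S.inc₀ (basisG k))) = _
  fin_cases k
  all_goals
    simp only [Fin.mk_zero, Fin.mk_one, Fin.reduceFinMk, basisG_zero, basisG_one, basisG_two,
      basisG_three, S.co_inc, S.co_E, S.co_X, S.superMul_linear, S.superMul_inc, S.inc_mul,
      S.parity_inc, Cl.parity_x, Cl.parity_y, map_one, TensorProduct.tmul_add,
      TensorProduct.add_tmul, TensorProduct.tmul_zero, TensorProduct.zero_tmul,
      TensorProduct.map_tmul, mul_one, one_mul, S.Rb_rules, map_add, map_sub, map_smul, map_neg,
      map_zero, S.Cl_rules, TensorProduct.tmul_sub, TensorProduct.tmul_neg, TensorProduct.neg_tmul,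
      smul_zero, add_zero, zero_add, mul_neg, neg_mul, neg_zero, sub_zero,
      smul_neg, one_smul]
  · rfl
  · change _ = S.b₁ ⊗ₜ[ℂ] S.b₀
    module
  · change _ = (-Complex.I) • (S.b₀ ⊗ₜ[ℂ] S.b₁)
    module
  · change _ = (-1 : ℂ) • (S.b₀ ⊗ₜ[ℂ] S.b₀) + (-Complex.I) • (S.b₁ ⊗ₜ[ℂ] S.b₁)
    match_scalars <;> simp

/-- As `b = e₁ - x⁺x⁻e₁`, this is `Δ(e₁) - Δ(x⁺)Δ(x⁻)Δ(e₁)`; only the mixed sectors occur because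
`Δ(e₁)` lies there. -/
theorem co_b₀ : S.co S.b₀.1 =
    S.inc₀ 1 ⊗ₜ[ℂ] S.inc₁ 1 + S.inc₁ 1 ⊗ₜ[ℂ] S.inc₀ 1
      + (-1 : ℂ) • S.inc₀ (Cl.x * Cl.y) ⊗ₜ[ℂ] S.inc₁ 1 + S.inc₀ Cl.y ⊗ₜ[ℂ] S.inc₁ Cl.x
      + (-1 : ℂ) • S.inc₀ Cl.x ⊗ₜ[ℂ] S.inc₁ Cl.y + (-1 : ℂ) • S.inc₀ 1 ⊗ₜ[ℂ] S.inc₁ (Cl.x * Cl.y)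
      + (-1 : ℂ) • S.inc₁ (Cl.x * Cl.y) ⊗ₜ[ℂ] S.inc₀ 1
      + (-Complex.I) • S.inc₁ Cl.y ⊗ₜ[ℂ] S.inc₀ Cl.x + Complex.I • S.inc₁ Cl.x ⊗ₜ[ℂ] S.inc₀ Cl.y
      + S.inc₁ 1 ⊗ₜ[ℂ] S.inc₀ (Cl.x * Cl.y) := by
  rw [S.b₀_val, S.co_inc.2.2.2.2.2]
  simp only [S.co_E, S.co_X, S.superMul_linear, S.superMul_inc, S.inc_mul, S.parity_basis,
    TensorProduct.tmul_add, TensorProduct.add_tmul, TensorProduct.tmul_zero, TensorProduct.zero_tmul,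
    mul_one, one_mul, map_sub, map_smul, map_zero, S.Cl_rules, TensorProduct.tmul_sub,
    TensorProduct.tmul_neg, TensorProduct.neg_tmul, smul_zero, add_zero, zero_add, mul_neg, neg_zero,
    sub_zero, zero_sub, smul_neg, one_smul]
  match_scalars <;> simp

theorem co_b₁ : S.co S.b₁.1 =
    S.inc₀ Cl.x ⊗ₜ[ℂ] S.inc₁ 1 + S.inc₀ 1 ⊗ₜ[ℂ] S.inc₁ Cl.x + S.inc₁ Cl.x ⊗ₜ[ℂ] S.inc₀ 1
      + (-Complex.I) • S.inc₁ 1 ⊗ₜ[ℂ] S.inc₀ Cl.x := by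
  rw [S.b₁_val, S.co_inc.2.2.2.2.1]
  simp only [S.co_E, S.co_X, S.superMul_linear, S.superMul_inc, S.inc_mul, S.parity_basis,
    TensorProduct.tmul_add, TensorProduct.add_tmul, TensorProduct.tmul_zero, TensorProduct.zero_tmul,
    mul_one, one_mul, map_zero, smul_zero, add_zero, zero_add, sub_zero, zero_sub]
  module

theorem superSwap_even {U V : Type} [AddCommGroup U] [Module ℂ U] [AddCommGroup V] [Module ℂ V]
    {q : S} (h : parity q = q) (ω : U →ₗ[ℂ] U) (p : S) (u : U) (v : V) :
    superSwap (parityLin S) ω ((p ⊗ₜ q) ⊗ₜ (u ⊗ₜ v)) = (p ⊗ₜ[ℂ] u) ⊗ₜ[ℂ] (q ⊗ₜ[ℂ] v) :=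
  superSwap_even_left ω p u v h

theorem superSwap_odd {U V : Type} [AddCommGroup U] [Module ℂ U] [AddCommGroup V] [Module ℂ V]
    {q : S} (h : parity q = -q) (ω : U →ₗ[ℂ] U) (p : S) (u : U) (v : V) :
    superSwap (parityLin S) ω ((p ⊗ₜ q) ⊗ₜ (u ⊗ₜ v)) = (p ⊗ₜ[ℂ] ω u) ⊗ₜ[ℂ] (q ⊗ₜ[ℂ] v) :=
  superSwap_odd_left ω p u v h

theorem actS_rules : (∀ {X : SF} (a : G) (x : X.c₀.V), actS X.c₀ (S.inc₀ a ⊗ₜ x) = X.c₀.ρ a x) ∧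
    (∀ {X : SF} (a : Cl 1) (x : X.c₀.V), actS X.c₀ (S.inc₁ a ⊗ₜ x) = 0) ∧
    (∀ {X : SF}, X.c₀.ρ Cl.x = A₁ X) ∧ (∀ {X : SF}, X.c₀.ρ Cl.y = A₂ X) ∧
    (∀ {X : SF}, X.c₀.ω = par₀ X) ∧ (∀ {X : SF}, X.c₁.ω = par₁ X) ∧
    S.δ₁ = S.inc₀ (1 + Cl.x * Cl.y) + S.inc₁ (1 + Cl.x * Cl.y) := by
  refine ⟨fun a x => rfl, fun {X} a x => ?_, rfl, rfl, rfl, rfl, ?_⟩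
  · change X.c₀.ρ 0 x = 0
    rw [map_zero]
    rfl
  · simp only [S.δ₁, S.eq_inc, add_mul, mul_add, S.inc_mul, map_add, mul_one, add_zero, zero_add]
    abel

/-- The terms that survive `R_b` in the second leg are `(1 - x⁺x⁻) ⊗ b + x⁻ ⊗ x⁺b` for `Δ(b)`. The
element `δ₁ = 1 + x⁺x⁻` inverts `1 - x⁺x⁻` on the untwisted part, which simplifies the formula for
`b` and creates the last term of the one for `x⁺b`. -/
theorem Δ01_apply (x : X.c₀.V) (y : Y.c₁.V) :
    Δ01 X.c₀ Y.c₁ (S.b₀ ⊗ₜ[ℂ] (x ⊗ₜ[ℂ] y)) = x ⊗ₜ[ℂ] (S.b₀ ⊗ₜ[ℂ] y) + A₂ X (par₀ X x) ⊗ₜ[ℂ] (S.b₁ ⊗ₜ[ℂ] y) ∧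
    Δ01 X.c₀ Y.c₁ (S.b₁ ⊗ₜ[ℂ] (x ⊗ₜ[ℂ] y)) = A₁ X x ⊗ₜ[ℂ] (S.b₀ ⊗ₜ[ℂ] y) + par₀ X x ⊗ₜ[ℂ] (S.b₁ ⊗ₜ[ℂ] y) +
      A₁ X (A₂ X (par₀ X x)) ⊗ₜ[ℂ] (S.b₁ ⊗ₜ[ℂ] y) := by
  obtain ⟨h₁, h₂, h₃, h₄, h₅, h₆, h₇, h₈⟩ := S.parity_basis
  constructor
  all_goals
    simp only [Δ01, LinearMap.comp_apply, TensorProduct.map_tmul, Submodule.subtype_apply, co_b₀,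
      co_b₁, LinearMap.id_apply, TensorProduct.add_tmul, TensorProduct.sub_tmul, map_add, map_sub,
      ← TensorProduct.smul_tmul', map_smul, superSwap_even h₁, superSwap_even h₂, superSwap_odd h₃,
      superSwap_odd h₄, superSwap_odd h₅, superSwap_odd h₆, superSwap_even h₇, superSwap_even h₈,
      S.Rb_rules, TensorProduct.zero_tmul, TensorProduct.tmul_zero, LinearMap.mulRight_apply,
      actS_rules, mul_add, S.inc_mul, mul_one, mul_assoc, S.Cl_rules, zero_smul, map_zero, mul_zero,
      map_mul, LinearMap.add_apply, Module.End.mul_apply, map_one, Module.End.one_apply, add_zero,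
      zero_add, sub_zero, smul_zero, one_mul, neg_zero, zero_sub, map_neg]
    module

/-- Here `R_b` acts on the first leg, where it annihilates the terms with `x⁻` and `x⁺x⁻`. -/
theorem Δ10_apply (x : X.c₁.V) (y : Y.c₀.V) :
    Δ10 X.c₁ Y.c₀ (S.b₀ ⊗ₜ[ℂ] (x ⊗ₜ[ℂ] y)) = (S.b₀ ⊗ₜ[ℂ] x) ⊗ₜ[ℂ] y +
      Complex.I • ((S.b₁ ⊗ₜ[ℂ] par₁ X x) ⊗ₜ[ℂ] A₂ Y y) + (S.b₀ ⊗ₜ[ℂ] x) ⊗ₜ[ℂ] A₁ Y (A₂ Y y) ∧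
    Δ10 X.c₁ Y.c₀ (S.b₁ ⊗ₜ[ℂ] (x ⊗ₜ[ℂ] y)) = (S.b₁ ⊗ₜ[ℂ] x) ⊗ₜ[ℂ] y +
      (-Complex.I) • ((S.b₀ ⊗ₜ[ℂ] par₁ X x) ⊗ₜ[ℂ] A₁ Y y) := by
  obtain ⟨h₁, h₂, h₃, h₄, h₅, h₆, h₇, h₈⟩ := S.parity_basis
  constructor
  all_goals
    simp only [Δ10, LinearMap.comp_apply, TensorProduct.map_tmul, Submodule.subtype_apply, co_b₀,
      co_b₁, LinearMap.id_apply, TensorProduct.add_tmul, TensorProduct.sub_tmul, map_add, map_sub,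
      ← TensorProduct.smul_tmul', map_smul, superSwap_even h₁, superSwap_even h₂, superSwap_odd h₃,
      superSwap_odd h₄, superSwap_odd h₅, superSwap_odd h₆, superSwap_even h₇, superSwap_even h₈,
      S.Rb_rules, TensorProduct.zero_tmul, TensorProduct.tmul_zero, actS_rules, map_mul,
      Module.End.mul_apply, map_one, Module.End.one_apply, add_zero, zero_add, sub_zero, smul_zero,
      zero_sub]

/-- The middle flip moves `x` past the second vector of `B`; it leaves the parity of `x` exactly
when that vector is the odd one, `x⁺b`. -/
theorem Δ11_apply (x : X.c₁.V) (y : Y.c₁.V) :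
    Δ11 X.c₁ Y.c₁ (basisG 0 ⊗ₜ[ℂ] (x ⊗ₜ[ℂ] y)) = (S.b₀ ⊗ₜ[ℂ] x) ⊗ₜ[ℂ] (S.b₀ ⊗ₜ[ℂ] y) ∧
    Δ11 X.c₁ Y.c₁ (basisG 1 ⊗ₜ[ℂ] (x ⊗ₜ[ℂ] y)) = (S.b₁ ⊗ₜ[ℂ] x) ⊗ₜ[ℂ] (S.b₀ ⊗ₜ[ℂ] y) ∧
    Δ11 X.c₁ Y.c₁ (basisG 2 ⊗ₜ[ℂ] (x ⊗ₜ[ℂ] y)) =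
      (-Complex.I) • ((S.b₀ ⊗ₜ[ℂ] par₁ X x) ⊗ₜ[ℂ] (S.b₁ ⊗ₜ[ℂ] y)) ∧
    Δ11 X.c₁ Y.c₁ (basisG 3 ⊗ₜ[ℂ] (x ⊗ₜ[ℂ] y)) =
      (-1 : ℂ) • ((S.b₀ ⊗ₜ[ℂ] x) ⊗ₜ[ℂ] (S.b₀ ⊗ₜ[ℂ] y)) + (-Complex.I) •
       ((S.b₁ ⊗ₜ[ℂ] par₁ X x) ⊗ₜ[ℂ] (S.b₁ ⊗ₜ[ℂ] y)) := by
  have h₀ (p : S.B) := superSwap_even_left (ωQ := modB.ω) X.c₁.ω p x y S.B_rules.2.2.2.2.2.2.2.2.1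
  have h₁ (p : S.B) := superSwap_odd_left (ωQ := modB.ω) X.c₁.ω p x y S.B_rules.2.2.2.2.2.2.2.2.2
  refine ⟨?_, ?_, ?_, ?_⟩ <;>
    simp only [Δ11, LinearMap.comp_apply, TensorProduct.map_tmul, co_11, Matrix.cons_val,
      LinearMap.id_apply, TensorProduct.add_tmul, ← TensorProduct.smul_tmul', map_add, map_smul, h₀,
      h₁] <;> rfl

/-- The map `Γ` on generators. -/
theorem Γ_rules : (∀ (x : X.c₀.V) (w : (D.obj Y).V),
      RepS.Γ (D.obj X) (D.obj Y) (du X x ⊗ₜ w) = du X x ⊗ₜ w) ∧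
    (∀ (w : (D.obj X).V) (y : Y.c₀.V), RepS.Γ (D.obj X) (D.obj Y) (w ⊗ₜ du Y y) = w ⊗ₜ du Y y) ∧
    (∀ (t : S.B) (x : X.c₁.V) (y : Y.c₁.V), RepS.Γ (D.obj X) (D.obj Y) (db X t x ⊗ₜ db Y S.b₀ y) =
      db X t x ⊗ₜ db Y S.b₁ y) ∧
    (∀ (t : S.B) (x : X.c₁.V) (y : Y.c₁.V), RepS.Γ (D.obj X) (D.obj Y) (db X t x ⊗ₜ db Y S.b₁ y) =
      db X t x ⊗ₜ db Y S.b₀ y) := by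
  have h (t : S.B) : S.actB S.e₁ t = t := by
    obtain ⟨a, c, rfl⟩ := Submodule.mem_span_pair.1 (S.B_span t)
    simp only [map_add, map_smul, S.B_rules]
  -- On twisted pairs `1 + (ξ - 1) = ξ` acts on the second factor, and `ξ = x⁺ + x⁻` exchanges `b`
  -- and `x⁺b`; on any other pair `e₁` kills one factor.
  refine ⟨fun x w => ?_, fun w y => ?_, fun t x y => ?_, fun t x y => ?_⟩ <;>
    simp only [RepS.Γ, LinearMap.add_apply, LinearMap.id_apply, TensorProduct.map_tmul, D_rules, S_fst,
      map_zero, LinearMap.zero_apply, TensorProduct.zero_tmul, TensorProduct.tmul_zero, add_zero,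
      map_mul, Module.End.mul_apply, h, S.ξ, map_sub, map_add, map_one, LinearMap.sub_apply,
      LinearMap.add_apply, S.B_rules, Module.End.one_apply, TensorProduct.tmul_sub,
      TensorProduct.tmul_add, zero_add] <;>
    abel

/-- The map `Π`, with the opaque tensor product of `SF`. -/
def mapT (X Y : SF) : (P.obj (tens X Y)).V →ₗ[ℂ] (P.obj X).V ⊗[ℂ] (P.obj Y).V := mapP X Y

/-- The identity maps `toP` mark the passage from `S`-modules to `Q`-modules, so that the rules for
either side can be applied by rewriting. -/
theorem mapT_toP (v : (D.obj (tens X Y)).V) :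
    mapT X Y (toP _ v) = map (toP X) (toP Y) (RepS.Γ (D.obj X) (D.obj Y) (ΔT X Y v)) := by
  have h : map (toP X) (toP Y) = LinearMap.id := TensorProduct.map_id
  rw [h]
  rfl

/-- The map `Π` on generators. -/
theorem mapT_rules :
    (∀ {X Y : SF} (x : X.c₀.V) (y : Y.c₀.V), mapT X Y (pu _ (ten₀₀ x y)) =
      pu X x ⊗ₜ pu Y y + pu X (A₂ X (par₀ X x)) ⊗ₜ pu Y (A₁ Y y)) ∧
    (∀ {X Y : SF} (x : X.c₁.V) (y : Y.c₁.V), mapT X Y (pu _ (ten₁₁ 0 x y)) = pb₀ X x ⊗ₜ pb₁ Y y) ∧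
    (∀ {X Y : SF} (x : X.c₁.V) (y : Y.c₁.V), mapT X Y (pu _ (ten₁₁ 1 x y)) = pb₁ X x ⊗ₜ pb₁ Y y) ∧
    (∀ {X Y : SF} (x : X.c₁.V) (y : Y.c₁.V), mapT X Y (pu _ (ten₁₁ 2 x y)) =
      -(Complex.I • (pb₀ X (par₁ X x) ⊗ₜ pb₀ Y y))) ∧
    (∀ {X Y : SF} (x : X.c₁.V) (y : Y.c₁.V), mapT X Y (pu _ (ten₁₁ 3 x y)) =
      -(Complex.I • (pb₁ X (par₁ X x) ⊗ₜ pb₀ Y y)) - pb₀ X x ⊗ₜ pb₁ Y y) ∧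
    (∀ {X Y : SF} (x : X.c₀.V) (y : Y.c₁.V), mapT X Y (pb₀ _ (ten₀₁ x y)) =
      pu X x ⊗ₜ pb₀ Y y + pu X (A₂ X (par₀ X x)) ⊗ₜ pb₁ Y y) ∧
    (∀ {X Y : SF} (x : X.c₀.V) (y : Y.c₁.V), mapT X Y (pb₁ _ (ten₀₁ x y)) =
      pu X (A₁ X x) ⊗ₜ pb₀ Y y + pu X (par₀ X x) ⊗ₜ pb₁ Y y +
        pu X (A₁ X (A₂ X (par₀ X x))) ⊗ₜ pb₁ Y y) ∧
    (∀ {X Y : SF} (x : X.c₁.V) (y : Y.c₀.V), mapT X Y (pb₀ _ (ten₁₀ x y)) =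
      pb₀ X x ⊗ₜ pu Y y + Complex.I • (pb₁ X (par₁ X x) ⊗ₜ pu Y (A₂ Y y)) +
        pb₀ X x ⊗ₜ pu Y (A₁ Y (A₂ Y y))) ∧
    (∀ {X Y : SF} (x : X.c₁.V) (y : Y.c₀.V), mapT X Y (pb₁ _ (ten₁₀ x y)) =
      pb₁ X x ⊗ₜ pu Y y - Complex.I • (pb₀ X (par₁ X x) ⊗ₜ pu Y (A₁ Y y))) := by
  refine ⟨?_, ?_, ?_, ?_, ?_, ?_, ?_, ?_, ?_⟩ <;> intro X Y x y <;>
    simp only [pu, pb₀, pb₁, LinearMap.comp_apply, mapT_toP, ΔT_sectors, Δ00_apply, Δ01_apply,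
      Δ10_apply, Δ11_apply, map_add, map_smul, TensorProduct.map_tmul, TensorProduct.lift.tmul,
      Γ_rules]
  all_goals module

end Coherence

end SF

namespace RepQ

/-! ## The action of `Q` on tensor products -/

/-- The actions of the generators of `Q` on a tensor product. -/
theorem act2_Δ (X Y : RepQ) :
    act2 X Y (Q.Δ Q.E) = map LinearMap.id (Y.ρ Q.E) + map (X.ρ Q.E) (Y.ρ Q.K) ∧
    act2 X Y (Q.Δ Q.F) = map (X.ρ Q.Kinv) (Y.ρ Q.F) + map (X.ρ Q.F) LinearMap.id ∧
    act2 X Y (Q.Δ Q.K) = map (X.ρ Q.K) (Y.ρ Q.K) ∧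
    act2 X Y (Q.Δ Q.Kinv) = map (X.ρ Q.Kinv) (Y.ρ Q.Kinv) := by
  have h (M : RepQ) : M.ρ 1 = LinearMap.id := map_one M.ρ
  refine ⟨?_, ?_, ?_, ?_⟩ <;> rw [Q.Δ, Q.lift_gen] <;>
    simp only [Q.genValues, map_add, act2_tmul, h]

end RepQ

/-! ### Linearity of `Π` over `Q` -/

namespace SF

section Coherence

variable {X Y : SF}

/-- Extensionality on the generators of `P (X * Y)`. -/
theorem P_tens_ext {M : Type} [AddCommGroup M] [Module ℂ M] {f g : (P.obj (tens X Y)).V →ₗ[ℂ] M}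
    (h₀₀ : ∀ x y, f (pu _ (ten₀₀ x y)) = g (pu _ (ten₀₀ x y)))
    (h₀ : ∀ x y, f (pu _ (ten₁₁ 0 x y)) = g (pu _ (ten₁₁ 0 x y)))
    (h₁ : ∀ x y, f (pu _ (ten₁₁ 1 x y)) = g (pu _ (ten₁₁ 1 x y)))
    (h₂ : ∀ x y, f (pu _ (ten₁₁ 2 x y)) = g (pu _ (ten₁₁ 2 x y)))
    (h₃ : ∀ x y, f (pu _ (ten₁₁ 3 x y)) = g (pu _ (ten₁₁ 3 x y)))
    (h₀₁ : ∀ x y, f (pb₀ _ (ten₀₁ x y)) = g (pb₀ _ (ten₀₁ x y)))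
    (h₁₀ : ∀ x y, f (pb₀ _ (ten₁₀ x y)) = g (pb₀ _ (ten₁₀ x y)))
    (h₀₁' : ∀ x y, f (pb₁ _ (ten₀₁ x y)) = g (pb₁ _ (ten₀₁ x y)))
    (h₁₀' : ∀ x y, f (pb₁ _ (ten₁₀ x y)) = g (pb₁ _ (ten₁₀ x y))) : f = g := by
  apply P_ext
  all_goals first | apply tens_c₀_ext | apply tens_c₁_ext
  all_goals intro x; refine LinearMap.ext fun y => ?_
  exacts [h₀₀ x y, h₀ x y, h₁ x y, h₂ x y, h₃ x y, h₀₁ x y, h₁₀ x y, h₀₁' x y, h₁₀' x y]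

/-- Both sides are actions of `Q`, so generators of the algebra suffice; for each of them the nine
formulas for `Π` are compared with the coproduct. After expansion this is an identity of
coefficients in which only `i² = -1` is used. -/
theorem mapT_gen (X Y : SF) (u : QGen) (v : (P.obj (tens X Y)).V) :
    mapT X Y ((P.obj (tens X Y)).ρ (Q.gen u) v) =
      RepQ.act2 (P.obj X) (P.obj Y) (Q.Δ (Q.gen u)) (mapT X Y v) := by
  refine LinearMap.congr_fun (f := mapT X Y ∘ₗ (P.obj (tens X Y)).ρ (Q.gen u))
    (g := RepQ.act2 (P.obj X) (P.obj Y) (Q.Δ (Q.gen u)) ∘ₗ mapT X Y) ?_ v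
  cases u
  all_goals
    apply P_tens_ext <;> intro x y
  all_goals
    simp only [LinearMap.comp_apply, P_rules, mapT_rules,
      RepQ.act2_Δ, par_rules, grassmann_rules, LinearMap.add_apply, TensorProduct.map_tmul,
      LinearMap.id_apply, map_add, map_sub, map_neg, map_smul, map_zero, TensorProduct.tmul_add,
      TensorProduct.add_tmul, TensorProduct.neg_tmul, TensorProduct.tmul_neg,
      ← TensorProduct.smul_tmul', TensorProduct.tmul_smul, TensorProduct.zero_tmul,
      TensorProduct.tmul_zero, ten_linear, smul_zero, neg_zero, add_zero, zero_add]
  all_goals match_scalars <;> simp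

end Coherence

end SF

/-! ### The action of `Φ` on modules in the image of `P` -/

namespace SF

section Coherence

variable {X Y : SF}

/-- Coefficients are normalized as polynomials in `i`; these rules bring them to degree at most one.
-/
theorem I_powers : Complex.I ^ 2 = -1 ∧ Complex.I ^ 3 = -Complex.I ∧ Complex.I ^ 4 = 1 ∧
    Complex.I ^ 5 = Complex.I ∧ Complex.I ^ 6 = -1 ∧ Complex.I ^ 7 = -Complex.I ∧
    Complex.I ^ 8 = 1 ∧ Complex.I ^ 9 = Complex.I := by
  refine ⟨?_, ?_, ?_, ?_, ?_, ?_, ?_, ?_⟩ <;> rw [Complex.I_pow_eq_pow_mod] <;> norm_num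

/-- The action of the central idempotents of `Q` on generators. -/
theorem P_idempotents :
    (∀ {X : SF} (x : X.c₀.V), (P.obj X).ρ Q.e₀ (pu X x) = pu X x) ∧
    (∀ {X : SF} (x : X.c₀.V), (P.obj X).ρ Q.e₁ (pu X x) = 0) ∧
    (∀ {X : SF} (x : X.c₁.V), (P.obj X).ρ Q.e₀ (pb₀ X x) = 0) ∧
    (∀ {X : SF} (x : X.c₁.V), (P.obj X).ρ Q.e₁ (pb₀ X x) = pb₀ X x) ∧
    (∀ {X : SF} (x : X.c₁.V), (P.obj X).ρ Q.e₀ (pb₁ X x) = 0) ∧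
    (∀ {X : SF} (x : X.c₁.V), (P.obj X).ρ Q.e₁ (pb₁ X x) = pb₁ X x) := by
  refine ⟨?_, ?_, ?_, ?_, ?_, ?_⟩ <;> intro X x <;>
    simp only [Q.e₀, Q.e₁, pow_two, map_smul, map_add, map_sub, map_one, map_mul, map_neg,
      LinearMap.smul_apply, LinearMap.add_apply, LinearMap.sub_apply, Module.End.one_apply,
      Module.End.mul_apply, P_rules, par_rules] <;>
    match_scalars <;> simp <;> norm_num

/-- The action of some products of generators of `Q` on the twisted part. -/
theorem P_products :
    (∀ {X : SF} (x : X.c₁.V), (P.obj X).ρ (Q.E * Q.F) (pb₀ X x) = pb₀ X (par₁ X x)) ∧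
    (∀ {X : SF} (x : X.c₁.V), (P.obj X).ρ (Q.E * Q.F) (pb₁ X x) = 0) ∧
    (∀ {X : SF} (x : X.c₁.V), (P.obj X).ρ (Q.E * Q.F * Q.K) (pb₀ X x) = Complex.I • pb₀ X x) ∧
    (∀ {X : SF} (x : X.c₁.V), (P.obj X).ρ (Q.E * Q.F * Q.K) (pb₁ X x) = 0) ∧
    (∀ {X : SF} (x : X.c₁.V), (P.obj X).ρ (Q.F * Q.K) (pb₀ X x) = -pb₁ X (par₁ X x)) ∧
    (∀ {X : SF} (x : X.c₁.V), (P.obj X).ρ (Q.F * Q.K) (pb₁ X x) = 0) ∧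
    (∀ {X : SF} (x : X.c₁.V), (P.obj X).ρ (Q.E * Q.K) (pb₀ X x) = 0) ∧
    (∀ {X : SF} (x : X.c₁.V), (P.obj X).ρ (Q.E * Q.K) (pb₁ X x) = -pb₀ X x) := by
  refine ⟨?_, ?_, ?_, ?_, ?_, ?_, ?_, ?_⟩ <;> intro X x <;>
    simp only [map_mul, map_smul, map_neg, map_zero, Module.End.mul_apply, P_rules, par_rules, smul_zero,
      neg_zero] <;>
    match_scalars <;> (try ring_nf) <;> (try simp only [I_powers]) <;> (try ring_nf)

/-- The associator of `Rep Q` on the images of objects of `SF`. -/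
def assocP (β : ℂ) (X Y Z : SF) : (P.obj X).V ⊗[ℂ] ((P.obj Y).V ⊗[ℂ] (P.obj Z).V) →ₗ[ℂ]
    ((P.obj X).V ⊗[ℂ] (P.obj Y).V) ⊗[ℂ] (P.obj Z).V :=
  RepQ.assocMap β (P.obj X) (P.obj Y) (P.obj Z)

/-- The associator in the sectors where it is trivial. -/
theorem assocP_trivial (β : ℂ) :
    (∀ {X Y Z : SF} (x : X.c₀.V) (y : Y.c₀.V) (z : Z.c₀.V),
      assocP β X Y Z (pu X x ⊗ₜ (pu Y y ⊗ₜ pu Z z)) =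
      (pu X x ⊗ₜ pu Y y) ⊗ₜ pu Z z) ∧
    (∀ {X Y Z : SF} (x : X.c₁.V) (y : Y.c₀.V) (z : Z.c₀.V),
      assocP β X Y Z (pb₀ X x ⊗ₜ (pu Y y ⊗ₜ pu Z z)) =
      (pb₀ X x ⊗ₜ pu Y y) ⊗ₜ pu Z z) ∧
    (∀ {X Y Z : SF} (x : X.c₁.V) (y : Y.c₀.V) (z : Z.c₀.V),
      assocP β X Y Z (pb₁ X x ⊗ₜ (pu Y y ⊗ₜ pu Z z)) =
      (pb₁ X x ⊗ₜ pu Y y) ⊗ₜ pu Z z) ∧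
    (∀ {X Y Z : SF} (x : X.c₀.V) (y : Y.c₀.V) (z : Z.c₁.V),
      assocP β X Y Z (pu X x ⊗ₜ (pu Y y ⊗ₜ pb₀ Z z)) =
      (pu X x ⊗ₜ pu Y y) ⊗ₜ pb₀ Z z) ∧
    (∀ {X Y Z : SF} (x : X.c₀.V) (y : Y.c₀.V) (z : Z.c₁.V),
      assocP β X Y Z (pu X x ⊗ₜ (pu Y y ⊗ₜ pb₁ Z z)) =
      (pu X x ⊗ₜ pu Y y) ⊗ₜ pb₁ Z z) ∧
    (∀ {X Y Z : SF} (x : X.c₁.V) (y : Y.c₁.V) (z : Z.c₀.V),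
      assocP β X Y Z (pb₀ X x ⊗ₜ (pb₀ Y y ⊗ₜ pu Z z)) =
      (pb₀ X x ⊗ₜ pb₀ Y y) ⊗ₜ pu Z z) ∧
    (∀ {X Y Z : SF} (x : X.c₁.V) (y : Y.c₁.V) (z : Z.c₀.V),
      assocP β X Y Z (pb₀ X x ⊗ₜ (pb₁ Y y ⊗ₜ pu Z z)) =
      (pb₀ X x ⊗ₜ pb₁ Y y) ⊗ₜ pu Z z) ∧
    (∀ {X Y Z : SF} (x : X.c₁.V) (y : Y.c₁.V) (z : Z.c₀.V),
      assocP β X Y Z (pb₁ X x ⊗ₜ (pb₀ Y y ⊗ₜ pu Z z)) =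
      (pb₁ X x ⊗ₜ pb₀ Y y) ⊗ₜ pu Z z) ∧
    (∀ {X Y Z : SF} (x : X.c₁.V) (y : Y.c₁.V) (z : Z.c₀.V),
      assocP β X Y Z (pb₁ X x ⊗ₜ (pb₁ Y y ⊗ₜ pu Z z)) =
      (pb₁ X x ⊗ₜ pb₁ Y y) ⊗ₜ pu Z z) ∧
    (∀ {X Y Z : SF} (x : X.c₀.V) (y : Y.c₁.V) (z : Z.c₁.V),
      assocP β X Y Z (pu X x ⊗ₜ (pb₀ Y y ⊗ₜ pb₀ Z z)) =
      (pu X x ⊗ₜ pb₀ Y y) ⊗ₜ pb₀ Z z) ∧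
    (∀ {X Y Z : SF} (x : X.c₀.V) (y : Y.c₁.V) (z : Z.c₁.V),
      assocP β X Y Z (pu X x ⊗ₜ (pb₀ Y y ⊗ₜ pb₁ Z z)) =
      (pu X x ⊗ₜ pb₀ Y y) ⊗ₜ pb₁ Z z) ∧
    (∀ {X Y Z : SF} (x : X.c₀.V) (y : Y.c₁.V) (z : Z.c₁.V),
      assocP β X Y Z (pu X x ⊗ₜ (pb₁ Y y ⊗ₜ pb₀ Z z)) =
      (pu X x ⊗ₜ pb₁ Y y) ⊗ₜ pb₀ Z z) ∧
    (∀ {X Y Z : SF} (x : X.c₀.V) (y : Y.c₁.V) (z : Z.c₁.V),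
      assocP β X Y Z (pu X x ⊗ₜ (pb₁ Y y ⊗ₜ pb₁ Z z)) =
      (pu X x ⊗ₜ pb₁ Y y) ⊗ₜ pb₁ Z z) := by
  refine ⟨?_, ?_, ?_, ?_, ?_, ?_, ?_, ?_, ?_, ?_, ?_, ?_, ?_⟩ <;> intro X Y Z x y z <;>
    -- The central idempotents fix or kill each generator, so exactly one of the eight summands of
    -- `Φ` acts, in these sectors as the identity.
    simp only [assocP, RepQ.assocMap, LinearMap.comp_apply, Q.Φ, map_add, map_mul, RepQ.act3_tmul,
      Module.End.mul_apply, LinearMap.add_apply, TensorProduct.map_tmul, P_idempotents,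
      TensorProduct.tmul_zero, TensorProduct.zero_tmul, map_zero, add_zero, zero_add] <;>
    rfl

/-- The associator in the sector 010. -/
theorem assocP_010 (β : ℂ) :
    (∀ {X Y Z : SF} (x : X.c₀.V) (y : Y.c₁.V) (z : Z.c₀.V),
      assocP β X Y Z (pu X x ⊗ₜ (pb₀ Y y ⊗ₜ pu Z z)) =
      (pu X x ⊗ₜ pb₀ Y y) ⊗ₜ pu Z z +
      (1 + Complex.I : ℂ) • ((pu X (A₂ X (par₀ X x)) ⊗ₜ pb₀ Y (par₁ Y y)) ⊗ₜ pu Z (A₁ Z z)) +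
      (-1 + Complex.I : ℂ) • ((pu X (A₁ X (par₀ X x)) ⊗ₜ pb₀ Y (par₁ Y y)) ⊗ₜ pu Z (A₂ Z z)) +
      (-2 : ℂ) • ((pu X (A₁ X (A₂ X x)) ⊗ₜ pb₀ Y y) ⊗ₜ pu Z (A₁ Z (A₂ Z z)))) ∧
    (∀ {X Y Z : SF} (x : X.c₀.V) (y : Y.c₁.V) (z : Z.c₀.V),
      assocP β X Y Z (pu X x ⊗ₜ (pb₁ Y y ⊗ₜ pu Z z)) =
      (pu X x ⊗ₜ pb₁ Y y) ⊗ₜ pu Z z +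
      (-1 - Complex.I : ℂ) • ((pu X (A₂ X (par₀ X x)) ⊗ₜ pb₁ Y (par₁ Y y)) ⊗ₜ pu Z (A₁ Z z)) +
      (1 - Complex.I : ℂ) • ((pu X (A₁ X (par₀ X x)) ⊗ₜ pb₁ Y (par₁ Y y)) ⊗ₜ pu Z (A₂ Z z)) +
      (-2 : ℂ) • ((pu X (A₁ X (A₂ X x)) ⊗ₜ pb₁ Y y) ⊗ₜ pu Z (A₁ Z (A₂ Z z)))) := by
  refine ⟨?_, ?_⟩ <;> intro X Y Z x y z <;>
    simp only [assocP, RepQ.assocMap, LinearMap.comp_apply, Q.Φ, map_add, map_mul, RepQ.act3_tmul,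
      Module.End.mul_apply, LinearMap.add_apply, TensorProduct.map_tmul, P_idempotents,
      TensorProduct.tmul_zero, TensorProduct.zero_tmul, map_zero, add_zero, zero_add] <;>
    -- Once the idempotents have selected the summand, its terms are evaluated one after the other
    -- on the three generators.
    simp only [Q.Φ010, map_add, map_sub, map_smul, RepQ.act3_tmul, map_mul, LinearMap.add_apply,
      LinearMap.sub_apply, LinearMap.smul_apply, TensorProduct.map_tmul, Module.End.mul_apply, map_one,
      Module.End.one_apply, P_rules, par_rules, grassmann_rules, map_neg, neg_neg, map_zero,
      TensorProduct.tmul_zero, TensorProduct.zero_tmul, smul_zero, add_zero, zero_add, sub_zero,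
      neg_zero, TensorProduct.neg_tmul, TensorProduct.tmul_neg, ← TensorProduct.smul_tmul',
      TensorProduct.tmul_smul, LinearEquiv.coe_coe, TensorProduct.assoc_symm_tmul] <;>
    match_scalars <;> (try ring_nf) <;>
    (try simp only [I_powers]) <;> (try ring_nf)

/-- The associator in the sector 101. -/
theorem assocP_101 (β : ℂ) :
    (∀ {X Y Z : SF} (x : X.c₁.V) (y : Y.c₀.V) (z : Z.c₁.V),
      assocP β X Y Z (pb₀ X x ⊗ₜ (pu Y y ⊗ₜ pb₀ Z z)) =
      (pb₀ X x ⊗ₜ pu Y (par₀ Y y)) ⊗ₜ pb₀ Z z +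
      (1 - Complex.I : ℂ) • ((pb₀ X x ⊗ₜ pu Y (A₂ Y y)) ⊗ₜ pb₁ Z z) +
      (-1 + Complex.I : ℂ) • ((pb₁ X (par₁ X x) ⊗ₜ pu Y (A₂ Y (par₀ Y y))) ⊗ₜ pb₀ Z z)) ∧
    (∀ {X Y Z : SF} (x : X.c₁.V) (y : Y.c₀.V) (z : Z.c₁.V),
      assocP β X Y Z (pb₀ X x ⊗ₜ (pu Y y ⊗ₜ pb₁ Z z)) =
      (1 + Complex.I : ℂ) • ((pb₀ X x ⊗ₜ pu Y (A₁ Y y)) ⊗ₜ pb₀ Z z) +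
      (pb₀ X x ⊗ₜ pu Y (par₀ Y y)) ⊗ₜ pb₁ Z z +
      (-1 + Complex.I : ℂ) • ((pb₁ X (par₁ X x) ⊗ₜ pu Y (A₂ Y (par₀ Y y))) ⊗ₜ pb₁ Z z) +
      (2 : ℂ) • ((pb₁ X (par₁ X x) ⊗ₜ pu Y (A₁ Y (A₂ Y y))) ⊗ₜ pb₀ Z z) +
      (2 : ℂ) • ((pb₀ X x ⊗ₜ pu Y (A₁ Y (A₂ Y (par₀ Y y)))) ⊗ₜ pb₁ Z z)) ∧
    (∀ {X Y Z : SF} (x : X.c₁.V) (y : Y.c₀.V) (z : Z.c₁.V),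
      assocP β X Y Z (pb₁ X x ⊗ₜ (pu Y y ⊗ₜ pb₀ Z z)) =
      (pb₁ X x ⊗ₜ pu Y (par₀ Y y)) ⊗ₜ pb₀ Z z +
      (-2 : ℂ) • ((pb₁ X x ⊗ₜ pu Y (A₁ Y (A₂ Y (par₀ Y y)))) ⊗ₜ pb₀ Z z) +
      (1 - Complex.I : ℂ) • ((pb₁ X x ⊗ₜ pu Y (A₂ Y y)) ⊗ₜ pb₁ Z z) +
      (-1 - Complex.I : ℂ) • ((pb₀ X (par₁ X x) ⊗ₜ pu Y (A₁ Y (par₀ Y y))) ⊗ₜ pb₀ Z z) +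
      (-2 : ℂ) • ((pb₀ X (par₁ X x) ⊗ₜ pu Y (A₁ Y (A₂ Y y))) ⊗ₜ pb₁ Z z)) ∧
    (∀ {X Y Z : SF} (x : X.c₁.V) (y : Y.c₀.V) (z : Z.c₁.V),
      assocP β X Y Z (pb₁ X x ⊗ₜ (pu Y y ⊗ₜ pb₁ Z z)) =
      (1 + Complex.I : ℂ) • ((pb₁ X x ⊗ₜ pu Y (A₁ Y y)) ⊗ₜ pb₀ Z z) +
      (pb₁ X x ⊗ₜ pu Y (par₀ Y y)) ⊗ₜ pb₁ Z z +
      (-1 - Complex.I : ℂ) • ((pb₀ X (par₁ X x) ⊗ₜ pu Y (A₁ Y (par₀ Y y))) ⊗ₜ pb₁ Z z)) := by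
  refine ⟨?_, ?_, ?_, ?_⟩ <;> intro X Y Z x y z <;>
    simp only [assocP, RepQ.assocMap, LinearMap.comp_apply, Q.Φ, map_add, map_mul, RepQ.act3_tmul,
      Module.End.mul_apply, LinearMap.add_apply, TensorProduct.map_tmul, P_idempotents,
      TensorProduct.tmul_zero, TensorProduct.zero_tmul, map_zero, add_zero, zero_add] <;>
    simp only [Q.Φ101, map_add, map_sub, map_smul, RepQ.act3_tmul, map_mul, LinearMap.add_apply,
      LinearMap.sub_apply, LinearMap.smul_apply, TensorProduct.map_tmul, Module.End.mul_apply, map_one,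
      Module.End.one_apply, P_rules, par_rules, grassmann_rules, map_neg, neg_neg, map_zero,
      TensorProduct.tmul_zero, TensorProduct.zero_tmul, smul_zero, add_zero, zero_add, sub_zero,
      neg_zero, TensorProduct.neg_tmul, TensorProduct.tmul_neg, ← TensorProduct.smul_tmul',
      TensorProduct.tmul_smul, LinearEquiv.coe_coe, TensorProduct.assoc_symm_tmul] <;>
    match_scalars <;> (try ring_nf) <;>
    (try simp only [I_powers]) <;> (try ring_nf)

/-- The associator in the sector 111. -/
theorem assocP_111_even (β : ℂ) :
    (∀ {X Y Z : SF} (x : X.c₁.V) (y : Y.c₁.V) (z : Z.c₁.V),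
      assocP β X Y Z (pb₀ X x ⊗ₜ (pb₀ Y y ⊗ₜ pb₀ Z z)) =
      β ^ 2 • ((pb₀ X x ⊗ₜ pb₀ Y (par₁ Y y)) ⊗ₜ pb₀ Z z)) ∧
    (∀ {X Y Z : SF} (x : X.c₁.V) (y : Y.c₁.V) (z : Z.c₁.V),
      assocP β X Y Z (pb₀ X x ⊗ₜ (pb₀ Y y ⊗ₜ pb₁ Z z)) =
      (β ^ 2 * (-1 + Complex.I)) • ((pb₀ X x ⊗ₜ pb₁ Y y) ⊗ₜ pb₀ Z z) +
      β ^ 2 • ((pb₀ X x ⊗ₜ pb₀ Y (par₁ Y y)) ⊗ₜ pb₁ Z z) +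
      (β ^ 2 * (-1 - Complex.I)) • ((pb₁ X (par₁ X x) ⊗ₜ pb₀ Y y) ⊗ₜ pb₀ Z z)) ∧
    (∀ {X Y Z : SF} (x : X.c₁.V) (y : Y.c₁.V) (z : Z.c₁.V),
      assocP β X Y Z (pb₀ X x ⊗ₜ (pb₁ Y y ⊗ₜ pb₀ Z z)) =
      (β ^ 2 * (-1 - 2 * Complex.I)) • ((pb₀ X x ⊗ₜ pb₁ Y (par₁ Y y)) ⊗ₜ pb₀ Z z) +
      (β ^ 2 * (-1 + Complex.I)) • ((pb₀ X x ⊗ₜ pb₀ Y y) ⊗ₜ pb₁ Z z) +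
      (β ^ 2 * (1 - Complex.I)) • ((pb₁ X (par₁ X x) ⊗ₜ pb₀ Y (par₁ Y y)) ⊗ₜ pb₀ Z z)) ∧
    (∀ {X Y Z : SF} (x : X.c₁.V) (y : Y.c₁.V) (z : Z.c₁.V),
      assocP β X Y Z (pb₀ X x ⊗ₜ (pb₁ Y y ⊗ₜ pb₁ Z z)) =
      (-β ^ 2) • ((pb₀ X x ⊗ₜ pb₁ Y (par₁ Y y)) ⊗ₜ pb₁ Z z) +
      (β ^ 2 * (1 - Complex.I)) • ((pb₁ X (par₁ X x) ⊗ₜ pb₁ Y y) ⊗ₜ pb₀ Z z) +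
      (β ^ 2 * (-1 - Complex.I)) • ((pb₁ X (par₁ X x) ⊗ₜ pb₀ Y (par₁ Y y)) ⊗ₜ pb₁ Z z)) := by
  refine ⟨?_, ?_, ?_, ?_⟩ <;> intro X Y Z x y z <;>
    simp only [assocP, RepQ.assocMap, LinearMap.comp_apply, Q.Φ, map_add, map_mul, RepQ.act3_tmul,
      Module.End.mul_apply, LinearMap.add_apply, TensorProduct.map_tmul, P_idempotents,
      TensorProduct.tmul_zero, TensorProduct.zero_tmul, map_zero, add_zero, zero_add] <;>
    -- Products such as `EFK` are not split here: they are evaluated as a whole by `P_products`,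
    -- under which most of the eighteen terms vanish or are a single tensor.
    simp only [Q.Φ111, map_add, map_sub, map_smul, RepQ.act3_tmul, LinearMap.add_apply,
      LinearMap.sub_apply, LinearMap.smul_apply, TensorProduct.map_tmul, map_one,
      Module.End.one_apply, P_rules, P_products, par_rules, map_neg, neg_neg, map_zero,
      TensorProduct.tmul_zero, TensorProduct.zero_tmul, smul_zero, add_zero, zero_add, sub_zero,
      neg_zero, TensorProduct.neg_tmul, TensorProduct.tmul_neg, ← TensorProduct.smul_tmul',
      TensorProduct.tmul_smul, LinearEquiv.coe_coe, TensorProduct.assoc_symm_tmul] <;>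
    match_scalars <;> (try ring_nf) <;>
    (try simp only [I_powers]) <;> (try ring_nf)

/-- The associator in the sector 111. -/
theorem assocP_111_odd (β : ℂ) :
    (∀ {X Y Z : SF} (x : X.c₁.V) (y : Y.c₁.V) (z : Z.c₁.V),
      assocP β X Y Z (pb₁ X x ⊗ₜ (pb₀ Y y ⊗ₜ pb₀ Z z)) =
      β ^ 2 • ((pb₁ X x ⊗ₜ pb₀ Y (par₁ Y y)) ⊗ₜ pb₀ Z z) +
      (β ^ 2 * (-1 - Complex.I)) • ((pb₀ X (par₁ X x) ⊗ₜ pb₀ Y y) ⊗ₜ pb₁ Z z) +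
      (β ^ 2 * (1 - Complex.I)) • ((pb₀ X (par₁ X x) ⊗ₜ pb₁ Y (par₁ Y y)) ⊗ₜ pb₀ Z z)) ∧
    (∀ {X Y Z : SF} (x : X.c₁.V) (y : Y.c₁.V) (z : Z.c₁.V),
      assocP β X Y Z (pb₁ X x ⊗ₜ (pb₀ Y y ⊗ₜ pb₁ Z z)) =
      (β ^ 2 * (1 + Complex.I)) • ((pb₁ X x ⊗ₜ pb₁ Y y) ⊗ₜ pb₀ Z z) +
      (β ^ 2 * (1 - 2 * Complex.I)) • ((pb₁ X x ⊗ₜ pb₀ Y (par₁ Y y)) ⊗ₜ pb₁ Z z) +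
      (β ^ 2 * (-1 - Complex.I)) • ((pb₀ X (par₁ X x) ⊗ₜ pb₁ Y (par₁ Y y)) ⊗ₜ pb₁ Z z)) ∧
    (∀ {X Y Z : SF} (x : X.c₁.V) (y : Y.c₁.V) (z : Z.c₁.V),
      assocP β X Y Z (pb₁ X x ⊗ₜ (pb₁ Y y ⊗ₜ pb₀ Z z)) =
      (-β ^ 2) • ((pb₁ X x ⊗ₜ pb₁ Y (par₁ Y y)) ⊗ₜ pb₀ Z z) +
      (β ^ 2 * (1 + Complex.I)) • ((pb₁ X x ⊗ₜ pb₀ Y y) ⊗ₜ pb₁ Z z) +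
      (β ^ 2 * (1 - Complex.I)) • ((pb₀ X (par₁ X x) ⊗ₜ pb₁ Y y) ⊗ₜ pb₁ Z z)) ∧
    (∀ {X Y Z : SF} (x : X.c₁.V) (y : Y.c₁.V) (z : Z.c₁.V),
      assocP β X Y Z (pb₁ X x ⊗ₜ (pb₁ Y y ⊗ₜ pb₁ Z z)) =
      (-β ^ 2) • ((pb₁ X x ⊗ₜ pb₁ Y (par₁ Y y)) ⊗ₜ pb₁ Z z)) := by
  refine ⟨?_, ?_, ?_, ?_⟩ <;> intro X Y Z x y z <;>
    simp only [assocP, RepQ.assocMap, LinearMap.comp_apply, Q.Φ, map_add, map_mul, RepQ.act3_tmul,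
      Module.End.mul_apply, LinearMap.add_apply, TensorProduct.map_tmul, P_idempotents,
      TensorProduct.tmul_zero, TensorProduct.zero_tmul, map_zero, add_zero, zero_add] <;>
    simp only [Q.Φ111, map_add, map_sub, map_smul, RepQ.act3_tmul, LinearMap.add_apply,
      LinearMap.sub_apply, LinearMap.smul_apply, TensorProduct.map_tmul, map_one,
      Module.End.one_apply, P_rules, P_products, par_rules, map_neg, neg_neg, map_zero,
      TensorProduct.tmul_zero, TensorProduct.zero_tmul, smul_zero, add_zero, zero_add, sub_zero,
      neg_zero, TensorProduct.neg_tmul, TensorProduct.tmul_neg, ← TensorProduct.smul_tmul',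
      TensorProduct.tmul_smul, LinearEquiv.coe_coe, TensorProduct.assoc_symm_tmul] <;>
    match_scalars <;> (try ring_nf) <;>
    (try simp only [I_powers]) <;> (try ring_nf)


end Coherence

end SF

/-! ### Compatibility of `Π` with morphisms, associators and braidings -/

namespace SF

section Coherence

theorem P_map : (∀ {X Y : SF} (f : X ⟶ Y) (x : X.c₀.V), RepQ.lin (P.map f) (pu X x) =
      pu Y (map₀ f x)) ∧
    (∀ {X Y : SF} (f : X ⟶ Y) (x : X.c₁.V), RepQ.lin (P.map f) (pb₀ X x) = pb₀ Y (map₁ f x)) ∧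
    (∀ {X Y : SF} (f : X ⟶ Y) (x : X.c₁.V), RepQ.lin (P.map f) (pb₁ X x) = pb₁ Y (map₁ f x)) :=
  ⟨fun f _ => Prod.ext rfl (map_zero (map LinearMap.id (map₁ f))),
    fun f _ => Prod.ext (map_zero (map₀ f)) rfl, fun f _ => Prod.ext (map_zero (map₀ f)) rfl⟩

/-- The formulas for `Π` involve only parities and the actions of `a₁`, `a₂`, with which morphisms
commute. -/
theorem mapT_naturality {X X' Y Y' : SF} (f : X ⟶ X') (g : Y ⟶ Y') :
    mapT X' Y' ∘ₗ RepQ.lin (P.map (tensHom f g)) =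
      map (RepQ.lin (P.map f)) (RepQ.lin (P.map g)) ∘ₗ mapT X Y := by
  apply P_tens_ext <;> intro x y <;>
    simp only [LinearMap.comp_apply, P_map, tensHom_rules, mapT_rules, map_add, map_sub, map_neg,
      map_smul, TensorProduct.map_tmul, map₀_A₁, map₀_A₂, map₀_par₀, map₁_par₁]

/-- This is the square that identifies `Φ` with the associator of `SF`. It holds for every `β`,
since both associators contain `β` only as the factor `β²` in sector 111. -/
theorem mapT_assoc (β : ℂ) (X Y Z : SF) :
    assocP β X Y Z ∘ₗ map LinearMap.id (mapT Y Z) ∘ₗ mapT X (tens Y Z) =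
      map (mapT X Y) LinearMap.id ∘ₗ mapT (tens X Y) Z ∘ₗ RepQ.lin (P.map (assocHom β X Y Z)) := by
  apply P_ext
  all_goals repeat' (first | apply tens_c₀_ext | apply tens_c₁_ext | apply LinearMap.ext | intro _)
  all_goals
    simp only [LinearMap.comp_apply, tenL_rules, P_map, map₀_assocHom, map₁_assocHom, assoc_rules,
      mapT_rules, map_add, map_sub, map_neg, map_smul, map_zero, par_rules, grassmann_rules,
      ten_linear, TensorProduct.map_tmul, LinearMap.id_apply, TensorProduct.tmul_add,
      TensorProduct.add_tmul, TensorProduct.tmul_sub, TensorProduct.sub_tmul,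
      TensorProduct.tmul_neg, TensorProduct.neg_tmul, TensorProduct.tmul_smul,
      ← TensorProduct.smul_tmul', TensorProduct.tmul_zero, TensorProduct.zero_tmul, assocP_trivial,
      assocP_010, assocP_101, assocP_111_even, assocP_111_odd, smul_zero, add_zero, zero_add,
      neg_zero, neg_neg]
  all_goals
    match_scalars <;> (try ring_nf) <;> (try simp only [I_powers]) <;> (try ring_nf)

/-- The braiding of `Rep Q` on the images of objects of `SF`. -/
def braidP (β : ℂ) (X Y : SF) : (P.obj X).V ⊗[ℂ] (P.obj Y).V →ₗ[ℂ] (P.obj Y).V ⊗[ℂ] (P.obj X).V :=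
  RepQ.braidMap β (P.obj X) (P.obj Y)

set_option maxHeartbeats 1000000 in
-- This is the square that identifies `R` with the braiding of `SF`. It too holds for every `β`,
-- which occurs on both sides only as a factor of the twisted-twisted sector.
theorem mapT_braid (β : ℂ) (X Y : SF) :
    braidP β X Y ∘ₗ mapT X Y = mapT Y X ∘ₗ RepQ.lin (P.map (braidHom β X Y)) := by
  apply P_ext
  all_goals first | apply tens_c₀_ext_homogeneous | apply tens_c₁_ext_homogeneous
  all_goals try (intro k; fin_cases k)
  all_goals intro x hx; refine LinearMap.ext fun y => ?_
  all_goals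
    simp only [LinearMap.comp_apply, tenL_rules, P_map, map₀_braidHom, map₁_braidHom, braid_rules, hx,
      Fin.mk_zero, Fin.mk_one, Fin.reduceFinMk, mapT_rules, map_add, map_sub, map_neg, map_smul,
      par_rules, grassmann_rules, TensorProduct.tmul_neg, TensorProduct.neg_tmul, braidP,
      RepQ.braidMap, Q.R, map_mul, RepQ.act2_tmul, LinearMap.add_apply, Module.End.mul_apply,
      TensorProduct.map_tmul, P_idempotents, TensorProduct.tmul_zero, TensorProduct.zero_tmul,
      map_zero, smul_zero, add_zero, zero_add, neg_zero]
  all_goals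
    -- The idempotents have selected one of the four components of `R`; its two factors are now
    -- applied in turn.
    simp only [Q.R00, Q.R01, Q.R10, Q.R11, map_add, map_sub, map_smul, map_mul, RepQ.act2_tmul,
      LinearMap.add_apply, LinearMap.sub_apply, LinearMap.smul_apply, Module.End.mul_apply,
      TensorProduct.map_tmul, map_one, Module.End.one_apply, P_rules, par_rules, hx, map_neg, map_zero,
      grassmann_rules, TensorProduct.tmul_zero, TensorProduct.zero_tmul, TensorProduct.tmul_neg,
      TensorProduct.neg_tmul, TensorProduct.tmul_smul, ← TensorProduct.smul_tmul', smul_zero,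
      add_zero, zero_add, neg_zero, neg_neg, sub_zero, zero_sub, LinearEquiv.coe_coe,
      TensorProduct.tmul_sub, TensorProduct.sub_tmul,
      TensorProduct.comm_tmul]
  all_goals
    match_scalars <;> (try ring_nf) <;> (try simp only [I_powers]) <;> (try ring_nf)

end Coherence

end SF

namespace SF

/-! ## The maps `P (X * Y) → P X ⊗ P Y` are bijective -/

section Coherence

/-- The coordinates on `B` with respect to `b`, `x⁺b`. -/
def coordB (k : Fin 4) : S.B →ₗ[ℂ] ℂ where
  toFun s := (s : S).2.coord k
  map_add' _ _ := rfl
  map_smul' _ _ := rfl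

/-- As `b = (1 - x⁺x⁻)e₁` and `x⁺b = x⁺e₁`, the coefficients of `1` and `x⁺` in the Clifford algebra
are dual coordinates on `B`. -/
theorem coordB_rules : coordB 0 S.b₀ = 1 ∧ coordB 0 S.b₁ = 0 ∧ coordB 1 S.b₀ = 0 ∧
    coordB 1 S.b₁ = 1 := by
  have h (k : Fin 4) (s : S.B) : coordB k s = (s : S).2.coord k := rfl
  simp only [h, S.b₀_val, S.b₁_val, S.inc₁, LinearMap.inr_apply, Cl.x_mul_y]
  simp [Cl.one_def, Cl.x, sub_eq_add_neg]

section Coordinates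

variable (X : SF)

/-- The projection of `P X` onto the untwisted component. -/
def qu : (P.obj X).V →ₗ[ℂ] X.c₀.V := LinearMap.fst ℂ X.c₀.V (S.B ⊗[ℂ] X.c₁.V)

/-- The coordinate with respect to `b` (for `k = 0`) or `x⁺b` (for `k = 1`) on `P X`. -/
def qb (k : Fin 4) : (P.obj X).V →ₗ[ℂ] X.c₁.V :=
  (lid ℂ X.c₁.V).toLinearMap ∘ₗ LinearMap.rTensor X.c₁.V (coordB k) ∘ₗ
    LinearMap.snd ℂ X.c₀.V (S.B ⊗[ℂ] X.c₁.V)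

variable {X}

theorem coord_rules : (∀ {X : SF} (x : X.c₀.V), qu X (pu X x) = x) ∧
    (∀ {X : SF} (x : X.c₁.V), qu X (pb₀ X x) = 0) ∧ (∀ {X : SF} (x : X.c₁.V), qu X (pb₁ X x) = 0) ∧
    (∀ {X : SF} (k : Fin 4) (x : X.c₀.V), qb X k (pu X x) = 0) ∧
    (∀ {X : SF} (x : X.c₁.V), qb X 0 (pb₀ X x) = x) ∧
    (∀ {X : SF} (x : X.c₁.V), qb X 0 (pb₁ X x) = 0) ∧
    (∀ {X : SF} (x : X.c₁.V), qb X 1 (pb₀ X x) = 0) ∧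
    (∀ {X : SF} (x : X.c₁.V), qb X 1 (pb₁ X x) = x) := by
  have h {X : SF} (k : Fin 4) (t : S.B) (x : X.c₁.V) :
      qb X k (toP X (db X t x)) = coordB k t • x := rfl
  refine ⟨fun x => rfl, fun x => rfl, fun x => rfl, fun {X} k x => ?_, fun x => ?_, fun x => ?_, fun x => ?_, fun x => ?_⟩
  · exact map_zero ((lid ℂ X.c₁.V).toLinearMap ∘ₗ LinearMap.rTensor X.c₁.V (coordB k))
  all_goals
    simp only [pb₀, pb₁, LinearMap.comp_apply, h, coordB_rules, one_smul, zero_smul]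

variable (X) in
theorem pu_qu_add : pu X ∘ₗ qu X + (pb₀ X ∘ₗ qb X 0 + pb₁ X ∘ₗ qb X 1) = LinearMap.id := by
  apply P_ext <;> refine LinearMap.ext fun x => ?_ <;>
    simp only [LinearMap.comp_apply, LinearMap.add_apply, coord_rules, map_zero, add_zero, zero_add,
      LinearMap.id_apply]

variable (X) in
-- The factor `2` is the dimension of `B`.
theorem finrank_P : Module.finrank ℂ (P.obj X).V =
    Module.finrank ℂ X.c₀.V + 2 * Module.finrank ℂ X.c₁.V := by
  let e : (P.obj X).V ≃ₗ[ℂ] X.c₀.V × (X.c₁.V × X.c₁.V) := LinearEquiv.ofLinearMap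
    ((qu X).prod ((qb X 0).prod (qb X 1))) ((pu X).coprod ((pb₀ X).coprod (pb₁ X)))
    (LinearMap.ext fun x => by
      have h (f : (P.obj X).V →ₗ[ℂ] X.c₀.V) (g g' : (P.obj X).V →ₗ[ℂ] X.c₁.V) (v : (P.obj X).V) :
          f.prod (g.prod g') v = (f v, g v, g' v) := rfl
      simp only [LinearMap.comp_apply, LinearMap.coprod_apply, h, map_add, coord_rules, add_zero,
        zero_add, LinearMap.id_apply])
    (pu_qu_add X)
  rw [e.finrank_eq, Module.finrank_prod, Module.finrank_prod, two_mul]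

end Coordinates

/-- A subspace of `P X ⊗ P Y` which contains the tensors of generators is everything. -/
theorem P_tmul_eq_top {X Y : SF} {p : Submodule ℂ ((P.obj X).V ⊗[ℂ] (P.obj Y).V)}
    (h : ∀ x y, pu X x ⊗ₜ pu Y y ∈ p ∧ (∀ y, pu X x ⊗ₜ pb₀ Y y ∈ p ∧ pu X x ⊗ₜ pb₁ Y y ∈ p))
    (h' : ∀ x y, (pb₀ X x ⊗ₜ pu Y y ∈ p ∧ pb₁ X x ⊗ₜ pu Y y ∈ p) ∧
      (∀ y, pb₀ X x ⊗ₜ pb₀ Y y ∈ p ∧ pb₀ X x ⊗ₜ pb₁ Y y ∈ p ∧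
        pb₁ X x ⊗ₜ pb₀ Y y ∈ p ∧ pb₁ X x ⊗ₜ pb₁ Y y ∈ p)) : p = ⊤ := by
  have key (v : (P.obj X).V) (hu : ∀ y, v ⊗ₜ pu Y y ∈ p) (h₀ : ∀ y, v ⊗ₜ pb₀ Y y ∈ p)
      (h₁ : ∀ y, v ⊗ₜ pb₁ Y y ∈ p) : p.comap (TensorProduct.mk ℂ _ _ v) = ⊤ := P_eq_top hu h₀ h₁
  have key' (w : (P.obj Y).V) : p.comap ((TensorProduct.mk ℂ _ _).flip w) = ⊤ := by
    refine P_eq_top (fun x => ?_) (fun x => ?_) fun x => ?_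
    -- The argument `0` is a dummy: the second half of the hypothesis does not depend on it.
    · exact Submodule.eq_top_iff'.1 (key (pu X x) (fun y => (h x y).1) (fun y => ((h x 0).2 y).1)
        fun y => ((h x 0).2 y).2) w
    · exact Submodule.eq_top_iff'.1 (key (pb₀ X x) (fun y => (h' x y).1.1)
        (fun y => ((h' x 0).2 y).1) fun y => ((h' x 0).2 y).2.1) w
    · exact Submodule.eq_top_iff'.1 (key (pb₁ X x) (fun y => (h' x y).1.2)
        (fun y => ((h' x 0).2 y).2.2.1) fun y => ((h' x 0).2 y).2.2.2) w
  refine Submodule.eq_top_iff'.2 fun t => ?_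
  induction t with
  | zero => exact p.zero_mem
  | add t t' ht ht' => exact p.add_mem ht ht'
  | tmul v w => exact Submodule.eq_top_iff'.1 (key' w) v

/-- The values of `Π` are the pure tensors of generators, up to order and scalars, plus corrections
which can be removed step by step since `a₁` and `a₂` are nilpotent. -/
theorem range_mapT (X Y : SF) : LinearMap.range (mapT X Y) = ⊤ := by
  have mem (v) : mapT X Y v ∈ LinearMap.range (mapT X Y) := ⟨v, rfl⟩
  have m01 (x : X.c₀.V) (y : Y.c₁.V) : pu X x ⊗ₜ pb₀ Y y ∈ LinearMap.range (mapT X Y) := by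
    -- The second term cancels the `x⁺b` part of the first and introduces `a₁a₂x ⊗ b`, which the
    -- third removes.
    refine ⟨pb₀ _ (ten₀₁ x y) + pb₁ _ (ten₀₁ (A₂ X x) y) - pb₀ _ (ten₀₁ (A₁ X (A₂ X x)) y), ?_⟩
    simp only [map_add, map_sub, mapT_rules, par_rules, grassmann_rules, map_neg, map_zero,
      TensorProduct.neg_tmul, TensorProduct.zero_tmul]
    abel
  have m01' (x : X.c₀.V) (y : Y.c₁.V) : pu X (par₀ X x) ⊗ₜ pb₁ Y y ∈ LinearMap.range (mapT X Y) := by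
    have h := Submodule.sub_mem _ (Submodule.sub_mem _ (mem (pb₁ _ (ten₀₁ x y))) (m01 (A₁ X x) y))
      (mem (pb₁ _ (ten₀₁ (A₁ X (A₂ X x)) y)))
    simp only [mapT_rules, par_rules, grassmann_rules, map_neg, map_zero, TensorProduct.neg_tmul,
      TensorProduct.zero_tmul] at h
    convert h using 1
    abel
  have m10 (x : X.c₁.V) (y : Y.c₀.V) : pb₀ X x ⊗ₜ pu Y y ∈ LinearMap.range (mapT X Y) := by
    -- The subtracted value cancels both corrections in the first one, as its own correction is `x ⊗
    -- a₁a₂y` with coefficient `i · i = -1`.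
    refine ⟨pb₀ _ (ten₁₀ x y) - Complex.I • pb₁ _ (ten₁₀ (par₁ X x) (A₂ Y y)), ?_⟩
    simp only [map_sub, map_smul, mapT_rules, par_rules, smul_sub, smul_smul, Complex.I_mul_I]
    module
  have m10' (x : X.c₁.V) (y : Y.c₀.V) : pb₁ X x ⊗ₜ pu Y y ∈ LinearMap.range (mapT X Y) := by
    have h := Submodule.add_mem _ (mem (pb₁ _ (ten₁₀ x y)))
      (Submodule.smul_mem _ Complex.I (m10 (par₁ X x) (A₁ Y y)))
    rwa [mapT_rules.2.2.2.2.2.2.2.2, sub_add_cancel] at h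
  have m11 (x : X.c₁.V) (y : Y.c₁.V) : pb₁ X x ⊗ₜ pb₀ Y y ∈ LinearMap.range (mapT X Y) := by
    -- The value on `a₁a₂` contains `-b ⊗ x⁺b`, which the value on `1` cancels.
    refine ⟨Complex.I • pu _ (ten₁₁ 3 (par₁ X x) y) + Complex.I • pu _ (ten₁₁ 0 (par₁ X x) y), ?_⟩
    simp only [map_add, map_smul, mapT_rules, par_rules, smul_sub, smul_neg, smul_smul,
      Complex.I_mul_I]
    module
  have m11' (x : X.c₁.V) (y : Y.c₁.V) : pb₀ X x ⊗ₜ pb₀ Y y ∈ LinearMap.range (mapT X Y) := by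
    refine ⟨Complex.I • pu _ (ten₁₁ 2 (par₁ X x) y), ?_⟩
    simp only [map_smul, mapT_rules, par_rules, smul_neg, smul_smul, Complex.I_mul_I]
    module
  refine P_tmul_eq_top (fun x y => ⟨⟨pu _ (ten₀₀ x y) - pu _ (ten₀₀ (A₂ X (par₀ X x)) (A₁ Y y)), ?_⟩,
      fun y => ⟨m01 x y, ?_⟩⟩) fun x y => ⟨⟨m10 x y, m10' x y⟩, fun y => ⟨m11' x y,
      ⟨_, mapT_rules.2.1 x y⟩, m11 x y, ⟨_, mapT_rules.2.2.1 x y⟩⟩⟩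
  · simp only [map_sub, mapT_rules, grassmann_rules, map_zero, TensorProduct.tmul_zero, add_zero,
      add_sub_cancel_right]
  · have h := m01' (par₀ X x) y
    simpa only [par_rules] using h

/-- With components of dimensions `(m, n)` for `X` and `(p, q)` for `Y`, both sides have dimension
`(m + 2n)(p + 2q) = (mp + 4nq) + 2(mq + np)`. -/
theorem bijective_mapT (X Y : SF) : Function.Bijective (mapT X Y) :=
  bijective_of_range_eq_top _ (by
    rw [Module.finrank_tensorProduct, finrank_P, finrank_P, finrank_P, finrank_tens_c₀,
      finrank_tens_c₁]
    ring) (range_mapT X Y)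

end Coherence

end SF

namespace Q

/-! ## Relations in `Q` -/

theorem K_mul_E : K * E = -(E * K) := by
  have h := congrArg (· * K) relations.K_E
  simpa only [mul_assoc, relations.Kinv_K, mul_one, Complex.I_sq, neg_smul, one_smul, neg_mul] using h

theorem K_mul_F : K * F = -(F * K) := by
  have h := congrArg (· * K) relations.K_F
  simpa only [mul_assoc, relations.Kinv_K, mul_one, Complex.I_sq, inv_neg, inv_one, neg_smul, one_smul,
    neg_mul] using h

theorem Kinv_eq : Kinv = K * K * K := by
  have h := congrArg (Kinv * ·) relations.K_pow
  simp only [pow_succ, pow_zero, one_mul, mul_one] at h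
  rw [← h]
  simp only [← mul_assoc, relations.Kinv_K, one_mul]

theorem fp_mul_fp : fp * fp = 0 := by
  rw [fp, smul_mul_smul_comm, ← pow_two F, relations.F_sq, smul_zero]

theorem fm_mul_fm : fm * fm = 0 := by
  have h : Kinv * E = -(E * Kinv) := by
    have h := congrArg (Kinv * · * Kinv) K_mul_E
    simp only [← mul_assoc, relations.Kinv_K, one_mul, mul_neg, neg_mul] at h
    rw [h, mul_assoc _ K, relations.K_Kinv, mul_one, neg_neg]
  rw [fm, mul_assoc, ← mul_assoc Kinv, h, neg_mul, mul_neg, ← mul_assoc, ← mul_assoc, ← pow_two E,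
    relations.E_sq, zero_mul, zero_mul, neg_zero]

theorem K_mul_fp : K * fp = -(fp * K) := by
  rw [fp, mul_smul_comm, K_mul_F, smul_neg, smul_mul_assoc]

theorem K_mul_fm : K * fm = -(fm * K) := by
  rw [fm, ← mul_assoc, K_mul_E, neg_mul, mul_assoc, mul_assoc, relations.K_Kinv, relations.Kinv_K]

theorem K_mul_K : K * K = e₀ - e₁ := by
  rw [e₀, e₁, pow_two]
  module

theorem e₀_add_e₁ : e₀ + e₁ = 1 := by
  rw [e₀, e₁]
  module

/-- This is the Clifford relation: `f⁺f⁻ + f⁻f⁺ = i [E, F] K⁻¹ = (1 - K⁻²)/2`, and `K⁻² = K²`. -/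
theorem fp_mul_fm : fp * fm = e₁ - fm * fp := by
  have h : Kinv * F = -(F * Kinv) := by
    have h := congrArg (Kinv * · * Kinv) K_mul_F
    simp only [← mul_assoc, relations.Kinv_K, one_mul, mul_neg, neg_mul] at h
    rw [h, mul_assoc _ K, relations.K_Kinv, mul_one, neg_neg]
  have h' : Kinv * Kinv = K ^ 2 := by
    nth_rw 1 [Kinv_eq]
    rw [mul_assoc, relations.K_Kinv, mul_one, pow_two]
  have hc : (Complex.I - Complex.I⁻¹)⁻¹ = -(Complex.I * (1 / 2)) := by
    rw [Complex.inv_I, sub_neg_eq_add, ← two_mul, mul_inv, Complex.inv_I]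
    ring
  have h₁ := congrArg (· * Kinv) relations.E_F
  simp only [sub_mul, smul_mul_assoc, relations.K_Kinv, h', hc, mul_assoc] at h₁
  rw [eq_sub_iff_add_eq, fp, fm, smul_mul_assoc, mul_smul_comm, mul_assoc, h, mul_neg, e₁]
  have h₂ : F * (E * Kinv) = E * (F * Kinv) - -(Complex.I * (1 / 2)) • (1 - K ^ 2) := by
    rw [← h₁, sub_sub_cancel]
  rw [h₂, smul_sub, smul_smul]
  match_scalars <;> ring_nf <;> simp only [Complex.I_sq] <;> norm_num

/-- `K` anticommutes with `E` and `F`, so `K²` is central. -/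
theorem e₀_comm (a : Q) : e₀ * a = a * e₀ := by
  have hE : K ^ 2 * E = E * K ^ 2 := by
    rw [pow_two, mul_assoc, K_mul_E, mul_neg, ← mul_assoc, K_mul_E, neg_mul, neg_neg, mul_assoc]
  have hF : K ^ 2 * F = F * K ^ 2 := by
    rw [pow_two, mul_assoc, K_mul_F, mul_neg, ← mul_assoc, K_mul_F, neg_mul, neg_neg, mul_assoc]
  induction a using induction with
  | hs z => exact (Algebra.commutes z e₀).symm
  | hg u =>
    rw [e₀, smul_mul_assoc, mul_smul_comm, add_mul, mul_add, one_mul, mul_one]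
    congr 2
    cases u
    · exact hE
    · exact hF
    · exact (pow_succ K 2).symm.trans (pow_succ' K 2)
    · change K ^ 2 * Kinv = Kinv * K ^ 2
      rw [pow_two, mul_assoc, relations.K_Kinv, ← mul_assoc, relations.Kinv_K, mul_one, one_mul]
  | ha a b ha hb => rw [mul_add, add_mul, ha, hb]
  | hm a b ha hb => rw [← mul_assoc, ha, mul_assoc, hb, mul_assoc]

theorem e₀_mul_e₀ : e₀ * e₀ = e₀ := by
  have h := relations.K_pow
  rw [e₀, smul_mul_smul_comm, add_mul, mul_add, mul_add, ← pow_add, h]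
  simp only [one_mul, mul_one]
  module

theorem e₁_eq : e₁ = 1 - e₀ := eq_sub_of_add_eq' e₀_add_e₁

theorem e₁_comm (a : Q) : e₁ * a = a * e₁ := by
  rw [e₁_eq, sub_mul, mul_sub, e₀_comm, one_mul, mul_one]

theorem e₀_mul_e₁ : e₀ * e₁ = 0 := by
  rw [e₁_eq, mul_sub, mul_one, e₀_mul_e₀, sub_self]

theorem e₁_mul_e₀ : e₁ * e₀ = 0 := by rw [e₁_comm, e₀_mul_e₁]

theorem e₁_mul_e₁ : e₁ * e₁ = e₁ := by
  nth_rw 1 [e₁_eq]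
  rw [sub_mul, one_mul, e₀_mul_e₁, sub_zero]

theorem E_eq : E = fm * K := by rw [fm, mul_assoc, relations.Kinv_K, mul_one]

theorem F_eq : F = Complex.I • fp := by
  rw [fp, smul_smul, mul_neg, Complex.I_mul_I, neg_neg, one_smul]

end Q

/-! ### Operators on a `Q`-module and bijective intertwiners -/

namespace RepQ

variable (M : RepQ)

/-- Relations of operators on a `Q`-module. -/
theorem ρ_rules : (∀ v, M.ρ Q.fp (M.ρ Q.fp v) = 0) ∧ (∀ v, M.ρ Q.fm (M.ρ Q.fm v) = 0) ∧
    (∀ v, M.ρ Q.fp (M.ρ Q.fm v) = M.ρ Q.e₁ v - M.ρ Q.fm (M.ρ Q.fp v)) ∧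
    (∀ v, M.ρ Q.K (M.ρ Q.fp v) = -M.ρ Q.fp (M.ρ Q.K v)) ∧
    (∀ v, M.ρ Q.K (M.ρ Q.fm v) = -M.ρ Q.fm (M.ρ Q.K v)) ∧
    (∀ v, M.ρ Q.K (M.ρ Q.K v) = M.ρ Q.e₀ v - M.ρ Q.e₁ v) ∧
    (∀ v, M.ρ Q.e₀ (M.ρ Q.e₀ v) = M.ρ Q.e₀ v) ∧ (∀ v, M.ρ Q.e₁ (M.ρ Q.e₁ v) = M.ρ Q.e₁ v) ∧
    (∀ v, M.ρ Q.e₀ (M.ρ Q.e₁ v) = 0) ∧ (∀ v, M.ρ Q.e₁ (M.ρ Q.e₀ v) = 0) ∧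
    (∀ v, M.ρ Q.e₀ (M.ρ Q.fp v) = M.ρ Q.fp (M.ρ Q.e₀ v)) ∧
    (∀ v, M.ρ Q.e₀ (M.ρ Q.fm v) = M.ρ Q.fm (M.ρ Q.e₀ v)) ∧
    (∀ v, M.ρ Q.e₀ (M.ρ Q.K v) = M.ρ Q.K (M.ρ Q.e₀ v)) ∧
    (∀ v, M.ρ Q.e₁ (M.ρ Q.fp v) = M.ρ Q.fp (M.ρ Q.e₁ v)) ∧
    (∀ v, M.ρ Q.e₁ (M.ρ Q.fm v) = M.ρ Q.fm (M.ρ Q.e₁ v)) ∧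
    (∀ v, M.ρ Q.e₁ (M.ρ Q.K v) = M.ρ Q.K (M.ρ Q.e₁ v)) := by
  have h (a b : Q) (v : M.V) : M.ρ a (M.ρ b v) = M.ρ (a * b) v := by rw [map_mul]; rfl
  simp only [h, Q.fp_mul_fp, Q.fm_mul_fm, Q.fp_mul_fm, Q.K_mul_fp, Q.K_mul_fm, Q.K_mul_K,
    Q.e₀_mul_e₀, Q.e₁_mul_e₁, Q.e₀_mul_e₁, Q.e₁_mul_e₀, Q.e₀_comm Q.fp,
    Q.e₀_comm Q.fm, Q.e₀_comm Q.K, Q.e₁_comm Q.fp, Q.e₁_comm Q.fm, Q.e₁_comm Q.K, map_sub, map_neg,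
    map_zero, LinearMap.sub_apply, LinearMap.neg_apply, LinearMap.zero_apply, implies_true, and_self]

theorem ρ_e₀ (v : M.V) : M.ρ Q.e₀ v = v - M.ρ Q.e₁ v := by
  rw [eq_sub_iff_add_eq, ← LinearMap.add_apply, ← map_add, Q.e₀_add_e₁, map_one, Module.End.one_apply]

variable {M}

/-- A bijective intertwiner is an isomorphism. -/
def isoOfBijective {N : RepQ} (f : M ⟶ N) (h : Function.Bijective (lin f)) : M ≅ N where
  hom := f
  inv := ⟨(LinearEquiv.ofBijective (lin f) h).symm.toLinearMap, fun a v =>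
    (LinearEquiv.symm_apply_eq _).2 (by
      rw [LinearEquiv.ofBijective_apply, lin_ρ]
      exact congrArg _ ((LinearEquiv.ofBijective (lin f) h).apply_symm_apply v).symm)⟩
  hom_inv_id := Subtype.ext (LinearMap.ext (LinearEquiv.ofBijective (lin f) h).symm_apply_apply)
  inv_hom_id := Subtype.ext (LinearMap.ext (LinearEquiv.ofBijective (lin f) h).apply_symm_apply)

end RepQ

namespace SF

/-! ## `P` is an equivalence -/

section Coherence

/-- The actions of `f⁺`, `f⁻` and the central idempotents on `P X`. -/
theorem P_rules' :
    (∀ {X : SF} (x : X.c₀.V), (P.obj X).ρ Q.fp (pu X x) = pu X (A₁ X x)) ∧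
    (∀ {X : SF} (x : X.c₁.V), (P.obj X).ρ Q.fp (pb₀ X x) = pb₁ X x) ∧
    (∀ {X : SF} (x : X.c₁.V), (P.obj X).ρ Q.fp (pb₁ X x) = 0) ∧
    (∀ {X : SF} (x : X.c₀.V), (P.obj X).ρ Q.fm (pu X x) = pu X (A₂ X x)) ∧
    (∀ {X : SF} (x : X.c₁.V), (P.obj X).ρ Q.fm (pb₀ X x) = 0) ∧
    (∀ {X : SF} (x : X.c₁.V), (P.obj X).ρ Q.fm (pb₁ X x) = pb₀ X x) := by
  refine ⟨?_, ?_, ?_, ?_, ?_, ?_⟩ <;> intro X x <;>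
    simp only [Q.fp, Q.fm, map_smul, LinearMap.smul_apply, map_mul, Module.End.mul_apply, P_rules,
      par_rules, smul_smul, neg_mul, Complex.I_mul_I, neg_neg, neg_smul, one_smul, smul_zero, map_neg, map_zero,
      LinearMap.neg_apply,
      neg_zero, smul_neg]

/-- The element of `Q` which acts on `P X` as the projection onto `b ⊗ X`. -/
def projb : Q := Q.fm * Q.fp * Q.e₁

/-- The projections onto the untwisted component and onto `b ⊗ X` are actions of elements of `Q`;
therefore every `Q`-linear map commutes with them. -/
theorem P_proj : (∀ {X : SF} (v : (P.obj X).V), (P.obj X).ρ Q.e₀ v = pu X (qu X v)) ∧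
    (∀ {X : SF} (v : (P.obj X).V), (P.obj X).ρ projb v = pb₀ X (qb X 0 v)) := by
  refine ⟨fun {X} => LinearMap.congr_fun (g := pu X ∘ₗ qu X) ?_,
    fun {X} => LinearMap.congr_fun (g := pb₀ X ∘ₗ qb X 0) ?_⟩ <;>
    apply P_ext <;> refine LinearMap.ext fun x => ?_ <;>
    simp only [LinearMap.comp_apply, coord_rules, P_idempotents, projb, map_mul, Module.End.mul_apply,
      map_zero, P_rules']

instance : P.Additive where
  map_add {X Y f g} := by
    refine Subtype.ext (P_ext ?_ ?_ ?_) <;> refine LinearMap.ext fun x => ?_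
    · exact (P_map.1 (f + g) x).trans <| (map_add (pu Y) _ _).trans <|
        congrArg₂ (· + ·) (P_map.1 f x).symm (P_map.1 g x).symm
    · exact (P_map.2.1 (f + g) x).trans <| (map_add (pb₀ Y) _ _).trans <|
        congrArg₂ (· + ·) (P_map.2.1 f x).symm (P_map.2.1 g x).symm
    · exact (P_map.2.2 (f + g) x).trans <| (map_add (pb₁ Y) _ _).trans <|
        congrArg₂ (· + ·) (P_map.2.2 f x).symm (P_map.2.2 g x).symm

instance : P.Linear ℂ where
  map_smul {X Y} f z := by
    refine Subtype.ext (P_ext ?_ ?_ ?_) <;> refine LinearMap.ext fun x => ?_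
    · exact (P_map.1 (z • f) x).trans <| (map_smul (pu Y) z _).trans <|
        congrArg (z • ·) (P_map.1 f x).symm
    · exact (P_map.2.1 (z • f) x).trans <| (map_smul (pb₀ Y) z _).trans <|
        congrArg (z • ·) (P_map.2.1 f x).symm
    · exact (P_map.2.2 (z • f) x).trans <| (map_smul (pb₁ Y) z _).trans <|
        congrArg (z • ·) (P_map.2.2 f x).symm

instance : P.Faithful where
  map_injective {X Y f g} h := by
    refine hom_ext (LinearMap.ext fun x => ?_) (LinearMap.ext fun x => ?_)
    · rw [← coord_rules.1 (map₀ f x), ← P_map.1, h, P_map.1, coord_rules.1]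
    · rw [← coord_rules.2.2.2.2.1 (map₁ f x), ← P_map.2.1, h, P_map.2.1, coord_rules.2.2.2.2.1]

/-- A `Q`-linear map commutes with the two projections of `P_proj`, hence maps untwisted vectors to
untwisted ones and `b ⊗ X` to `b ⊗ Y`. The resulting components are compatible with the `SF`
structure because `K`, `f⁺` and `f⁻` express the parities, `a₁` and `a₂`. -/
instance : P.Full where
  map_surjective {X Y} f := by
    have hu (x : X.c₀.V) : pu Y (qu Y (RepQ.lin f (pu X x))) = RepQ.lin f (pu X x) := by
      rw [← P_proj.1, ← RepQ.lin_ρ, P_proj.1, coord_rules.1]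
    have hb (x : X.c₁.V) : pb₀ Y (qb Y 0 (RepQ.lin f (pb₀ X x))) = RepQ.lin f (pb₀ X x) := by
      rw [← P_proj.2, ← RepQ.lin_ρ, P_proj.2, coord_rules.2.2.2.2.1]
    have hu' {x : X.c₀.V} {y : Y.c₀.V} (h : RepQ.lin f (pu X x) = pu Y y) :
        (qu Y ∘ₗ RepQ.lin f ∘ₗ pu X) x = y := (congrArg (qu Y) h).trans (coord_rules.1 y)
    have hb' {x : X.c₁.V} {y : Y.c₁.V} (h : RepQ.lin f (pb₀ X x) = pb₀ Y y) :
        (qb Y 0 ∘ₗ RepQ.lin f ∘ₗ pb₀ X) x = y := (congrArg (qb Y 0) h).trans (coord_rules.2.2.2.2.1 y)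
    refine ⟨homMk (qu Y ∘ₗ RepQ.lin f ∘ₗ pu X) (qb Y 0 ∘ₗ RepQ.lin f ∘ₗ pb₀ X)
      (LinearMap.ext fun x => hu' ?_) (LinearMap.ext fun x => hu' ?_) (LinearMap.ext fun x => hu' ?_)
      (LinearMap.ext fun x => hb' ?_), ?_⟩
    · rw [← P_rules.1, RepQ.lin_ρ, ← hu, P_rules.1]
      rfl
    · rw [← P_rules'.1, RepQ.lin_ρ, ← hu, P_rules'.1]
      rfl
    · rw [← P_rules'.2.2.2.1, RepQ.lin_ρ, ← hu, P_rules'.2.2.2.1]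
      rfl
    -- On `b ⊗ Z` the element `K` acts by `i` times the parity, so the parity is `-iK`.
    · have h {Z : SF} (z : Z.c₁.V) : pb₀ Z (par₁ Z z) = -Complex.I • (P.obj Z).ρ Q.K (pb₀ Z z) := by
        rw [P_rules.2.1, smul_smul, neg_mul, Complex.I_mul_I, neg_neg, one_smul]
      rw [h, map_smul, RepQ.lin_ρ, ← hb, ← h]
      rfl
    · refine Subtype.ext (P_ext ?_ ?_ ?_) <;> refine LinearMap.ext fun x => ?_
      · exact (P_map.1 _ x).trans (hu x)
      · exact (P_map.2.1 _ x).trans (hb x)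
      · refine (P_map.2.2 _ x).trans ?_
        change _ = RepQ.lin f (pb₁ X x)
        -- On `x⁺b ⊗ X` the map is determined by its values on `b ⊗ X`, as `x⁺b ⊗ x` is the image of
        -- `b ⊗ x` under `f⁺`.
        rw [← P_rules'.2.1, ← P_rules'.2.1, RepQ.lin_ρ, ← hb]
        rfl

/-! ### Reconstruction of an object of `SF` from a `Q`-module -/

section Preimage

variable (M : RepQ)

/-- The action of `Q` on the eigenspace of `K²` with eigenvalue `1`. -/
def resU (a : Q) : Module.End ℂ (LinearMap.ker (M.ρ Q.e₁)) :=
  (M.ρ a).restrict fun v hv => by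
    have h := congrArg (M.ρ · v) (Q.e₁_comm a)
    simp only [map_mul, Module.End.mul_apply] at h
    exact LinearMap.mem_ker.2 (h.trans ((congrArg (M.ρ a) (LinearMap.mem_ker.1 hv)).trans (map_zero _)))

/-- Where `e₁` vanishes, the Clifford relation of `f⁺` and `f⁻` becomes the Grassmann relation. -/
theorem resU_relations : resU M Q.fp * resU M Q.fp = 0 ∧ resU M Q.fm * resU M Q.fm = 0 ∧
    resU M Q.fp * resU M Q.fm + resU M Q.fm * resU M Q.fp = algebraMap ℂ _ 0 :=
  ⟨LinearMap.ext fun v => Subtype.ext (M.ρ_rules.1 v),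
    LinearMap.ext fun v => Subtype.ext (M.ρ_rules.2.1 v),
    LinearMap.ext fun v => Subtype.ext (by
      rw [map_zero]
      change M.ρ Q.fp (M.ρ Q.fm v) + M.ρ Q.fm (M.ρ Q.fp v) = 0
      rw [M.ρ_rules.2.2.1, LinearMap.mem_ker.1 v.2, zero_sub, neg_add_cancel])⟩

/-- The eigenspace of `K²` on `M` with eigenvalue `1`, as a representation of `G`: the parity is
given by `K`, and `a₁`, `a₂` act by `f⁺`, `f⁻`. -/
def untwistedPart : SRep G where
  V := LinearMap.ker (M.ρ Q.e₁)
  ω := resU M Q.K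
  ω_ω v := Subtype.ext ((M.ρ_rules.2.2.2.2.2.1 v).trans (by
    rw [M.ρ_e₀, LinearMap.mem_ker.1 v.2, sub_zero, sub_zero]))
  ρ := Cl.lift (resU M Q.fp) (resU M Q.fm)
    (resU_relations M).1 (resU_relations M).2.1 (resU_relations M).2.2
  ω_ρ := Cl.parity_compat _ _
    (fun v => by rw [Cl.lift_x]; exact Subtype.ext (M.ρ_rules.2.2.2.1 v))
    (fun v => by rw [Cl.lift_y]; exact Subtype.ext (M.ρ_rules.2.2.2.2.1 v))

/-- The kernel of `f⁻` in the eigenspace of `K²` on `M` with eigenvalue `-1`, with the parity given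
by `-i K`. -/
def twistedPart : SVect where
  V := (LinearMap.ker (M.ρ Q.e₀) ⊓ LinearMap.ker (M.ρ Q.fm) : Submodule ℂ M.V)
  ω := (-Complex.I • M.ρ Q.K).restrict fun v (hv : M.ρ Q.e₀ v = 0 ∧ M.ρ Q.fm v = 0) => by
    have h := neg_eq_iff_eq_neg.2 (M.ρ_rules.2.2.2.2.1 v)
    refine Submodule.smul_mem _ _ ⟨?_, ?_⟩
    · change M.ρ Q.e₀ _ = 0
      rw [M.ρ_rules.2.2.2.2.2.2.2.2.2.2.2.2.1, hv.1, map_zero]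
    · change M.ρ Q.fm _ = 0
      rw [← h, hv.2, map_zero, neg_zero]
  ω_ω v := Subtype.ext (by
    -- On the kernel of `e₀` one has `K² = e₀ - e₁ = -1`, so `-iK` is an involution.
    change -Complex.I • M.ρ Q.K (-Complex.I • M.ρ Q.K v) = v
    have h : M.ρ Q.e₁ v = v := by
      rw [← sub_eq_zero, ← neg_eq_zero, neg_sub, ← M.ρ_e₀]
      exact v.2.1
    rw [map_smul, smul_smul, neg_mul_neg, Complex.I_mul_I, M.ρ_rules.2.2.2.2.2.1, h,
      LinearMap.mem_ker.1 v.2.1, zero_sub, neg_smul, one_smul, neg_neg])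

/-- The object of `SF` with image `M`. -/
def preimage : SF := ⟨untwistedPart M, twistedPart M⟩

/-- The inclusion of the untwisted component of the preimage of `M`. -/
def inclu : (preimage M).c₀.V →ₗ[ℂ] M.V := (LinearMap.ker (M.ρ Q.e₁)).subtype

/-- The inclusion of the twisted component of the preimage of `M`. -/
def inclb : (preimage M).c₁.V →ₗ[ℂ] M.V :=
  (LinearMap.ker (M.ρ Q.e₀) ⊓ LinearMap.ker (M.ρ Q.fm)).subtype

theorem incl_rules : (∀ x, inclu M (par₀ _ x) = M.ρ Q.K (inclu M x)) ∧
    (∀ x, inclu M (A₁ _ x) = M.ρ Q.fp (inclu M x)) ∧ (∀ x, inclu M (A₂ _ x) = M.ρ Q.fm (inclu M x)) ∧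
    (∀ x, inclb M (par₁ _ x) = -Complex.I • M.ρ Q.K (inclb M x)) ∧
    (∀ x, M.ρ Q.e₁ (inclu M x) = 0) ∧ (∀ x, M.ρ Q.e₀ (inclb M x) = 0) ∧
    (∀ x, M.ρ Q.e₁ (inclb M x) = inclb M x) ∧
    (∀ x, M.ρ Q.fm (inclb M x) = 0) := by
  refine ⟨fun x => rfl, fun x => ?_, fun x => ?_, fun x => rfl, fun x => x.2, fun x => x.2.1,
    fun x => ?_, fun x => x.2.2⟩
  · exact congrArg Subtype.val (LinearMap.congr_fun (Cl.lift_x _ _ (resU_relations M).1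
      (resU_relations M).2.1 (resU_relations M).2.2) x)
  · exact congrArg Subtype.val (LinearMap.congr_fun (Cl.lift_y _ _ (resU_relations M).1
      (resU_relations M).2.1 (resU_relations M).2.2) x)
  · have h : M.ρ Q.e₀ (inclb M x) = 0 := x.2.1
    rw [M.ρ_e₀, sub_eq_zero] at h
    exact h.symm

/-- The comparison map `P (preimage M) → M`. -/
def counitMap : (P.obj (preimage M)).V →ₗ[ℂ] M.V :=
  inclu M ∘ₗ qu _ + (inclb M ∘ₗ qb _ 0 + M.ρ Q.fp ∘ₗ inclb M ∘ₗ qb _ 1)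

theorem counitMap_rules : (∀ x, counitMap M (pu _ x) = inclu M x) ∧
    (∀ x, counitMap M (pb₀ _ x) = inclb M x) ∧
    (∀ x, counitMap M (pb₁ _ x) = M.ρ Q.fp (inclb M x)) := by
  refine ⟨?_, ?_, ?_⟩ <;> intro x <;>
    simp only [counitMap, LinearMap.comp_apply, LinearMap.add_apply, coord_rules, map_zero, add_zero,
      zero_add]

theorem counitMap_K (v : (P.obj (preimage M)).V) :
    counitMap M ((P.obj (preimage M)).ρ Q.K v) = M.ρ Q.K (counitMap M v) := by
  refine LinearMap.congr_fun (f := counitMap M ∘ₗ _) (g := _ ∘ₗ counitMap M) ?_ v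
  apply P_ext <;> refine LinearMap.ext fun x => ?_ <;>
    simp only [LinearMap.comp_apply, P_rules, counitMap_rules, incl_rules, map_smul, map_neg, smul_smul,
      mul_neg, Complex.I_mul_I, neg_neg, one_smul, M.ρ_rules]

theorem counitMap_fp (v : (P.obj (preimage M)).V) :
    counitMap M ((P.obj (preimage M)).ρ Q.fp v) = M.ρ Q.fp (counitMap M v) := by
  refine LinearMap.congr_fun (f := counitMap M ∘ₗ _) (g := _ ∘ₗ counitMap M) ?_ v
  apply P_ext <;> refine LinearMap.ext fun x => ?_ <;>
    simp only [LinearMap.comp_apply, P_rules', counitMap_rules, incl_rules, map_zero, M.ρ_rules]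

theorem counitMap_fm (v : (P.obj (preimage M)).V) :
    counitMap M ((P.obj (preimage M)).ρ Q.fm v) = M.ρ Q.fm (counitMap M v) := by
  -- On the kernel of `f⁻` in `e₁M` the Clifford relation reduces to `f⁻f⁺ = 1`.
  have h (x) : M.ρ Q.fm (M.ρ Q.fp (inclb M x)) = inclb M x := by
    have := M.ρ_rules.2.2.1 (inclb M x)
    rw [(incl_rules M).2.2.2.2.2.2.2, map_zero, (incl_rules M).2.2.2.2.2.2.1, eq_comm,
      sub_eq_zero] at this
    exact this.symm
  refine LinearMap.congr_fun (f := counitMap M ∘ₗ _) (g := _ ∘ₗ counitMap M) ?_ v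
  apply P_ext <;> refine LinearMap.ext fun x => ?_ <;>
    simp only [LinearMap.comp_apply, P_rules', counitMap_rules, incl_rules, map_zero, h]

/-- The comparison morphism `P (preimage M) ⟶ M`. -/
def counitHom : P.obj (preimage M) ⟶ M := ⟨counitMap M, by
  refine Q.intertwiner _ _ _ fun u v => ?_
  -- The generators are expressed by the three elements already treated: `E = f⁻K`, `F = i f⁺` and
  -- `K⁻¹ = K³`.
  cases u
  · change counitMap M ((P.obj (preimage M)).ρ Q.E v) = M.ρ Q.E _
    rw [Q.E_eq, map_mul, map_mul, Module.End.mul_apply, Module.End.mul_apply, counitMap_fm, counitMap_K]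
  · change counitMap M ((P.obj (preimage M)).ρ Q.F v) = M.ρ Q.F _
    rw [Q.F_eq, map_smul, map_smul, LinearMap.smul_apply, LinearMap.smul_apply, map_smul, counitMap_fp]
  · exact counitMap_K M v
  · change counitMap M ((P.obj (preimage M)).ρ Q.Kinv v) = M.ρ Q.Kinv _
    simp only [Q.Kinv_eq, map_mul, Module.End.mul_apply, counitMap_K]⟩

/-- `M = e₀M ⊕ e₁M`, and on `e₁M` the operators `f⁻f⁺` and `f⁺f⁻` are complementary idempotents. So
`e₁M` is the direct sum of `ker f⁻` and `f⁺(ker f⁻)`, with `f⁺` injective on `ker f⁻`. -/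
theorem bijective_counitMap : Function.Bijective (counitMap M) := by
  constructor
  · refine (injective_iff_map_eq_zero _).2 fun w hw => ?_
    -- Applying `e₀` isolates the untwisted coordinate, and then `f⁻` isolates the coordinate of
    -- `x⁺b`; the equation itself leaves that of `b`.
    have h₀ := congrArg (M.ρ Q.e₀) hw
    have h₁ := congrArg (M.ρ Q.fm) hw
    have hw' := LinearMap.congr_fun (pu_qu_add (preimage M)) w
    have hu : qu _ w = 0 := Subtype.ext (by
      change inclu M (qu _ w) = 0
      have h := M.ρ_e₀ (inclu M (qu _ w))
      simp only [counitMap, LinearMap.comp_apply, LinearMap.add_apply, map_add, incl_rules, M.ρ_rules,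
        map_zero, add_zero] at h₀
      rw [← h₀, h, (incl_rules M).2.2.2.2.1, sub_zero])
    have hb : qb _ 1 w = 0 := Subtype.ext (by
      change inclb M (qb _ 1 w) = 0
      rw [← counitMap_fm, ← LinearMap.id_apply (R := ℂ) w, ← hw'] at h₁
      simpa only [LinearMap.comp_apply, LinearMap.add_apply, map_add, hu, P_rules', map_zero, zero_add,
        counitMap_rules] using h₁)
    have hb' : qb _ 0 w = 0 := Subtype.ext (by
      change inclb M (qb _ 0 w) = 0
      simpa only [counitMap, LinearMap.comp_apply, LinearMap.add_apply, hu, hb, map_zero, zero_add,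
        add_zero] using hw)
    rw [← LinearMap.id_apply (R := ℂ) w, ← hw']
    simp only [LinearMap.comp_apply, LinearMap.add_apply, hu, hb, hb', map_zero, add_zero]
  · intro v
    have hu : M.ρ Q.e₁ (M.ρ Q.e₀ v) = 0 := by simp only [M.ρ_rules]
    have hb (u : M.V) : M.ρ Q.e₀ (M.ρ Q.fm (M.ρ Q.e₁ u)) = 0 ∧ M.ρ Q.fm (M.ρ Q.fm (M.ρ Q.e₁ u)) = 0 := by
      simp only [M.ρ_rules, map_zero, and_self]
    let x : (preimage M).c₀.V := (⟨_, hu⟩ : LinearMap.ker (M.ρ Q.e₁))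
    let y (u : M.V) : (preimage M).c₁.V :=
      (⟨_, hb u⟩ : (LinearMap.ker (M.ρ Q.e₀) ⊓ LinearMap.ker (M.ρ Q.fm) : Submodule ℂ M.V))
    -- This is the decomposition `v = e₀v + f⁻f⁺e₁v + f⁺f⁻e₁v`; every `f⁻e₁u` lies in the kernel of
    -- `f⁻` because `(f⁻)² = 0`.
    refine ⟨pu _ x + (pb₀ _ (y (M.ρ Q.fp v)) + pb₁ _ (y v)), ?_⟩
    simp only [map_add, counitMap_rules]
    change M.ρ Q.e₀ v + (M.ρ Q.fm (M.ρ Q.e₁ (M.ρ Q.fp v)) + M.ρ Q.fp (M.ρ Q.fm (M.ρ Q.e₁ v))) = v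
    simp only [M.ρ_rules, M.ρ_e₀]
    abel

/-- Every object of `Rep Q` is isomorphic to an object in the image of `P`. -/
def counitIso : P.obj (preimage M) ≅ M := RepQ.isoOfBijective (counitHom M) (bijective_counitMap M)

end Preimage

instance : P.EssSurj := ⟨fun M => ⟨preimage M, ⟨counitIso M⟩⟩⟩

instance : P.IsEquivalence where

end Coherence

end SF

namespace RepQ

/-! ## Structure isomorphisms of `Rep Q` -/

section Naturality

variable {X X' Y Y' Z Z' : RepQ}

theorem hom_ext {f g : X ⟶ Y} (h : lin f = lin g) : f = g := Subtype.ext h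

theorem lin_comp_ρ (f : X ⟶ X') (a : Q) : lin f ∘ₗ X.ρ a = X'.ρ a ∘ₗ lin f :=
  LinearMap.ext (lin_ρ f a)

/-- Each leg acts on its own factor, where morphisms commute with it. Thus any element of `Q ⊗ Q`
acts naturally, whether or not it commutes with the coproduct. -/
theorem act2_naturality (f : X ⟶ X') (g : Y ⟶ Y') (a : Q ⊗[ℂ] Q) :
    map (lin f) (lin g) ∘ₗ act2 X Y a = act2 X' Y' a ∘ₗ map (lin f) (lin g) := by
  induction a with
  | zero => rw [map_zero, map_zero, LinearMap.comp_zero, LinearMap.zero_comp]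
  | add a b ha hb => rw [map_add, map_add, LinearMap.comp_add, LinearMap.add_comp, ha, hb]
  | tmul a b =>
    rw [act2_tmul, act2_tmul, ← TensorProduct.map_comp, ← TensorProduct.map_comp, lin_comp_ρ,
      lin_comp_ρ]

theorem act3_naturality (f : X ⟶ X') (g : Y ⟶ Y') (h : Z ⟶ Z') (a : Q ⊗[ℂ] (Q ⊗[ℂ] Q)) :
    map (lin f) (map (lin g) (lin h)) ∘ₗ act3 X Y Z a =
      act3 X' Y' Z' a ∘ₗ map (lin f) (map (lin g) (lin h)) := by
  induction a with
  | zero => rw [map_zero, map_zero, LinearMap.comp_zero, LinearMap.zero_comp]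
  | add a b ha hb => rw [map_add, map_add, LinearMap.comp_add, LinearMap.add_comp, ha, hb]
  | tmul a b =>
    change _ ∘ₗ map (X.ρ a) (act2 Y Z b) = map (X'.ρ a) (act2 Y' Z' b) ∘ₗ _
    rw [← TensorProduct.map_comp, ← TensorProduct.map_comp, lin_comp_ρ, act2_naturality]

theorem assocMap_naturality (β : ℂ) (f : X ⟶ X') (g : Y ⟶ Y') (h : Z ⟶ Z') :
    assocMap β X' Y' Z' ∘ₗ map (lin f) (map (lin g) (lin h)) =
      map (map (lin f) (lin g)) (lin h) ∘ₗ assocMap β X Y Z := by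
  have e : (assoc ℂ X'.V Y'.V Z'.V).symm.toLinearMap ∘ₗ map (lin f) (map (lin g) (lin h)) =
      map (map (lin f) (lin g)) (lin h) ∘ₗ (assoc ℂ X.V Y.V Z.V).symm.toLinearMap :=
    TensorProduct.ext' fun x w => by
      induction w with
      | zero => rw [TensorProduct.tmul_zero, map_zero, map_zero]
      | add w w' hw hw' => rw [TensorProduct.tmul_add, map_add, map_add, hw, hw']
      | tmul y z => rfl
  rw [assocMap, assocMap, LinearMap.comp_assoc, ← act3_naturality, ← LinearMap.comp_assoc, e,
    LinearMap.comp_assoc]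

theorem braidMap_naturality (β : ℂ) (f : X ⟶ X') (g : Y ⟶ Y') :
    braidMap β X' Y' ∘ₗ map (lin f) (lin g) = map (lin g) (lin f) ∘ₗ braidMap β X Y := by
  have e : (comm ℂ X'.V Y'.V).toLinearMap ∘ₗ map (lin f) (lin g) =
      map (lin g) (lin f) ∘ₗ (comm ℂ X.V Y.V).toLinearMap := TensorProduct.ext' fun x y => rfl
  rw [braidMap, braidMap, LinearMap.comp_assoc, ← act2_naturality, ← LinearMap.comp_assoc, e,
    LinearMap.comp_assoc]

theorem tensorHom_id (X Y : RepQ) : tensorHom (𝟙 X) (𝟙 Y) = 𝟙 (tensorObj X Y) :=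
  hom_ext TensorProduct.map_id

theorem tensorHom_comp {X'' Y'' : RepQ} (f : X ⟶ X') (g : Y ⟶ Y') (f' : X' ⟶ X'') (g' : Y' ⟶ Y'') :
    tensorHom f g ≫ tensorHom f' g' = tensorHom (f ≫ f') (g ≫ g') :=
  hom_ext (TensorProduct.map_comp (lin f') (lin g') (lin f) (lin g)).symm

/-- The tensor product of isomorphisms. -/
def tensIso (e : X ≅ X') (e' : Y ≅ Y') : tensorObj X Y ≅ tensorObj X' Y' where
  hom := tensorHom e.hom e'.hom
  inv := tensorHom e.inv e'.inv
  hom_inv_id := by rw [tensorHom_comp, e.hom_inv_id, e'.hom_inv_id, tensorHom_id]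
  inv_hom_id := by rw [tensorHom_comp, e.inv_hom_id, e'.inv_hom_id, tensorHom_id]

/-- A linear map which becomes an isomorphism of representations after composition with an
isomorphism is an isomorphism of representations. -/
def descend (f : Y.V →ₗ[ℂ] Z.V) (g : X ≅ Y) (h : X ≅ Z) (e : f ∘ₗ lin g.hom = lin h.hom) : Y ≅ Z :=
  -- The map `f` is forced to be the composite of the inverse of `g` with `h`, hence is linear over
  -- `Q` and invertible without a separate check.
  have hf : f = lin (g.inv ≫ h.hom) := by
    change f = lin h.hom ∘ₗ lin g.inv
    rw [← e, LinearMap.comp_assoc, show lin g.hom ∘ₗ lin g.inv = lin (𝟙 Y) from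
      congrArg lin g.inv_hom_id]
    rfl
  { hom := ⟨f, hf ▸ (g.inv ≫ h.hom).2⟩
    inv := h.inv ≫ g.hom
    hom_inv_id := by
      rw [show (⟨f, hf ▸ (g.inv ≫ h.hom).2⟩ : Y ⟶ Z) = g.inv ≫ h.hom from hom_ext hf, Category.assoc,
        Iso.hom_inv_id_assoc, Iso.inv_hom_id]
    inv_hom_id := by
      rw [show (⟨f, hf ▸ (g.inv ≫ h.hom).2⟩ : Y ⟶ Z) = g.inv ≫ h.hom from hom_ext hf, Category.assoc,
        Iso.hom_inv_id_assoc, Iso.inv_hom_id] }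

end Naturality

end RepQ

/-! ### The comparison isomorphisms and the structure isomorphisms of `Rep Q` -/

namespace SF

section Coherence

/-- `P (X * Y) ≅ P X ⊗ P Y`. -/
def tensComparison (X Y : SF) : P.obj (tens X Y) ≅ RepQ.tensorObj (P.obj X) (P.obj Y) :=
  RepQ.isoOfBijective ⟨mapT X Y, Q.intertwiner _ _ _ (mapT_gen X Y)⟩ (bijective_mapT X Y)

/-- The projection `P 1 → 1`. -/
def unitMap : (P.obj unit).V →ₗ[ℂ] ℂ := ηP

theorem unitMap_rules : (∀ z, unitMap (pu unit z) = scalar z) ∧ (∀ x, unitMap (pb₀ unit x) = 0) ∧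
    (∀ x, unitMap (pb₁ unit x) = 0) := ⟨fun _ => rfl, fun _ => rfl, fun _ => rfl⟩

theorem unitMap_gen (u : QGen) (v : (P.obj unit).V) :
    unitMap ((P.obj unit).ρ (Q.gen u) v) = RepQ.tensorUnit.ρ (Q.gen u) (unitMap v) := by
  -- The counit acts on `ℂ` by its values `0, 0, 1, 1` on `E, F, K, K⁻¹`.
  have h (z : ℂ) : RepQ.tensorUnit.ρ (Q.gen u) z = Q.genValues 0 0 1 1 u * z :=
    congrArg (· * z) (Q.lift_gen _ _)
  refine LinearMap.congr_fun (f := unitMap ∘ₗ (P.obj unit).ρ (Q.gen u))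
    (g := RepQ.tensorUnit.ρ (Q.gen u) ∘ₗ unitMap) ?_ v
  apply P_ext <;> refine LinearMap.ext fun x => ?_ <;> refine Eq.trans ?_ (h _).symm <;> cases u <;>
    simp only [LinearMap.comp_apply, P_rules, unitMap_rules, unit_rules, Q.genValues, map_zero,
      map_smul, map_neg, smul_zero, neg_zero, zero_mul, one_mul, mul_zero] <;>
    first | exact (zero_mul _).symm | exact (one_mul _).symm

/-- The twisted component of the unit is zero, so `P 1` has dimension one. -/
theorem bijective_unitMap : Function.Bijective unitMap :=
  bijective_of_range_eq_top _ (by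
    rw [finrank_P, finrank_unit.1, finrank_unit.2, Module.finrank_self])
    (LinearMap.range_eq_top.2 fun z => ⟨pu unit (unitElt z), rfl⟩)

/-- `P 1 ≅ 1`. -/
def unitComparison : P.obj unit ≅ RepQ.tensorUnit :=
  RepQ.isoOfBijective ⟨unitMap, Q.intertwiner _ _ _ unitMap_gen⟩ bijective_unitMap

/-- The corrections in `Π` involve the action of `a₂` or `a₁` on the unit, which vanishes. -/
theorem mapT_left (X : SF) : (lid ℂ (P.obj X).V).toLinearMap ∘ₗ map unitMap LinearMap.id ∘ₗ
    mapT unit X = RepQ.lin (P.map (leftIso X).hom) := by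
  apply P_tens_ext <;> intro x y <;>
    simp only [LinearMap.comp_apply, mapT_rules, P_map, unitIso_rules, unit_rules, unitMap_rules, map_add,
      map_sub, map_neg, map_smul, map_zero, TensorProduct.map_tmul, TensorProduct.zero_tmul,
      LinearEquiv.coe_coe, TensorProduct.lid_tmul, LinearMap.id_apply, smul_zero, neg_zero, add_zero,
      zero_add, sub_zero]

theorem mapT_right (X : SF) : (rid ℂ (P.obj X).V).toLinearMap ∘ₗ map LinearMap.id unitMap ∘ₗ
    mapT X unit = RepQ.lin (P.map (rightIso X).hom) := by
  apply P_tens_ext <;> intro x y <;>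
    simp only [LinearMap.comp_apply, mapT_rules, P_map, unitIso_rules, unit_rules, unitMap_rules, map_add,
      map_sub, map_neg, map_smul, map_zero, TensorProduct.map_tmul, TensorProduct.tmul_zero,
      LinearEquiv.coe_coe, TensorProduct.rid_tmul, LinearMap.id_apply, smul_zero, neg_zero, add_zero,
      zero_add, sub_zero]

variable {β : ℂ} (hβ : β ^ 4 = -1)

/-- The associator of `Rep Q` on the image of `P`. -/
def assocIsoP (X Y Z : SF) :
    RepQ.tensorObj (P.obj X) (RepQ.tensorObj (P.obj Y) (P.obj Z)) ≅
      RepQ.tensorObj (RepQ.tensorObj (P.obj X) (P.obj Y)) (P.obj Z) :=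
  -- The square of `mapT_assoc` writes the action of `Φ` as a composite of `Π`, its inverse and the
  -- associator of `SF`, all linear over `Q` and invertible.
  RepQ.descend (RepQ.assocMap β (P.obj X) (P.obj Y) (P.obj Z))
    (tensComparison X (tens Y Z) ≪≫ RepQ.tensIso (Iso.refl _) (tensComparison Y Z))
    (P.mapIso (assocIso hβ X Y Z) ≪≫ tensComparison (tens X Y) Z ≪≫
      RepQ.tensIso (tensComparison X Y) (Iso.refl _))
    (mapT_assoc β X Y Z)

/-- The associator of `Rep Q`. -/
def assocIsoQ (X Y Z : RepQ) :
    RepQ.tensorObj X (RepQ.tensorObj Y Z) ≅ RepQ.tensorObj (RepQ.tensorObj X Y) Z :=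
  -- Naturality of the action of `Φ` along the isomorphisms `P (preimage M) ≅ M` reduces arbitrary
  -- modules to the image of `P`.
  RepQ.descend (RepQ.assocMap β X Y Z)
    (RepQ.tensIso (counitIso X) (RepQ.tensIso (counitIso Y) (counitIso Z)))
    (assocIsoP hβ (preimage X) (preimage Y) (preimage Z) ≪≫
      RepQ.tensIso (RepQ.tensIso (counitIso X) (counitIso Y)) (counitIso Z))
    (RepQ.assocMap_naturality β (counitIso X).hom (counitIso Y).hom (counitIso Z).hom)

/-- The braiding of `Rep Q` on the image of `P`. -/
def braidIsoP (X Y : SF) : RepQ.tensorObj (P.obj X) (P.obj Y) ≅ RepQ.tensorObj (P.obj Y) (P.obj X) :=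
  RepQ.descend (RepQ.braidMap β (P.obj X) (P.obj Y)) (tensComparison X Y)
    (P.mapIso (braidIso hβ X Y) ≪≫ tensComparison Y X) (mapT_braid β X Y)

/-- The braiding of `Rep Q`. -/
def braidIsoQ (X Y : RepQ) : RepQ.tensorObj X Y ≅ RepQ.tensorObj Y X :=
  RepQ.descend (RepQ.braidMap β X Y) (RepQ.tensIso (counitIso X) (counitIso Y))
    (braidIsoP hβ (preimage X) (preimage Y) ≪≫ RepQ.tensIso (counitIso Y) (counitIso X))
    (RepQ.braidMap_naturality β (counitIso X).hom (counitIso Y).hom)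

theorem lid_naturality {X Y : RepQ} (f : X ⟶ Y) : (lid ℂ Y.V).toLinearMap ∘ₗ map LinearMap.id (RepQ.lin f) =
    RepQ.lin f ∘ₗ (lid ℂ X.V).toLinearMap :=
  TensorProduct.ext' fun z x => (map_smul (RepQ.lin f) z x).symm

theorem rid_naturality {X Y : RepQ} (f : X ⟶ Y) : (rid ℂ Y.V).toLinearMap ∘ₗ map (RepQ.lin f) LinearMap.id =
    RepQ.lin f ∘ₗ (rid ℂ X.V).toLinearMap :=
  TensorProduct.ext' fun x z => (map_smul (RepQ.lin f) z x).symm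

/-- The left unit isomorphism of `Rep Q` on the image of `P`. -/
def leftIsoP (X : SF) : RepQ.tensorObj RepQ.tensorUnit (P.obj X) ≅ P.obj X :=
  RepQ.descend (lid ℂ (P.obj X).V).toLinearMap
    (tensComparison unit X ≪≫ RepQ.tensIso unitComparison (Iso.refl _)) (P.mapIso (leftIso X))
    (mapT_left X)

/-- The left unit isomorphism of `Rep Q`. -/
def leftIsoQ (X : RepQ) : RepQ.tensorObj RepQ.tensorUnit X ≅ X :=
  RepQ.descend (lid ℂ X.V).toLinearMap (RepQ.tensIso (Iso.refl _) (counitIso X))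
    (leftIsoP (preimage X) ≪≫ counitIso X) (lid_naturality (counitIso X).hom)

/-- The right unit isomorphism of `Rep Q` on the image of `P`. -/
def rightIsoP (X : SF) : RepQ.tensorObj (P.obj X) RepQ.tensorUnit ≅ P.obj X :=
  RepQ.descend (rid ℂ (P.obj X).V).toLinearMap
    (tensComparison X unit ≪≫ RepQ.tensIso (Iso.refl _) unitComparison) (P.mapIso (rightIso X))
    (mapT_right X)

/-- The right unit isomorphism of `Rep Q`. -/
def rightIsoQ (X : RepQ) : RepQ.tensorObj X RepQ.tensorUnit ≅ X :=
  RepQ.descend (rid ℂ X.V).toLinearMap (RepQ.tensIso (counitIso X) (Iso.refl _))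
    (rightIsoP (preimage X) ≪≫ counitIso X) (rid_naturality (counitIso X).hom)

end Coherence

end SF

/-! ## Transport of laws along an equivalence -/

section Counit

variable {C D : Type*} [Category C] [Category D] (P : C ⥤ D) [P.IsEquivalence]

/-- The counit of the equivalence `P`. -/
def k (X : D) : P.obj (P.inv.obj X) ≅ X := P.asEquivalence.counitIso.app X

/-- By naturality of the counit, the composite of the quasi-inverse and `P` acts on morphisms by
conjugation with the counit. -/
theorem map_inv_map {X Y : D} (f : X ⟶ Y) :
    P.map (P.inv.map f) = (k P X).hom ≫ f ≫ (k P Y).inv := by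
  rw [← Category.assoc, Iso.eq_comp_inv]
  exact P.asEquivalence.counitIso.hom.naturality f

end Counit

section Transport

open MonoidalCategory

variable {C D : Type*} [Category C] [MonoidalCategory C] [BraidedCategory C] [Category D]
  [MonoidalCategoryStruct D]

/-- A functor `P` from a braided monoidal category with natural isomorphisms
`P X ⊗ P Y ≅ P (X ⊗ Y)` and `1 ≅ P 1`, which are compatible with natural structure isomorphisms on
the target; the latter are not assumed to satisfy the coherence laws. -/
structure BraidedComparison (P : C ⥤ D) (c : ∀ X Y : D, X ⊗ Y ≅ Y ⊗ X) where
  μ : ∀ X Y : C, P.obj X ⊗ P.obj Y ≅ P.obj (X ⊗ Y)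
  ε : 𝟙_ D ≅ P.obj (𝟙_ C)
  whiskerLeft_eq : ∀ (X : D) {Y Y' : D} (f : Y ⟶ Y'), X ◁ f = 𝟙 X ⊗ₘ f
  whiskerRight_eq : ∀ {X X' : D} (f : X ⟶ X') (Y : D), f ▷ Y = f ⊗ₘ 𝟙 Y
  id_tensorHom_id : ∀ X Y : D, 𝟙 X ⊗ₘ 𝟙 Y = 𝟙 (X ⊗ Y)
  tensorHom_comp : ∀ {X X' X'' Y Y' Y'' : D} (f : X ⟶ X') (g : Y ⟶ Y') (f' : X' ⟶ X'')
    (g' : Y' ⟶ Y''), (f ⊗ₘ g) ≫ (f' ⊗ₘ g') = (f ≫ f') ⊗ₘ (g ≫ g')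
  μ_naturality : ∀ {X X' Y Y' : C} (f : X ⟶ X') (g : Y ⟶ Y'),
    (P.map f ⊗ₘ P.map g) ≫ (μ X' Y').hom = (μ X Y).hom ≫ P.map (f ⊗ₘ g)
  α_naturality : ∀ {X X' Y Y' Z Z' : D} (f : X ⟶ X') (g : Y ⟶ Y') (h : Z ⟶ Z'),
    ((f ⊗ₘ g) ⊗ₘ h) ≫ (α_ X' Y' Z').hom = (α_ X Y Z).hom ≫ (f ⊗ₘ (g ⊗ₘ h))
  l_naturality : ∀ {X Y : D} (f : X ⟶ Y), (𝟙 (𝟙_ D) ⊗ₘ f) ≫ (λ_ Y).hom = (λ_ X).hom ≫ f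
  r_naturality : ∀ {X Y : D} (f : X ⟶ Y), (f ⊗ₘ 𝟙 (𝟙_ D)) ≫ (ρ_ Y).hom = (ρ_ X).hom ≫ f
  c_naturality : ∀ {X X' Y Y' : D} (f : X ⟶ X') (g : Y ⟶ Y'),
    (f ⊗ₘ g) ≫ (c X' Y').hom = (c X Y).hom ≫ (g ⊗ₘ f)
  α_comparison : ∀ X Y Z : C, ((μ X Y).hom ⊗ₘ 𝟙 (P.obj Z)) ≫ (μ (X ⊗ Y) Z).hom ≫ P.map (α_ X Y Z).hom =
    (α_ (P.obj X) (P.obj Y) (P.obj Z)).hom ≫ (𝟙 (P.obj X) ⊗ₘ (μ Y Z).hom) ≫ (μ X (Y ⊗ Z)).hom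
  l_comparison : ∀ X : C,
    (λ_ (P.obj X)).hom = (ε.hom ⊗ₘ 𝟙 (P.obj X)) ≫ (μ (𝟙_ C) X).hom ≫ P.map (λ_ X).hom
  r_comparison : ∀ X : C,
    (ρ_ (P.obj X)).hom = (𝟙 (P.obj X) ⊗ₘ ε.hom) ≫ (μ X (𝟙_ C)).hom ≫ P.map (ρ_ X).hom
  c_comparison : ∀ X Y : C,
    (μ X Y).hom ≫ P.map (β_ X Y).hom = (c (P.obj X) (P.obj Y)).hom ≫ (μ Y X).hom

namespace BraidedComparison

variable {P : C ⥤ D} {c : ∀ X Y : D, X ⊗ Y ≅ Y ⊗ X} (T : BraidedComparison P c)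

/-- This is bifunctoriality in the form for longer composites; it is taken from the comparison
because the target is not yet a monoidal category. -/
theorem tensorHom_comp_assoc (T : BraidedComparison P c) {X X' X'' Y Y' Y'' Z : D} (f : X ⟶ X') (g : Y ⟶ Y') (f' : X' ⟶ X'')
    (g' : Y' ⟶ Y'') (h : X'' ⊗ Y'' ⟶ Z) :
    (f ⊗ₘ g) ≫ (f' ⊗ₘ g') ≫ h = ((f ≫ f') ⊗ₘ (g ≫ g')) ≫ h := by
  rw [← Category.assoc, T.tensorHom_comp]

/-- The tensor product of isomorphisms. -/
def tensorIso {X X' Y Y' : D} (e : X ≅ X') (e' : Y ≅ Y') : X ⊗ Y ≅ X' ⊗ Y' where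
  hom := e.hom ⊗ₘ e'.hom
  inv := e.inv ⊗ₘ e'.inv
  hom_inv_id := by rw [T.tensorHom_comp, e.hom_inv_id, e'.hom_inv_id, T.id_tensorHom_id]
  inv_hom_id := by rw [T.tensorHom_comp, e.inv_hom_id, e'.inv_hom_id, T.id_tensorHom_id]

theorem map_tensorHom {X X' Y Y' : C} (f : X ⟶ X') (g : Y ⟶ Y') :
    P.map (f ⊗ₘ g) = (T.μ X Y).inv ≫ (P.map f ⊗ₘ P.map g) ≫ (T.μ X' Y').hom := by
  rw [T.μ_naturality, Iso.inv_hom_id_assoc]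

/-- The comparison square for the associators is solved for the image of the source associator,
using that tensor products of inverse maps cancel. -/
theorem map_α (X Y Z : C) : P.map (α_ X Y Z).hom = (T.μ (X ⊗ Y) Z).inv ≫
    ((T.μ X Y).inv ⊗ₘ 𝟙 (P.obj Z)) ≫ (α_ (P.obj X) (P.obj Y) (P.obj Z)).hom ≫
      (𝟙 (P.obj X) ⊗ₘ (T.μ Y Z).hom) ≫ (T.μ X (Y ⊗ Z)).hom := by
  rw [← T.α_comparison, T.tensorHom_comp_assoc, Iso.inv_hom_id, Category.comp_id, T.id_tensorHom_id,
    Category.id_comp, Iso.inv_hom_id_assoc]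

variable [P.IsEquivalence]

/-- The tensor comparison of the inverse of `P`. -/
def invμ (X Y : D) : P.inv.obj X ⊗ P.inv.obj Y ≅ P.inv.obj (X ⊗ Y) :=
  P.preimageIso ((T.μ _ _).symm ≪≫
    T.tensorIso (k P X) (k P Y) ≪≫
      (k P (X ⊗ Y)).symm)

/-- The unit comparison of the inverse of `P`. -/
def invε : 𝟙_ C ≅ P.inv.obj (𝟙_ D) :=
  P.preimageIso (T.ε.symm ≪≫ (k P (𝟙_ D)).symm)

theorem map_invμ_hom (X Y : D) : P.map (T.invμ X Y).hom =
    (T.μ _ _).inv ≫ ((k P X).hom ⊗ₘ (k P Y).hom) ≫ (k P (X ⊗ Y)).inv := P.map_preimage _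

theorem map_invμ_inv (X Y : D) : P.map (T.invμ X Y).inv =
    (k P (X ⊗ Y)).hom ≫ ((k P X).inv ⊗ₘ (k P Y).inv) ≫ (T.μ _ _).hom :=
  (P.map_preimage _).trans (Category.assoc _ _ _)

theorem map_invε_inv : P.map T.invε.inv = (k P (𝟙_ D)).hom ≫ T.ε.hom := P.map_preimage _

theorem inv_map_tensorHom {X X' Y Y' : D} (f : X ⟶ X') (g : Y ⟶ Y') : P.inv.map (f ⊗ₘ g) =
    (T.invμ X Y).inv ≫ (P.inv.map f ⊗ₘ P.inv.map g) ≫ (T.invμ X' Y').hom := by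
  -- `P` is faithful, and after `P` the images under the quasi-inverse become conjugates by the
  -- counit, which cancel against those in `invμ`.
  apply P.map_injective
  simp only [P.map_comp, T.map_tensorHom, map_inv_map, map_invμ_hom, map_invμ_inv, Category.assoc,
    Iso.inv_hom_id_assoc, Iso.hom_inv_id_assoc, T.tensorHom_comp_assoc, Iso.inv_hom_id, Category.comp_id]

/-- The inverse of `P` reflects the tensor product of the target. -/
def inducing : Monoidal.InducingFunctorData P.inv where
  μIso := T.invμ
  εIso := T.invε
  whiskerLeft_eq X _ _ f := by
    rw [T.whiskerLeft_eq, T.inv_map_tensorHom, P.inv.map_id, id_tensorHom]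
  whiskerRight_eq f Y := by
    rw [T.whiskerRight_eq, T.inv_map_tensorHom, P.inv.map_id, tensorHom_id]
  tensorHom_eq f g := T.inv_map_tensorHom f g
  associator_eq X Y Z := by
    -- After `P`, the associator of the source is replaced by the one of the target, conjugated by
    -- comparison maps which cancel.
    apply P.map_injective
    simp only [Iso.trans_hom, tensorIso_hom, Iso.symm_hom, Iso.refl_hom, P.map_comp, T.map_tensorHom,
      P.map_id, T.map_α, map_inv_map, map_invμ_hom, map_invμ_inv, Category.assoc,
      Iso.inv_hom_id_assoc, Iso.hom_inv_id_assoc, T.tensorHom_comp_assoc, Iso.inv_hom_id,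
      Iso.hom_inv_id, Category.comp_id, Category.id_comp]
    iterate 4 rw [T.tensorHom_comp_assoc]
    simp only [Category.assoc, Iso.inv_hom_id_assoc, Iso.hom_inv_id_assoc, Iso.inv_hom_id, Iso.hom_inv_id,
      Category.comp_id, Category.id_comp]
    -- What remains is a conjugate of the target associator by tensor products of counit maps;
    -- naturality moves these through it.
    have h := T.α_naturality (k P X).hom (k P Y).hom (k P Z).hom
    rw [← Category.assoc (α_ _ _ _).hom, ← h]
    rw [Category.assoc, T.tensorHom_comp_assoc, T.tensorHom_comp, Iso.inv_hom_id, Iso.inv_hom_id,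
      Iso.inv_hom_id, T.id_tensorHom_id, T.id_tensorHom_id, Category.id_comp]
  leftUnitor_eq X := by
    apply P.map_injective
    simp only [Iso.trans_hom, tensorIso_hom, Iso.symm_hom, Iso.refl_hom, P.map_comp, T.map_tensorHom,
      P.map_id, map_inv_map, map_invε_inv, map_invμ_inv, Category.assoc,
      Iso.inv_hom_id_assoc, Iso.hom_inv_id_assoc, T.tensorHom_comp_assoc, Iso.inv_hom_id,
      Iso.hom_inv_id, Category.comp_id, Category.id_comp]
    rw [T.tensorHom_comp_assoc]
    simp only [Category.assoc, Iso.inv_hom_id_assoc, Iso.hom_inv_id_assoc, Iso.inv_hom_id, Iso.hom_inv_id,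
      Category.comp_id, Category.id_comp]
    -- Naturality moves the unit isomorphism from `X` to the image of `P`, where it is known by
    -- comparison.
    have h := T.l_naturality (k P X).inv
    rw [← h, T.l_comparison, T.tensorHom_comp_assoc, Category.id_comp, Category.comp_id]
  rightUnitor_eq X := by
    apply P.map_injective
    simp only [Iso.trans_hom, tensorIso_hom, Iso.symm_hom, Iso.refl_hom, P.map_comp, T.map_tensorHom,
      P.map_id, map_inv_map, map_invε_inv, map_invμ_inv, Category.assoc,
      Iso.inv_hom_id_assoc, Iso.hom_inv_id_assoc, T.tensorHom_comp_assoc, Iso.inv_hom_id,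
      Iso.hom_inv_id, Category.comp_id, Category.id_comp]
    rw [T.tensorHom_comp_assoc]
    simp only [Category.assoc, Iso.inv_hom_id_assoc, Iso.hom_inv_id_assoc, Iso.inv_hom_id, Iso.hom_inv_id,
      Category.comp_id, Category.id_comp]
    have h := T.r_naturality (k P X).inv
    rw [← h, T.r_comparison, T.tensorHom_comp_assoc, Category.id_comp, Category.comp_id]


/-- The monoidal structure on the target. -/
@[reducible] def monoidal : MonoidalCategory D := Monoidal.induced P.inv T.inducing

/-- The braiding on the target. -/
@[reducible] def braided : @BraidedCategory D _ T.monoidal :=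
  letI := T.monoidal
  letI : P.inv.Monoidal := Monoidal.fromInducedMonoidal P.inv T.inducing
  -- A faithful monoidal functor that preserves the braiding reflects the hexagons; the preservation
  -- is tested after `P`.
  BraidedCategory.ofFaithful P.inv c fun X Y => P.map_injective <| by
    change P.map ((T.invμ X Y).hom ≫ _) = P.map (_ ≫ (T.invμ Y X).hom)
    rw [P.map_comp, P.map_comp, map_inv_map, map_invμ_hom, map_invμ_hom,
      ← cancel_epi (T.μ _ _).hom, reassoc_of% T.c_comparison]
    simp only [Category.assoc, Iso.inv_hom_id_assoc, Iso.hom_inv_id_assoc]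
    rw [reassoc_of% T.c_naturality]

include T in
-- The quasi-inverse is faithful and takes the given structure maps to those of `C`, up to
-- comparison isomorphisms. Each axiom can thus be tested in `C`, where it holds. The induced
-- structure has the given data, so its axioms are the desired ones.
theorem laws : BraidedMonoidalLaws D c :=
  letI := T.monoidal
  letI := T.braided
  { tensorHom_def := MonoidalCategory.tensorHom_def
    id_tensorHom_id := MonoidalCategory.id_tensorHom_id
    tensorHom_comp_tensorHom := MonoidalCategory.tensorHom_comp_tensorHom
    whiskerLeft_id := MonoidalCategory.whiskerLeft_id
    id_whiskerRight := MonoidalCategory.id_whiskerRight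
    associator_naturality := MonoidalCategory.associator_naturality
    leftUnitor_naturality := MonoidalCategory.leftUnitor_naturality
    rightUnitor_naturality := MonoidalCategory.rightUnitor_naturality
    pentagon := MonoidalCategory.pentagon
    triangle := MonoidalCategory.triangle
    braiding_naturality_right := BraidedCategory.braiding_naturality_right
    braiding_naturality_left := BraidedCategory.braiding_naturality_left
    hexagon_forward := BraidedCategory.hexagon_forward
    hexagon_reverse := BraidedCategory.hexagon_reverse }

/-- The functor `P` as a braided monoidal functor. -/
@[reducible] def functorBraided :
    letI := T.laws.monoidal
    letI := T.laws.braided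
    P.Braided :=
  letI := T.laws.monoidal
  letI := T.laws.braided
  letI : P.CoreMonoidal :=
    { εIso := T.ε
      μIso := T.μ
      μIso_hom_natural_left := fun {X Y} f X' => by
        -- Whiskerings are rewritten as tensor products with identities, the form in which the
        -- comparison data are stated.
        rw [← tensorHom_id, ← P.map_id, T.μ_naturality, tensorHom_id]
      μIso_hom_natural_right := fun {X Y} X' f => by
        rw [← id_tensorHom, ← P.map_id, T.μ_naturality, id_tensorHom]
      associativity := fun X Y Z => by
        rw [← tensorHom_id, ← id_tensorHom]
        exact T.α_comparison X Y Z
      left_unitality := fun X => by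
        rw [← tensorHom_id]
        exact T.l_comparison X
      right_unitality := fun X => by
        rw [← id_tensorHom]
        exact T.r_comparison X }
  { this.toMonoidal with
    braided := fun X Y => T.c_comparison X Y }

end BraidedComparison

end Transport

namespace SF

/-! ## `Rep Q` as a braided monoidal category, and the braided monoidal functor `P` -/

section Comparison

variable {β : ℂ} (hβ : β ^ 4 = -1)

/-- The tensor product of `Rep Q` with its structure isomorphisms. -/
@[reducible] def repStruct : MonoidalCategoryStruct RepQ :=
  RepQ.monoidalStruct (assocIsoQ hβ) leftIsoQ rightIsoQ

/-- The monoidal category `SF`. -/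
@[reducible] def tensMonoidal : MonoidalCategory SF :=
  @BraidedMonoidalLaws.monoidal SF _ (tensStruct hβ) (braidIso hβ) (tensStruct_laws hβ)

/-- The braided category `SF`. -/
@[reducible] def tensBraided : @BraidedCategory SF _ (tensMonoidal hβ) :=
  @BraidedMonoidalLaws.braided SF _ (tensStruct hβ) (braidIso hβ) (tensStruct_laws hβ)

/-- The map `Π` goes from `P (X * Y)` to the tensor product, whereas the comparison data use the
opposite direction; the square for `Π` is inverted. -/
theorem tensComparison_naturality {X X' Y Y' : SF} (f : X ⟶ X') (g : Y ⟶ Y') :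
    RepQ.tensorHom (P.map f) (P.map g) ≫ (tensComparison X' Y').inv =
      (tensComparison X Y).inv ≫ P.map (tensHom f g) := by
  rw [Iso.comp_inv_eq, Category.assoc, Iso.eq_inv_comp]
  exact RepQ.hom_ext (mapT_naturality f g).symm

theorem assocIsoQ_naturality {X X' Y Y' Z Z' : RepQ} (f : X ⟶ X') (g : Y ⟶ Y') (h : Z ⟶ Z') :
    RepQ.tensorHom (RepQ.tensorHom f g) h ≫ (assocIsoQ hβ X' Y' Z').inv =
      (assocIsoQ hβ X Y Z).inv ≫ RepQ.tensorHom f (RepQ.tensorHom g h) := by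
  rw [Iso.comp_inv_eq, Category.assoc, Iso.eq_inv_comp]
  exact RepQ.hom_ext (RepQ.assocMap_naturality β f g h).symm

/-- All arrows in the square of `mapT_assoc` are isomorphisms; reversing them gives the square for
the inverse associators and the inverse of `Π`. -/
theorem assocIsoQ_comparison (X Y Z : SF) :
    RepQ.tensorHom (tensComparison X Y).inv (𝟙 (P.obj Z)) ≫ (tensComparison (tens X Y) Z).inv ≫
      P.map (assocIso hβ X Y Z).inv =
    (assocIsoQ hβ (P.obj X) (P.obj Y) (P.obj Z)).inv ≫
      RepQ.tensorHom (𝟙 (P.obj X)) (tensComparison Y Z).inv ≫ (tensComparison X (tens Y Z)).inv := by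
  have h : tensComparison X (tens Y Z) ≪≫ RepQ.tensIso (Iso.refl _) (tensComparison Y Z) ≪≫
      assocIsoQ hβ (P.obj X) (P.obj Y) (P.obj Z) = P.mapIso (assocIso hβ X Y Z) ≪≫
        tensComparison (tens X Y) Z ≪≫ RepQ.tensIso (tensComparison X Y) (Iso.refl _) :=
    Iso.ext (RepQ.hom_ext (mapT_assoc β X Y Z))
  have h' := congrArg Iso.inv h
  simp only [Iso.trans_inv, Category.assoc] at h'
  exact h'.symm

theorem leftIsoQ_comparison (X : SF) : (leftIsoQ (P.obj X)).hom =
    RepQ.tensorHom unitComparison.inv (𝟙 (P.obj X)) ≫ (tensComparison unit X).inv ≫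
      P.map (leftIso X).hom := by
  -- The identity proved for linear maps becomes one of isomorphisms, so that it can be solved for
  -- the unit isomorphism.
  have h : tensComparison unit X ≪≫ RepQ.tensIso unitComparison (Iso.refl _) ≪≫ leftIsoQ (P.obj X) =
      P.mapIso (leftIso X) := Iso.ext (RepQ.hom_ext (mapT_left X))
  rw [← P.mapIso_hom, ← h]
  simp only [Iso.trans_hom, Iso.inv_hom_id_assoc]
  exact ((RepQ.tensIso unitComparison (Iso.refl _)).inv_hom_id_assoc _).symm

theorem rightIsoQ_comparison (X : SF) : (rightIsoQ (P.obj X)).hom =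
    RepQ.tensorHom (𝟙 (P.obj X)) unitComparison.inv ≫ (tensComparison X unit).inv ≫
      P.map (rightIso X).hom := by
  have h : tensComparison X unit ≪≫ RepQ.tensIso (Iso.refl _) unitComparison ≪≫ rightIsoQ (P.obj X) =
      P.mapIso (rightIso X) := Iso.ext (RepQ.hom_ext (mapT_right X))
  rw [← P.mapIso_hom, ← h]
  simp only [Iso.trans_hom, Iso.inv_hom_id_assoc]
  exact ((RepQ.tensIso (Iso.refl _) unitComparison).inv_hom_id_assoc _).symm

theorem braidIsoQ_comparison (X Y : SF) : (tensComparison X Y).inv ≫ P.map (braidIso hβ X Y).hom =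
    (braidIsoQ hβ (P.obj X) (P.obj Y)).hom ≫ (tensComparison Y X).inv := by
  rw [Iso.inv_comp_eq, ← Category.assoc, Iso.eq_comp_inv]
  exact RepQ.hom_ext (mapT_braid β X Y).symm

/-- The functor `P` with the maps `Π`. -/
def comparison :
    @BraidedComparison SF RepQ _ (tensMonoidal hβ) (tensBraided hβ) _
      (repStruct hβ) P (braidIsoQ hβ) :=
  letI := tensMonoidal hβ
  letI := tensBraided hβ
  letI := repStruct hβ
  { μ := fun X Y => (tensComparison X Y).symm
    ε := unitComparison.symm
    whiskerLeft_eq := fun _ _ _ _ => rfl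
    whiskerRight_eq := fun _ _ => rfl
    id_tensorHom_id := RepQ.tensorHom_id
    tensorHom_comp := RepQ.tensorHom_comp
    μ_naturality := tensComparison_naturality
    α_naturality := assocIsoQ_naturality hβ
    l_naturality := fun f => RepQ.hom_ext (lid_naturality f)
    r_naturality := fun f => RepQ.hom_ext (rid_naturality f)
    c_naturality := fun f g => RepQ.hom_ext (RepQ.braidMap_naturality β f g)
    α_comparison := assocIsoQ_comparison hβ
    l_comparison := leftIsoQ_comparison
    r_comparison := rightIsoQ_comparison
    c_comparison := braidIsoQ_comparison hβ }

/-- The braided monoidal category `Rep (Q, Φ, R)`. -/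
def repBraidedStructure : RepQ.BraidedStructure β where
  assoc := assocIsoQ hβ
  leftUnitor := leftIsoQ
  rightUnitor := rightIsoQ
  braiding := braidIsoQ hβ
  -- `RepQ.descend` keeps the given linear map and only adds the proof of linearity and the inverse.
  lin_assoc _ _ _ := rfl
  lin_leftUnitor _ := rfl
  lin_rightUnitor _ := rfl
  lin_braiding _ _ := rfl
  laws :=
    letI := tensMonoidal hβ
    letI := tensBraided hβ
    letI := repStruct hβ
    (comparison hβ).laws

/-- The braided monoidal functor `P`. -/
@[reducible] def functorBraided :
    letI := tensMonoidal hβ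
    letI := tensBraided hβ
    letI := (repBraidedStructure hβ).monoidal
    letI := (repBraidedStructure hβ).braided
    P.Braided :=
  letI := tensMonoidal hβ
  letI := tensBraided hβ
  letI := repStruct hβ
  (comparison hβ).functorBraided

end Comparison

end SF

end SympFerm

end

theorem theorem3 (β : ℂ) (hβ : β ^ 4 = -1) :
    ∃ (s : SympFerm.SF.BraidedStructure β) (t : SympFerm.RepQ.BraidedStructure β),
      SympFerm.SF.P.Additive ∧ SympFerm.SF.P.Linear ℂ ∧ SympFerm.SF.P.IsEquivalence ∧
      letI := s.monoidal
      letI := s.braided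
      letI := t.monoidal
      letI := t.braided
      ∃ _ : SympFerm.SF.P.Braided,
        (∀ U V : SympFerm.SF, SympFerm.RepQ.lin (Functor.OplaxMonoidal.δ SympFerm.SF.P U V) =
          SympFerm.SF.mapP U V) ∧
        SympFerm.RepQ.lin (Functor.OplaxMonoidal.η SympFerm.SF.P) = SympFerm.SF.ηP :=
  -- The oplax maps of `P` are the inverses of its tensor and unit comparisons, which were defined
  -- as the inverses of `Π` and of the projection; so the last two claims are definitional.
  ⟨SympFerm.SF.braidedStructure hβ, SympFerm.SF.repBraidedStructure hβ, inferInstance, inferInstance,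
    inferInstance, SympFerm.SF.functorBraided hβ, fun _ _ => rfl, rfl⟩
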